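/- **Setting.** Let $T>0$ and let $\Gamma(0)=\partial\Omega\subset\mathbb R^3$ be a closed $C^m$ surface ($m\ge 3$), the boundary of a nonempty bounded open set. Let $\Phi_t$ ($t\in[0,T]$, $\Phi_0=\mathrm{id}$) be $C^m$ diffeomorphisms of $\Gamma(0)$ onto $\Gamma(t)=\Phi_t(\Gamma(0))$, of class $C^2$ in time with values in $C^m$, such that the velocity $\mathbf V(\Phi_t(z),t)=\partial_t\Phi_t(z)$ is normal to $\Gamma(t)$. Let $k_u\ge2$, $k_g\ge1$ and $\rho>0$. *Discrete surfaces.* Consider a conforming triangulation by flat, outward oriented triangles with vertices on $\Gamma(0)$ whose union is contained in the region where the closest point projection $\pi$ onto $\Gamma(0)$ is defined and is mapped by $\pi$ bijectively onto $\Gamma(0)$. With $\hat T$ the reference triangle and $A_K:\hat T\to\mathbb R^3$ the affine parametrization of a flat triangle $K$, the element $K(t)$ of $\Gamma_h(t)$ is the image of $F_{K}(t)$, the degree-$k_g$ Lagrange interpolant on $\hat T$ of $\Phi_t\circ\pi\circ A_K$. So the Lagrange nodes move on $\Gamma(t)$ with velocity $\mathbf V$; the material velocity of $\Gamma_h(t)$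 is the corresponding Lagrange interpolant $\mathbf V_h$ of $\mathbf V$. Let $h$ be the maximum over $t\in[0,T]$ and $K$ of $\operatorname{diam}K(t)$. The mesh is called $\rho$-quasi-uniform if for all $t\in[0,T]$ and all $K$ the flat triangle spanned by the vertices of $K(t)$ has inradius at least $\rho h$. Let $\mathbf n_h$ be the elementwise outward unit normal of $\Gamma_h(t)$, $\mathbf P_h=\mathbf I-\mathbf n_h\otimes\mathbf n_h$, $\nabla_{\Gamma_h}$ the tangential derivative and $E_h(\mathbf w)=\frac12\big(\mathbf P_h\nabla_{\Gamma_h}\mathbf w+(\mathbf P_h\nabla_{\Gamma_h}\mathbf w)^T\big)$. *Finite elements.* $S_h^k(t)$ is the space of continuous functions on $\Gamma_h(t)$ whose pull-backs to $\hat T$ are polynomials of degree at most $k$ on each element; $\mathbf V_h(t)=(S^{k_u}_h(t))^3$, $Q_h(t)=\{q\in S^{k_u-1}_h(t):\int_{\Gamma_h(t)}q=0\}$, $\Lambda_h(t)=S_h^{k_u}(t)$. The time-lift $\underline{z}(\cdot,t)$ of a finite element function $z$ on $\Gamma_h(s)$ is the finite element function on $\Gamma_h(t)$ with the same pull-backs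 (the same nodal values). On $\Gamma_h(t)$ put $$\mathbf m_h(\mathbf w,\mathbf v)=\int \mathbf w\cdot\mathbf v,\quad \mathbf g_h(\mathbf w,\mathbf v)=\int \operatorname{div}_{\Gamma_h}(\mathbf V_h)\,\mathbf w\cdot\mathbf v,\quad a_{S,h}(\mathbf w,\mathbf v)=\int E_h(\mathbf w):E_h(\mathbf v),\quad a_h=a_{S,h}+\mathbf m_h,$$ $$c_h(\mathbf z;\mathbf w,\mathbf v)=\tfrac12\int\big((\mathbf z\cdot\nabla_{\Gamma_h})\mathbf w\cdot\mathbf v-(\mathbf z\cdot\nabla_{\Gamma_h})\mathbf v\cdot\mathbf w\big),\qquad b_h(\mathbf w,\{q,\xi\})=\int\mathbf w\cdot\nabla_{\Gamma_h}q+\int\xi\,\mathbf w\cdot\mathbf n_h,$$ $\|\mathbf w\|_{a_h}=\|E_h(\mathbf w)\|_{L^2}+\|\mathbf w\|_{L^2}$, and $\mathbf V_h^{div}(t)=\{\mathbf w\in\mathbf V_h(t): b_h(\mathbf w,\{q,\xi\})=0\ \ \forall\,\{q,\xi\}\in Q_h(t)\times\Lambda_h(t)\}$. *Scheme.* Let $N\ge1$,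 $\Delta t=T/N$, $t_n=n\Delta t$, and let an index $n$ denote objects at time $t_n$. Given $\mathbf f_h^n\in L^2(\Gamma_h^n)^3$ ($0\le n\le N$) and $\mathbf u_h^0\in\mathbf V_h^{0,div}$, a solution consists of $\mathbf u_h^n\in\mathbf V_h^n$, $\{p_h^n,\lambda_h^n\}\in Q_h^n\times\Lambda_h^n$, $1\le n\le N$, such that for all $\mathbf v\in\mathbf V_h^n$ and $\{q,\xi\}\in Q_h^n\times\Lambda_h^n$ $$\tfrac1{\Delta t}\big(\mathbf m_h(\mathbf u_h^n,\mathbf v)-\mathbf m_h(\mathbf u_h^{n-1},\underline{\mathbf v}(\cdot,t_{n-1}))\big)-\mathbf g_h(\mathbf u_h^n,\mathbf v)+a_{S,h}(\mathbf u_h^n,\mathbf v)+c_h(\underline{\mathbf u_h^{n-1}}(\cdot,t_n);\mathbf u_h^n,\mathbf v)+b_h(\mathbf v,\{p_h^n,\lambda_h^n\})=\mathbf m_h(\mathbf f_h^n,\mathbf v),$$ $$b_h(\mathbf u_h^n,\{q,\xi\})=0 .$$ The Leray time-projection $\hat{\mathbf u}_h^{n-1}\in\mathbf V_h^{n,div}$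 of $\mathbf u_h^{n-1}$ is determined by: for some $\{\hat p,\hat\lambda\}\in Q_h^n\times\Lambda_h^n$, $\mathbf m_h(\hat{\mathbf u}_h^{n-1},\mathbf v)+b_h(\mathbf v,\{\hat p,\hat\lambda\})=\mathbf m_h(\mathbf u_h^{n-1},\underline{\mathbf v}(\cdot,t_{n-1}))$ for all $\mathbf v\in\mathbf V_h^n$. The discrete inverse Stokes operator $\mathcal A_h^n:\mathbf V_h^{n,div}\to\mathbf V_h^{n,div}$ is given by $a_h(\mathcal A_h^n\mathbf w,\mathbf v)=\mathbf m_h(\mathbf w,\mathbf v)$ for all $\mathbf v\in\mathbf V_h^{n,div}$. For $c>0$ put $$\mathbf A_n(\mathbf u_h^0,\mathbf f_h)=e^{ct_n}\Big(\|\mathbf u_h^0\|_{L^2(\Gamma_h^0)}^2+\Delta t\sum_{k=0}^n\|\mathbf f_h^k\|_{L^2(\Gamma_h^k)}^2\Big).$$ **Lemma (auxiliary bound).** There are constants $h_0,\tau_0,c>0$, depending only on the evolving surface (including $T$), $k_u$, $k_g$ and $\rho$, such that the following holds for all $\rho$-quasi-uniform meshes with $h<h_0$, all $N$ with $\Delta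 t\le\tau_0$, all data and all solutions of the scheme. (i) $\displaystyle \|\mathbf u_h^n\|^2_{L^2(\Gamma_h^n)}+\Delta t\sum_{k=1}^n\|\mathbf u_h^k\|_{a_h}^2\le\mathbf A_n(\mathbf u_h^0,\mathbf f_h)$ for $1\le n\le N$ (so that $\mathbf A_n$ is the bound in the velocity stability estimate). (ii) For every $C_a>0$ there is a constant $C=C(C_a)>0$, depending otherwise only on the same quantities as $h_0,\tau_0,c$ (in particular not on $h$, $\Delta t$, $n$, the mesh, the data or the solution), such that if $\|\mathbf u_h^k\|_{a_h}\le C_a$ for $0\le k\le N$, then for $1\le n\le N$ $$\sum_{k=1}^n\Delta t\,\Big\|\frac{\mathcal A_h^k(\mathbf u_h^k-\hat{\mathbf u}_h^{k-1})}{\Delta t}\Big\|_{a_h}^2\le C(C_a)\,\mathbf A_n(\mathbf u_h^0,\mathbf f_h).$$ -/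

import Mathlib

open Set Filter Topology MeasureTheory
open scoped Matrix

noncomputable section

namespace ESFEM

/-- Euclidean space `ℝ³`. -/
abbrev E3 : Type := EuclideanSpace ℝ (Fin 3)

/-! ### The smooth evolving surface -/

/-- The time-dependent map `g` is continuous in time with values in `C^m(ℝ³)`: each `g t` is `C^m`
and all spatial derivatives of order at most `m` are jointly continuous. -/
def ContInTimeCm (m : ℕ) (g : ℝ → E3 → E3) : Prop :=
  (∀ t, ContDiff ℝ m (g t)) ∧
    ∀ j : ℕ, j ≤ m → Continuous fun q : ℝ × E3 => iteratedFDeriv ℝ j (g q.1) q.2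

/-- A closed (compact, without boundary) oriented `C^m` surface `Γ(0) = ∂Ω ⊂ ℝ³` that moves on the
time interval `[0,T]` with a purely normal velocity.  `flow t` is the normal trajectory map
`Φ_t`, so that `Γ(t) = Φ_t(Γ(0))`; `vel t z = ∂_t Φ_t(z)` is the surface velocity at the point
`Φ_t(z)`, and `acc` is the second time derivative of the flow.  Only the values of these maps on
`[0,T] × Γ(0)` are used; for convenience they are extended to `ℝ × ℝ³` with the same regularity. -/
structure EvolvingSurface (T : ℝ) (m : ℕ) where
  /-- the bounded open set enclosed by the initial surface -/
  dom : Set E3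
  dom_open : IsOpen dom
  dom_bounded : Bornology.IsBounded dom
  dom_nonempty : dom.Nonempty
  /-- the boundary is locally a regular level set of a `C^m` function, with `dom` on one side -/
  dom_boundary : ∀ x ∈ frontier dom, ∃ U ∈ 𝓝 x, ∃ φ : E3 → ℝ, ContDiff ℝ m φ ∧ fderiv ℝ φ x ≠ 0 ∧
    ∀ y ∈ U, (y ∈ dom ↔ φ y < 0)
  flow : ℝ → E3 → E3
  vel : ℝ → E3 → E3
  acc : ℝ → E3 → E3
  flow_zero : ∀ z ∈ frontier dom, flow 0 z = z
  flow_deriv : ∀ t z, HasDerivAt (fun s => flow s z) (vel t z) t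
  vel_deriv : ∀ t z, HasDerivAt (fun s => vel s z) (acc t z) t
  flow_reg : ContInTimeCm m flow
  vel_reg : ContInTimeCm m vel
  acc_reg : ContInTimeCm m acc
  /-- `Φ_t` is injective on `Γ(0)` -/
  flow_inj : ∀ t ∈ Icc 0 T, InjOn (flow t) (frontier dom)
  /-- `Φ_t` is an immersion of `Γ(0)` -/
  flow_immersion : ∀ t ∈ Icc 0 T, ∀ z ∈ frontier dom, ∀ τ ∈ tangentConeAt ℝ (frontier dom) z,
    fderiv ℝ (flow t) z τ = 0 → τ = 0
  /-- the velocity is normal to `Γ(t)`, whose tangent space at `Φ_t(z)` is `DΦ_t(z) (T_z Γ(0))` -/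
  vel_normal : ∀ t ∈ Icc 0 T, ∀ z ∈ frontier dom, ∀ τ ∈ tangentConeAt ℝ (frontier dom) z,
    inner ℝ (vel t z) (fderiv ℝ (flow t) z τ) = 0

/-- The initial surface `Γ(0)`. -/
def EvolvingSurface.init {T : ℝ} {m : ℕ} (S : EvolvingSurface T m) : Set E3 := frontier S.dom

/-- `ν` is the outward unit normal at `x` of the open set `Ω`. -/
def IsOuterNormal (Ω : Set E3) (x ν : E3) : Prop :=
  ‖ν‖ = 1 ∧ (∀ τ ∈ tangentConeAt ℝ (frontier Ω) x, inner ℝ ν τ = 0) ∧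
    (∀ᶠ s : ℝ in 𝓝[>] 0, x - s • ν ∈ Ω) ∧ (∀ᶠ s : ℝ in 𝓝[>] 0, x + s • ν ∉ closure Ω)

/-- The closest point projection `π` onto the set `Γ` (used only where the closest point is
unique). -/
def closestPt (Γ : Set E3) (x : E3) : E3 :=
  Classical.epsilon fun p => p ∈ Γ ∧ dist x p = Metric.infDist x Γ

/-! ### Reference triangle, Lagrange interpolation -/

/-- Points of the plane of the reference triangle. -/
abbrev R2 : Type := Fin 2 → ℝ

/-- The closed reference triangle. -/
def refTri : Set R2 := {ξ | 0 ≤ ξ 0 ∧ 0 ≤ ξ 1 ∧ ξ 0 + ξ 1 ≤ 1}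

/-- Barycentric coordinates on the reference triangle, as polynomials. -/
def baryPoly : Fin 3 → MvPolynomial (Fin 2) ℝ :=
  ![1 - MvPolynomial.X 0 - MvPolynomial.X 1, MvPolynomial.X 0, MvPolynomial.X 1]

/-- The affine parametrization over the reference triangle of the flat triangle with vertices
`v 0, v 1, v 2`. -/
def flatMap (v : Fin 3 → E3) (ξ : R2) : E3 :=
  ∑ j, MvPolynomial.eval ξ (baryPoly j) • v j

/-- The Lagrange node of order `k` with multi-index `α`, `α 0 + α 1 + α 2 = k`, in the reference
triangle; its barycentric coordinates are `α j / k`. -/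
def lagrangeNode (k : ℕ) (α : Fin 3 → ℕ) : R2 := ![(α 1 : ℝ) / k, (α 2 : ℝ) / k]

/-- The Lagrange basis polynomial of degree `k` that is `1` at the node `α` and `0` at the other
nodes of order `k`. -/
def lagrangePoly (k : ℕ) (α : Fin 3 → ℕ) : MvPolynomial (Fin 2) ℝ :=
  ∏ j, ∏ i ∈ Finset.range (α j),
    MvPolynomial.C (1 / ((i : ℝ) + 1)) *
      (MvPolynomial.C (k : ℝ) * baryPoly j - MvPolynomial.C (i : ℝ))

/-- Lagrange interpolation of degree `k` on the reference triangle of a map to `ℝ³`; the result is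
a triple of polynomials. -/
def lagrangeInterp (k : ℕ) (g : R2 → E3) : Fin 3 → MvPolynomial (Fin 2) ℝ := fun i =>
  ∑ α ∈ Finset.Nat.antidiagonalTuple 3 k,
    MvPolynomial.C (g (lagrangeNode k α) i) * lagrangePoly k α

/-- Twice the vector area of the flat triangle with vertices `v 0, v 1, v 2`. -/
def triNormal (v : Fin 3 → E3) : E3 :=
  WithLp.toLp 2 ((v 1 - v 0).ofLp ⨯₃ (v 2 - v 0).ofLp)

/-- Radius of the largest disc in the flat triangle with vertices `v 0, v 1, v 2`:
twice the area divided by the perimeter. -/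
def inradius (v : Fin 3 → E3) : ℝ :=
  ‖triNormal v‖ / (dist (v 0) (v 1) + dist (v 1) (v 2) + dist (v 2) (v 0))

/-! ### The evolving triangulated surface -/

/-- An admissible, conforming initial triangulation: finitely many flat triangles with vertices on
`Γ(0)`, forming a polyhedral surface that the closest point projection maps bijectively onto
`Γ(0)`. -/
structure Mesh {T : ℝ} {m : ℕ} (S : EvolvingSurface T m) where
  numTri : ℕ
  vert : Fin numTri → Fin 3 → E3
  vert_mem : ∀ K j, vert K j ∈ S.init
  affineIndep : ∀ K, AffineIndependent ℝ (vert K)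
  distinct : Function.Injective fun K => range (vert K)
  conforming : ∀ K K', convexHull ℝ (range (vert K)) ∩ convexHull ℝ (range (vert K')) =
    convexHull ℝ (range (vert K) ∩ range (vert K'))
  /-- the polyhedral surface lies where the closest point projection is defined -/
  tubular : ∀ K, ∀ x ∈ convexHull ℝ (range (vert K)),
    ∃! p, p ∈ S.init ∧ dist x p = Metric.infDist x S.init
  bijective : BijOn (closestPt S.init) (⋃ K, convexHull ℝ (range (vert K))) S.init
  /-- the vertices of each triangle are ordered such that its normal points outward -/
  oriented : ∀ K j ν, IsOuterNormal S.dom (vert K j) ν → 0 < inner ℝ ν (triNormal (vert K))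

namespace Mesh

variable {T : ℝ} {m : ℕ} {S : EvolvingSurface T m}

/-- The parametrization over the reference triangle of the element `K` of `Γ_h(t)`: the Lagrange
interpolant of degree `kg` with the nodes `α_j(t) = Φ_t(α_j(0))`, where the `α_j(0)` are the
closest point projections of the Lagrange nodes of the flat triangle. -/
def elem (M : Mesh S) (kg : ℕ) (t : ℝ) (K : Fin M.numTri) : Fin 3 → MvPolynomial (Fin 2) ℝ :=
  lagrangeInterp kg fun ξ => S.flow t (closestPt S.init (flatMap (M.vert K) ξ))

/-- The discrete material velocity on the element `K` of `Γ_h(t)`, pulled back to the reference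
triangle: the Lagrange interpolant of the surface velocity at the nodes `α_j(t)`. -/
def elemVel (M : Mesh S) (kg : ℕ) (t : ℝ) (K : Fin M.numTri) : Fin 3 → MvPolynomial (Fin 2) ℝ :=
  lagrangeInterp kg fun ξ => S.vel t (closestPt S.init (flatMap (M.vert K) ξ))

/-- The (curved) element `K` of `Γ_h(t)` as a subset of `ℝ³`. -/
def elemSet (M : Mesh S) (kg : ℕ) (t : ℝ) (K : Fin M.numTri) : Set E3 :=
  (fun ξ => WithLp.toLp 2 fun i => MvPolynomial.eval ξ (M.elem kg t K i)) '' refTri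

/-- The mesh size `h`, the largest diameter of an element over all times in `[0,T]`. -/
def size (M : Mesh S) (kg : ℕ) : ℝ :=
  sSup {d | ∃ t ∈ Icc 0 T, ∃ K, d = Metric.diam (M.elemSet kg t K)}

/-- Uniform quasi-uniformity with constant `ρ`. -/
def QuasiUniform (M : Mesh S) (kg : ℕ) (ρ : ℝ) : Prop :=
  ∀ t ∈ Icc 0 T, ∀ K, ρ * M.size kg ≤ inradius fun j => S.flow t (M.vert K j)

end Mesh

/-! ### Surface differential operators on one element

`F` is the polynomial parametrization of an element; functions on the element are given by their
pull-backs to the reference triangle. -/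

/-- Jacobian of a polynomial map from the reference triangle to `ℝ³`. -/
def jac (w : Fin 3 → MvPolynomial (Fin 2) ℝ) (ξ : R2) : Matrix (Fin 3) (Fin 2) ℝ :=
  Matrix.of fun i j => MvPolynomial.eval ξ (MvPolynomial.pderiv j (w i))

/-- First fundamental form of the element. -/
def metric (F : Fin 3 → MvPolynomial (Fin 2) ℝ) (ξ : R2) : Matrix (Fin 2) (Fin 2) ℝ :=
  (jac F ξ)ᵀ * jac F ξ

/-- Area density of the element. -/
def areaDensity (F : Fin 3 → MvPolynomial (Fin 2) ℝ) (ξ : R2) : ℝ := √(metric F ξ).det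

/-- Unit normal `n_h` of the element. -/
def normal (F : Fin 3 → MvPolynomial (Fin 2) ℝ) (ξ : R2) : Fin 3 → ℝ :=
  (areaDensity F ξ)⁻¹ • ((fun i => jac F ξ i 0) ⨯₃ (fun i => jac F ξ i 1))

/-- The projection `P_h = I - n_h ⊗ n_h`. -/
def tangProj (F : Fin 3 → MvPolynomial (Fin 2) ℝ) (ξ : R2) : Matrix (Fin 3) (Fin 3) ℝ :=
  1 - Matrix.vecMulVec (normal F ξ) (normal F ξ)

/-- Tangential gradient of a scalar function. -/
def gradS (F : Fin 3 → MvPolynomial (Fin 2) ℝ) (q : MvPolynomial (Fin 2) ℝ) (ξ : R2) :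
    Fin 3 → ℝ :=
  (jac F ξ * (metric F ξ)⁻¹) *ᵥ fun j => MvPolynomial.eval ξ (MvPolynomial.pderiv j q)

/-- Tangential (directional) derivative of a vector field: the matrix whose row `i` is the
tangential gradient of the component `i`. -/
def gradV (F w : Fin 3 → MvPolynomial (Fin 2) ℝ) (ξ : R2) : Matrix (Fin 3) (Fin 3) ℝ :=
  Matrix.of fun i => gradS F (w i) ξ

/-- Covariant derivative `P_h ∇_{Γ_h} w`. -/
def covV (F w : Fin 3 → MvPolynomial (Fin 2) ℝ) (ξ : R2) : Matrix (Fin 3) (Fin 3) ℝ :=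
  tangProj F ξ * gradV F w ξ

/-- Rate-of-strain tensor `E_h`. -/
def strain (F w : Fin 3 → MvPolynomial (Fin 2) ℝ) (ξ : R2) : Matrix (Fin 3) (Fin 3) ℝ :=
  (1 / 2 : ℝ) • (covV F w ξ + (covV F w ξ)ᵀ)

/-- Surface divergence. -/
def divV (F w : Fin 3 → MvPolynomial (Fin 2) ℝ) (ξ : R2) : ℝ := (gradV F w ξ).trace

/-! ### Finite element spaces

A finite element function on `Γ_h(t)` is given by its polynomial pull-backs to the reference
triangle, one for each element.  These pull-backs are unchanged by the time-lift, because the nodal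
basis functions are transported with the discrete flow; so one and the same family represents
a finite element function on `Γ_h(s)` and its time-lift to `Γ_h(t)`. -/

/-- Pull-backs of elementwise polynomial scalar functions. -/
abbrev ScalarFn {T : ℝ} {m : ℕ} {S : EvolvingSurface T m} (M : Mesh S) : Type :=
  Fin M.numTri → MvPolynomial (Fin 2) ℝ

/-- Pull-backs of elementwise polynomial vector fields, by components. -/
abbrev VectorFn {T : ℝ} {m : ℕ} {S : EvolvingSurface T m} (M : Mesh S) : Type :=
  Fin 3 → ScalarFn M

/-- Pull-backs of arbitrary vector fields on `Γ_h(t)`. -/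
abbrev VectorField {T : ℝ} {m : ℕ} {S : EvolvingSurface T m} (M : Mesh S) : Type :=
  Fin M.numTri → R2 → Fin 3 → ℝ

namespace Mesh

variable {T : ℝ} {m : ℕ} {S : EvolvingSurface T m}

/-- The pulled-back vector field of a finite element function. -/
def field (M : Mesh S) (w : VectorFn M) : VectorField M :=
  fun K ξ i => MvPolynomial.eval ξ (w i K)

/-- The polynomial pull-back of `w` on the element `K`. -/
def loc (M : Mesh S) (w : VectorFn M) (K : Fin M.numTri) : Fin 3 → MvPolynomial (Fin 2) ℝ :=
  fun i => w i K

/-- Continuous Lagrange finite elements of degree `k`: polynomials of degree at most `k` on each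
element, with equal values at the points shared by several elements. -/
def scalarSpace (M : Mesh S) (k : ℕ) : Set (ScalarFn M) :=
  {q | (∀ K, (q K).totalDegree ≤ k) ∧
    ∀ K K', ∀ ξ ∈ refTri, ∀ ξ' ∈ refTri, flatMap (M.vert K) ξ = flatMap (M.vert K') ξ' →
      MvPolynomial.eval ξ (q K) = MvPolynomial.eval ξ' (q K')}

/-- The velocity space: vector fields with components in the scalar space of degree `k`. -/
def velSpace (M : Mesh S) (k : ℕ) : Set (VectorFn M) := {w | ∀ i, w i ∈ M.scalarSpace k}

/-- Integral over `Γ_h(t)` of a function given by its pull-backs. -/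
def integral (M : Mesh S) (kg : ℕ) (t : ℝ) (φ : Fin M.numTri → R2 → ℝ) : ℝ :=
  ∑ K, ∫ ξ in refTri, φ K ξ * areaDensity (M.elem kg t K) ξ

/-- The space `Q_h(t)`: scalar finite elements of degree `k` with zero mean on `Γ_h(t)`. -/
def presSpace (M : Mesh S) (kg k : ℕ) (t : ℝ) : Set (ScalarFn M) :=
  {q | q ∈ M.scalarSpace k ∧ M.integral kg t (fun K ξ => MvPolynomial.eval ξ (q K)) = 0}

/-! ### Discrete bilinear and trilinear forms on `Γ_h(t)` -/

/-- `m_h(t; w, v)`, the `L²` inner product. -/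
def mForm (M : Mesh S) (kg : ℕ) (t : ℝ) (w v : VectorField M) : ℝ :=
  M.integral kg t fun K ξ => w K ξ ⬝ᵥ v K ξ

/-- `g_h(t; V_h; w, v)` with the discrete material velocity `V_h`. -/
def gForm (M : Mesh S) (kg : ℕ) (t : ℝ) (w v : VectorFn M) : ℝ :=
  M.integral kg t fun K ξ =>
    divV (M.elem kg t K) (M.elemVel kg t K) ξ * (M.field w K ξ ⬝ᵥ M.field v K ξ)

/-- `a_{S,h}(t; w, v)`. -/
def aSForm (M : Mesh S) (kg : ℕ) (t : ℝ) (w v : VectorFn M) : ℝ :=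
  M.integral kg t fun K ξ =>
    ((strain (M.elem kg t K) (M.loc w K) ξ)ᵀ * strain (M.elem kg t K) (M.loc v K) ξ).trace

/-- `a_h(t; w, v)`. -/
def aForm (M : Mesh S) (kg : ℕ) (t : ℝ) (w v : VectorFn M) : ℝ :=
  M.aSForm kg t w v + M.mForm kg t (M.field w) (M.field v)

/-- `c_h(t; z; w, v)`, the skew-symmetrized directional convective form. -/
def cForm (M : Mesh S) (kg : ℕ) (t : ℝ) (z w v : VectorFn M) : ℝ :=
  (1 / 2 : ℝ) *
    (M.integral kg t (fun K ξ =>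
        (gradV (M.elem kg t K) (M.loc w K) ξ *ᵥ M.field z K ξ) ⬝ᵥ M.field v K ξ) -
      M.integral kg t (fun K ξ =>
        (gradV (M.elem kg t K) (M.loc v K) ξ *ᵥ M.field z K ξ) ⬝ᵥ M.field w K ξ))

/-- `b_h^L(t; w, {q, η})`. -/
def bForm (M : Mesh S) (kg : ℕ) (t : ℝ) (w : VectorFn M) (q η : ScalarFn M) : ℝ :=
  M.integral kg t (fun K ξ => M.field w K ξ ⬝ᵥ gradS (M.elem kg t K) (q K) ξ) +
    M.integral kg t (fun K ξ =>
      MvPolynomial.eval ξ (η K) * (M.field w K ξ ⬝ᵥ normal (M.elem kg t K) ξ))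

/-- The `L²(Γ_h(t))` norm. -/
def normL2 (M : Mesh S) (kg : ℕ) (t : ℝ) (w : VectorField M) : ℝ := √(M.mForm kg t w w)

/-- The energy norm `‖w‖_{a_h} = ‖E_h(w)‖_{L²} + ‖w‖_{L²}` on `Γ_h(t)`. -/
def normA (M : Mesh S) (kg : ℕ) (t : ℝ) (w : VectorFn M) : ℝ :=
  √(M.aSForm kg t w w) + M.normL2 kg t (M.field w)

/-- Discrete weakly tangential divergence-free functions on `Γ_h(t)`, for the Taylor-Hood triple
of degrees `ku`, `ku - 1`, `ku` for velocity, pressure and normal multiplier. -/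
def divFree (M : Mesh S) (ku kg : ℕ) (t : ℝ) : Set (VectorFn M) :=
  {w | w ∈ M.velSpace ku ∧
    ∀ q ∈ M.presSpace kg (ku - 1) t, ∀ η ∈ M.scalarSpace ku, M.bForm kg t w q η = 0}

/-! ### The fully discrete scheme and the auxiliary operators -/

/-- The time `t_n = n Δt`, `Δt = T / N`. -/
def time (_M : Mesh S) (N n : ℕ) : ℝ := n * (T / N)

/-- `(u, p, l)` solves the linearized directional fully discrete scheme on `[0,T]` with `N` time
steps and data `f`. -/
structure IsSolution (M : Mesh S) (ku kg N : ℕ) (f : ℕ → VectorField M) (u : ℕ → VectorFn M)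
    (p l : ℕ → ScalarFn M) : Prop where
  init : u 0 ∈ M.divFree ku kg 0
  vel_mem : ∀ n, 1 ≤ n → n ≤ N → u n ∈ M.velSpace ku
  pres_mem : ∀ n, 1 ≤ n → n ≤ N → p n ∈ M.presSpace kg (ku - 1) (M.time N n)
  mult_mem : ∀ n, 1 ≤ n → n ≤ N → l n ∈ M.scalarSpace ku
  momentum : ∀ n, 1 ≤ n → n ≤ N → ∀ v ∈ M.velSpace ku,
    1 / (T / N) * (M.mForm kg (M.time N n) (M.field (u n)) (M.field v)
        - M.mForm kg (M.time N (n - 1)) (M.field (u (n - 1))) (M.field v))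
      - M.gForm kg (M.time N n) (u n) v
      + M.aSForm kg (M.time N n) (u n) v
      + M.cForm kg (M.time N n) (u (n - 1)) (u n) v
      + M.bForm kg (M.time N n) v (p n) (l n)
      = M.mForm kg (M.time N n) (f n) (M.field v)
  constraint : ∀ n, 1 ≤ n → n ≤ N → ∀ q ∈ M.presSpace kg (ku - 1) (M.time N n),
    ∀ η ∈ M.scalarSpace ku, M.bForm kg (M.time N n) (u n) q η = 0

/-- `what` is the Leray time-projection to `Γ_h(t)` of the function `w` on `Γ_h(s)`. -/
def IsLerayProj (M : Mesh S) (ku kg : ℕ) (s t : ℝ) (w what : VectorFn M) : Prop :=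
  what ∈ M.velSpace ku ∧
  (∃ p ∈ M.presSpace kg (ku - 1) t, ∃ l ∈ M.scalarSpace ku, ∀ v ∈ M.velSpace ku,
    M.mForm kg t (M.field what) (M.field v) + M.bForm kg t v p l
      = M.mForm kg s (M.field w) (M.field v)) ∧
  ∀ q ∈ M.presSpace kg (ku - 1) t, ∀ η ∈ M.scalarSpace ku, M.bForm kg t what q η = 0

/-- `z = 𝒜_h w` on `Γ_h(t)`, where `𝒜_h` is the discrete inverse Stokes operator. -/
def IsInvStokes (M : Mesh S) (ku kg : ℕ) (t : ℝ) (w z : VectorFn M) : Prop :=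
  z ∈ M.divFree ku kg t ∧
    ∀ v ∈ M.divFree ku kg t, M.aForm kg t z v = M.mForm kg t (M.field w) (M.field v)

/-- The quantity `exp(c t_n) (‖u⁰‖² + Δt ∑_{k=0}^n ‖f^k‖²)`. -/
def energyBound (M : Mesh S) (kg N : ℕ) (c : ℝ) (u0 : VectorFn M) (f : ℕ → VectorField M)
    (n : ℕ) : ℝ :=
  Real.exp (c * M.time N n) *
    (M.normL2 kg 0 (M.field u0) ^ 2 +
      T / N * ∑ k ∈ Finset.range (n + 1), M.normL2 kg (M.time N k) (f k) ^ 2)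

/-- `f^k ∈ L²(Γ_h(t_k))` for `k = 0, …, N`. -/
def SquareIntegrable (M : Mesh S) (N : ℕ) (f : ℕ → VectorField M) : Prop :=
  ∀ k, k ≤ N → ∀ K i, MemLp (fun ξ => f k K ξ i) 2 (volume.restrict refTri)

end Mesh

end ESFEM

end

namespace ESFEM

/-! ### The reference triangle -/

/-! Both bounds come from testing the scheme with discretely divergence-free fields, for which the
pressure and the multiplier drop out; no inf-sup condition enters.

(i) Testing with u^n removes the skew-symmetric convective term. The mass form at t_{n-1} is
compared with the one at t_n through the area densities of the moving elements, whose ratio is 1 +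
O(Δt). The term g_h is harmless because the discrete velocity has bounded surface divergence. A
discrete Gronwall argument closes the estimate (`energy_step`, `discrete_gronwall`).

(ii) For z = A_h(u^n - û^{n-1}), the definitions of A_h and of the Leray time-projection give
a_h(z,z) = m_h(u^n,z) - m_h(u^{n-1},z), the two mass forms being taken at t_n and t_{n-1}
(`aForm_invStokes_eq`). The scheme tested with z then expresses a_h(z,z)/Δt by g_h, a_{S,h}, c_h and
the force. All terms but c_h yield to Young's inequality. For c_h(u^{n-1};u^n,z) a bound by the
product of three energy norms, uniform in h, is needed; C_a absorbs the norm of u^{n-1}. Hence the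
square of ‖z‖_a/Δt is bounded by ‖u^n‖_a² + ‖f^n‖², and the sum over n is controlled by (i).

The trilinear bound is Hölder's inequality with exponents 2, 4, 4 together with two discrete
inequalities.

Ladyzhenskaya (`exists_sum_integral_pow_four_le`): the pull-backs of finite element functions do not
depend on time, so they may be viewed as continuous functions on the polyhedral surface of the
initial triangulation. Near each point of Γ(0) this polyhedron is a graph over the tangent plane
(`Mesh.exists_chart`). After localization by a partition of unity, the planar
Gagliardo-Nirenberg-Sobolev inequality is applied to the square of the function.

Korn (`exists_korn`): pointwise, the strain controls the tangential part of the gradient up to the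
term n·(∂₁w × ∂₂w) (`trace_strain_sq`). If n is replaced by a continuous piecewise linear N, this
term is a sum of Jacobian determinants up to lower order, and these integrate to zero over the
closed polyhedron (`exists_sum_integral_bracket_eq_zero`). The normal part n·∂ⱼw is controlled by
the multiplier constraint: superapproximation shows that w·N is O(h) in L², and an inverse
inequality bounds its gradient (`exists_refSum_normal_grad_le`).

The geometry enters only through `exists_regular`: Jacobians of order h, area densities of order h²,
normals within O(h) of a continuous interpolant, and Lipschitz dependence on time. All integrals are
carried to the reference triangle, where the Dirichlet integral is scale-invariant and the L² norm
carries a factor h. -/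

theorem eval_baryPoly_zero (ξ : R2) : MvPolynomial.eval ξ (baryPoly 0) = 1 - ξ 0 - ξ 1 := by
  simp [baryPoly]

theorem eval_baryPoly_one (ξ : R2) : MvPolynomial.eval ξ (baryPoly 1) = ξ 0 := by
  simp [baryPoly]

theorem eval_baryPoly_two (ξ : R2) : MvPolynomial.eval ξ (baryPoly 2) = ξ 1 := by
  simp [baryPoly]

theorem sum_eval_baryPoly (ξ : R2) : ∑ j, MvPolynomial.eval ξ (baryPoly j) = 1 := by
  rw [Fin.sum_univ_three, eval_baryPoly_zero, eval_baryPoly_one, eval_baryPoly_two]; ring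

theorem mem_refTri_iff (ξ : R2) : ξ ∈ refTri ↔ ∀ j, 0 ≤ MvPolynomial.eval ξ (baryPoly j) := by
  rw [Fin.forall_fin_succ, Fin.forall_fin_two, eval_baryPoly_zero]
  simp only [Fin.succ_zero_eq_one, Fin.succ_one_eq_two, eval_baryPoly_one, eval_baryPoly_two,
    refTri, mem_ofPred_eq]
  constructor <;> rintro ⟨h1, h2, h3⟩ <;> refine ⟨?_, ?_, ?_⟩ <;> linarith

theorem eval_baryPoly_nonneg {ξ : R2} (hξ : ξ ∈ refTri) (j : Fin 3) :
    0 ≤ MvPolynomial.eval ξ (baryPoly j) := (mem_refTri_iff ξ).1 hξ j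

theorem isClosed_refTri : IsClosed refTri := by
  have h0 : Continuous fun ξ : R2 => ξ 0 := continuous_apply 0
  have h1 : Continuous fun ξ : R2 => ξ 1 := continuous_apply 1
  exact (isClosed_le continuous_const h0).inter ((isClosed_le continuous_const h1).inter
    (isClosed_le (h0.add h1) continuous_const))

theorem isCompact_refTri : IsCompact refTri := by
  refine (isCompact_Icc (a := (0 : R2)) (b := 1)).of_isClosed_subset isClosed_refTri ?_
  rintro ξ ⟨h0, h1, h2⟩
  constructor <;> intro j <;> fin_cases j <;> simp <;> linarith

theorem measurableSet_refTri : MeasurableSet refTri := isClosed_refTri.measurableSet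

theorem convex_refTri : Convex ℝ refTri := by
  rintro x ⟨h0, h1, h2⟩ y ⟨g0, g1, g2⟩ a b ha hb hab
  refine ⟨?_, ?_, ?_⟩ <;> simp only [Pi.add_apply, Pi.smul_apply, smul_eq_mul]
  · positivity
  · positivity
  · calc _ = a * (x 0 + x 1) + b * (y 0 + y 1) := by ring
      _ ≤ a * 1 + b * 1 := by gcongr
      _ = 1 := by linarith

/-- The open reference triangle. -/
def openTri : Set R2 := {ξ | 0 < ξ 0 ∧ 0 < ξ 1 ∧ ξ 0 + ξ 1 < 1}

theorem mem_openTri_iff (ξ : R2) : ξ ∈ openTri ↔ ∀ j, 0 < MvPolynomial.eval ξ (baryPoly j) := by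
  rw [Fin.forall_fin_succ, Fin.forall_fin_two, eval_baryPoly_zero]
  simp only [Fin.succ_zero_eq_one, Fin.succ_one_eq_two, eval_baryPoly_one, eval_baryPoly_two,
    openTri, mem_ofPred_eq]
  constructor <;> rintro ⟨h1, h2, h3⟩ <;> refine ⟨?_, ?_, ?_⟩ <;> linarith

theorem openTri_subset_refTri : openTri ⊆ refTri := fun _ h => ⟨h.1.le, h.2.1.le, h.2.2.le⟩

theorem isOpen_openTri : IsOpen openTri := by
  have h0 : Continuous fun ξ : R2 => ξ 0 := continuous_apply 0
  have h1 : Continuous fun ξ : R2 => ξ 1 := continuous_apply 1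
  exact (isOpen_lt continuous_const h0).inter ((isOpen_lt continuous_const h1).inter
    (isOpen_lt (h0.add h1) continuous_const))

theorem refTri_subset_closure_openTri : refTri ⊆ closure openTri := by
  intro ξ hξ
  have hc : (![1 / 3, 1 / 3] : R2) ∈ openTri := by simp [openTri]; norm_num
  have hlim : Tendsto (fun t : ℝ => AffineMap.lineMap ξ (![1 / 3, 1 / 3] : R2) t) (𝓝[>] 0)
      (𝓝 ξ) := by
    have : ContinuousAt (fun t : ℝ => AffineMap.lineMap ξ (![1 / 3, 1 / 3] : R2) t) 0 :=
      AffineMap.lineMap_continuous.continuousAt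
    have h := this.tendsto.mono_left (nhdsWithin_le_nhds (s := Ioi (0 : ℝ)))
    simpa using h
  refine mem_closure_of_tendsto hlim ?_
  have h1 : ∀ᶠ t : ℝ in 𝓝[>] 0, 0 < t ∧ t < 1 := eventually_mem_nhdsWithin.and
    ((eventually_lt_nhds one_pos).filter_mono nhdsWithin_le_nhds)
  filter_upwards [h1] with t ht
  obtain ⟨h0, h1, h2⟩ := hξ
  have hval : ∀ j, AffineMap.lineMap ξ (![1 / 3, 1 / 3] : R2) t j = ξ j + t * (1 / 3 - ξ j) := by
    intro j
    fin_cases j <;> simp [AffineMap.lineMap_apply, Matrix.vecHead, Matrix.vecTail] <;> ring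
  refine ⟨?_, ?_, ?_⟩ <;> simp only [hval] <;> nlinarith [ht.1, ht.2]

theorem convex_openTri : Convex ℝ openTri := by
  rintro x ⟨h0, h1, h2⟩ y ⟨g0, g1, g2⟩ a b ha hb hab
  have key : ∀ u v : ℝ, 0 < u → 0 < v → 0 < a * u + b * v := by
    intro u v hu hv
    rcases ha.eq_or_lt with rfl | ha
    · rw [zero_add] at hab; rw [hab]; linarith
    · positivity
  refine ⟨key _ _ h0 g0, key _ _ h1 g1, ?_⟩
  have := key (1 - x 0 - x 1) (1 - y 0 - y 1) (by linarith) (by linarith)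
  simp only [Pi.add_apply, Pi.smul_apply, smul_eq_mul]
  nlinarith

/-- The frontier of a convex set is Lebesgue null. Disjointness and differentiability of charts hold
on open triangles, whereas the forms integrate over closed ones; this equality moves between the
two. -/
theorem openTri_ae_eq_refTri : openTri =ᵐ[volume] refTri := by
  refine Filter.EventuallyLE.antisymm (LE.le.eventuallyLE openTri_subset_refTri) ?_
  have h := convex_openTri.addHaar_frontier volume
  rw [isOpen_openTri.frontier_eq] at h
  exact ae_le_set.2 (measure_mono_null (sdiff_subset_sdiff_left refTri_subset_closure_openTri) h)

/-! ### Derivatives of polynomials -/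

theorem hasFDerivAt_eval (p : MvPolynomial (Fin 2) ℝ) (ξ : R2) :
    HasFDerivAt (fun x : R2 => MvPolynomial.eval x p)
      (∑ j, MvPolynomial.eval ξ (MvPolynomial.pderiv j p) •
        (ContinuousLinearMap.proj j : R2 →L[ℝ] ℝ)) ξ := by
  induction p using MvPolynomial.induction_on with
  | C a => simpa using hasFDerivAt_const a ξ
  | add p q hp hq =>
    have e : (fun x : R2 => MvPolynomial.eval x (p + q)) =
        (fun x => MvPolynomial.eval x p) + fun x => MvPolynomial.eval x q := by ext x; simp
    rw [e]
    exact (hp.add hq).congr_fderiv (by simp [add_smul, Finset.sum_add_distrib])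
  | mul_X p i hp =>
    have hX : HasFDerivAt (fun x : R2 => x i) (ContinuousLinearMap.proj i : R2 →L[ℝ] ℝ) ξ :=
      (ContinuousLinearMap.proj i : R2 →L[ℝ] ℝ).hasFDerivAt
    have e : (fun x : R2 => MvPolynomial.eval x (p * MvPolynomial.X i)) =
        (fun x => MvPolynomial.eval x p) * fun x => x i := by ext x; simp
    rw [e]
    refine (hp.mul hX).congr_fderiv ?_
    ext v
    simp only [Derivation.leibniz, MvPolynomial.pderiv_X]
    fin_cases i <;> simp [Fin.sum_univ_two, Pi.single_apply] <;> ring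

theorem continuous_eval (p : MvPolynomial (Fin 2) ℝ) : Continuous fun ξ : R2 =>
    MvPolynomial.eval ξ p := MvPolynomial.continuous_eval p

/-- A polynomial is Lipschitz on the reference triangle. -/
theorem exists_lipschitz_eval (p : MvPolynomial (Fin 2) ℝ) :
    ∃ M : ℝ, 0 ≤ M ∧ ∀ x ∈ refTri, ∀ y ∈ refTri,
      |MvPolynomial.eval x p - MvPolynomial.eval y p| ≤ M * ‖x - y‖ := by
  have hc : Continuous fun ξ : R2 => ∑ j, MvPolynomial.eval ξ (MvPolynomial.pderiv j p) •
        (ContinuousLinearMap.proj j : R2 →L[ℝ] ℝ) := by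
    have := fun j => continuous_eval (MvPolynomial.pderiv j p)
    fun_prop
  obtain ⟨M, hM⟩ := isCompact_refTri.exists_bound_of_continuousOn hc.continuousOn
  refine ⟨max M 0, le_max_right _ _, fun x hx y hy => ?_⟩
  have := convex_refTri.norm_image_sub_le_of_norm_hasFDerivWithin_le
    (f := fun x : R2 => MvPolynomial.eval x p)
    (fun z _ => (hasFDerivAt_eval p z).hasFDerivWithinAt)
    (fun z hz => (hM z hz).trans (le_max_left M 0)) hy hx
  simpa [Real.norm_eq_abs] using this

theorem integrableOn_refTri {f : R2 → ℝ} (hf : ContinuousOn f refTri) :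
    IntegrableOn f refTri := hf.integrableOn_compact isCompact_refTri

theorem eq_zero_of_integral_sq_eq_zero {p : MvPolynomial (Fin 2) ℝ}
    (h : ∫ ξ in refTri, MvPolynomial.eval ξ p ^ 2 = 0) : p = 0 := by
  have hc : Continuous fun ξ : R2 => MvPolynomial.eval ξ p ^ 2 := (continuous_eval p).pow 2
  have hae : (fun ξ : R2 => MvPolynomial.eval ξ p ^ 2) =ᵐ[volume.restrict refTri] 0 :=
    (integral_eq_zero_iff_of_nonneg (fun ξ => sq_nonneg _)
      (integrableOn_refTri hc.continuousOn)).1 h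
  have hae' : (fun ξ : R2 => MvPolynomial.eval ξ p ^ 2) =ᵐ[volume.restrict openTri]
      fun _ => 0 := ae_mono (Measure.restrict_mono openTri_subset_refTri le_rfl) hae
  have heq : EqOn (fun ξ : R2 => MvPolynomial.eval ξ p ^ 2) (fun _ => 0) openTri :=
    Measure.eqOn_open_of_ae_eq hae' isOpen_openTri hc.continuousOn continuousOn_const
  -- A polynomial vanishing on a product of infinite sets is zero, and the square (0,1/2)² lies in
  -- the open triangle.
  refine MvPolynomial.funext_set (fun _ => Ioo (0 : ℝ) (1 / 2))
    (fun _ => Ioo_infinite (by norm_num)) fun x hx => ?_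
  have h0 := hx 0 (mem_univ _)
  have h1 := hx 1 (mem_univ _)
  have := heq (show x ∈ openTri from ⟨h0.1, h1.1, by linarith [h0.2, h1.2]⟩)
  simpa using this

/-! ### Lagrange interpolation -/

theorem eval_baryPoly_lagrangeNode {k : ℕ} (hk : 1 ≤ k) {α : Fin 3 → ℕ}
    (hα : α ∈ Finset.Nat.antidiagonalTuple 3 k) (j : Fin 3) :
    MvPolynomial.eval (lagrangeNode k α) (baryPoly j) = (α j : ℝ) / k := by
  rw [Finset.Nat.mem_antidiagonalTuple, Fin.sum_univ_three] at hα
  have hk' : (k : ℝ) ≠ 0 := by positivity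
  have : (α 0 : ℝ) + α 1 + α 2 = k := by exact_mod_cast hα
  fin_cases j
  · simp only [Fin.zero_eta, eval_baryPoly_zero, lagrangeNode]
    simp
    field_simp
    linarith
  · simp [eval_baryPoly_one, lagrangeNode]
  · simp [eval_baryPoly_two, lagrangeNode]

theorem lagrangeNode_mem_refTri {k : ℕ} (hk : 1 ≤ k) {α : Fin 3 → ℕ}
    (hα : α ∈ Finset.Nat.antidiagonalTuple 3 k) : lagrangeNode k α ∈ refTri := by
  rw [mem_refTri_iff]
  intro j
  rw [eval_baryPoly_lagrangeNode hk hα]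
  positivity

theorem eval_lagrangePoly (k : ℕ) (α : Fin 3 → ℕ) (ξ : R2) :
    MvPolynomial.eval ξ (lagrangePoly k α) = ∏ j, ∏ i ∈ Finset.range (α j),
      (1 / ((i : ℝ) + 1) * (k * MvPolynomial.eval ξ (baryPoly j) - i)) := by
  simp [lagrangePoly, map_prod]

theorem eval_lagrangePoly_node {k : ℕ} (hk : 1 ≤ k) {α β : Fin 3 → ℕ}
    (hα : α ∈ Finset.Nat.antidiagonalTuple 3 k) (hβ : β ∈ Finset.Nat.antidiagonalTuple 3 k) :
    MvPolynomial.eval (lagrangeNode k β) (lagrangePoly k α) = if α = β then 1 else 0 := by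
  have hk' : (k : ℝ) ≠ 0 := by positivity
  rw [eval_lagrangePoly]
  simp only [eval_baryPoly_lagrangeNode hk hβ, mul_div_cancel₀ _ hk']
  split_ifs with h
  · subst h
    refine Finset.prod_eq_one fun j _ => ?_
    rw [Finset.prod_mul_distrib]
    -- Reversing the order of the second product pairs 1/(i+1) with α j - (α j - 1 - i) = i + 1, so
    -- every factor is 1.
    rw [← Finset.prod_range_reflect (fun i : ℕ => (α j : ℝ) - i), ← Finset.prod_mul_distrib]
    refine Finset.prod_eq_one fun i hi => ?_
    rw [Finset.mem_range] at hi
    have : ((α j - 1 - i : ℕ) : ℝ) = α j - 1 - i := by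
      rw [Nat.cast_sub (by omega), Nat.cast_sub (by omega)]; simp
    rw [this]
    field_simp
    ring
  -- Distinct multi-indices of equal sum cannot be ordered componentwise. Where β j < α j, the
  -- factor with i = β j vanishes at the node β.
  · have : ∃ j, β j < α j := by
      by_contra! hle
      apply h
      rw [Finset.Nat.mem_antidiagonalTuple] at hα hβ
      have hs : ∑ j, α j = ∑ j, β j := by rw [hα, hβ]
      funext j
      exact (Finset.sum_eq_sum_iff_of_le fun i _ => hle i).1 hs j (Finset.mem_univ j)
    obtain ⟨j, hj⟩ := this
    refine Finset.prod_eq_zero (Finset.mem_univ j) ?_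
    exact Finset.prod_eq_zero (Finset.mem_range.2 hj) (by simp)

theorem totalDegree_baryPoly_le (j : Fin 3) : (baryPoly j).totalDegree ≤ 1 := by
  have h0 : (1 : MvPolynomial (Fin 2) ℝ).totalDegree ≤ 1 := by simp
  have hX : ∀ i : Fin 2, (MvPolynomial.X i : MvPolynomial (Fin 2) ℝ).totalDegree ≤ 1 := fun i => by
    simp
  fin_cases j
  · exact (MvPolynomial.totalDegree_sub _ _).trans (max_le
      ((MvPolynomial.totalDegree_sub _ _).trans (max_le h0 (hX 0))) (hX 1))
  · exact hX 0
  · exact hX 1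

theorem totalDegree_lagrangePoly_le {k : ℕ} {α : Fin 3 → ℕ}
    (hα : α ∈ Finset.Nat.antidiagonalTuple 3 k) : (lagrangePoly k α).totalDegree ≤ k := by
  rw [Finset.Nat.mem_antidiagonalTuple] at hα
  rw [← hα]
  refine (MvPolynomial.totalDegree_finsetProd _ _).trans (Finset.sum_le_sum fun j _ => ?_)
  refine (MvPolynomial.totalDegree_finsetProd _ _).trans ?_
  calc _ ≤ ∑ i ∈ Finset.range (α j), 1 := Finset.sum_le_sum fun i _ => ?_
    _ = α j := by simp
  refine (MvPolynomial.totalDegree_mul _ _).trans ?_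
  rw [MvPolynomial.totalDegree_C, zero_add]
  refine (MvPolynomial.totalDegree_sub _ _).trans (max_le ?_
    (by rw [MvPolynomial.totalDegree_C]; exact zero_le_one))
  refine (MvPolynomial.totalDegree_mul _ _).trans ?_
  rw [MvPolynomial.totalDegree_C, zero_add]
  exact totalDegree_baryPoly_le j

/-- Completing an exponent pair by k - n₀ - n₁ injects the monomials of degree at most k into the
node indices. This dimension count turns linear independence of the Lagrange polynomials into
spanning. -/
theorem finrank_restrictTotalDegree_le (k : ℕ) :
    Module.finrank ℝ (MvPolynomial.restrictTotalDegree (Fin 2) ℝ k) ≤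
      (Finset.Nat.antidiagonalTuple 3 k).card := by
  have hb := MvPolynomial.basisRestrictSupport ℝ {n : Fin 2 →₀ ℕ | (n.sum fun _ e => e) ≤ k}
  have hsum : ∀ n : Fin 2 →₀ ℕ, (n.sum fun _ e => e) = n 0 + n 1 := fun n => by
    rw [Finsupp.sum_fintype _ _ (fun _ => rfl), Fin.sum_univ_two]
  let e : {n : Fin 2 →₀ ℕ | (n.sum fun _ e => e) ≤ k} → Finset.Nat.antidiagonalTuple 3 k :=
    fun n => ⟨![k - (n.1 0 + n.1 1), n.1 0, n.1 1], by
      have := n.2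
      rw [mem_ofPred_eq, hsum] at this
      rw [Finset.Nat.mem_antidiagonalTuple, Fin.sum_univ_three]
      simp
      omega⟩
  have he : Function.Injective e := by
    intro a b hab
    have h := congrArg Subtype.val hab
    have h0 := congrFun h 1
    have h1 := congrFun h 2
    apply Subtype.ext
    ext i
    fin_cases i
    · exact h0
    · exact h1
  have := Finite.of_injective e he
  rw [MvPolynomial.restrictTotalDegree, Module.finrank_eq_nat_card_basis hb]
  refine (Nat.card_le_card_of_injective e he).trans ?_
  simp

/-- Lagrange interpolation of degree `k` reproduces polynomials of degree at most `k`. -/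
theorem sum_lagrangePoly_eq {k : ℕ} (hk : 1 ≤ k) {p : MvPolynomial (Fin 2) ℝ}
    (hp : p.totalDegree ≤ k) :
    p = ∑ α ∈ Finset.Nat.antidiagonalTuple 3 k,
      MvPolynomial.C (MvPolynomial.eval (lagrangeNode k α) p) * lagrangePoly k α := by
  let V := MvPolynomial.restrictTotalDegree (Fin 2) ℝ k
  let b : Finset.Nat.antidiagonalTuple 3 k → V := fun α => ⟨lagrangePoly k α,
    (MvPolynomial.mem_restrictTotalDegree _ _ _).2 (totalDegree_lagrangePoly_le α.2)⟩
  have hev : ∀ (c : Finset.Nat.antidiagonalTuple 3 k → ℝ) (β : Finset.Nat.antidiagonalTuple 3 k),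
      MvPolynomial.eval (lagrangeNode k β) (∑ α, c α • b α : V).1 = c β := by
    intro c β
    rw [AddSubmonoidClass.coe_finsetSum, map_sum, Finset.sum_eq_single β]
    · simp [b, MvPolynomial.smul_eval, eval_lagrangePoly_node hk β.2 β.2]
    · intro α _ hne
      have : (α : Fin 3 → ℕ) ≠ β := fun h => hne (Subtype.ext h)
      simp [b, MvPolynomial.smul_eval, eval_lagrangePoly_node hk α.2 β.2, this]
    · simp
  have hli : LinearIndependent ℝ b := by
    rw [Fintype.linearIndependent_iff]
    intro c hc β
    rw [← hev c β, hc]; simp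
  have hcard : Fintype.card (Finset.Nat.antidiagonalTuple 3 k) = Module.finrank ℝ V := by
    apply le_antisymm hli.fintype_card_le_finrank
    simpa using finrank_restrictTotalDegree_le k
  have hspan := hli.span_eq_top_of_card_eq_finrank' hcard
  have hpV : (⟨p, (MvPolynomial.mem_restrictTotalDegree _ _ _).2 hp⟩ : V) ∈
      Submodule.span ℝ (range b) := hspan ▸ Submodule.mem_top
  obtain ⟨c, hc⟩ := (Submodule.mem_span_range_iff_exists_fun ℝ).1 hpV
  have hcβ : ∀ β : Finset.Nat.antidiagonalTuple 3 k,
      MvPolynomial.eval (lagrangeNode k β) p = c β := fun β => by rw [← hev c β, hc]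
  have hp' : p = (∑ α, c α • b α : V).1 := by rw [hc]
  calc p = (∑ α, c α • b α : V).1 := hp'
    _ = ∑ α : Finset.Nat.antidiagonalTuple 3 k,
          MvPolynomial.C (MvPolynomial.eval (lagrangeNode k α) p) * lagrangePoly k α := by
        rw [AddSubmonoidClass.coe_finsetSum]
        refine Finset.sum_congr rfl fun α _ => ?_
        rw [hcβ]
        simp [b, MvPolynomial.smul_eq_C_mul]
    _ = _ := Finset.sum_coe_sort (Finset.Nat.antidiagonalTuple 3 k) fun α =>
          MvPolynomial.C (MvPolynomial.eval (lagrangeNode k α) p) * lagrangePoly k α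

theorem exists_bound_lagrangePoly (k : ℕ) : ∃ B > 0, ∀ α ∈ Finset.Nat.antidiagonalTuple 3 k,
    ∀ ξ ∈ refTri, |MvPolynomial.eval ξ (lagrangePoly k α)| ≤ B ∧
      ∀ j, |MvPolynomial.eval ξ (MvPolynomial.pderiv j (lagrangePoly k α))| ≤ B := by
  have h : ∀ p : MvPolynomial (Fin 2) ℝ, ∃ B, ∀ ξ ∈ refTri, |MvPolynomial.eval ξ p| ≤ B :=
    fun p => isCompact_refTri.exists_bound_of_continuousOn (continuous_eval p).continuousOn
  choose B hB using h
  refine ⟨1 + ∑ α ∈ Finset.Nat.antidiagonalTuple 3 k, (|B (lagrangePoly k α)| +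
    ∑ j, |B (MvPolynomial.pderiv j (lagrangePoly k α))|), by positivity, fun α hα ξ hξ => ?_⟩
  have h1 : |B (lagrangePoly k α)| + ∑ j, |B (MvPolynomial.pderiv j (lagrangePoly k α))| ≤
      ∑ α ∈ Finset.Nat.antidiagonalTuple 3 k, (|B (lagrangePoly k α)| +
        ∑ j, |B (MvPolynomial.pderiv j (lagrangePoly k α))|) :=
    Finset.single_le_sum (f := fun α => |B (lagrangePoly k α)| +
        ∑ j, |B (MvPolynomial.pderiv j (lagrangePoly k α))|) (fun i _ => by positivity) hα
  have h0 : 0 ≤ ∑ j, |B (MvPolynomial.pderiv j (lagrangePoly k α))| := by positivity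
  constructor
  · have := hB (lagrangePoly k α) ξ hξ
    have := le_abs_self (B (lagrangePoly k α))
    linarith
  · intro j
    have h2 := hB (MvPolynomial.pderiv j (lagrangePoly k α)) ξ hξ
    have h3 := le_abs_self (B (MvPolynomial.pderiv j (lagrangePoly k α)))
    have h4 : |B (MvPolynomial.pderiv j (lagrangePoly k α))| ≤
        ∑ j, |B (MvPolynomial.pderiv j (lagrangePoly k α))| :=
      Finset.single_le_sum (f := fun j => |B (MvPolynomial.pderiv j (lagrangePoly k α))|)
        (fun i _ => abs_nonneg _) (Finset.mem_univ j)
    have := abs_nonneg (B (lagrangePoly k α))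
    linarith

/-- A linear functional on a finite-dimensional inner product space is continuous; the constant is
its squared norm. -/
theorem exists_bound_of_inner {V : Type*} [AddCommGroup V] [Module ℝ V] [FiniteDimensional ℝ V]
    (core : InnerProductSpace.Core ℝ V) (l : V →ₗ[ℝ] ℝ) :
    ∃ C ≥ 0, ∀ v, l v ^ 2 ≤ C * core.inner v v := by
  let := core.toNormedAddCommGroup
  let : InnerProductSpace ℝ V := InnerProductSpace.ofCore _
  let l' : V →L[ℝ] ℝ := LinearMap.toContinuousLinearMap l
  refine ⟨‖l'‖ ^ 2, by positivity, fun v => ?_⟩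
  have h1 : ‖l v‖ ≤ ‖l'‖ * ‖v‖ := l'.le_opNorm v
  have h2 : ‖v‖ ^ 2 = core.inner v v := (real_inner_self_eq_norm_sq v).symm
  rw [← h2, ← mul_pow, ← sq_abs, ← Real.norm_eq_abs]
  gcongr

/-- Linear functionals on polynomials of bounded degree are bounded by the `L²` norm. -/
theorem exists_bound_linearMap (k : ℕ) (l : MvPolynomial (Fin 2) ℝ →ₗ[ℝ] ℝ) :
    ∃ C ≥ 0, ∀ p : MvPolynomial (Fin 2) ℝ, p.totalDegree ≤ k →
      l p ^ 2 ≤ C * ∫ ξ in refTri, MvPolynomial.eval ξ p ^ 2 := by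
  let V := MvPolynomial.restrictTotalDegree (Fin 2) ℝ k
  have hi : ∀ p q : MvPolynomial (Fin 2) ℝ, IntegrableOn
      (fun ξ => MvPolynomial.eval ξ p * MvPolynomial.eval ξ q) refTri := fun p q =>
    integrableOn_refTri ((continuous_eval p).mul (continuous_eval q)).continuousOn
  let core : InnerProductSpace.Core ℝ V :=
    { inner := fun p q => ∫ ξ in refTri, MvPolynomial.eval ξ p.1 * MvPolynomial.eval ξ q.1
      conj_inner_symm := fun p q => by simp [mul_comm]
      re_inner_nonneg := fun p => by
        simp only [RCLike.re_to_real]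
        exact integral_nonneg fun ξ => mul_self_nonneg _
      add_left := fun p q r => by
        rw [← integral_add (hi _ _) (hi _ _)]
        simp [add_mul]
      smul_left := fun p q r => by
        rw [← integral_const_mul]
        simp [MvPolynomial.smul_eval, mul_assoc]
      definite := fun p hp => by
        apply Subtype.ext
        apply eq_zero_of_integral_sq_eq_zero
        simpa [sq] using hp }
  obtain ⟨C, hC0, hC⟩ := exists_bound_of_inner core (l ∘ₗ V.subtype)
  refine ⟨C, hC0, fun p hp => ?_⟩
  have := hC ⟨p, (MvPolynomial.mem_restrictTotalDegree _ _ _).2 hp⟩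
  have e : ∫ ξ in refTri, MvPolynomial.eval ξ p ^ 2 =
      ∫ ξ in refTri, MvPolynomial.eval ξ p * MvPolynomial.eval ξ p := by simp only [sq]
  rw [e]
  exact this

/-- Inverse inequality: pointwise bounds of a polynomial and its derivatives on the reference
triangle by the `L²` norm. -/
theorem exists_inverse_bound (k : ℕ) : ∃ C > 0, ∀ p : MvPolynomial (Fin 2) ℝ, p.totalDegree ≤ k →
    ∀ ξ ∈ refTri, MvPolynomial.eval ξ p ^ 2 ≤ C * (∫ ξ in refTri, MvPolynomial.eval ξ p ^ 2) ∧
      ∀ j, MvPolynomial.eval ξ (MvPolynomial.pderiv j p) ^ 2 ≤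
        C * ∫ ξ in refTri, MvPolynomial.eval ξ p ^ 2 := by
  -- Nodes of order k + 1 instead of k keep the interpolation formula valid for k = 0, where the
  -- nodes of order k would involve a division by zero.
  obtain ⟨B, hB0, hB⟩ := exists_bound_lagrangePoly (k + 1)
  set I := Finset.Nat.antidiagonalTuple 3 (k + 1) with hI
  have hl : ∀ α : Fin 3 → ℕ, ∃ C ≥ 0, ∀ p : MvPolynomial (Fin 2) ℝ, p.totalDegree ≤ k →
      MvPolynomial.eval (lagrangeNode (k + 1) α) p ^ 2 ≤
        C * ∫ ξ in refTri, MvPolynomial.eval ξ p ^ 2 := fun α =>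
    exists_bound_linearMap k (MvPolynomial.aeval (lagrangeNode (k + 1) α)).toLinearMap
  choose C hC0 hC using hl
  have key : ∀ (p : MvPolynomial (Fin 2) ℝ), p.totalDegree ≤ k → ∀ (v : (Fin 3 → ℕ) → ℝ),
      (∀ α ∈ I, |v α| ≤ B) →
      (∑ α ∈ I, MvPolynomial.eval (lagrangeNode (k + 1) α) p * v α) ^ 2 ≤
        (1 + I.card * ∑ α ∈ I, C α * B ^ 2) * ∫ ξ in refTri, MvPolynomial.eval ξ p ^ 2 := by
    intro p hp v hv
    have hint : 0 ≤ ∫ ξ in refTri, MvPolynomial.eval ξ p ^ 2 :=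
      integral_nonneg fun ξ => sq_nonneg _
    calc _ ≤ I.card * ∑ α ∈ I, (MvPolynomial.eval (lagrangeNode (k + 1) α) p * v α) ^ 2 :=
          sq_sum_le_card_mul_sum_sq
      _ ≤ I.card * ∑ α ∈ I, (C α * B ^ 2) * ∫ ξ in refTri, MvPolynomial.eval ξ p ^ 2 := by
          gcongr with α hα
          rw [mul_pow, mul_right_comm]
          have : v α ^ 2 ≤ B ^ 2 := by rw [← sq_abs]; gcongr; exact hv α hα
          have := hC α p hp
          gcongr
          exact mul_nonneg (hC0 α) hint
      _ = (0 + I.card * ∑ α ∈ I, C α * B ^ 2) * ∫ ξ in refTri, MvPolynomial.eval ξ p ^ 2 := by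
          rw [← Finset.sum_mul]; ring
      _ ≤ _ := by gcongr; norm_num
  refine ⟨1 + I.card * ∑ α ∈ I, C α * B ^ 2, ?_, fun p hp ξ hξ => ⟨?_, fun j => ?_⟩⟩
  · have : 0 ≤ ∑ α ∈ I, C α * B ^ 2 :=
      Finset.sum_nonneg fun α _ => mul_nonneg (hC0 α) (sq_nonneg _)
    positivity
  · have h := sum_lagrangePoly_eq (k := k + 1) (by omega) (hp.trans (by omega))
    have h2 := key p hp (fun α => MvPolynomial.eval ξ (lagrangePoly (k + 1) α))
      fun α hα => (hB α hα ξ hξ).1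
    have h3 := congrArg (MvPolynomial.eval ξ) h
    rw [map_sum] at h3
    simp only [map_mul, MvPolynomial.eval_C] at h3
    rwa [← h3] at h2
  · have h := sum_lagrangePoly_eq (k := k + 1) (by omega) (hp.trans (by omega))
    have h2 := key p hp (fun α => MvPolynomial.eval ξ (MvPolynomial.pderiv j
      (lagrangePoly (k + 1) α))) fun α hα => (hB α hα ξ hξ).2 j
    have h3 := congrArg (fun q => MvPolynomial.eval ξ (MvPolynomial.pderiv j q)) h
    simp only [map_sum, MvPolynomial.pderiv_C_mul, map_mul, MvPolynomial.eval_C] at h3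
    rwa [← h3] at h2

/-! ### The Cauchy-Schwarz inequality -/

/-- The quadratic polynomial s ↦ ∑ ∫ (f + s g)² is nonnegative, so its discriminant is not positive.
-/
theorem sq_sum_integral_mul_le {n : ℕ} {f g : Fin n → R2 → ℝ}
    (hf : ∀ K, IntegrableOn (fun ξ => f K ξ ^ 2) refTri)
    (hg : ∀ K, IntegrableOn (fun ξ => g K ξ ^ 2) refTri)
    (hfg : ∀ K, IntegrableOn (fun ξ => f K ξ * g K ξ) refTri) :
    (∑ K, ∫ ξ in refTri, f K ξ * g K ξ) ^ 2 ≤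
      (∑ K, ∫ ξ in refTri, f K ξ ^ 2) * ∑ K, ∫ ξ in refTri, g K ξ ^ 2 := by
  have h : ∀ s : ℝ, 0 ≤ (∑ K, ∫ ξ in refTri, g K ξ ^ 2) * (s * s) +
      (2 * ∑ K, ∫ ξ in refTri, f K ξ * g K ξ) * s + ∑ K, ∫ ξ in refTri, f K ξ ^ 2 := by
    intro s
    have h0 : 0 ≤ ∑ K, ∫ ξ in refTri, (f K ξ + s * g K ξ) ^ 2 :=
      Finset.sum_nonneg fun K _ => integral_nonneg fun ξ => sq_nonneg _
    have h1 : ∀ K, ∫ ξ in refTri, (f K ξ + s * g K ξ) ^ 2 =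
        (∫ ξ in refTri, f K ξ ^ 2) + 2 * s * (∫ ξ in refTri, f K ξ * g K ξ) +
          s ^ 2 * ∫ ξ in refTri, g K ξ ^ 2 := by
      intro K
      have e : ∀ ξ, (f K ξ + s * g K ξ) ^ 2 =
          (f K ξ ^ 2 + 2 * s * (f K ξ * g K ξ)) + s ^ 2 * g K ξ ^ 2 := fun ξ => by ring
      simp_rw [e]
      rw [integral_add, integral_add (hf K) ((hfg K).const_mul _), integral_const_mul,
        integral_const_mul]
      · exact (hf K).add ((hfg K).const_mul _)
      · exact (hg K).const_mul _
    simp_rw [h1, Finset.sum_add_distrib, ← Finset.mul_sum] at h0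
    linarith
  have := discrim_le_zero h
  rw [discrim] at this
  nlinarith

end ESFEM

namespace ESFEM

/-! ### Crossing a boundary, Taylor's formula -/

/-- If the path avoided the frontier, Ω and the complement of its closure would disconnect the
connected image of the interval. -/
theorem exists_mem_frontier_of_path {E : Type*} [TopologicalSpace E] {Ω : Set E} (hΩ : IsOpen Ω)
    {g : ℝ → E} (hg : Continuous g) {a b : ℝ} (hab : a ≤ b) (ha : g a ∈ Ω) (hb : g b ∉ Ω) :
    ∃ s ∈ Icc a b, g s ∈ frontier Ω := by
  by_contra! hne
  have hpre : IsPreconnected (g '' Icc a b) := isPreconnected_Icc.image g hg.continuousOn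
  have hcov : g '' Icc a b ⊆ Ω ∪ (closure Ω)ᶜ := by
    rintro _ ⟨s, hs, rfl⟩
    have := hne s hs
    rw [hΩ.frontier_eq] at this
    by_cases h : g s ∈ Ω
    · exact Or.inl h
    · exact Or.inr fun hc => this ⟨hc, h⟩
  have hb' : g b ∈ (closure Ω)ᶜ := by
    rcases hcov ⟨b, ⟨hab, le_rfl⟩, rfl⟩ with h | h
    · exact absurd h hb
    · exact h
  obtain ⟨x, -, h1, h2⟩ := hpre Ω (closure Ω)ᶜ hΩ isClosed_closure.isOpen_compl hcov
    ⟨g a, ⟨a, ⟨le_rfl, hab⟩, rfl⟩, ha⟩ ⟨g b, ⟨b, ⟨hab, le_rfl⟩, rfl⟩, hb'⟩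
  exact h2 (subset_closure h1)

theorem norm_sub_sub_fderiv_le {E F : Type*} [NormedAddCommGroup E] [NormedSpace ℝ E]
    [NormedAddCommGroup F] [NormedSpace ℝ F] {f : E → F} {s : Set E} (hs : Convex ℝ s) {M : ℝ}
    (hf : Differentiable ℝ f) (hM : 0 ≤ M)
    (hL : ∀ x ∈ s, ∀ y ∈ s, ‖fderiv ℝ f x - fderiv ℝ f y‖ ≤ M * ‖x - y‖) {x y : E} (hx : x ∈ s)
    (hy : y ∈ s) : ‖f x - f y - fderiv ℝ f y (x - y)‖ ≤ M * ‖x - y‖ ^ 2 := by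
  have hseg : segment ℝ y x ⊆ s := hs.segment_subset hy hx
  have := (convex_segment y x).norm_image_sub_le_of_norm_fderiv_le' (𝕜 := ℝ) (f := f)
    (φ := fderiv ℝ f y) (C := M * ‖x - y‖) (fun z _ => hf z) (fun z hz => ?_)
    (left_mem_segment ℝ y x) (right_mem_segment ℝ y x)
  · calc _ ≤ _ := this
      _ = _ := by ring
  · refine (hL z (hseg hz) y hy).trans ?_
    gcongr
    obtain ⟨t, ht, rfl⟩ := (segment_eq_image' ℝ y x).subset hz
    rw [add_sub_cancel_left, norm_smul, Real.norm_eq_abs, abs_of_nonneg ht.1]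
    exact mul_le_of_le_one_left (norm_nonneg _) ht.2

/-! ### Normals of the initial surface -/

/-- `ν` is the outward unit normal at `p` of the open set `Ω`, with a two-sided paraboloid
condition of constant `L` in the ball of radius `r`. -/
structure TwoSidedNormal (Ω : Set E3) (L r : ℝ) (p ν : E3) : Prop where
  norm_eq : ‖ν‖ = 1
  inside : ∀ x, ‖x - p‖ ≤ r → inner ℝ (x - p) ν < -(L * ‖x - p‖ ^ 2) → x ∈ Ω
  outside : ∀ x, ‖x - p‖ ≤ r → L * ‖x - p‖ ^ 2 < inner ℝ (x - p) ν → x ∉ Ω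

namespace TwoSidedNormal

variable {Ω : Set E3} {L r : ℝ} {p q ν μ : E3}

theorem mono {L' r' : ℝ} (h : TwoSidedNormal Ω L r p ν) (hL : L ≤ L') (hr : r' ≤ r) :
    TwoSidedNormal Ω L' r' p ν := by
  refine ⟨h.norm_eq, fun x hx h1 => h.inside x (hx.trans hr) (h1.trans_le ?_),
    fun x hx h1 => h.outside x (hx.trans hr) (lt_of_le_of_lt ?_ h1)⟩
  · gcongr
  · gcongr

/-- A frontier point lies in neither of the two regions beyond the paraboloids. The outer condition
only excludes Ω itself, so it is used on a whole neighbourhood to exclude the closure; this is why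
‖q - p‖ < r is strict. -/
theorem inner_le (h : TwoSidedNormal Ω L r p ν) (hΩ : IsOpen Ω) (hq : q ∈ frontier Ω)
    (hqr : ‖q - p‖ < r) : |inner ℝ (q - p) ν| ≤ L * ‖q - p‖ ^ 2 := by
  rw [abs_le]
  constructor
  · by_contra! hlt
    have := h.inside q hqr.le hlt
    rw [hΩ.frontier_eq] at hq
    exact hq.2 this
  · by_contra! hlt
    have hcont : Continuous fun x : E3 => inner ℝ (x - p) ν - L * ‖x - p‖ ^ 2 := by fun_prop
    have hcont2 : Continuous fun x : E3 => ‖x - p‖ := by fun_prop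
    have hev : ∀ᶠ x in 𝓝 q, x ∉ Ω := by
      filter_upwards [hcont.continuousAt.eventually_const_lt
        (show 0 < inner ℝ (q - p) ν - L * ‖q - p‖ ^ 2 by linarith),
        hcont2.continuousAt.eventually_lt_const hqr] with x hx hx2
      exact h.outside x hx2.le (by linarith)
    have := mem_closure_iff_frequently.1 hq.1
    exact this hev

/-- Chords of the frontier at p have normal components quadratic in their lengths, so limits of
rescaled chords are orthogonal to ν. The lemma makes the orientation condition of a mesh applicable
to ν. -/
theorem isOuterNormal (h : TwoSidedNormal Ω L r p ν) (hΩ : IsOpen Ω) (hr : 0 < r) :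
    IsOuterNormal Ω p ν := by
  have hn : inner ℝ ν ν = (1 : ℝ) := by rw [real_inner_self_eq_norm_sq, h.norm_eq]; norm_num
  have hev : ∀ᶠ s : ℝ in 𝓝[>] 0, 0 < s ∧ s < r ∧ L * s < 1 := by
    have h1 : ∀ᶠ s : ℝ in 𝓝 0, s < r ∧ L * s < 1 :=
      (eventually_lt_nhds hr).and
        ((continuous_const.mul continuous_id).continuousAt.eventually_lt_const (by simp))
    exact (eventually_mem_nhdsWithin).and (h1.filter_mono nhdsWithin_le_nhds)
  refine ⟨h.norm_eq, ?_, ?_, ?_⟩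
  · intro τ hτ
    rw [mem_tangentConeAt_iff_exists_seq] at hτ
    obtain ⟨c, d, hd, hmem, hlim⟩ := hτ
    have h1 : Tendsto (fun n => inner ℝ ν (c n • d n)) atTop (𝓝 (inner ℝ ν τ)) :=
      (continuous_const.inner continuous_id).continuousAt.tendsto.comp hlim
    have h2 : Tendsto (fun n => |L| * ‖c n • d n‖ * ‖d n‖) atTop (𝓝 (|L| * ‖τ‖ * ‖(0 : E3)‖)) :=
      (hlim.norm.const_mul _).mul hd.norm
    rw [norm_zero, mul_zero] at h2
    have h3 : ∀ᶠ n in atTop, ‖inner ℝ ν (c n • d n)‖ ≤ |L| * ‖c n • d n‖ * ‖d n‖ := by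
      have : ∀ᶠ n in atTop, ‖d n‖ < r := by
        have := hd.norm
        rw [norm_zero] at this
        exact this.eventually_lt_const hr
      filter_upwards [hmem, this] with n hn hn2
      have := h.inner_le hΩ hn (by simpa using hn2)
      rw [add_sub_cancel_left] at this
      rw [inner_smul_right, Real.norm_eq_abs, abs_mul, real_inner_comm, norm_smul,
        Real.norm_eq_abs]
      calc |c n| * |inner ℝ (d n) ν| ≤ |c n| * (|L| * ‖d n‖ ^ 2) := by
            gcongr
            exact this.trans (by gcongr; exact le_abs_self L)
        _ = _ := by ring
    exact tendsto_nhds_unique h1 (squeeze_zero_norm' h3 h2)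
  · filter_upwards [hev] with s hs
    refine h.inside _ ?_ ?_
    · simp [norm_smul, h.norm_eq, abs_of_pos hs.1, hs.2.1.le]
    · simp only [sub_sub_cancel_left, inner_neg_left, inner_smul_left, hn, norm_neg, norm_smul,
        h.norm_eq, Real.norm_eq_abs, abs_of_pos hs.1]
      simp; nlinarith [hs.1, hs.2.2]
  · filter_upwards [hev] with s hs hcl
    have hcont : Continuous fun x : E3 => inner ℝ (x - p) ν - L * ‖x - p‖ ^ 2 := by fun_prop
    have hcont2 : Continuous fun x : E3 => ‖x - p‖ := by fun_prop
    have hevv : ∀ᶠ x in 𝓝 (p + s • ν), x ∉ Ω := by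
      have e1 : 0 < inner ℝ (p + s • ν - p) ν - L * ‖p + s • ν - p‖ ^ 2 := by
        simp only [add_sub_cancel_left, inner_smul_left, hn, norm_smul,
          h.norm_eq, Real.norm_eq_abs, abs_of_pos hs.1]
        simp; nlinarith [hs.1, hs.2.2]
      have e2 : ‖p + s • ν - p‖ < r := by
        simp [norm_smul, h.norm_eq, abs_of_pos hs.1, hs.2.1]
      filter_upwards [hcont.continuousAt.eventually_const_lt e1,
        hcont2.continuousAt.eventually_lt_const e2] with x hx hx2
      exact h.outside x hx2.le (by linarith)
    exact mem_closure_iff_frequently.1 hcl hevv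

/-- A point near the surface is moved onto the surface along a normal of a nearby point. -/
theorem exists_mem_frontier (h : TwoSidedNormal Ω L r p ν) (hΩ : IsOpen Ω)
    (hpf : p ∈ frontier Ω) (hL : 0 < L) {y : E3}
    (hy : 8 * (1 + L) * (1 + 3 * L) * ‖y - p‖ ≤ min 1 r) :
    ∃ s : ℝ, |s| ≤ 2 * (|inner ℝ (y - p) ν| + 3 * L * ‖y - p‖ ^ 2) ∧ y + s • ν ∈ frontier Ω := by
  have hn : inner ℝ ν ν = (1 : ℝ) := by rw [real_inner_self_eq_norm_sq, h.norm_eq]; norm_num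
  rcases eq_or_ne y p with rfl | hne
  · exact ⟨0, by simp, by simpa using hpf⟩
  have hd : 0 < ‖y - p‖ := norm_pos_iff.2 (sub_ne_zero.2 hne)
  have hα : |inner ℝ (y - p) ν| ≤ ‖y - p‖ := by
    simpa [h.norm_eq] using abs_real_inner_le_norm (y - p) ν
  have hin : ∀ s : ℝ, inner ℝ (y + s • ν - p) ν = inner ℝ (y - p) ν + s := by
    intro s
    rw [add_sub_right_comm, inner_add_left, real_inner_smul_left, hn, mul_one]
  set d := ‖y - p‖ with hdd
  set α := inner ℝ (y - p) ν with hαd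
  have h1 := hy.trans (min_le_left _ _)
  have h2 := hy.trans (min_le_right _ _)
  have hd1 : d ≤ 1 := by nlinarith [mul_pos hL hd, mul_pos hL (mul_pos hL hd)]
  -- The points y ± σν have to lie beyond the two paraboloids, that is L(d + σ)² < σ - |α|. This
  -- follows from L(d + σ)² ≤ 2Ld² + 2Lσ², from 4Lσ ≤ 1 and from σ/2 = |α| + 3Ld².
  set σ := 2 * (|α| + 3 * L * d ^ 2) with hσ
  have hσ0 : 0 < σ := by have := abs_nonneg α; positivity
  have hσd : σ ≤ 2 * (1 + 3 * L) * d := by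
    have : d ^ 2 ≤ d := by nlinarith
    nlinarith [mul_le_mul_of_nonneg_left this hL.le]
  have hσL : 4 * L * σ ≤ 1 := by
    nlinarith [mul_le_mul_of_nonneg_left hσd hL.le, mul_pos hL hd]
  have hnorm : ∀ s : ℝ, |s| = σ → ‖y + s • ν - p‖ ≤ d + σ := by
    intro s hs
    rw [add_sub_right_comm]
    refine (norm_add_le _ _).trans ?_
    rw [norm_smul, h.norm_eq, Real.norm_eq_abs, hs, mul_one]
  have hr' : d + σ ≤ r := by nlinarith [mul_pos hL hd, mul_pos hL (mul_pos hL hd)]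
  have hsq : ∀ s : ℝ, |s| = σ → L * ‖y + s • ν - p‖ ^ 2 < σ - |α| := by
    intro s hs
    have : ‖y + s • ν - p‖ ^ 2 ≤ (d + σ) ^ 2 := by gcongr; exact hnorm s hs
    have h3 := mul_le_mul_of_nonneg_left this hL.le
    have h4 : 0 < L * d ^ 2 := by positivity
    nlinarith [mul_nonneg hL.le (sq_nonneg (d - σ)), mul_le_mul_of_nonneg_right hσL hσ0.le]
  have hcont : Continuous fun s : ℝ => y + s • ν := by fun_prop
  have hpos : |σ| = σ := abs_of_pos hσ0
  have hneg : |-σ| = σ := by rw [abs_neg, hpos]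
  have ha := h.inside (y + (-σ) • ν) ((hnorm _ hneg).trans hr') (by
    rw [hin]; have := hsq _ hneg; linarith [le_abs_self α])
  have hb := h.outside (y + σ • ν) ((hnorm _ hpos).trans hr') (by
    rw [hin]; have := hsq _ hpos; linarith [neg_abs_le α])
  obtain ⟨s, hs, hmem⟩ := exists_mem_frontier_of_path hΩ hcont (by linarith) ha hb
  exact ⟨s, abs_le.2 hs, hmem⟩

/-- If ‖ν - μ‖ were larger, a step w of length ε ≥ ‖p - q‖ opposite to ν - μ would have inner
products -ε‖ν - μ‖/2 with ν and +ε‖ν - μ‖/2 with μ. Then p + w would be inside by the condition at p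
and outside by the condition at q. -/
theorem norm_sub_le (hp : TwoSidedNormal Ω L r p ν) (hq : TwoSidedNormal Ω L r q μ)
    (hΩ : IsOpen Ω) (hL : 0 < L) (hpf : p ∈ frontier Ω) (hpq : 2 * ‖p - q‖ < r) :
    ‖ν - μ‖ ≤ 10 * L * ‖p - q‖ := by
  by_contra! hlt
  have hD := norm_nonneg (p - q)
  -- For p ≠ q the step length is ‖p - q‖; for p = q any small positive length serves, which gives
  -- uniqueness of the normal.
  obtain ⟨ε, hε0, hεD, hεr, hε⟩ : ∃ ε > 0, ‖p - q‖ ≤ ε ∧ 2 * ε ≤ r ∧ 10 * L * ε < ‖ν - μ‖ := by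
    rcases hD.eq_or_lt with h0 | h0
    · rw [← h0] at hlt hpq ⊢
      refine ⟨min (r / 2) (‖ν - μ‖ / (20 * L)), ?_, ?_, ?_, ?_⟩
      · have : 0 < ‖ν - μ‖ := by linarith
        have : 0 < r := by linarith
        positivity
      · have : 0 < ‖ν - μ‖ := by linarith
        have : 0 < r := by linarith
        positivity
      · linarith [min_le_left (r / 2) (‖ν - μ‖ / (20 * L))]
      · calc 10 * L * min (r / 2) (‖ν - μ‖ / (20 * L)) ≤ 10 * L * (‖ν - μ‖ / (20 * L)) := by
              gcongr; exact min_le_right _ _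
          _ = ‖ν - μ‖ / 2 := by field_simp; ring
          _ < _ := by linarith
    · exact ⟨_, h0, le_rfl, hpq.le, hlt⟩
  have he0 : 0 < ‖ν - μ‖ := lt_trans (by positivity) hε
  have hνν : inner ℝ ν ν = (1 : ℝ) := by rw [real_inner_self_eq_norm_sq, hp.norm_eq]; norm_num
  have hμμ : inner ℝ μ μ = (1 : ℝ) := by rw [real_inner_self_eq_norm_sq, hq.norm_eq]; norm_num
  have hee : ‖ν - μ‖ ^ 2 = 2 - 2 * inner ℝ ν μ := by
    rw [norm_sub_sq_real, hp.norm_eq, hq.norm_eq]; ring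
  set e := ‖ν - μ‖ with hed
  set w : E3 := (-(ε / e)) • (ν - μ) with hw
  have hwn : ‖w‖ = ε := by
    rw [hw, norm_smul, Real.norm_eq_abs, abs_neg, abs_of_pos (by positivity), ← hed]
    field_simp
  have hwν : inner ℝ w ν = -(ε * e / 2) := by
    rw [hw, real_inner_smul_left, inner_sub_left, hνν, real_inner_comm]
    have : inner ℝ ν μ = 1 - e ^ 2 / 2 := by linarith
    rw [this]; field_simp; ring
  have hwμ : inner ℝ w μ = ε * e / 2 := by
    rw [hw, real_inner_smul_left, inner_sub_left, hμμ]
    have : inner ℝ ν μ = 1 - e ^ 2 / 2 := by linarith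
    rw [this]; field_simp; ring
  have hin := hp.inside (p + w) (by rw [add_sub_cancel_left, hwn]; linarith) (by
    rw [add_sub_cancel_left, hwn, hwν]
    nlinarith [mul_pos hL (sq_pos_of_pos hε0), mul_lt_mul_of_pos_left hε hε0])
  have hx : p + w - q = (p - q) + w := by abel
  have hxn : ‖p + w - q‖ ≤ 2 * ε := by
    rw [hx]; exact (norm_add_le _ _).trans (by rw [hwn]; linarith)
  refine hq.outside (p + w) (hxn.trans hεr) ?_ hin
  have h1 := hq.inner_le hΩ hpf (by linarith)
  have h2 : L * ‖p - q‖ ^ 2 ≤ L * ε ^ 2 := by gcongr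
  have h3 : L * ‖p + w - q‖ ^ 2 ≤ L * (2 * ε) ^ 2 := by gcongr
  rw [hx, inner_add_left, hwμ, ← hx]
  have h4 := (abs_le.1 h1).1
  nlinarith [mul_lt_mul_of_pos_left hε hε0, mul_pos hL (sq_pos_of_pos hε0)]

/-- The segment from a point to its closest point on the surface is normal. -/
theorem sub_eq_smul_of_closest (h : TwoSidedNormal Ω L r p ν) (hΩ : IsOpen Ω)
    (hpf : p ∈ frontier Ω) (hL : 0 < L) (hr : 0 < r) {x : E3}
    (hx : ∀ q ∈ frontier Ω, ‖x - p‖ ≤ ‖x - q‖) : x - p = (inner ℝ (x - p) ν : ℝ) • ν := by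
  have hn : inner ℝ ν ν = (1 : ℝ) := by rw [real_inner_self_eq_norm_sq, h.norm_eq]; norm_num
  set β : ℝ := inner ℝ (x - p) ν with hβ
  set τ : E3 := x - p - β • ν with hτ
  have hτν : inner ℝ τ ν = (0 : ℝ) := by
    rw [hτ, inner_sub_left, real_inner_smul_left, hn, ← hβ]; ring
  by_contra hne
  have hτ0 : 0 < ‖τ‖ := norm_pos_iff.2 (sub_ne_zero.2 hne)
  have hxτ : inner ℝ (x - p) τ = ‖τ‖ ^ 2 := by
    have : x - p = τ + β • ν := by rw [hτ]; abel
    rw [this, inner_add_left, real_inner_smul_left, real_inner_comm, real_inner_comm τ ν, hτν,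
      real_inner_self_eq_norm_sq]
    ring
  set a := ‖x - p‖ with ha
  -- If the tangential part τ is nonzero, the surface point found near p + ετ is closer to x than p:
  -- the gain 2ε‖τ‖² in the squared distance is of first order, while the correction s is O(ε²). The
  -- last condition on ε expresses this comparison.
  have hev : ∀ᶠ ε : ℝ in 𝓝[>] 0, 0 < ε ∧ ε < 1 ∧ 8 * (1 + L) * (1 + 3 * L) * (ε * ‖τ‖) < min 1 r ∧
      ε * (1 + 12 * L * a + 36 * L ^ 2 * ‖τ‖ ^ 2) < 1 := by
    have h1 : ContinuousAt (fun ε : ℝ => 8 * (1 + L) * (1 + 3 * L) * (ε * ‖τ‖)) 0 := by fun_prop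
    have h2 : ContinuousAt (fun ε : ℝ => ε * (1 + 12 * L * a + 36 * L ^ 2 * ‖τ‖ ^ 2)) 0 := by
      fun_prop
    exact eventually_mem_nhdsWithin.and (((eventually_lt_nhds one_pos).and
      ((h1.eventually_lt_const (by simpa using hr)).and
      (h2.eventually_lt_const (by simp)))).filter_mono nhdsWithin_le_nhds)
  obtain ⟨ε, hε0, hε1, hε2, hε3⟩ := hev.exists
  have hyn : ‖p + ε • τ - p‖ = ε * ‖τ‖ := by
    rw [add_sub_cancel_left, norm_smul, Real.norm_eq_abs, abs_of_pos hε0]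
  obtain ⟨s, hs, hmem⟩ := h.exists_mem_frontier hΩ hpf hL (y := p + ε • τ) (by
    rw [hyn]; exact hε2.le)
  rw [hyn, add_sub_cancel_left, real_inner_smul_left, hτν] at hs
  simp only [mul_zero, abs_zero, zero_add] at hs
  have hq := hx _ hmem
  have hsq : ‖x - (p + ε • τ + s • ν)‖ ^ 2 =
      a ^ 2 - 2 * ε * ‖τ‖ ^ 2 + ε ^ 2 * ‖τ‖ ^ 2 - 2 * s * β + s ^ 2 := by
    have : x - (p + ε • τ + s • ν) = (x - p) - (ε • τ + s • ν) := by abel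
    rw [this, norm_sub_sq_real, norm_add_sq_real, inner_add_right, real_inner_smul_right,
      real_inner_smul_right, real_inner_smul_left, real_inner_smul_right, hτν, hxτ, norm_smul,
      norm_smul, h.norm_eq, mul_pow, mul_pow, Real.norm_eq_abs, Real.norm_eq_abs, sq_abs, sq_abs,
      ← ha, ← hβ]
    ring
  have hq2 : a ^ 2 ≤ ‖x - (p + ε • τ + s • ν)‖ ^ 2 := by
    have : 0 ≤ a := norm_nonneg _
    gcongr
  rw [hsq] at hq2
  have hβa : |β| ≤ a := by simpa [h.norm_eq] using abs_real_inner_le_norm (x - p) ν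
  have h1 : -2 * s * β ≤ 2 * (6 * L * ε ^ 2 * ‖τ‖ ^ 2) * a := by
    calc -2 * s * β ≤ |-2 * s * β| := le_abs_self _
      _ = 2 * |s| * |β| := by rw [abs_mul, abs_mul]; norm_num
      _ ≤ 2 * (2 * (3 * L * (ε * ‖τ‖) ^ 2)) * a := by gcongr
      _ = _ := by ring
  have h2 : s ^ 2 ≤ 36 * L ^ 2 * ε ^ 2 * ‖τ‖ ^ 4 := by
    calc s ^ 2 = |s| ^ 2 := (sq_abs s).symm
      _ ≤ (2 * (3 * L * (ε * ‖τ‖) ^ 2)) ^ 2 := by gcongr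
      _ = 36 * L ^ 2 * ε ^ 2 * ‖τ‖ ^ 4 * ε ^ 2 := by ring
      _ ≤ 36 * L ^ 2 * ε ^ 2 * ‖τ‖ ^ 4 * 1 := by gcongr; nlinarith
      _ = _ := by ring
  have hpos : 0 < ε * ‖τ‖ ^ 2 := by positivity
  have h3 : ε * ‖τ‖ ^ 2 * (ε * (1 + 12 * L * a + 36 * L ^ 2 * ‖τ‖ ^ 2)) < ε * ‖τ‖ ^ 2 * 1 :=
    mul_lt_mul_of_pos_left hε3 hpos
  nlinarith

end TwoSidedNormal

/-- The normal is the normalized gradient of the local defining function. The Taylor remainder K‖y -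
p‖², divided by a lower bound ε of the gradient, gives the paraboloid constant K/ε; adding 1 makes
it positive, and half the radius keeps all points in one ball. -/
theorem exists_local_twoSidedNormal {T : ℝ} {m : ℕ} (hm : 2 ≤ m) (S : EvolvingSurface T m)
    {x : E3} (hx : x ∈ S.init) :
    ∃ L > 0, ∃ r > 0, ∀ p ∈ S.init, dist p x < r → ∃ ν, TwoSidedNormal S.dom L r p ν := by
  obtain ⟨U, hU, φ, hφ, hφx, hdom⟩ := S.dom_boundary x hx
  have hφ2 : ContDiff ℝ 2 φ := hφ.of_le (by exact_mod_cast hm)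
  have hd : Differentiable ℝ φ := hφ2.differentiable (by norm_num)
  have hd1 : ContDiff ℝ 1 (fderiv ℝ φ) := hφ2.fderiv_right (by norm_num)
  obtain ⟨K, V, hV, hK⟩ := hd1.contDiffAt.exists_lipschitzOnWith (x := x)
  have hε : 0 < ‖fderiv ℝ φ x‖ / 2 := half_pos (norm_pos_iff.2 hφx)
  set ε := ‖fderiv ℝ φ x‖ / 2 with hεd
  have hW : ∀ᶠ y in 𝓝 x, ε < ‖fderiv ℝ φ y‖ :=
    hd1.continuous.norm.continuousAt.eventually_const_lt (by simp only [hεd]; linarith)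
  obtain ⟨R, hR, hball⟩ := Metric.mem_nhds_iff.1 (inter_mem (inter_mem hU hV) hW)
  have hT : ∀ y ∈ Metric.ball x R, ∀ p ∈ Metric.ball x R,
      ‖φ y - φ p - fderiv ℝ φ p (y - p)‖ ≤ K * ‖y - p‖ ^ 2 := by
    intro y hy p hp
    refine norm_sub_sub_fderiv_le (convex_ball x R) hd K.2 ?_ hy hp
    intro a ha b hb
    simpa [dist_eq_norm] using hK.dist_le_mul a (hball ha).1.2 b (hball hb).1.2
  refine ⟨K / ε + 1, by positivity, R / 2, by positivity, fun p hp hpx => ?_⟩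
  have hpR : p ∈ Metric.ball x R := by rw [Metric.mem_ball]; linarith
  -- A positive value would exclude a neighbourhood of p from the domain; a negative value would put
  -- p itself into the open domain.
  have hp0 : φ p = 0 := by
    have hp' := hp
    rw [EvolvingSurface.init, S.dom_open.frontier_eq] at hp'
    apply le_antisymm
    · by_contra! hlt
      have h1 : ∀ᶠ y in 𝓝 p, y ∉ S.dom := by
        filter_upwards [Metric.isOpen_ball.mem_nhds hpR,
          hd.continuous.continuousAt.eventually_const_lt hlt] with y hy hy2
        rw [hdom y (hball hy).1.1]
        exact not_lt.2 hy2.le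
      exact mem_closure_iff_frequently.1 hp'.1 h1
    · have := hp'.2
      rw [hdom p (hball hpR).1.1] at this
      exact not_lt.1 this
  set g : E3 := (InnerProductSpace.toDual ℝ E3).symm (fderiv ℝ φ p) with hg
  have hgn : ‖g‖ = ‖fderiv ℝ φ p‖ := by rw [hg, LinearIsometryEquiv.norm_map]
  have hgε : ε < ‖g‖ := by rw [hgn]; exact (hball hpR).2
  have hg0 : 0 < ‖g‖ := hε.trans hgε
  have hgi : ∀ y, fderiv ℝ φ p y = ‖g‖ * inner ℝ y (‖g‖⁻¹ • g) := by
    intro y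
    rw [real_inner_smul_right, real_inner_comm, hg, InnerProductSpace.toDual_symm_apply, ← hg]
    field_simp
  have hyR : ∀ y, ‖y - p‖ ≤ R / 2 → y ∈ Metric.ball x R := by
    intro y hy
    rw [Metric.mem_ball]
    rw [← dist_eq_norm] at hy
    linarith [dist_triangle y p x]
  have hKL : ∀ a : ℝ, (K : ℝ) * a ^ 2 ≤ ‖g‖ * ((K / ε + 1) * a ^ 2) := by
    intro a
    have : (K : ℝ) ≤ ‖g‖ * (K / ε + 1) := by
      calc (K : ℝ) = ε * (K / ε) := by field_simp
        _ ≤ ‖g‖ * (K / ε + 1) := by gcongr; linarith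
    nlinarith [mul_le_mul_of_nonneg_right this (sq_nonneg a)]
  refine ⟨‖g‖⁻¹ • g, ?_, ?_, ?_⟩
  · rw [norm_smul, norm_inv, norm_norm]; field_simp
  · intro y hy hlt
    rw [hdom y (hball (hyR y hy)).1.1]
    have := (abs_le.1 ((Real.norm_eq_abs _).symm.le.trans (hT y (hyR y hy) p hpR))).2
    rw [hp0, hgi] at this
    nlinarith [mul_lt_mul_of_pos_left hlt hg0, hKL ‖y - p‖]
  · intro y hy hlt
    rw [hdom y (hball (hyR y hy)).1.1]
    have := (abs_le.1 ((Real.norm_eq_abs _).symm.le.trans (hT y (hyR y hy) p hpR))).1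
    rw [hp0, hgi] at this
    nlinarith [mul_lt_mul_of_pos_left hlt hg0, hKL ‖y - p‖]

theorem EvolvingSurface.isCompact_init {T : ℝ} {m : ℕ} (S : EvolvingSurface T m) :
    IsCompact S.init :=
  Metric.isCompact_of_isClosed_isBounded isClosed_frontier
    (S.dom_bounded.closure.subset frontier_subset_closure)

/-- Uniform two-sided normals. -/
theorem exists_normalField {T : ℝ} {m : ℕ} (hm : 2 ≤ m) (S : EvolvingSurface T m) :
    ∃ L > 0, ∃ r > 0, ∃ ν : E3 → E3, (∀ p ∈ S.init, TwoSidedNormal S.dom L r p (ν p)) ∧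
      ∀ p ∈ S.init, ∀ q ∈ S.init, ‖ν p - ν q‖ ≤ L * ‖p - q‖ := by
  have hloc : ∃ L > 0, ∃ r > 0, ∀ p ∈ S.init, p ∈ S.init → ∃ ν, TwoSidedNormal S.dom L r p ν := by
    refine S.isCompact_init.induction_on (p := fun s => ∃ L > 0, ∃ r > 0, ∀ p ∈ S.init, p ∈ s →
      ∃ ν, TwoSidedNormal S.dom L r p ν) ?_ ?_ ?_ ?_
    · exact ⟨1, one_pos, 1, one_pos, by simp⟩
    · rintro s t hst ⟨L, hL, r, hr, h⟩
      exact ⟨L, hL, r, hr, fun p hp hps => h p hp (hst hps)⟩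
    · rintro s t ⟨L, hL, r, hr, h⟩ ⟨L', hL', r', hr', h'⟩
      refine ⟨max L L', lt_max_of_lt_left hL, min r r', lt_min hr hr', fun p hp hps => ?_⟩
      rcases hps with hps | hps
      · obtain ⟨ν, hν⟩ := h p hp hps
        exact ⟨ν, hν.mono (le_max_left _ _) (min_le_left _ _)⟩
      · obtain ⟨ν, hν⟩ := h' p hp hps
        exact ⟨ν, hν.mono (le_max_right _ _) (min_le_right _ _)⟩
    · intro x hx
      obtain ⟨L, hL, r, hr, h⟩ := exists_local_twoSidedNormal hm S hx
      exact ⟨Metric.ball x r, mem_nhdsWithin_of_mem_nhds (Metric.ball_mem_nhds x hr), L, hL, r, hr,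
        fun p hp hps => h p hp hps⟩
  obtain ⟨L, hL, r, hr, h⟩ := hloc
  choose! ν hν using fun p hp => h p hp hp
  -- 10L is the Lipschitz constant for points closer than r/2. For the others the trivial bound 2 =
  -- (4/r)(r/2) on the difference of unit vectors suffices.
  refine ⟨10 * L + 4 / r, by positivity, r, hr, ν, fun p hp => (hν p hp).mono ?_ le_rfl,
    fun p hp q hq => ?_⟩
  · have : 0 < 4 / r := by positivity
    linarith
  · rcases lt_or_ge (2 * ‖p - q‖) r with hlt | hge
    · refine ((hν p hp).norm_sub_le (hν q hq) S.dom_open hL hp hlt).trans ?_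
      gcongr
      have : 0 < 4 / r := by positivity
      linarith
    · calc ‖ν p - ν q‖ ≤ ‖ν p‖ + ‖ν q‖ := norm_sub_le _ _
        _ = 2 := by rw [(hν p hp).norm_eq, (hν q hq).norm_eq]; norm_num
        _ = 4 / r * (r / 2) := by field_simp; norm_num
        _ ≤ 4 / r * ‖p - q‖ := by gcongr; linarith
        _ ≤ _ := by gcongr; linarith

end ESFEM

namespace ESFEM

/-! ### Lipschitz functions on the plane -/

/-- Let u be the last parameter in a closed set that contains a. Beyond u this set is not needed, so
induction applies to the smaller family on [u, b]. Covering only the half-open interval is what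
survives this step; the left end point is recovered from closedness. -/
theorem dist_le_of_finset_closed_cover {F ι : Type*} [PseudoMetricSpace F] [DecidableEq ι]
    {C : ι → Set ℝ} (hC : ∀ i, IsClosed (C i)) {f : ℝ → F} {M : ℝ} {b : ℝ} (s : Finset ι) :
    ∀ a ≤ b, Ioc a b ⊆ ⋃ i ∈ s, C i →
      (∀ i, ∀ x ∈ C i ∩ Icc a b, ∀ y ∈ C i ∩ Icc a b, dist (f x) (f y) ≤ M * dist x y) →
      dist (f a) (f b) ≤ M * (b - a) := by
  induction s using Finset.strongInduction with
  | H s ih =>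
    intro a hab hcov hL
    rcases hab.eq_or_lt with rfl | hlt
    · simp
    have hclosed : IsClosed (⋃ i ∈ s, C i) := s.finite_toSet.isClosed_biUnion fun i _ => hC i
    have ha : a ∈ ⋃ i ∈ s, C i := by
      have : a ∈ closure (Ioc a b) := by
        rw [closure_Ioc hlt.ne]; exact ⟨le_rfl, hab⟩
      exact closure_minimal hcov hclosed this
    simp only [mem_iUnion] at ha
    obtain ⟨i, his, hai⟩ := ha
    have hcomp : IsCompact (C i ∩ Icc a b) := isCompact_Icc.inter_left (hC i)
    have hne : (C i ∩ Icc a b).Nonempty := ⟨a, hai, le_rfl, hab⟩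
    set u := sSup (C i ∩ Icc a b) with hu
    have hmem : u ∈ C i ∩ Icc a b := hcomp.sSup_mem hne
    have h1 : dist (f a) (f u) ≤ M * (u - a) := by
      have := hL i a ⟨hai, le_rfl, hab⟩ u hmem
      rwa [Real.dist_eq, abs_sub_comm, abs_of_nonneg (sub_nonneg.2 hmem.2.1)] at this
    have h2 : dist (f u) (f b) ≤ M * (b - u) := by
      refine ih (s.erase i) (Finset.erase_ssubset his) u hmem.2.2 ?_ ?_
      · intro x hx
        have hx' := hcov ⟨hmem.2.1.trans_lt hx.1, hx.2⟩
        simp only [mem_iUnion] at hx' ⊢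
        obtain ⟨j, hj, hxj⟩ := hx'
        refine ⟨j, Finset.mem_erase.2 ⟨?_, hj⟩, hxj⟩
        rintro rfl
        exact absurd (le_csSup hcomp.bddAbove ⟨hxj, hmem.2.1.trans hx.1.le, hx.2⟩) (not_le.2 hx.1)
      · intro j x hx y hy
        exact hL j x ⟨hx.1, hmem.2.1.trans hx.2.1, hx.2.2⟩ y ⟨hy.1, hmem.2.1.trans hy.2.1, hy.2.2⟩
    calc dist (f a) (f b) ≤ _ := dist_triangle _ (f u) _
      _ ≤ M * (u - a) + M * (b - u) := add_le_add h1 h2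
      _ = _ := by ring

/-- A function on a convex set that is Lipschitz on each of finitely many closed sets covering the
set is Lipschitz. -/
theorem dist_le_of_finite_closed_cover {E F ι : Type*} [NormedAddCommGroup E] [NormedSpace ℝ E]
    [PseudoMetricSpace F] [Finite ι] {C : ι → Set E} (hC : ∀ i, IsClosed (C i)) {s : Set E}
    (hs : Convex ℝ s) (hcov : s ⊆ ⋃ i, C i) {f : E → F} {M : ℝ}
    (hL : ∀ i, ∀ x ∈ C i ∩ s, ∀ y ∈ C i ∩ s, dist (f x) (f y) ≤ M * dist x y) {x y : E}
    (hx : x ∈ s) (hy : y ∈ s) : dist (f x) (f y) ≤ M * dist x y := by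
  classical
  have := Fintype.ofFinite ι
  let g : ℝ → E := fun t => AffineMap.lineMap x y t
  have hg : Continuous g := AffineMap.lineMap_continuous
  have hgs : ∀ t ∈ Icc (0 : ℝ) 1, g t ∈ s := fun t ht => hs.lineMap_mem hx hy ht
  have := dist_le_of_finset_closed_cover (C := fun i => g ⁻¹' C i) (f := f ∘ g)
    (M := M * dist x y) (fun i => (hC i).preimage hg) Finset.univ (b := 1) 0 zero_le_one ?_ ?_
  · simpa [g] using this
  · intro t ht
    simpa using hcov (hgs t ⟨ht.1.le, ht.2⟩)
  · intro i a ha b hb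
    have := hL i (g a) ⟨ha.1, hgs a ha.2⟩ (g b) ⟨hb.1, hgs b hb.2⟩
    simp only [g, dist_lineMap_lineMap] at this
    simpa [g, mul_comm, mul_left_comm, mul_assoc] using this

theorem lineDeriv_comp_add {E : Type*} [NormedAddCommGroup E] [NormedSpace ℝ E] (g : E → ℝ)
    (c x v : E) : lineDeriv ℝ (fun y => g (y + c)) x v = lineDeriv ℝ g (x + c) v := by
  simp only [lineDeriv, add_right_comm]

theorem hasCompactSupport_comp_add {E : Type*} [NormedAddCommGroup E] {g : E → ℝ}
    (hg : HasCompactSupport g) (c : E) : HasCompactSupport fun y => g (y + c) :=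
  hg.comp_homeomorph (Homeomorph.addRight c)

theorem lineDeriv_eq_zero_of_eventuallyEq {E : Type*} [NormedAddCommGroup E] [NormedSpace ℝ E]
    {g : E → ℝ} {x : E} (h : g =ᶠ[𝓝 x] fun _ => 0) (v : E) : lineDeriv ℝ g x v = 0 := by
  rw [h.lineDeriv_eq]
  simp [lineDeriv]

section

variable {E : Type*} [NormedAddCommGroup E] [NormedSpace ℝ E] [MeasurableSpace E] [BorelSpace E]
  {μ : Measure E} [μ.IsAddHaarMeasure]

theorem integrable_lineDeriv {g : E → ℝ} {D : NNReal} (hg : LipschitzWith D g)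
    (hgs : HasCompactSupport g) (v : E) : Integrable (fun x => lineDeriv ℝ g x v) μ := by
  have hb : ∀ x, ‖lineDeriv ℝ g x v‖ ≤ D * ‖v‖ := fun x => norm_lineDeriv_le_of_lipschitz ℝ hg
  have h : IntegrableOn (fun x => lineDeriv ℝ g x v) (tsupport g) μ :=
    Measure.integrableOn_of_bounded hgs.measure_lt_top.ne
      (measurable_lineDeriv hg.continuous).aestronglyMeasurable (ae_of_all _ hb)
  rwa [integrableOn_iff_integrable_of_support_subset] at h
  intro x hx
  by_contra hx'
  refine hx ?_
  refine lineDeriv_eq_zero_of_eventuallyEq ?_ v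
  filter_upwards [(isClosed_tsupport g).isOpen_compl.mem_nhds hx'] with y hy
  exact image_eq_zero_of_notMem_tsupport hy

variable [FiniteDimensional ℝ E]

/-- Symmetry of the bilinear form `∫ ∂_v f ∂_w g` for Lipschitz functions with compact support. -/
theorem integral_lineDeriv_mul_lineDeriv_comm {f g : E → ℝ} {C D : NNReal}
    (hf : LipschitzWith C f) (hfs : HasCompactSupport f) (hg : LipschitzWith D g)
    (hgs : HasCompactSupport g) (v w : E) :
    ∫ x, lineDeriv ℝ f x v * lineDeriv ℝ g x w ∂μ =
      ∫ x, lineDeriv ℝ f x w * lineDeriv ℝ g x v ∂μ := by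
  have hIf := integrable_lineDeriv (μ := μ) hf hfs v
  have hIg := integrable_lineDeriv (μ := μ) hg hgs (-v)
  have h1 := hg.integral_inv_smul_sub_mul_tendsto_integral_lineDeriv_mul hIf w
  have h2 := hf.integral_inv_smul_sub_mul_tendsto_integral_lineDeriv_mul hIg (-w)
  have hc : ∀ c : E, Integrable (fun x => lineDeriv ℝ f x v * g (x + c)) μ := fun c =>
    hIf.mul_bdd (c := hgs.exists_bound_of_continuous hg.continuous |>.choose)
      ((hg.continuous.comp (continuous_add_const c)).aestronglyMeasurable)
      (ae_of_all _ fun x => (hgs.exists_bound_of_continuous hg.continuous).choose_spec _)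
  have hd : ∀ c : E, Integrable (fun x => f (x + c) * lineDeriv ℝ g x (-v)) μ := fun c =>
    hIg.bdd_mul (c := hfs.exists_bound_of_continuous hf.continuous |>.choose)
      ((hf.continuous.comp (continuous_add_const c)).aestronglyMeasurable)
      (ae_of_all _ fun x => (hfs.exists_bound_of_continuous hf.continuous).choose_spec _)
  -- Integration by parts in the direction v, followed by a translation by c, moves the shift from g
  -- to f. The difference quotient of g in the direction w thus becomes one of f in the direction
  -- -w, and the limit gives the symmetry without second derivatives.
  have key : ∀ c : E, ∫ x, lineDeriv ℝ f x v * g (x + c) ∂μ =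
      ∫ x, f (x + -c) * lineDeriv ℝ g x (-v) ∂μ := by
    intro c
    have hgc : LipschitzWith D fun y => g (y + c) := by
      have := hg.comp (isometry_add_right c).lipschitz
      rwa [mul_one] at this
    rw [hf.integral_lineDeriv_mul_eq hgc (hasCompactSupport_comp_add hgs c)]
    simp only [lineDeriv_comp_add]
    rw [← integral_add_right_eq_self (μ := μ) (fun x => f (x + -c) * lineDeriv ℝ g x (-v)) c]
    simp [mul_comm]
  have heq : (fun t : ℝ => ∫ x, (t⁻¹ • (g (x + t • w) - g x)) * lineDeriv ℝ f x v ∂μ) =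
      fun t : ℝ => ∫ x, (t⁻¹ • (f (x + t • -w) - f x)) * lineDeriv ℝ g x (-v) ∂μ := by
    funext t
    have e1 : ∀ x, (t⁻¹ • (g (x + t • w) - g x)) * lineDeriv ℝ f x v =
        t⁻¹ * (lineDeriv ℝ f x v * g (x + t • w) - lineDeriv ℝ f x v * g (x + 0)) := by
      intro x; rw [add_zero, smul_eq_mul]; ring
    have e2 : ∀ x, (t⁻¹ • (f (x + t • -w) - f x)) * lineDeriv ℝ g x (-v) =
        t⁻¹ * (f (x + -(t • w)) * lineDeriv ℝ g x (-v) - f (x + -0) * lineDeriv ℝ g x (-v)) := by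
      intro x; rw [neg_zero, add_zero, smul_eq_mul, smul_neg]; ring
    simp_rw [e1, e2]
    rw [integral_const_mul, integral_const_mul, integral_sub (hc _) (hc _),
      integral_sub (hd _) (by simpa using hd 0), key, key]
  rw [heq] at h1
  have := tendsto_nhds_unique h1 h2
  calc ∫ x, lineDeriv ℝ f x v * lineDeriv ℝ g x w ∂μ
      = ∫ x, lineDeriv ℝ g x w * lineDeriv ℝ f x v ∂μ := by simp_rw [mul_comm]
    _ = _ := this
    _ = _ := by simp [lineDeriv_neg]

end

/-- A Lipschitz function is absolutely continuous, so its value is the integral of its derivative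
from a point to the left of the support. -/
theorem enorm_le_lintegral_deriv {g : ℝ → ℝ} {D : NNReal} (hg : LipschitzWith D g)
    (hgs : HasCompactSupport g) (x : ℝ) : ‖g x‖ₑ ≤ ∫⁻ t, ‖deriv g t‖ₑ := by
  obtain ⟨R, hR⟩ := hgs.isBounded.subset_closedBall 0
  obtain ⟨a, ha1, ha2⟩ : ∃ a, a ≤ x ∧ a < -R := ⟨min x (-R) - 1, by
    have := min_le_left x (-R); linarith, by have := min_le_right x (-R); linarith⟩
  have hga : g a = 0 := by
    apply image_eq_zero_of_notMem_tsupport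
    intro h
    have := hR h
    rw [mem_closedBall_zero_iff, Real.norm_eq_abs, abs_le] at this
    linarith [this.1]
  have hac : AbsolutelyContinuousOnInterval g a x :=
    (hg.lipschitzOnWith (s := uIcc a x)).absolutelyContinuousOnInterval
  have hi := hac.integral_deriv_eq_sub
  rw [hga, sub_zero] at hi
  rw [← hi, intervalIntegral.integral_of_le ha1]
  exact (enorm_integral_le_lintegral_enorm _).trans (setLIntegral_le_lintegral _ _)

theorem lineDeriv_single_eq_deriv_update (f : (Fin 2 → ℝ) → ℝ) (x : Fin 2 → ℝ) (i : Fin 2)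
    (t : ℝ) : deriv (fun s => f (Function.update x i s)) t =
      lineDeriv ℝ f (Function.update x i t) (Pi.single i 1) := by
  have h : ∀ s, Function.update x i t + s • Pi.single i (1 : ℝ) = Function.update x i (t + s) := by
    intro s
    ext j
    by_cases hj : j = i
    · subst hj; simp
    · simp [hj]
  simp only [lineDeriv, h]
  rw [deriv_comp_const_add (f := fun s => f (Function.update x i s)), add_zero]

/-- Gagliardo-Nirenberg-Sobolev inequality `‖f‖_{L²} ≤ ‖∇f‖_{L¹}` in the plane for Lipschitz
functions with compact support. -/
theorem lintegral_sq_le_sq_lintegral_lineDeriv {f : (Fin 2 → ℝ) → ℝ} {D : NNReal}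
    (hf : LipschitzWith D f) (hfs : HasCompactSupport f) :
    ∫⁻ x, ‖f x‖ₑ ^ 2 ≤
      (∫⁻ x, (‖lineDeriv ℝ f x (Pi.single 0 1)‖ₑ + ‖lineDeriv ℝ f x (Pi.single 1 1)‖ₑ)) ^ 2 := by
  set G : (Fin 2 → ℝ) → ENNReal := fun x =>
    ‖lineDeriv ℝ f x (Pi.single 0 1)‖ₑ + ‖lineDeriv ℝ f x (Pi.single 1 1)‖ₑ with hG
  have hGm : Measurable G :=
    ((measurable_lineDeriv hf.continuous).enorm).add ((measurable_lineDeriv hf.continuous).enorm)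
  have hGi : ∀ (i : Fin 2) x, ‖lineDeriv ℝ f x (Pi.single i 1)‖ₑ ≤ G x := by
    intro i x
    fin_cases i
    · exact le_self_add
    · exact le_add_self
  have hpt : ∀ (i : Fin 2) x, ‖f x‖ₑ ≤ ∫⁻ t, G (Function.update x i t) := by
    intro i x
    have hl : LipschitzWith D fun s => f (Function.update x i s) := by
      have : LipschitzWith 1 fun s : ℝ => Function.update x i s := by
        refine LipschitzWith.of_dist_le_mul fun s t => ?_
        rw [dist_pi_le_iff (by positivity)]
        intro j
        by_cases hj : j = i
        · subst hj; simp
        · simp [hj]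
      have := hf.comp this
      rwa [mul_one] at this
    have hs : HasCompactSupport fun s => f (Function.update x i s) := by
      obtain ⟨R, hR⟩ := hfs.isBounded.subset_closedBall 0
      refine HasCompactSupport.intro (isCompact_closedBall (0 : ℝ) R) fun s hs => ?_
      apply image_eq_zero_of_notMem_tsupport
      intro h
      apply hs
      have := mem_closedBall_zero_iff.1 (hR h)
      rw [mem_closedBall_zero_iff]
      have h2 := norm_le_pi_norm (Function.update x i s) i
      rw [Function.update_self] at h2
      exact h2.trans this
    have := enorm_le_lintegral_deriv hl hs (x i)
    simp only [Function.update_eq_self, lineDeriv_single_eq_deriv_update] at this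
    exact this.trans (lintegral_mono fun t => hGi i _)
  have hp : Real.HolderConjugate (Fintype.card (Fin 2) : ℝ) 2 := by
    rw [Fintype.card_fin, Real.holderConjugate_iff]; norm_num
  -- In dimension two the exponent 1/(2 - 1) is 1: the product of the two line integrals, each
  -- constant along one coordinate, integrates to at most the square of the full integral.
  have key := lintegral_prod_lintegral_pow_le (fun _ : Fin 2 => (volume : Measure ℝ)) hp hGm
  have hn : (1 : ℝ) / ((Fintype.card (Fin 2) : ℕ) - 1 : ℝ) = 1 := by
    rw [Fintype.card_fin]; norm_num
  simp only [hn, ENNReal.rpow_one, Fin.prod_univ_two, ENNReal.rpow_ofNat] at key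
  refine le_trans (lintegral_mono fun x => ?_) key
  rw [sq]
  exact mul_le_mul' (hpt 0 x) (hpt 1 x)

end ESFEM

namespace ESFEM

/-! ### Flat triangles -/

theorem flatMap_eq (v : Fin 3 → E3) (ξ : R2) :
    flatMap v ξ = v 0 + ξ 0 • (v 1 - v 0) + ξ 1 • (v 2 - v 0) := by
  simp only [flatMap, Fin.sum_univ_three, eval_baryPoly_zero, eval_baryPoly_one, eval_baryPoly_two]
  module

theorem continuous_flatMap (v : Fin 3 → E3) : Continuous (flatMap v) := by
  have : flatMap v = fun ξ => v 0 + ξ 0 • (v 1 - v 0) + ξ 1 • (v 2 - v 0) :=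
    funext (flatMap_eq v)
  rw [this]
  fun_prop

theorem exists_mem_refTri_of_weights {w : Fin 3 → ℝ} (h0 : ∀ j, 0 ≤ w j) (h1 : ∑ j, w j = 1) :
    ∃ ξ ∈ refTri, ∀ j, MvPolynomial.eval ξ (baryPoly j) = w j := by
  have h : ∀ j, MvPolynomial.eval ![w 1, w 2] (baryPoly j) = w j := by
    rw [Fin.sum_univ_three] at h1
    intro j
    fin_cases j
    · simp [eval_baryPoly_zero]; linarith
    · simp [eval_baryPoly_one]
    · simp [eval_baryPoly_two]
  exact ⟨_, (mem_refTri_iff _).2 fun j => by rw [h]; exact h0 j, h⟩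

theorem convexHull_range_eq (v : Fin 3 → E3) : convexHull ℝ (range v) = flatMap v '' refTri := by
  apply Subset.antisymm
  · refine convexHull_min ?_ ?_
    · rintro _ ⟨j, rfl⟩
      obtain ⟨ξ, hξ, h⟩ := exists_mem_refTri_of_weights (w := Pi.single j 1)
        (fun i => by by_cases hi : i = j <;> simp [hi]) (by simp)
      refine ⟨ξ, hξ, ?_⟩
      simp only [flatMap, h]
      rw [Finset.sum_eq_single j] <;> simp +contextual
    · rintro _ ⟨x, hx, rfl⟩ _ ⟨y, hy, rfl⟩ a b ha hb hab
      refine ⟨a • x + b • y, convex_refTri hx hy ha hb hab, ?_⟩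
      simp only [flatMap_eq, Pi.add_apply, Pi.smul_apply, smul_eq_mul]
      have : v 0 = a • v 0 + b • v 0 := by rw [← add_smul, hab, one_smul]
      nth_rewrite 1 [this]
      module
  · rintro _ ⟨ξ, hξ, rfl⟩
    exact (convex_convexHull ℝ _).sum_mem (fun j _ => eval_baryPoly_nonneg hξ j)
      (sum_eval_baryPoly ξ) fun j _ => subset_convexHull ℝ _ ⟨j, rfl⟩

theorem flatMap_mem_convexHull (v : Fin 3 → E3) {ξ : R2} (hξ : ξ ∈ refTri) :
    flatMap v ξ ∈ convexHull ℝ (range v) := by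
  rw [convexHull_range_eq]; exact ⟨ξ, hξ, rfl⟩

theorem norm_flatMap_sub_le {v : Fin 3 → E3} {h : ℝ} {p : E3} (hv : ∀ j, ‖v j - p‖ ≤ h) {ξ : R2}
    (hξ : ξ ∈ refTri) : ‖flatMap v ξ - p‖ ≤ h := by
  have e : flatMap v ξ - p = ∑ j, MvPolynomial.eval ξ (baryPoly j) • (v j - p) := by
    simp only [smul_sub, Finset.sum_sub_distrib, ← Finset.sum_smul, sum_eval_baryPoly, one_smul,
      flatMap]
  rw [e]
  calc _ ≤ ∑ j, MvPolynomial.eval ξ (baryPoly j) * h := by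
        refine norm_sum_le_of_le _ fun j _ => ?_
        rw [norm_smul, Real.norm_eq_abs, abs_of_nonneg (eval_baryPoly_nonneg hξ j)]
        exact mul_le_mul_of_nonneg_left (hv j) (eval_baryPoly_nonneg hξ j)
    _ = h := by rw [← Finset.sum_mul, sum_eval_baryPoly, one_mul]

theorem eval_baryPoly_eq_of_flatMap_eq {v : Fin 3 → E3} (hv : AffineIndependent ℝ v) {ξ : R2}
    {w : Fin 3 → ℝ} (hw : ∑ j, w j = 1) (h : flatMap v ξ = ∑ j, w j • v j) (j : Fin 3) :
    MvPolynomial.eval ξ (baryPoly j) = w j := by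
  rw [affineIndependent_iff] at hv
  have := hv Finset.univ (fun j => MvPolynomial.eval ξ (baryPoly j) - w j)
    (by rw [Finset.sum_sub_distrib, sum_eval_baryPoly, hw, sub_self])
    (by simp only [sub_smul, Finset.sum_sub_distrib, ← h, flatMap, sub_self]) j (Finset.mem_univ j)
  linarith

theorem toLp_eval_lagrangeInterp (k : ℕ) (g : R2 → E3) (ξ : R2) :
    (WithLp.toLp 2 fun i => MvPolynomial.eval ξ (lagrangeInterp k g i) : E3) =
      ∑ α ∈ Finset.Nat.antidiagonalTuple 3 k,
        MvPolynomial.eval ξ (lagrangePoly k α) • g (lagrangeNode k α) := by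
  ext i
  simp [lagrangeInterp, map_sum, mul_comm]

theorem toLp_eval_lagrangeInterp_node {k : ℕ} (hk : 1 ≤ k) (g : R2 → E3) {β : Fin 3 → ℕ}
    (hβ : β ∈ Finset.Nat.antidiagonalTuple 3 k) :
    (WithLp.toLp 2 fun i => MvPolynomial.eval (lagrangeNode k β) (lagrangeInterp k g i) : E3) =
      g (lagrangeNode k β) := by
  rw [toLp_eval_lagrangeInterp, Finset.sum_eq_single β]
  · rw [eval_lagrangePoly_node hk hβ hβ]; simp
  · intro α hα hne
    rw [eval_lagrangePoly_node hk hα hβ, if_neg hne, zero_smul]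
  · exact fun h => absurd hβ h

theorem vertexNode_mem (k : ℕ) (j : Fin 3) :
    Pi.single j k ∈ Finset.Nat.antidiagonalTuple 3 k := by
  rw [Finset.Nat.mem_antidiagonalTuple, Finset.sum_pi_single']; simp

theorem flatMap_vertexNode {k : ℕ} (hk : 1 ≤ k) (v : Fin 3 → E3) (j : Fin 3) :
    flatMap v (lagrangeNode k (Pi.single j k)) = v j := by
  have hk' : (k : ℝ) ≠ 0 := by positivity
  rw [flatMap, Finset.sum_eq_single j]
  · rw [eval_baryPoly_lagrangeNode hk (vertexNode_mem k j), Pi.single_eq_same, div_self hk',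
      one_smul]
  · intro i _ hne
    rw [eval_baryPoly_lagrangeNode hk (vertexNode_mem k j), Pi.single_eq_of_ne hne]; simp
  · simp

theorem norm_triNormal_le (v : Fin 3 → E3) : ‖triNormal v‖ ≤ dist (v 1) (v 0) * dist (v 2) (v 0) := by
  have h : ‖triNormal v‖ ^ 2 ≤ (dist (v 1) (v 0) * dist (v 2) (v 0)) ^ 2 := by
    rw [mul_pow, dist_eq_norm, dist_eq_norm, triNormal]
    simp only [EuclideanSpace.real_norm_sq_eq, Fin.sum_univ_three, cross_apply]
    simp only [Matrix.cons_val_zero, Matrix.cons_val_one, Matrix.cons_val]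
    nlinarith [sq_nonneg ((v 1 - v 0).ofLp 0 * (v 2 - v 0).ofLp 0 +
      (v 1 - v 0).ofLp 1 * (v 2 - v 0).ofLp 1 + (v 1 - v 0).ofLp 2 * (v 2 - v 0).ofLp 2)]
  exact le_of_sq_le_sq h (by positivity)

/-- With P the perimeter, r P ≤ ‖n‖ ≤ P², so r ≤ P and r² ≤ r P ≤ ‖n‖. A zero perimeter is
impossible, since the inradius would then be 0 by convention. -/
theorem sq_le_norm_triNormal {v : Fin 3 → E3} {r : ℝ} (hr : 0 < r) (h : r ≤ inradius v) :
    r ^ 2 ≤ ‖triNormal v‖ := by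
  rw [inradius] at h
  set P := dist (v 0) (v 1) + dist (v 1) (v 2) + dist (v 2) (v 0) with hP
  have hP0 : 0 ≤ P := by positivity
  have hPpos : 0 < P := by
    rcases hP0.eq_or_lt with h0 | h0
    · rw [← h0, div_zero] at h; linarith
    · exact h0
  have h1 : r * P ≤ ‖triNormal v‖ := (le_div_iff₀ hPpos).1 h
  have h2 : ‖triNormal v‖ ≤ P * P := by
    refine (norm_triNormal_le v).trans ?_
    rw [dist_comm (v 1)]
    have := dist_nonneg (x := v 0) (y := v 1)
    have := dist_nonneg (x := v 1) (y := v 2)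
    have := dist_nonneg (x := v 2) (y := v 0)
    gcongr <;> linarith
  have h3 : r ≤ P := le_of_mul_le_mul_right (h1.trans h2) hPpos
  nlinarith

/-! ### Triangulations -/

theorem closestPt_spec {Γ : Set E3} {x : E3} (h : ∃ p, p ∈ Γ ∧ dist x p = Metric.infDist x Γ) :
    closestPt Γ x ∈ Γ ∧ dist x (closestPt Γ x) = Metric.infDist x Γ :=
  Classical.epsilon_spec h

theorem closestPt_of_mem {Γ : Set E3} {x : E3} (hx : x ∈ Γ) : closestPt Γ x = x := by
  have h := closestPt_spec (Γ := Γ) (x := x) ⟨x, hx, by rw [dist_self, Metric.infDist_zero_of_mem hx]⟩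
  rw [Metric.infDist_zero_of_mem hx] at h
  exact (dist_eq_zero.1 h.2).symm

namespace Mesh

variable {T : ℝ} {m : ℕ} {S : EvolvingSurface T m}

/-- The polyhedral surface of the initial triangulation. -/
def poly (M : Mesh S) : Set E3 := ⋃ K, convexHull ℝ (range (M.vert K))

theorem mem_poly_iff (M : Mesh S) {x : E3} :
    x ∈ M.poly ↔ ∃ K, ∃ ξ ∈ refTri, flatMap (M.vert K) ξ = x := by
  simp only [poly, mem_iUnion, convexHull_range_eq]; rfl

theorem closestPt_mem (M : Mesh S) {x : E3} (hx : x ∈ M.poly) : closestPt S.init x ∈ S.init := by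
  obtain ⟨K, hK⟩ := mem_iUnion.1 hx
  exact (closestPt_spec (M.tubular K x hK).exists).1

theorem norm_sub_closestPt_le (M : Mesh S) {x : E3} (hx : x ∈ M.poly) {q : E3} (hq : q ∈ S.init) :
    ‖x - closestPt S.init x‖ ≤ ‖x - q‖ := by
  obtain ⟨K, hK⟩ := mem_iUnion.1 hx
  rw [← dist_eq_norm, ← dist_eq_norm, (closestPt_spec (M.tubular K x hK).exists).2]
  exact Metric.infDist_le_dist_of_mem hq

/-- By conformity a common point lies in the hull of the shared vertices. Barycentric coordinates
are unique, so in both triangles they are given by a single weight W on vertices that vanishes off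
the shared ones. The matching of shared vertices extends to a permutation. Continuity across edges
is reduced to this fact throughout. -/
theorem exists_perm (M : Mesh S) {K K' : Fin M.numTri} {ξ ξ' : R2} (hξ : ξ ∈ refTri)
    (hξ' : ξ' ∈ refTri) (h : flatMap (M.vert K) ξ = flatMap (M.vert K') ξ') :
    ∃ σ : Equiv.Perm (Fin 3), ∀ j,
      MvPolynomial.eval ξ (baryPoly j) = MvPolynomial.eval ξ' (baryPoly (σ j)) ∧
      (MvPolynomial.eval ξ (baryPoly j) ≠ 0 → M.vert K j = M.vert K' (σ j)) := by
  classical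
  set v := M.vert K
  set v' := M.vert K'
  have hinj : Function.Injective v := (M.affineIndep K).injective
  have hinj' : Function.Injective v' := (M.affineIndep K').injective
  set s : Finset E3 := Finset.univ.image v ∩ Finset.univ.image v' with hs
  have hmem : flatMap v ξ ∈ convexHull ℝ (s : Set E3) := by
    have := M.conforming K K'
    have h2 : (s : Set E3) = range v ∩ range v' := by simp [hs]
    rw [h2, ← this]
    exact ⟨flatMap_mem_convexHull v hξ, h ▸ flatMap_mem_convexHull v' hξ'⟩
  rw [Finset.mem_convexHull'] at hmem
  obtain ⟨w, hw0, hw1, hw2⟩ := hmem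
  set W : E3 → ℝ := fun y => if y ∈ s then w y else 0 with hW
  have key : ∀ (u : Fin 3 → E3), AffineIndependent ℝ u → s ⊆ Finset.univ.image u → ∀ η : R2,
      flatMap u η = flatMap v ξ → ∀ j, MvPolynomial.eval η (baryPoly j) = W (u j) := by
    intro u hu hsu η hη j
    refine eval_baryPoly_eq_of_flatMap_eq hu (w := fun j => W (u j)) ?_ ?_ j
    · rw [← Finset.sum_image (f := W) (g := u) (fun a _ b _ hab => hu.injective hab),
        ← Finset.sum_subset hsu (fun y _ hy => by simp [hW, hy]), ← hw1]
      exact Finset.sum_congr rfl fun y hy => by simp [hW, hy]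
    · rw [← Finset.sum_image (f := fun y => W y • y) (g := u) (fun a _ b _ hab => hu.injective hab),
        ← Finset.sum_subset hsu (fun y _ hy => by simp [hW, hy]), hη, ← hw2]
      exact Finset.sum_congr rfl fun y hy => by simp [hW, hy]
  have hξW := key v (M.affineIndep K) Finset.inter_subset_left ξ rfl
  have hξW' := key v' (M.affineIndep K') Finset.inter_subset_right ξ' h.symm
  have hex : ∀ j : {j // v j ∈ s}, ∃ j' : {j' // v' j' ∈ s}, v' j' = v j := by
    rintro ⟨j, hj⟩
    have hj2 := (Finset.mem_inter.1 hj).2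
    simp only [Finset.mem_image, Finset.mem_univ, true_and] at hj2
    obtain ⟨j', hj'⟩ := hj2
    exact ⟨⟨j', hj' ▸ hj⟩, hj'⟩
  choose f hf using hex
  have hfb : Function.Bijective f := by
    constructor
    · intro a b hab
      apply Subtype.ext
      apply hinj
      rw [← hf a, ← hf b, hab]
    · rintro ⟨j', hj'⟩
      have hj2 := (Finset.mem_inter.1 hj').1
      simp only [Finset.mem_image, Finset.mem_univ, true_and] at hj2
      obtain ⟨j, hj⟩ := hj2
      refine ⟨⟨j, hj ▸ hj'⟩, Subtype.ext (hinj' ?_)⟩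
      rw [hf, hj]
  let e := Equiv.ofBijective f hfb
  refine ⟨e.extendSubtype, fun j => ?_⟩
  by_cases hj : v j ∈ s
  · have h1 : e.extendSubtype j = f ⟨j, hj⟩ := e.extendSubtype_apply_of_mem j hj
    rw [h1, hξW, hξW', hf ⟨j, hj⟩]
    exact ⟨rfl, fun _ => rfl⟩
  · have h1 := e.extendSubtype_not_mem j hj
    have h2 : MvPolynomial.eval ξ (baryPoly j) = 0 := by rw [hξW]; simp [hW, hj]
    refine ⟨?_, fun hne => absurd h2 hne⟩
    rw [h2, hξW']
    simp [hW, h1]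

/-- All weights of an interior point are nonzero, so all three vertices are shared, and triangles
with the same vertex set coincide. -/
theorem eq_of_flatMap_eq (M : Mesh S) {K K' : Fin M.numTri} {ξ ξ' : R2} (hξ : ξ ∈ openTri)
    (hξ' : ξ' ∈ refTri) (h : flatMap (M.vert K) ξ = flatMap (M.vert K') ξ') : K = K' := by
  obtain ⟨σ, hσ⟩ := M.exists_perm (openTri_subset_refTri hξ) hξ' h
  apply M.distinct
  have hv : ∀ j, M.vert K j = M.vert K' (σ j) := fun j =>
    (hσ j).2 ((mem_openTri_iff ξ).1 hξ j).ne'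
  ext x
  constructor
  · rintro ⟨j, rfl⟩; exact ⟨σ j, (hv j).symm⟩
  · rintro ⟨j, rfl⟩; exact ⟨σ.symm j, by rw [hv, Equiv.apply_symm_apply]⟩

/-! ### Finite element functions -/

theorem mul_mem_scalarSpace (M : Mesh S) {k l : ℕ} {p q : ScalarFn M} (hp : p ∈ M.scalarSpace k)
    (hq : q ∈ M.scalarSpace l) : (fun K => p K * q K) ∈ M.scalarSpace (k + l) :=
  ⟨fun K => (MvPolynomial.totalDegree_mul _ _).trans (add_le_add (hp.1 K) (hq.1 K)),
    fun K K' ξ hξ ξ' hξ' h => by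
      rw [map_mul, map_mul, hp.2 K K' ξ hξ ξ' hξ' h, hq.2 K K' ξ hξ ξ' hξ' h]⟩

theorem add_mem_scalarSpace (M : Mesh S) {k : ℕ} {p q : ScalarFn M} (hp : p ∈ M.scalarSpace k)
    (hq : q ∈ M.scalarSpace k) : p + q ∈ M.scalarSpace k :=
  ⟨fun K => (MvPolynomial.totalDegree_add _ _).trans (max_le (hp.1 K) (hq.1 K)),
    fun K K' ξ hξ ξ' hξ' h => by
      rw [Pi.add_apply, Pi.add_apply, map_add, map_add, hp.2 K K' ξ hξ ξ' hξ' h,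
        hq.2 K K' ξ hξ ξ' hξ' h]⟩

theorem sum_mem_scalarSpace (M : Mesh S) {k : ℕ} {ι : Type*} (s : Finset ι) {p : ι → ScalarFn M}
    (hp : ∀ i ∈ s, p i ∈ M.scalarSpace k) : ∑ i ∈ s, p i ∈ M.scalarSpace k := by
  classical
  induction s using Finset.induction_on with
  | empty => exact ⟨fun K => by simp, fun K K' ξ _ ξ' _ _ => by simp⟩
  | insert i s hi ih =>
    rw [Finset.sum_insert hi]
    exact M.add_mem_scalarSpace (hp i (Finset.mem_insert_self i s))
      (ih fun j hj => hp j (Finset.mem_insert_of_mem hj))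

/-- The piecewise linear function with given values at the vertices. -/
noncomputable def vertexInterp (M : Mesh S) (N : E3 → ℝ) : ScalarFn M := fun K =>
  ∑ j, MvPolynomial.C (N (M.vert K j)) * baryPoly j

theorem eval_vertexInterp (M : Mesh S) (N : E3 → ℝ) (K : Fin M.numTri) (ξ : R2) :
    MvPolynomial.eval ξ (M.vertexInterp N K) =
      ∑ j, N (M.vert K j) * MvPolynomial.eval ξ (baryPoly j) := by
  simp [vertexInterp, map_sum]

theorem vertexInterp_mem (M : Mesh S) (N : E3 → ℝ) : M.vertexInterp N ∈ M.scalarSpace 1 := by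
  refine ⟨fun K => ?_, fun K K' ξ hξ ξ' hξ' h => ?_⟩
  · refine MvPolynomial.totalDegree_finsetSum_le fun j _ => ?_
    refine (MvPolynomial.totalDegree_mul _ _).trans ?_
    rw [MvPolynomial.totalDegree_C, zero_add]
    exact totalDegree_baryPoly_le j
  · obtain ⟨σ, hσ⟩ := M.exists_perm hξ hξ' h
    rw [eval_vertexInterp, eval_vertexInterp,
      ← Equiv.sum_comp σ fun j => N (M.vert K' j) * MvPolynomial.eval ξ' (baryPoly j)]
    refine Finset.sum_congr rfl fun j _ => ?_
    by_cases h0 : MvPolynomial.eval ξ (baryPoly j) = 0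
    · rw [← (hσ j).1, h0, mul_zero, mul_zero]
    · rw [(hσ j).2 h0, (hσ j).1]

/-- Nodal values that agree at common points define a finite element function. -/
theorem sum_lagrangePoly_mem (M : Mesh S) {k : ℕ} (hk : 1 ≤ k)
    (G : Fin M.numTri → R2 → ℝ)
    (hG : ∀ K K', ∀ ξ ∈ refTri, ∀ ξ' ∈ refTri, flatMap (M.vert K) ξ = flatMap (M.vert K') ξ' →
      G K ξ = G K' ξ') :
    (fun K => ∑ α ∈ Finset.Nat.antidiagonalTuple 3 k,
      MvPolynomial.C (G K (lagrangeNode k α)) * lagrangePoly k α) ∈ M.scalarSpace k := by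
  refine ⟨fun K => ?_, fun K K' ξ hξ ξ' hξ' h => ?_⟩
  · refine MvPolynomial.totalDegree_finsetSum_le fun α hα => ?_
    refine (MvPolynomial.totalDegree_mul _ _).trans ?_
    rw [MvPolynomial.totalDegree_C, zero_add]
    exact totalDegree_lagrangePoly_le hα
  · obtain ⟨σ, hσ⟩ := M.exists_perm hξ hξ' h
    simp only [map_sum, map_mul, MvPolynomial.eval_C]
    have hmem : ∀ α : Fin 3 → ℕ, α ∈ Finset.Nat.antidiagonalTuple 3 k →
        α ∘ σ.symm ∈ Finset.Nat.antidiagonalTuple 3 k := by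
      intro α hα
      rw [Finset.Nat.mem_antidiagonalTuple] at hα ⊢
      rw [← hα, ← Equiv.sum_comp σ.symm α]; rfl
    refine Finset.sum_bij' (fun α _ => α ∘ σ.symm) (fun α _ => α ∘ σ) hmem ?_ ?_ ?_ ?_
    · intro α hα
      rw [Finset.Nat.mem_antidiagonalTuple] at hα ⊢
      rw [← hα, ← Equiv.sum_comp σ α]; rfl
    · intro α _; ext j; simp
    · intro α _; ext j; simp
    · intro α hα
      have hL : MvPolynomial.eval ξ' (lagrangePoly k (α ∘ σ.symm)) =
          MvPolynomial.eval ξ (lagrangePoly k α) := by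
        rw [eval_lagrangePoly, eval_lagrangePoly, ← Equiv.prod_comp σ]
        refine Finset.prod_congr rfl fun j _ => ?_
        rw [(hσ j).1, Function.comp_apply, Equiv.symm_apply_apply]
      rw [hL]
      -- If α vanishes wherever the barycentric coordinates of ξ do, its node lies on the common
      -- face and the nodal values agree. Otherwise the basis polynomial of α vanishes at ξ and its
      -- value is irrelevant.
      by_cases hsupp : ∀ j, MvPolynomial.eval ξ (baryPoly j) = 0 → α j = 0
      · congr 1
        refine hG _ _ _ (lagrangeNode_mem_refTri hk hα) _ (lagrangeNode_mem_refTri hk (hmem α hα)) ?_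
        rw [flatMap, flatMap, ← Equiv.sum_comp σ fun j => MvPolynomial.eval
          (lagrangeNode k (α ∘ σ.symm)) (baryPoly j) • M.vert K' j]
        refine Finset.sum_congr rfl fun j _ => ?_
        rw [eval_baryPoly_lagrangeNode hk hα, eval_baryPoly_lagrangeNode hk (hmem α hα),
          Function.comp_apply, Equiv.symm_apply_apply]
        by_cases h0 : MvPolynomial.eval ξ (baryPoly j) = 0
        · simp [hsupp j h0]
        · rw [(hσ j).2 h0]
      · push Not at hsupp
        obtain ⟨j, hj0, hj⟩ := hsupp
        have : MvPolynomial.eval ξ (lagrangePoly k α) = 0 := by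
          rw [eval_lagrangePoly]
          refine Finset.prod_eq_zero (Finset.mem_univ j) ?_
          refine Finset.prod_eq_zero (Finset.mem_range.2 (Nat.pos_of_ne_zero hj)) ?_
          simp [hj0]
        rw [this, mul_zero, mul_zero]

/-! ### Mesh size -/

theorem toLp_eval_elem (M : Mesh S) (kg : ℕ) (t : ℝ) (K : Fin M.numTri) (ξ : R2) :
    (WithLp.toLp 2 fun i => MvPolynomial.eval ξ (M.elem kg t K i) : E3) =
      ∑ α ∈ Finset.Nat.antidiagonalTuple 3 kg, MvPolynomial.eval ξ (lagrangePoly kg α) •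
        S.flow t (closestPt S.init (flatMap (M.vert K) (lagrangeNode kg α))) :=
  toLp_eval_lagrangeInterp _ _ _

theorem flow_vert_mem_elemSet (M : Mesh S) {kg : ℕ} (hkg : 1 ≤ kg) (t : ℝ) (K : Fin M.numTri)
    (j : Fin 3) : S.flow t (M.vert K j) ∈ M.elemSet kg t K := by
  refine ⟨lagrangeNode kg (Pi.single j kg), lagrangeNode_mem_refTri hkg (vertexNode_mem kg j), ?_⟩
  refine (toLp_eval_lagrangeInterp_node hkg _ (vertexNode_mem kg j)).trans ?_
  rw [flatMap_vertexNode hkg, closestPt_of_mem (M.vert_mem K j)]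

theorem exists_elemSet_subset_closedBall (M : Mesh S) (kg : ℕ) :
    ∃ R : ℝ, ∀ t ∈ Icc 0 T, ∀ K, M.elemSet kg t K ⊆ Metric.closedBall 0 R := by
  obtain ⟨B, hB0, hB⟩ := exists_bound_lagrangePoly kg
  have hb : ∀ (p : E3), ∃ R, ∀ t ∈ Icc 0 T, ‖S.flow t p‖ ≤ R := by
    intro p
    refine isCompact_Icc.exists_bound_of_continuousOn (f := fun t => S.flow t p) ?_
    exact fun t _ => (S.flow_deriv t p).continuousAt.continuousWithinAt
  choose R hR using hb
  let x : Fin M.numTri → (Fin 3 → ℕ) → E3 := fun K α =>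
    closestPt S.init (flatMap (M.vert K) (lagrangeNode kg α))
  refine ⟨∑ K, ∑ α ∈ Finset.Nat.antidiagonalTuple 3 kg, B * |R (x K α)|, fun t ht K => ?_⟩
  rintro _ ⟨ξ, hξ, rfl⟩
  simp only [mem_closedBall_zero_iff, toLp_eval_elem]
  calc _ ≤ ∑ α ∈ Finset.Nat.antidiagonalTuple 3 kg, B * |R (x K α)| := by
        refine norm_sum_le_of_le _ fun α hα => ?_
        rw [norm_smul, Real.norm_eq_abs]
        have := (hR (x K α) t ht).trans (le_abs_self _)
        gcongr
        exact (hB α hα ξ hξ).1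
    _ ≤ _ := Finset.single_le_sum (f := fun K => ∑ α ∈ Finset.Nat.antidiagonalTuple 3 kg,
        B * |R (x K α)|) (fun K _ => by positivity) (Finset.mem_univ K)

theorem dist_flow_vert_le (M : Mesh S) {kg : ℕ} (hkg : 1 ≤ kg) {t : ℝ} (ht : t ∈ Icc 0 T)
    (K : Fin M.numTri) (i j : Fin 3) :
    dist (S.flow t (M.vert K i)) (S.flow t (M.vert K j)) ≤ M.size kg := by
  obtain ⟨R, hR⟩ := M.exists_elemSet_subset_closedBall kg
  -- Without an upper bound the supremum that defines the mesh size would be the default value 0.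
  have hbdd : BddAbove {d | ∃ t ∈ Icc 0 T, ∃ K, d = Metric.diam (M.elemSet kg t K)} := by
    refine ⟨2 * max R 0, ?_⟩
    rintro _ ⟨t, ht, K, rfl⟩
    exact (Metric.diam_mono ((hR t ht K).trans (Metric.closedBall_subset_closedBall
      (le_max_left R 0))) Metric.isBounded_closedBall).trans
      (Metric.diam_closedBall (le_max_right R 0))
  refine (Metric.dist_le_diam_of_mem (Metric.isBounded_closedBall.subset (hR t ht K))
    (M.flow_vert_mem_elemSet hkg t K i) (M.flow_vert_mem_elemSet hkg t K j)).trans ?_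
  exact le_csSup hbdd ⟨t, ht, K, rfl⟩

theorem norm_vert_sub_le (M : Mesh S) (hT : 0 < T) {kg : ℕ} (hkg : 1 ≤ kg)
    (K : Fin M.numTri) (i j : Fin 3) : ‖M.vert K i - M.vert K j‖ ≤ M.size kg := by
  have := M.dist_flow_vert_le hkg ⟨le_rfl, hT.le⟩ K i j
  rwa [S.flow_zero _ (M.vert_mem K i), S.flow_zero _ (M.vert_mem K j), dist_eq_norm] at this

theorem size_pos (M : Mesh S) (hT : 0 < T) {kg : ℕ} (hkg : 1 ≤ kg) (K : Fin M.numTri) :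
    0 < M.size kg := by
  refine lt_of_lt_of_le ?_ (M.norm_vert_sub_le hT hkg K 0 1)
  exact norm_pos_iff.2 (sub_ne_zero.2 ((M.affineIndep K).injective.ne (by decide)))

theorem sq_le_norm_triNormal_flow (M : Mesh S) (hT : 0 < T) {kg : ℕ} (hkg : 1 ≤ kg) {ρ : ℝ}
    (hρ : 0 < ρ) (hM : M.QuasiUniform kg ρ) {t : ℝ} (ht : t ∈ Icc 0 T) (K : Fin M.numTri) :
    ρ ^ 2 * M.size kg ^ 2 ≤ ‖triNormal fun j => S.flow t (M.vert K j)‖ := by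
  rw [← mul_pow]
  exact sq_le_norm_triNormal (mul_pos hρ (M.size_pos hT hkg K)) (hM t ht K)

theorem sq_le_norm_triNormal_vert (M : Mesh S) (hT : 0 < T) {kg : ℕ} (hkg : 1 ≤ kg) {ρ : ℝ}
    (hρ : 0 < ρ) (hM : M.QuasiUniform kg ρ) (K : Fin M.numTri) :
    ρ ^ 2 * M.size kg ^ 2 ≤ ‖triNormal (M.vert K)‖ := by
  have := M.sq_le_norm_triNormal_flow hT hkg hρ hM ⟨le_rfl, hT.le⟩ K
  have e : (fun j => S.flow 0 (M.vert K j)) = M.vert K :=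
    funext fun j => S.flow_zero _ (M.vert_mem K j)
  rwa [e] at this

end Mesh

end ESFEM

namespace ESFEM

/-! ### Bounds for the evolving surface -/

theorem exists_bound_of_contInTimeCm {m : ℕ} (hm : 2 ≤ m) {g : ℝ → E3 → E3}
    (hg : ContInTimeCm m g) (T : ℝ) {B : Set E3} (hB : IsCompact B) (hBc : Convex ℝ B) :
    ∃ L : ℝ, ∀ t ∈ Icc 0 T, (∀ x ∈ B, ‖fderiv ℝ (g t) x‖ ≤ L) ∧
      (∀ x ∈ B, ∀ y ∈ B, ‖g t x - g t y‖ ≤ L * ‖x - y‖) ∧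
      ∀ x ∈ B, ∀ y ∈ B, ‖fderiv ℝ (g t) x - fderiv ℝ (g t) y‖ ≤ L * ‖x - y‖ := by
  have hcomp : IsCompact (Icc (0 : ℝ) T ×ˢ B) := isCompact_Icc.prod hB
  obtain ⟨L1, hL1⟩ := hcomp.exists_bound_of_continuousOn (hg.2 1 (by omega)).continuousOn
  obtain ⟨L2, hL2⟩ := hcomp.exists_bound_of_continuousOn (hg.2 2 hm).continuousOn
  have h1 : ∀ t ∈ Icc 0 T, ∀ x ∈ B, ‖fderiv ℝ (g t) x‖ ≤ max L1 L2 := by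
    intro t ht x hx
    have := hL1 (t, x) ⟨ht, hx⟩
    rw [norm_iteratedFDeriv_one] at this
    exact this.trans (le_max_left _ _)
  have h2 : ∀ t ∈ Icc 0 T, ∀ x ∈ B, ‖fderiv ℝ (fderiv ℝ (g t)) x‖ ≤ max L1 L2 := by
    intro t ht x hx
    have := hL2 (t, x) ⟨ht, hx⟩
    rw [← norm_iteratedFDeriv_fderiv, norm_iteratedFDeriv_one] at this
    exact this.trans (le_max_right _ _)
  have hc : ∀ t, ContDiff ℝ 2 (g t) := fun t => (hg.1 t).of_le (by exact_mod_cast hm)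
  refine ⟨max L1 L2, fun t ht => ⟨h1 t ht, fun x hx y hy => ?_, fun x hx y hy => ?_⟩⟩
  · exact hBc.norm_image_sub_le_of_norm_fderiv_le (𝕜 := ℝ)
      (fun z _ => (hc t).differentiable (by norm_num) z) (h1 t ht) hy hx
  · have hd : ContDiff ℝ 1 (fderiv ℝ (g t)) := (hc t).fderiv_right (by norm_num)
    exact hBc.norm_image_sub_le_of_norm_fderiv_le (𝕜 := ℝ)
      (fun z _ => hd.differentiable (by norm_num) z) (h2 t ht) hy hx

/-- Quantitative regularity of the evolving surface. -/
structure SurfaceBounds {T : ℝ} {m : ℕ} (S : EvolvingSurface T m) (L r : ℝ) (ν : E3 → E3) :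
    Prop where
  one_le : 1 ≤ L
  flow_diff : ∀ t, Differentiable ℝ (S.flow t)
  r_pos : 0 < r
  normal : ∀ p ∈ S.init, TwoSidedNormal S.dom L r p (ν p)
  normal_lip : ∀ p ∈ S.init, ∀ q ∈ S.init, ‖ν p - ν q‖ ≤ L * ‖p - q‖
  flow_fderiv : ∀ t ∈ Icc 0 T, ∀ x ∈ convexHull ℝ S.init, ‖fderiv ℝ (S.flow t) x‖ ≤ L
  flow_lip : ∀ t ∈ Icc 0 T, ∀ x ∈ convexHull ℝ S.init, ∀ y ∈ convexHull ℝ S.init,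
    ‖S.flow t x - S.flow t y‖ ≤ L * ‖x - y‖
  flow_fderiv_lip : ∀ t ∈ Icc 0 T, ∀ x ∈ convexHull ℝ S.init, ∀ y ∈ convexHull ℝ S.init,
    ‖fderiv ℝ (S.flow t) x - fderiv ℝ (S.flow t) y‖ ≤ L * ‖x - y‖
  vel_lip : ∀ t ∈ Icc 0 T, ∀ x ∈ convexHull ℝ S.init, ∀ y ∈ convexHull ℝ S.init,
    ‖S.vel t x - S.vel t y‖ ≤ L * ‖x - y‖

theorem exists_surfaceBounds {T : ℝ} {m : ℕ} (hm : 2 ≤ m) (S : EvolvingSurface T m) :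
    ∃ L r ν, SurfaceBounds S L r ν := by
  obtain ⟨L, hL, r, hr, ν, hν, hlip⟩ := exists_normalField hm S
  obtain ⟨R, hR⟩ := S.isCompact_init.isBounded.subset_closedBall 0
  have hsub : convexHull ℝ S.init ⊆ Metric.closedBall 0 R :=
    convexHull_min hR (convex_closedBall 0 R)
  have hcomp := isCompact_closedBall (0 : E3) R
  obtain ⟨L1, h1⟩ := exists_bound_of_contInTimeCm hm S.flow_reg T hcomp (convex_closedBall 0 R)
  obtain ⟨L2, h2⟩ := exists_bound_of_contInTimeCm hm S.vel_reg T hcomp (convex_closedBall 0 R)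
  have e0 : L ≤ 1 + L + |L1| + |L2| := by have := abs_nonneg L1; have := abs_nonneg L2; linarith
  have e1 : L1 ≤ 1 + L + |L1| + |L2| := by have := le_abs_self L1; have := abs_nonneg L2; linarith
  have e2 : L2 ≤ 1 + L + |L1| + |L2| := by have := abs_nonneg L1; have := le_abs_self L2; linarith
  refine ⟨1 + L + |L1| + |L2|, r, ν, by have := abs_nonneg L1; have := abs_nonneg L2; linarith,
    fun t => (show ContDiff ℝ 2 (S.flow t) from
      (S.flow_reg.1 t).of_le (by exact_mod_cast hm)).differentiable (by norm_num),
    hr,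
    fun p hp => (hν p hp).mono e0 le_rfl, fun p hp q hq => (hlip p hp q hq).trans (by gcongr),
    fun t ht x hx => ((h1 t ht).1 x (hsub hx)).trans e1,
    fun t ht x hx y hy => ((h1 t ht).2.1 x (hsub hx) y (hsub hy)).trans (by gcongr),
    fun t ht x hx y hy => ((h1 t ht).2.2 x (hsub hx) y (hsub hy)).trans (by gcongr),
    fun t ht x hx y hy => ((h2 t ht).2.1 x (hsub hx) y (hsub hy)).trans (by gcongr)⟩

/-! ### The cross product in Euclidean space -/

/-- The cross product of `ℝ³`. -/
noncomputable def crossE (a b : E3) : E3 := WithLp.toLp 2 (a.ofLp ⨯₃ b.ofLp)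

theorem crossE_sub_left (a a' b : E3) : crossE (a - a') b = crossE a b - crossE a' b := by
  ext i; simp [crossE]

theorem crossE_sub_right (a b b' : E3) : crossE a (b - b') = crossE a b - crossE a b' := by
  ext i; simp [crossE]

theorem inner_E3 (a b : E3) : inner ℝ a b = a 0 * b 0 + a 1 * b 1 + a 2 * b 2 := by
  simp [PiLp.inner_apply, Fin.sum_univ_three, mul_comm]

theorem norm_sq_E3 (a : E3) : ‖a‖ ^ 2 = a 0 ^ 2 + a 1 ^ 2 + a 2 ^ 2 := by
  rw [EuclideanSpace.real_norm_sq_eq, Fin.sum_univ_three]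

theorem crossE_apply (a b : E3) : (crossE a b) 0 = a 1 * b 2 - a 2 * b 1 ∧
    (crossE a b) 1 = a 2 * b 0 - a 0 * b 2 ∧ (crossE a b) 2 = a 0 * b 1 - a 1 * b 0 := by
  simp [crossE, cross_apply]

theorem norm_sq_crossE (a b : E3) : ‖crossE a b‖ ^ 2 = ‖a‖ ^ 2 * ‖b‖ ^ 2 - inner ℝ a b ^ 2 := by
  obtain ⟨h0, h1, h2⟩ := crossE_apply a b
  rw [norm_sq_E3, norm_sq_E3, norm_sq_E3, inner_E3, h0, h1, h2]
  ring

theorem norm_crossE_le (a b : E3) : ‖crossE a b‖ ≤ ‖a‖ * ‖b‖ := by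
  refine le_of_sq_le_sq ?_ (by positivity)
  rw [norm_sq_crossE, mul_pow]
  nlinarith [sq_nonneg (inner ℝ a b)]

theorem norm_crossE_sub_le (a b a' b' : E3) :
    ‖crossE a b - crossE a' b'‖ ≤ ‖a - a'‖ * ‖b‖ + ‖a'‖ * ‖b - b'‖ := by
  have : crossE a b - crossE a' b' = crossE (a - a') b + crossE a' (b - b') := by
    rw [crossE_sub_left, crossE_sub_right]; abel
  rw [this]
  exact (norm_add_le _ _).trans (add_le_add (norm_crossE_le _ _) (norm_crossE_le _ _))

theorem crossE_crossE (ν a b : E3) :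
    crossE ν (crossE a b) = (inner ℝ b ν : ℝ) • a - (inner ℝ a ν : ℝ) • b := by
  obtain ⟨h0, h1, h2⟩ := crossE_apply a b
  obtain ⟨g0, g1, g2⟩ := crossE_apply ν (crossE a b)
  ext i
  fin_cases i <;> simp only [Fin.zero_eta, Fin.mk_one, Fin.reduceFinMk, g0, g1, g2, h0, h1, h2,
    PiLp.sub_apply, PiLp.smul_apply, smul_eq_mul, inner_E3] <;> ring

theorem triNormal_eq_crossE (v : Fin 3 → E3) :
    triNormal v = crossE (v 1 - v 0) (v 2 - v 0) := rfl

/-- The standard basis vectors. -/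
noncomputable def basisE (i : Fin 3) : E3 := EuclideanSpace.single i 1

theorem norm_basisE (i : Fin 3) : ‖basisE i‖ = 1 := by simp [basisE]

theorem eq_sum_basisE (a : E3) : a = a 0 • basisE 0 + a 1 • basisE 1 + a 2 • basisE 2 := by
  ext i
  fin_cases i <;> simp [basisE]

/-- The cofactor of a linear map of `ℝ³`, applied to a vector. -/
noncomputable def cofactor (A : E3 →L[ℝ] E3) (ν : E3) : E3 :=
  ν 0 • crossE (A (basisE 1)) (A (basisE 2)) + ν 1 • crossE (A (basisE 2)) (A (basisE 0)) +
    ν 2 • crossE (A (basisE 0)) (A (basisE 1))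

/-- The transformation law of vector areas. It carries the initial normals along the flow. -/
theorem crossE_map (A : E3 →L[ℝ] E3) (a b : E3) :
    crossE (A a) (A b) = cofactor A (crossE a b) := by
  have ha : A a = a 0 • A (basisE 0) + a 1 • A (basisE 1) + a 2 • A (basisE 2) := by
    conv_lhs => rw [eq_sum_basisE a]
    simp
  have hb : A b = b 0 • A (basisE 0) + b 1 • A (basisE 1) + b 2 • A (basisE 2) := by
    conv_lhs => rw [eq_sum_basisE b]
    simp
  obtain ⟨h0, h1, h2⟩ := crossE_apply a b
  rw [ha, hb, cofactor, h0, h1, h2]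
  ext i
  fin_cases i <;> simp [crossE, cross_apply] <;> ring

theorem cofactor_sub (A : E3 →L[ℝ] E3) (ν μ : E3) :
    cofactor A ν - cofactor A μ = cofactor A (ν - μ) := by
  simp only [cofactor, PiLp.sub_apply]; module

theorem cofactor_smul (A : E3 →L[ℝ] E3) (c : ℝ) (ν : E3) :
    cofactor A (c • ν) = c • cofactor A ν := by
  simp only [cofactor, PiLp.smul_apply, smul_eq_mul]; module

theorem abs_apply_le (a : E3) (i : Fin 3) : |a i| ≤ ‖a‖ := by
  simpa using PiLp.norm_apply_le a i

theorem norm_cofactor_le {A : E3 →L[ℝ] E3} {L : ℝ} (hA : ‖A‖ ≤ L) (ν : E3) :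
    ‖cofactor A ν‖ ≤ 3 * L ^ 2 * ‖ν‖ := by
  have hL : 0 ≤ L := (norm_nonneg _).trans hA
  have hb : ∀ i, ‖A (basisE i)‖ ≤ L := fun i => by
    simpa [norm_basisE] using A.le_of_opNorm_le hA (basisE i)
  have h : ∀ i j k, ‖ν i • crossE (A (basisE j)) (A (basisE k))‖ ≤ L ^ 2 * ‖ν‖ := by
    intro i j k
    rw [norm_smul, mul_comm, Real.norm_eq_abs, sq]
    gcongr
    · exact (norm_crossE_le _ _).trans (by gcongr <;> apply hb)
    · exact abs_apply_le ν i
  refine (norm_add₃_le).trans ?_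
  linarith [h 0 1 2, h 1 2 0, h 2 0 1]

theorem norm_cofactor_sub_le {A B : E3 →L[ℝ] E3} {L : ℝ} (hA : ‖A‖ ≤ L) (hB : ‖B‖ ≤ L) (ν : E3) :
    ‖cofactor A ν - cofactor B ν‖ ≤ 6 * L * ‖A - B‖ * ‖ν‖ := by
  have hL : 0 ≤ L := (norm_nonneg _).trans hA
  have hb : ∀ i, ‖A (basisE i)‖ ≤ L := fun i => by
    simpa [norm_basisE] using A.le_of_opNorm_le hA (basisE i)
  have hb' : ∀ i, ‖B (basisE i)‖ ≤ L := fun i => by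
    simpa [norm_basisE] using B.le_of_opNorm_le hB (basisE i)
  have hd : ∀ i, ‖A (basisE i) - B (basisE i)‖ ≤ ‖A - B‖ := fun i => by
    simpa [norm_basisE] using (A - B).le_opNorm (basisE i)
  have h : ∀ i j k, ‖ν i • (crossE (A (basisE j)) (A (basisE k)) -
      crossE (B (basisE j)) (B (basisE k)))‖ ≤ 2 * L * ‖A - B‖ * ‖ν‖ := by
    intro i j k
    rw [norm_smul, mul_comm, Real.norm_eq_abs]
    gcongr
    · refine (norm_crossE_sub_le _ _ _ _).trans ?_
      calc _ ≤ ‖A - B‖ * L + L * ‖A - B‖ := by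
            gcongr
            exacts [hd j, hb k, hb' j, hd k]
        _ = _ := by ring
    · exact abs_apply_le ν i
  have e : cofactor A ν - cofactor B ν =
      ν 0 • (crossE (A (basisE 1)) (A (basisE 2)) - crossE (B (basisE 1)) (B (basisE 2))) +
      ν 1 • (crossE (A (basisE 2)) (A (basisE 0)) - crossE (B (basisE 2)) (B (basisE 0))) +
      ν 2 • (crossE (A (basisE 0)) (A (basisE 1)) - crossE (B (basisE 0)) (B (basisE 1))) := by
    simp only [cofactor]; module
  rw [e]
  refine (norm_add₃_le).trans ?_
  linarith [h 0 1 2, h 1 2 0, h 2 0 1]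

/-- The vectors are first compared after scaling by ‖y‖: one copy of ‖x - y‖ is the difference of
the vectors, the other that of their lengths. The case x = 0 is included since 0⁻¹ = 0. -/
theorem norm_inv_smul_sub_le {x y : E3} (hy : y ≠ 0) :
    ‖‖x‖⁻¹ • x - ‖y‖⁻¹ • y‖ ≤ 2 * ‖x - y‖ / ‖y‖ := by
  have hy0 : 0 < ‖y‖ := norm_pos_iff.2 hy
  rcases eq_or_ne x 0 with rfl | hx
  · simp only [smul_zero, zero_sub, norm_neg, norm_smul, norm_inv, norm_norm]
    rw [inv_mul_cancel₀ hy0.ne', mul_div_assoc, div_self hy0.ne']; norm_num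
  have hx0 : 0 < ‖x‖ := norm_pos_iff.2 hx
  rw [le_div_iff₀ hy0]
  calc ‖‖x‖⁻¹ • x - ‖y‖⁻¹ • y‖ * ‖y‖ = ‖‖y‖ • (‖x‖⁻¹ • x - ‖y‖⁻¹ • y)‖ := by
        rw [norm_smul, norm_norm, mul_comm]
    _ = ‖((‖y‖ - ‖x‖) * ‖x‖⁻¹) • x + (x - y)‖ := by
        congr 1
        rw [smul_sub, smul_smul, smul_smul, mul_inv_cancel₀ hy0.ne', sub_mul,
          mul_inv_cancel₀ hx0.ne']
        module
    _ ≤ |‖y‖ - ‖x‖| + ‖x - y‖ := by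
        refine (norm_add_le _ _).trans ?_
        rw [norm_smul, norm_mul, norm_inv, norm_norm, Real.norm_eq_abs, mul_assoc,
          inv_mul_cancel₀ hx0.ne', mul_one]
    _ ≤ ‖x - y‖ + ‖x - y‖ := by
        gcongr
        rw [abs_sub_comm]; exact abs_norm_sub_norm_le x y
    _ = _ := by ring

/-! ### Jacobians of Lagrange interpolants -/

theorem jac_lagrangeInterp (k : ℕ) (g : R2 → E3) (ξ : R2) (i : Fin 3) (j : Fin 2) :
    jac (lagrangeInterp k g) ξ i j = ∑ α ∈ Finset.Nat.antidiagonalTuple 3 k,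
      g (lagrangeNode k α) i *
        MvPolynomial.eval ξ (MvPolynomial.pderiv j (lagrangePoly k α)) := by
  simp [jac, lagrangeInterp, map_sum]

theorem lagrangeInterp_flatMap {k : ℕ} (hk : 1 ≤ k) (w : Fin 3 → E3) (i : Fin 3) :
    lagrangeInterp k (flatMap w) i = ∑ j, MvPolynomial.C (w j i) * baryPoly j := by
  have hdeg : (∑ j, MvPolynomial.C (w j i) * baryPoly j : MvPolynomial (Fin 2) ℝ).totalDegree ≤
      k := by
    refine MvPolynomial.totalDegree_finsetSum_le fun j _ => ?_
    refine (MvPolynomial.totalDegree_mul _ _).trans ?_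
    rw [MvPolynomial.totalDegree_C, zero_add]
    exact (totalDegree_baryPoly_le j).trans hk
  rw [sum_lagrangePoly_eq hk hdeg, lagrangeInterp]
  refine Finset.sum_congr rfl fun α _ => ?_
  congr 2
  simp [flatMap, map_sum, mul_comm]

theorem jac_lagrangeInterp_flatMap {k : ℕ} (hk : 1 ≤ k) (w : Fin 3 → E3) (ξ : R2) (i : Fin 3)
    (j : Fin 2) : jac (lagrangeInterp k (flatMap w)) ξ i j = (w j.succ - w 0) i := by
  rw [jac, Matrix.of_apply, lagrangeInterp_flatMap hk, Fin.sum_univ_three]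
  fin_cases j <;> simp [baryPoly, MvPolynomial.pderiv_X] <;> ring

/-- Interpolation is linear and exact on affine maps, so the Jacobian error is a combination of the
nodal deviations from the affine map with bounded coefficients. Constant vertex data turn this into
a bound of the Jacobian itself. -/
theorem exists_jac_bound {k : ℕ} (hk : 1 ≤ k) : ∃ B ≥ 1, ∀ (g : R2 → E3) (w : Fin 3 → E3) (δ : ℝ),
    (∀ ξ ∈ refTri, ‖g ξ - flatMap w ξ‖ ≤ δ) → ∀ ξ ∈ refTri, ∀ i j,
      |jac (lagrangeInterp k g) ξ i j - (w j.succ - w 0) i| ≤ B * δ := by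
  obtain ⟨B, hB0, hB⟩ := exists_bound_lagrangePoly k
  refine ⟨1 + (Finset.Nat.antidiagonalTuple 3 k).card * B, by
    have : 0 ≤ (Finset.Nat.antidiagonalTuple 3 k).card * B := by positivity
    linarith, fun g w δ h ξ hξ i j => ?_⟩
  have hδ : 0 ≤ δ := (norm_nonneg _).trans (h ξ hξ)
  rw [← jac_lagrangeInterp_flatMap hk w ξ i j, jac_lagrangeInterp, jac_lagrangeInterp,
    ← Finset.sum_sub_distrib]
  calc _ ≤ ∑ α ∈ Finset.Nat.antidiagonalTuple 3 k, δ * B := by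
        refine (Finset.abs_sum_le_sum_abs _ _).trans (Finset.sum_le_sum fun α hα => ?_)
        rw [← sub_mul, abs_mul]
        gcongr
        · exact (abs_apply_le (g (lagrangeNode k α) - flatMap w (lagrangeNode k α)) i).trans
            (h _ (lagrangeNode_mem_refTri hk hα))
        · exact (hB α hα ξ hξ).2 j
    _ = (Finset.Nat.antidiagonalTuple 3 k).card * B * δ := by
        rw [Finset.sum_const, nsmul_eq_mul]; ring
    _ ≤ _ := by gcongr; linarith

/-- The columns of the Jacobian. -/
noncomputable def jacCol (F : Fin 3 → MvPolynomial (Fin 2) ℝ) (ξ : R2) (j : Fin 2) : E3 :=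
  WithLp.toLp 2 fun i => jac F ξ i j

theorem areaDensity_eq_norm (F : Fin 3 → MvPolynomial (Fin 2) ℝ) (ξ : R2) :
    areaDensity F ξ = ‖crossE (jacCol F ξ 0) (jacCol F ξ 1)‖ := by
  rw [areaDensity, ← Real.sqrt_sq (norm_nonneg (crossE _ _)), norm_sq_crossE, norm_sq_E3,
    norm_sq_E3, inner_E3]
  congr 1
  simp only [metric, Matrix.det_fin_two, Matrix.mul_apply, Fin.sum_univ_three,
    Matrix.transpose_apply, jacCol]
  ring

theorem normal_eq (F : Fin 3 → MvPolynomial (Fin 2) ℝ) (ξ : R2) :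
    normal F ξ = (‖crossE (jacCol F ξ 0) (jacCol F ξ 1)‖⁻¹ •
      crossE (jacCol F ξ 0) (jacCol F ξ 1)).ofLp := by
  rw [normal, areaDensity_eq_norm]; rfl

theorem norm_le_of_abs_apply_le {a : E3} {δ : ℝ} (h : ∀ i, |a i| ≤ δ) : ‖a‖ ≤ 2 * δ := by
  have hδ : 0 ≤ δ := (abs_nonneg _).trans (h 0)
  refine le_of_sq_le_sq ?_ (by positivity)
  rw [norm_sq_E3]
  have : ∀ i, a i ^ 2 ≤ δ ^ 2 := fun i => by rw [← sq_abs]; have := h i; gcongr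
  nlinarith [this 0, this 1, this 2]

end ESFEM

/-! ### Moving elements: distance to flat triangles and Jacobian bounds -/

namespace ESFEM

namespace Mesh

variable {T : ℝ} {m : ℕ} {S : EvolvingSurface T m} {L r : ℝ} {ν : E3 → E3}

theorem flatMap_mem_convexHull_init (M : Mesh S) (K : Fin M.numTri) {ξ : R2} (hξ : ξ ∈ refTri) :
    flatMap (M.vert K) ξ ∈ convexHull ℝ S.init :=
  convexHull_mono (by rintro _ ⟨j, rfl⟩; exact M.vert_mem K j)
    (flatMap_mem_convexHull (M.vert K) hξ)

theorem flatMap_mem_poly (M : Mesh S) (K : Fin M.numTri) {ξ : R2} (hξ : ξ ∈ refTri) :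
    flatMap (M.vert K) ξ ∈ M.poly := M.mem_poly_iff.2 ⟨K, ξ, hξ, rfl⟩

/-- Smallness of the mesh width with respect to the bounds of the surface. -/
def Fine (_M : Mesh S) (L r h : ℝ) : Prop := 8 * (1 + L) * (1 + 3 * L) * h < min 1 r

theorem Fine.lt_r {M : Mesh S} {h : ℝ} (hf : M.Fine L r h) (hL : 1 ≤ L) (hh : 0 < h) : h < r := by
  have h1 : 8 * (1 + L) * (1 + 3 * L) * h < r := lt_of_lt_of_le hf (min_le_right _ _)
  nlinarith [mul_nonneg (sub_nonneg.2 hL) hh.le, mul_nonneg (mul_nonneg (sub_nonneg.2 hL) hh.le)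
    (zero_le_one.trans hL)]

theorem Fine.mul_le_one {M : Mesh S} {h : ℝ} (hf : M.Fine L r h) (hL : 1 ≤ L) (hh : 0 < h) :
    8 * L * h ≤ 1 := by
  have h1 : 8 * (1 + L) * (1 + 3 * L) * h < 1 := lt_of_lt_of_le hf (min_le_left _ _)
  nlinarith [mul_nonneg (sub_nonneg.2 hL) hh.le, mul_nonneg (mul_nonneg (sub_nonneg.2 hL) hh.le)
    (zero_le_one.trans hL)]

theorem abs_inner_vert_sub_le (M : Mesh S) (hS : SurfaceBounds S L r ν) (hT : 0 < T) {kg : ℕ}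
    (hkg : 1 ≤ kg) (hf : M.Fine L r (M.size kg)) (K : Fin M.numTri) (i j : Fin 3) :
    |inner ℝ (M.vert K i - M.vert K j) (ν (M.vert K j))| ≤ L * M.size kg ^ 2 := by
  have hL := hS.one_le
  have h1 := M.norm_vert_sub_le hT hkg K i j
  refine ((hS.normal _ (M.vert_mem K j)).inner_le S.dom_open (M.vert_mem K i)
    (h1.trans_lt (hf.lt_r hS.one_le (M.size_pos hT hkg K)))).trans ?_
  gcongr

/-- The vertices, and hence their convex combinations, have height at most Lh² over the tangent
plane at one vertex. A surface point is then found within 2(Lh² + 3Lh²) = 8Lh² along the normal, and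
the closest point is no farther. -/
theorem norm_flatMap_sub_closestPt_le (M : Mesh S) (hS : SurfaceBounds S L r ν) (hT : 0 < T)
    {kg : ℕ} (hkg : 1 ≤ kg) (hf : M.Fine L r (M.size kg)) (K : Fin M.numTri) {ξ : R2}
    (hξ : ξ ∈ refTri) :
    ‖flatMap (M.vert K) ξ - closestPt S.init (flatMap (M.vert K) ξ)‖ ≤ 8 * L * M.size kg ^ 2 := by
  have hL := hS.one_le
  set h := M.size kg with hh
  set v := M.vert K with hv
  have hxv : ‖flatMap v ξ - v 0‖ ≤ h :=
    norm_flatMap_sub_le (fun j => M.norm_vert_sub_le hT hkg K j 0) hξ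
  have hin : |inner ℝ (flatMap v ξ - v 0) (ν (v 0))| ≤ L * h ^ 2 := by
    have e : flatMap v ξ - v 0 = ∑ j, MvPolynomial.eval ξ (baryPoly j) • (v j - v 0) := by
      simp only [smul_sub, Finset.sum_sub_distrib, ← Finset.sum_smul, sum_eval_baryPoly, one_smul,
        flatMap]
    rw [e, sum_inner]
    calc _ ≤ ∑ j, MvPolynomial.eval ξ (baryPoly j) * (L * h ^ 2) := by
          refine (Finset.abs_sum_le_sum_abs _ _).trans (Finset.sum_le_sum fun j _ => ?_)
          rw [real_inner_smul_left, abs_mul, abs_of_nonneg (eval_baryPoly_nonneg hξ j)]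
          exact mul_le_mul_of_nonneg_left (M.abs_inner_vert_sub_le hS hT hkg hf K j 0)
            (eval_baryPoly_nonneg hξ j)
      _ = _ := by rw [← Finset.sum_mul, sum_eval_baryPoly, one_mul]
  obtain ⟨s, hs, hq⟩ := (hS.normal _ (M.vert_mem K 0)).exists_mem_frontier S.dom_open
    (M.vert_mem K 0) (by linarith) (y := flatMap v ξ) (le_of_lt (lt_of_le_of_lt (by gcongr) hf))
  refine (M.norm_sub_closestPt_le (M.flatMap_mem_poly K hξ) hq).trans ?_
  rw [sub_add_cancel_left, norm_neg, norm_smul, (hS.normal _ (M.vert_mem K 0)).norm_eq, mul_one,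
    Real.norm_eq_abs]
  refine hs.trans ?_
  have : L * ‖flatMap v ξ - v 0‖ ^ 2 ≤ L * h ^ 2 := by gcongr
  linarith

theorem norm_closestPt_sub_vert_le (M : Mesh S) (hS : SurfaceBounds S L r ν) (hT : 0 < T)
    {kg : ℕ} (hkg : 1 ≤ kg) (hf : M.Fine L r (M.size kg)) (K : Fin M.numTri) {ξ : R2}
    (hξ : ξ ∈ refTri) (j : Fin 3) :
    ‖closestPt S.init (flatMap (M.vert K) ξ) - M.vert K j‖ ≤ 2 * M.size kg := by
  have h1 := M.norm_flatMap_sub_closestPt_le hS hT hkg hf K hξ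
  have h2 : ‖flatMap (M.vert K) ξ - M.vert K j‖ ≤ M.size kg :=
    norm_flatMap_sub_le (fun i => M.norm_vert_sub_le hT hkg K i j) hξ
  have h3 := hf.mul_le_one hS.one_le (M.size_pos hT hkg K)
  have h4 := M.size_pos hT hkg K
  rw [norm_sub_rev] at h1
  calc _ = ‖(closestPt S.init (flatMap (M.vert K) ξ) - flatMap (M.vert K) ξ) +
        (flatMap (M.vert K) ξ - M.vert K j)‖ := by rw [sub_add_sub_cancel]
    _ ≤ _ := norm_add_le _ _
    _ ≤ 2 * M.size kg := by nlinarith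

/-- Lagrange nodes of the moving element are close to the flat triangle. -/
theorem norm_flow_closestPt_sub_le (M : Mesh S) (hS : SurfaceBounds S L r ν) (hT : 0 < T)
    {kg : ℕ} (hkg : 1 ≤ kg) (hf : M.Fine L r (M.size kg)) {t : ℝ} (ht : t ∈ Icc 0 T)
    (K : Fin M.numTri) {ξ : R2} (hξ : ξ ∈ refTri) :
    ‖S.flow t (closestPt S.init (flatMap (M.vert K) ξ)) -
      flatMap (fun j => S.flow t (M.vert K j)) ξ‖ ≤ 9 * L ^ 2 * M.size kg ^ 2 := by
  have hL := hS.one_le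
  have hd := hS.flow_diff t
  set x := flatMap (M.vert K) ξ with hx
  have hxc := M.flatMap_mem_convexHull_init K hξ
  have h1 := hS.flow_lip t ht _ (subset_convexHull ℝ _
    (M.closestPt_mem (M.flatMap_mem_poly K hξ))) x hxc
  have h2 := M.norm_flatMap_sub_closestPt_le hS hT hkg hf K hξ
  rw [norm_sub_rev] at h2
  have h3 : ‖S.flow t x - flatMap (fun j => S.flow t (M.vert K j)) ξ‖ ≤ L * M.size kg ^ 2 := by
    -- The barycentric combination of the vectors from x to the vertices vanishes, so the
    -- first-order Taylor terms of the flow cancel and the interpolation error is quadratic.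
    have e0 : ∑ j, MvPolynomial.eval ξ (baryPoly j) • (M.vert K j - x) = 0 := by
      simp only [smul_sub, Finset.sum_sub_distrib, ← Finset.sum_smul, sum_eval_baryPoly, one_smul]
      exact sub_self _
    have e : flatMap (fun j => S.flow t (M.vert K j)) ξ - S.flow t x =
        ∑ j, MvPolynomial.eval ξ (baryPoly j) • (S.flow t (M.vert K j) - S.flow t x -
          fderiv ℝ (S.flow t) x (M.vert K j - x)) := by
      have eD : ∑ j, MvPolynomial.eval ξ (baryPoly j) •
          fderiv ℝ (S.flow t) x (M.vert K j - x) = 0 := by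
        rw [← map_zero (fderiv ℝ (S.flow t) x), ← e0, map_sum]
        simp only [map_smul]
      simp only [smul_sub, Finset.sum_sub_distrib, eD, ← Finset.sum_smul, sum_eval_baryPoly,
        one_smul, sub_zero]
      rfl
    rw [norm_sub_rev, e]
    calc _ ≤ ∑ j, MvPolynomial.eval ξ (baryPoly j) * (L * M.size kg ^ 2) := by
          refine norm_sum_le_of_le _ fun j _ => ?_
          rw [norm_smul, Real.norm_eq_abs, abs_of_nonneg (eval_baryPoly_nonneg hξ j)]
          refine mul_le_mul_of_nonneg_left ?_ (eval_baryPoly_nonneg hξ j)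
          refine (norm_sub_sub_fderiv_le (convex_convexHull ℝ S.init) hd (by linarith)
            (hS.flow_fderiv_lip t ht) (subset_convexHull ℝ _ (M.vert_mem K j)) hxc).trans ?_
          have : ‖M.vert K j - x‖ ≤ M.size kg := by
            rw [norm_sub_rev]
            exact norm_flatMap_sub_le (fun i => M.norm_vert_sub_le hT hkg K i j) hξ
          gcongr
      _ = _ := by rw [← Finset.sum_mul, sum_eval_baryPoly, one_mul]
  calc _ = ‖(S.flow t (closestPt S.init x) - S.flow t x) +
        (S.flow t x - flatMap (fun j => S.flow t (M.vert K j)) ξ)‖ := by rw [sub_add_sub_cancel]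
    _ ≤ L * (8 * L * M.size kg ^ 2) + L * M.size kg ^ 2 :=
        (norm_add_le _ _).trans (add_le_add (h1.trans (by gcongr)) h3)
    _ ≤ _ := by nlinarith [sq_nonneg (M.size kg), mul_nonneg (sub_nonneg.2 hL) (sq_nonneg (M.size kg)),
        mul_nonneg (mul_nonneg (sub_nonneg.2 hL) (zero_le_one.trans hL)) (sq_nonneg (M.size kg))]

theorem norm_flow_sub_flow_le (hS : SurfaceBounds S L r ν) {s t : ℝ} (hs : s ∈ Icc 0 T)
    (ht : t ∈ Icc 0 T) {x y : E3} (hx : x ∈ convexHull ℝ S.init) (hy : y ∈ convexHull ℝ S.init) :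
    ‖(S.flow t x - S.flow s x) - (S.flow t y - S.flow s y)‖ ≤ L * ‖x - y‖ * |t - s| := by
  have := (convex_Icc 0 T).norm_image_sub_le_of_norm_hasDerivWithin_le
    (f := fun τ => S.flow τ x - S.flow τ y) (f' := fun τ => S.vel τ x - S.vel τ y)
    (fun τ _ => ((S.flow_deriv τ x).sub (S.flow_deriv τ y)).hasDerivWithinAt)
    (fun τ hτ => hS.vel_lip τ hτ x hx y hy) hs ht
  rw [Real.norm_eq_abs] at this
  have e : (S.flow t x - S.flow s x) - (S.flow t y - S.flow s y) =
      (S.flow t x - S.flow t y) - (S.flow s x - S.flow s y) := by abel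
  rw [e]
  exact this

theorem flatMap_const (c : E3) (ξ : R2) : flatMap (fun _ => c) ξ = c := by
  rw [flatMap, ← Finset.sum_smul, sum_eval_baryPoly, one_smul]

/-- Bounds of the Jacobians of the elements and of the discrete velocity. -/
theorem exists_jac_bounds {kg : ℕ} (hkg : 1 ≤ kg) (hS : SurfaceBounds S L r ν) (hT : 0 < T) :
    ∃ D ≥ 1, ∀ M : Mesh S, M.Fine L r (M.size kg) → ∀ K, ∀ ξ ∈ refTri, ∀ t ∈ Icc 0 T, ∀ i j,
      |jac (M.elem kg t K) ξ i j - (S.flow t (M.vert K j.succ) - S.flow t (M.vert K 0)) i| ≤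
        D * M.size kg ^ 2 ∧
      |jac (M.elemVel kg t K) ξ i j| ≤ D * M.size kg ∧
      ∀ s ∈ Icc 0 T, |jac (M.elem kg t K) ξ i j - jac (M.elem kg s K) ξ i j| ≤
        D * M.size kg * |t - s| := by
  obtain ⟨B, hB1, hB⟩ := exists_jac_bound hkg
  have hL := hS.one_le
  have e1 : 1 ≤ B * (9 * L ^ 2) := by nlinarith
  have e2 : B * (2 * L) ≤ B * (9 * L ^ 2) := 
    mul_le_mul_of_nonneg_left (by nlinarith) (by linarith)
  refine ⟨B * (9 * L ^ 2), e1, fun M hf K ξ hξ t ht i j => ⟨?_, ?_, fun s hs => ?_⟩⟩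
  · have := hB _ _ _ (fun η hη => M.norm_flow_closestPt_sub_le hS hT hkg hf ht K hη) ξ hξ i j
    rwa [← mul_assoc] at this
  · have h0 := M.size_pos hT hkg K
    have := hB (fun η => S.vel t (closestPt S.init (flatMap (M.vert K) η)))
      (fun _ => S.vel t (M.vert K 0)) (L * (2 * M.size kg)) (fun η hη => by
        rw [flatMap_const]
        refine (hS.vel_lip t ht _ (subset_convexHull ℝ _ (M.closestPt_mem
          (M.flatMap_mem_poly K hη))) _ (subset_convexHull ℝ _ (M.vert_mem K 0))).trans ?_
        gcongr
        exact M.norm_closestPt_sub_vert_le hS hT hkg hf K hη 0) ξ hξ i j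
    simp only [sub_self, PiLp.zero_apply, sub_zero] at this
    refine this.trans ?_
    calc B * (L * (2 * M.size kg)) = B * (2 * L) * M.size kg := by ring
      _ ≤ _ := by gcongr
  · have h0 := M.size_pos hT hkg K
    -- The interpolated map is the increment of the flow between s and t. Compared with its value at
    -- one vertex it is O(h|t - s|), because the velocity is Lipschitz in space.
    have := hB (fun η => S.flow t (closestPt S.init (flatMap (M.vert K) η)) -
        S.flow s (closestPt S.init (flatMap (M.vert K) η)))
      (fun _ => S.flow t (M.vert K 0) - S.flow s (M.vert K 0)) (L * (2 * M.size kg) * |t - s|)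
      (fun η hη => by
        rw [flatMap_const]
        refine (norm_flow_sub_flow_le hS hs ht (subset_convexHull ℝ _ (M.closestPt_mem
          (M.flatMap_mem_poly K hη))) (subset_convexHull ℝ _ (M.vert_mem K 0))).trans ?_
        gcongr
        exact M.norm_closestPt_sub_vert_le hS hT hkg hf K hη 0) ξ hξ i j
    simp only [sub_self, PiLp.zero_apply, sub_zero] at this
    have e : jac (M.elem kg t K) ξ i j - jac (M.elem kg s K) ξ i j =
        jac (lagrangeInterp kg fun η => S.flow t (closestPt S.init (flatMap (M.vert K) η)) -
        S.flow s (closestPt S.init (flatMap (M.vert K) η))) ξ i j := by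
      rw [elem, elem, jac_lagrangeInterp, jac_lagrangeInterp, jac_lagrangeInterp,
        ← Finset.sum_sub_distrib]
      exact Finset.sum_congr rfl fun α _ => by rw [PiLp.sub_apply]; ring
    rw [e]
    refine this.trans ?_
    calc B * (L * (2 * M.size kg) * |t - s|) = B * (2 * L) * M.size kg * |t - s| := by ring
      _ ≤ _ := by gcongr

end Mesh

/-! ### Normals of the elements -/

variable {T : ℝ} {m : ℕ} {S : EvolvingSurface T m} {L r : ℝ} {ν : E3 → E3}

/-- A normal vector of the surface at time `t` in Lagrangian coordinates. -/
noncomputable def flowNormal (S : EvolvingSurface T m) (ν : E3 → E3) (t : ℝ) (z : E3) : E3 :=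
  cofactor (fderiv ℝ (S.flow t) z) (ν z)

theorem norm_flowNormal_sub_le (hS : SurfaceBounds S L r ν) {t : ℝ} (ht : t ∈ Icc 0 T) {x y : E3}
    (hx : x ∈ S.init) (hy : y ∈ S.init) :
    ‖flowNormal S ν t x - flowNormal S ν t y‖ ≤ 9 * L ^ 3 * ‖x - y‖ := by
  have hL := hS.one_le
  have hx' := subset_convexHull ℝ _ hx
  have hy' := subset_convexHull ℝ _ hy
  have h1 := norm_cofactor_sub_le (hS.flow_fderiv t ht x hx') (hS.flow_fderiv t ht y hy') (ν x)
  have h2 := norm_cofactor_le (hS.flow_fderiv t ht y hy') (ν x - ν y)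
  rw [← cofactor_sub] at h2
  rw [(hS.normal x hx).norm_eq, mul_one] at h1
  calc _ = ‖(cofactor (fderiv ℝ (S.flow t) x) (ν x) - cofactor (fderiv ℝ (S.flow t) y) (ν x)) +
        (cofactor (fderiv ℝ (S.flow t) y) (ν x) - cofactor (fderiv ℝ (S.flow t) y) (ν y))‖ := by
        rw [sub_add_sub_cancel]; rfl
    _ ≤ 6 * L * (L * ‖x - y‖) + 3 * L ^ 2 * (L * ‖x - y‖) := by
        refine (norm_add_le _ _).trans (add_le_add (h1.trans ?_) (h2.trans ?_))
        · gcongr; exact hS.flow_fderiv_lip t ht x hx' y hy'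
        · gcongr; exact hS.normal_lip x hx y hy
    _ = (6 * L ^ 2 + 3 * L ^ 3) * ‖x - y‖ := by ring
    _ ≤ _ := by
        gcongr
        nlinarith [mul_nonneg (sub_nonneg.2 hL) (sq_nonneg L)]

/-- The flat triangle spanned by the moved vertices has nearly the normal of the surface. -/
theorem exists_norm_triNormal_sub_le (hS : SurfaceBounds S L r ν) (hT : 0 < T) {kg : ℕ}
    (hkg : 1 ≤ kg) (M : Mesh S) (hf : M.Fine L r (M.size kg)) (K : Fin M.numTri) :
    ∃ β > 0, β ≤ M.size kg ^ 2 ∧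
      ‖triNormal (M.vert K) - β • ν (M.vert K 0)‖ ≤ 2 * L * M.size kg ^ 3 ∧ ∀ t ∈ Icc 0 T,
      ‖triNormal (fun j => S.flow t (M.vert K j)) - β • flowNormal S ν t (M.vert K 0)‖ ≤
        8 * L ^ 3 * M.size kg ^ 3 := by
  have hL := hS.one_le
  have hh := M.size_pos hT hkg K
  set h := M.size kg with hhd
  set v := M.vert K with hv
  have hv0 := M.vert_mem K 0
  have hν := hS.normal _ hv0
  have hνn := hν.norm_eq
  set n := triNormal v with hn
  set β : ℝ := inner ℝ (ν (v 0)) n with hβ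
  have hb : ∀ j, ‖v j - v 0‖ ≤ h := fun j => M.norm_vert_sub_le hT hkg K j 0
  have hnn : ‖n‖ ≤ h ^ 2 := by
    rw [hn, triNormal_eq_crossE, sq]
    exact (norm_crossE_le _ _).trans (by gcongr <;> apply hb)
  have hnβ : ‖n - β • ν (v 0)‖ ≤ 2 * L * h ^ 3 := by
    -- For a unit vector ν the part of n orthogonal to ν has the length of ν × n. The double cross
    -- product formula writes the latter by edges weighted with vertex heights, each height being
    -- O(h²).
    have e1 : ‖n - β • ν (v 0)‖ ^ 2 = ‖crossE (ν (v 0)) n‖ ^ 2 := by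
      rw [norm_sq_crossE, norm_sub_sq_real, real_inner_smul_right, norm_smul, hνn,
        Real.norm_eq_abs, mul_one, sq_abs, real_inner_comm, ← hβ]
      ring
    rw [(pow_left_inj₀ (norm_nonneg _) (norm_nonneg _) two_ne_zero).1 e1, hn, triNormal_eq_crossE,
      crossE_crossE]
    calc _ ≤ L * h ^ 2 * h + L * h ^ 2 * h := by
          refine (norm_sub_le _ _).trans ?_
          rw [norm_smul, norm_smul, Real.norm_eq_abs, Real.norm_eq_abs]
          gcongr
          · exact M.abs_inner_vert_sub_le hS hT hkg hf K 2 0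
          · exact hb 1
          · exact M.abs_inner_vert_sub_le hS hT hkg hf K 1 0
          · exact hb 2
      _ = _ := by ring
  -- The sign of β is the orientation condition of the mesh at the vertex 0; it fixes the sign of
  -- all discrete normals.
  refine ⟨β, M.oriented K 0 _ (hν.isOuterNormal S.dom_open hS.r_pos), ?_, hnβ, fun t ht => ?_⟩
  · refine (real_inner_le_norm _ _).trans ?_
    rw [hνn, one_mul]
    exact hnn
  · set A := fderiv ℝ (S.flow t) (v 0) with hA
    have hAL : ‖A‖ ≤ L := hS.flow_fderiv t ht _ (subset_convexHull ℝ _ hv0)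
    have hAb : ∀ j, ‖A (v j - v 0)‖ ≤ L * h := fun j =>
      (A.le_of_opNorm_le hAL _).trans (by gcongr; exact hb j)
    have ha : ∀ j, ‖S.flow t (v j) - S.flow t (v 0)‖ ≤ h := fun j => by
      rw [← dist_eq_norm]; exact M.dist_flow_vert_le hkg ht K j 0
    have hd : ∀ j, ‖(S.flow t (v j) - S.flow t (v 0)) - A (v j - v 0)‖ ≤ L * h ^ 2 := fun j =>
      (norm_sub_sub_fderiv_le (convex_convexHull ℝ S.init) (hS.flow_diff t) (by linarith)
        (hS.flow_fderiv_lip t ht) (subset_convexHull ℝ _ (M.vert_mem K j))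
        (subset_convexHull ℝ _ hv0)).trans (by gcongr; exact hb j)
    have h1 : ‖triNormal (fun j => S.flow t (v j)) - cofactor A n‖ ≤ 2 * L ^ 2 * h ^ 3 := by
      rw [hn, triNormal_eq_crossE, triNormal_eq_crossE, ← crossE_map]
      refine (norm_crossE_sub_le _ _ _ _).trans ?_
      calc _ ≤ L * h ^ 2 * h + L * h * (L * h ^ 2) := by
            gcongr
            exacts [hd 1, ha 2, hAb 1, hd 2]
        _ = (L + L ^ 2) * h ^ 3 := by ring
        _ ≤ _ := by gcongr; nlinarith
    have h2 : ‖cofactor A n - β • flowNormal S ν t (v 0)‖ ≤ 6 * L ^ 3 * h ^ 3 := by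
      rw [flowNormal, ← hA, ← cofactor_smul, cofactor_sub]
      refine (norm_cofactor_le hAL _).trans ?_
      calc _ ≤ 3 * L ^ 2 * (2 * L * h ^ 3) := by gcongr
        _ = _ := by ring
    calc _ = ‖(triNormal (fun j => S.flow t (v j)) - cofactor A n) +
          (cofactor A n - β • flowNormal S ν t (v 0))‖ := by rw [sub_add_sub_cancel]
      _ ≤ 2 * L ^ 2 * h ^ 3 + 6 * L ^ 3 * h ^ 3 := (norm_add_le _ _).trans (add_le_add h1 h2)
      _ = (2 * L ^ 2 + 6 * L ^ 3) * h ^ 3 := by ring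
      _ ≤ _ := by gcongr; nlinarith [mul_nonneg (sub_nonneg.2 hL) (sq_nonneg L)]

/-- Geometric properties of one family of moving elements of size `h`, with constant `C`. -/
structure Mesh.Regular (M : Mesh S) (kg : ℕ) (C : ℝ) : Prop where
  size_pos : 0 < M.size kg
  size_le : M.size kg ≤ 1
  abs_jac_le : ∀ t ∈ Icc 0 T, ∀ K, ∀ ξ ∈ refTri, ∀ i j,
    |jac (M.elem kg t K) ξ i j| ≤ C * M.size kg
  le_areaDensity : ∀ t ∈ Icc 0 T, ∀ K, ∀ ξ ∈ refTri,
    M.size kg ^ 2 ≤ C * areaDensity (M.elem kg t K) ξ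
  abs_jac_vel_le : ∀ t ∈ Icc 0 T, ∀ K, ∀ ξ ∈ refTri, ∀ i j,
    |jac (M.elemVel kg t K) ξ i j| ≤ C * M.size kg
  abs_jac_sub_le : ∀ t ∈ Icc 0 T, ∀ s ∈ Icc 0 T, ∀ K, ∀ ξ ∈ refTri, ∀ i j,
    |jac (M.elem kg t K) ξ i j - jac (M.elem kg s K) ξ i j| ≤ C * M.size kg * |t - s|
  exists_normal : ∀ t ∈ Icc 0 T, ∃ N : E3 → E3, (∀ K i, ‖N (M.vert K i)‖ ≤ 1) ∧
    (∀ K i j, ‖N (M.vert K i) - N (M.vert K j)‖ ≤ C * M.size kg) ∧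
    ∀ K, ∀ ξ ∈ refTri, ‖WithLp.toLp 2 (normal (M.elem kg t K) ξ) -
      flatMap (fun j => N (M.vert K j)) ξ‖ ≤ C * M.size kg

/-- Jacobian columns differ from the edges of the moved flat triangle by O(h²), so vector areas
differ by O(h³), while quasi-uniformity bounds them from below by ρ²h². For small h the area density
is therefore of order h². Normalizing the vectors `flowNormal` at the vertices gives a field that
varies by O(h) on an element and is O(h)-close to the discrete normal. -/
theorem exists_regular (hS : SurfaceBounds S L r ν) (hT : 0 < T) {kg : ℕ} (hkg : 1 ≤ kg) {ρ : ℝ}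
    (hρ : 0 < ρ) : ∃ h₀ > 0, ∃ C ≥ 1, ∀ M : Mesh S, M.QuasiUniform kg ρ → M.size kg < h₀ →
      (∃ _ : Fin M.numTri, True) → M.Regular kg C := by
  have hL := hS.one_le
  obtain ⟨D, hD1, hD⟩ := Mesh.exists_jac_bounds hkg hS hT
  -- Total error constant of the vector area: 6D from the Jacobian, 8L³ from the comparison of the
  -- moved flat triangle with the transported normal.
  set E := 6 * D + 8 * L ^ 3 with hE
  have hE0 : 0 < E := by positivity
  have hmin : 0 < min 1 r := lt_min one_pos hS.r_pos
  set h₀ := min (min 1 r / (8 * (1 + L) * (1 + 3 * L))) (min (1 / (2 * D)) (ρ ^ 2 / (2 * E)))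
    with hh₀
  have hh₀pos : 0 < h₀ := by positivity
  set C := max (2 + D) (max (2 / ρ ^ 2) ((4 * E + 72 * L ^ 3) / ρ ^ 2)) with hC
  have hC1 : 2 + D ≤ C := le_max_left _ _
  have hC2 : 2 / ρ ^ 2 ≤ C := (le_max_left _ _).trans (le_max_right _ _)
  have hC3 : (4 * E + 72 * L ^ 3) / ρ ^ 2 ≤ C := (le_max_right _ _).trans (le_max_right _ _)
  refine ⟨h₀, hh₀pos, C, by linarith, fun M hM hsize ⟨K₀, _⟩ => ?_⟩
  have hh := M.size_pos hT hkg K₀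
  have hf : M.Fine L r (M.size kg) := by
    have : M.size kg < min 1 r / (8 * (1 + L) * (1 + 3 * L)) :=
      lt_of_lt_of_le hsize (min_le_left _ _)
    rw [lt_div_iff₀ (by positivity)] at this
    rw [Mesh.Fine]; linarith
  have hDh : 2 * D * M.size kg ≤ 1 := by
    have : M.size kg ≤ 1 / (2 * D) :=
      hsize.le.trans ((min_le_right _ _).trans (min_le_left _ _))
    rw [le_div_iff₀ (by positivity)] at this
    linarith
  have hEh : 2 * E * M.size kg ≤ ρ ^ 2 := by
    have : M.size kg ≤ ρ ^ 2 / (2 * E) :=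
      hsize.le.trans ((min_le_right _ _).trans (min_le_right _ _))
    rw [le_div_iff₀ (by positivity)] at this
    linarith
  set h := M.size kg with hhd
  have hjac : ∀ t ∈ Icc 0 T, ∀ K, ∀ ξ ∈ refTri, ∀ j : Fin 2,
      ‖jacCol (M.elem kg t K) ξ j - (S.flow t (M.vert K j.succ) - S.flow t (M.vert K 0))‖ ≤
        2 * (D * h ^ 2) := fun t ht K ξ hξ j =>
    norm_le_of_abs_apply_le fun i => (hD M hf K ξ hξ t ht i j).1
  have ha : ∀ t ∈ Icc 0 T, ∀ K j, ‖S.flow t (M.vert K j) - S.flow t (M.vert K 0)‖ ≤ h :=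
    fun t ht K j => by rw [← dist_eq_norm]; exact M.dist_flow_vert_le hkg ht K j 0
  have hcross : ∀ t ∈ Icc 0 T, ∀ K, ∀ ξ ∈ refTri,
      ‖crossE (jacCol (M.elem kg t K) ξ 0) (jacCol (M.elem kg t K) ξ 1) -
        triNormal fun j => S.flow t (M.vert K j)‖ ≤ 6 * D * h ^ 3 := by
    intro t ht K ξ hξ
    have h1 : ‖jacCol (M.elem kg t K) ξ 1‖ ≤ 2 * h := by
      have := norm_le_norm_add_norm_sub' (jacCol (M.elem kg t K) ξ 1)
        (S.flow t (M.vert K 2) - S.flow t (M.vert K 0))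
      have h2 := hjac t ht K ξ hξ 1
      have h3 := ha t ht K 2
      rw [Fin.succ_one_eq_two] at h2
      nlinarith
    rw [triNormal_eq_crossE]
    refine (norm_crossE_sub_le _ _ _ _).trans ?_
    calc _ ≤ 2 * (D * h ^ 2) * (2 * h) + h * (2 * (D * h ^ 2)) := by
          gcongr
          exacts [hjac t ht K ξ hξ 0, ha t ht K 1, hjac t ht K ξ hξ 1]
      _ = _ := by ring
  have htri := fun t ht => M.sq_le_norm_triNormal_flow hT hkg hρ hM (t := t) ht
  refine ⟨hh, ?_, ?_, ?_, ?_, ?_, ?_⟩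
  · nlinarith
  · intro t ht K ξ hξ i j
    have h1 := (hD M hf K ξ hξ t ht i j).1
    have h2 := (abs_apply_le _ i).trans (ha t ht K j.succ)
    have h3 := abs_sub_abs_le_abs_sub (jac (M.elem kg t K) ξ i j)
      ((S.flow t (M.vert K j.succ) - S.flow t (M.vert K 0)) i)
    calc _ ≤ h + D * h ^ 2 := by linarith
      _ ≤ 2 * h := by nlinarith
      _ ≤ C * h := by gcongr; linarith
  · intro t ht K ξ hξ
    rw [areaDensity_eq_norm]
    have h1 := hcross t ht K ξ hξ
    have h2 := htri t ht K
    rw [norm_sub_rev] at h1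
    have h3 := norm_sub_norm_le (triNormal fun j => S.flow t (M.vert K j))
      (crossE (jacCol (M.elem kg t K) ξ 0) (jacCol (M.elem kg t K) ξ 1))
    have h4 : 6 * D * h ^ 3 ≤ ρ ^ 2 * h ^ 2 / 2 := by
      have : 6 * D * h ≤ ρ ^ 2 / 2 := by
        have : 6 * D ≤ E := by rw [hE]; have : 0 < L ^ 3 := by positivity
                               linarith
        nlinarith
      nlinarith [mul_le_mul_of_nonneg_right this (sq_nonneg h)]
    have h5 : ρ ^ 2 * h ^ 2 / 2 ≤
        ‖crossE (jacCol (M.elem kg t K) ξ 0) (jacCol (M.elem kg t K) ξ 1)‖ := by linarith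
    calc h ^ 2 = 2 / ρ ^ 2 * (ρ ^ 2 * h ^ 2 / 2) := by field_simp
      _ ≤ _ := by gcongr
  · intro t ht K ξ hξ i j
    exact (hD M hf K ξ hξ t ht i j).2.1.trans (by gcongr; linarith)
  · intro t ht s hs K ξ hξ i j
    exact ((hD M hf K ξ hξ t ht i j).2.2 s hs).trans (by gcongr; linarith)
  · intro t ht
    refine ⟨fun z => ‖flowNormal S ν t z‖⁻¹ • flowNormal S ν t z, fun K i => ?_, ?_⟩
    · rw [norm_smul, norm_inv, norm_norm]
      exact inv_mul_le_one
    -- The lower bound comes from the moved flat triangle: β‖N‖ ≥ ρ²h²/2 together with β ≤ h².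
    have hN : ∀ K i, ρ ^ 2 / 2 ≤ ‖flowNormal S ν t (M.vert K 0)‖ ∧
        ‖(‖flowNormal S ν t (M.vert K i)‖⁻¹ • flowNormal S ν t (M.vert K i)) -
          ‖flowNormal S ν t (M.vert K 0)‖⁻¹ • flowNormal S ν t (M.vert K 0)‖ ≤
          36 * L ^ 3 / ρ ^ 2 * h := by
      intro K i
      obtain ⟨β, hβ0, hβ1, -, hβ2⟩ := exists_norm_triNormal_sub_le hS hT hkg M hf K
      have h1 := hβ2 t ht
      have h2 := htri t ht K
      have h3 := norm_sub_norm_le (triNormal fun j => S.flow t (M.vert K j))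
        (β • flowNormal S ν t (M.vert K 0))
      rw [norm_smul, Real.norm_eq_abs, abs_of_pos hβ0] at h3
      have h4 : 8 * L ^ 3 * h ^ 3 ≤ ρ ^ 2 * h ^ 2 / 2 := by
        have : 8 * L ^ 3 * h ≤ ρ ^ 2 / 2 := by
          have : 8 * L ^ 3 ≤ E := by rw [hE]; linarith
          nlinarith
        nlinarith [mul_le_mul_of_nonneg_right this (sq_nonneg h)]
      have h5 : ρ ^ 2 / 2 ≤ ‖flowNormal S ν t (M.vert K 0)‖ := by
        have : ρ ^ 2 * h ^ 2 / 2 ≤ h ^ 2 * ‖flowNormal S ν t (M.vert K 0)‖ := by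
          calc _ ≤ β * ‖flowNormal S ν t (M.vert K 0)‖ := by linarith
            _ ≤ _ := by gcongr
        have hh2 : 0 < h ^ 2 := by positivity
        refine le_of_mul_le_mul_left ?_ hh2
        linarith
      refine ⟨h5, ?_⟩
      have hne : flowNormal S ν t (M.vert K 0) ≠ 0 := by
        intro h0
        rw [h0, norm_zero] at h5
        have : 0 < ρ ^ 2 := by positivity
        linarith
      refine (norm_inv_smul_sub_le hne).trans ?_
      have h6 := norm_flowNormal_sub_le hS ht (M.vert_mem K i) (M.vert_mem K 0)
      calc _ ≤ 2 * (9 * L ^ 3 * h) / (ρ ^ 2 / 2) := by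
            gcongr
            exact h6.trans (by gcongr; exact M.norm_vert_sub_le hT hkg K i 0)
        _ = _ := by field_simp; ring
    constructor
    · intro K i j
      calc _ ≤ 36 * L ^ 3 / ρ ^ 2 * h + 36 * L ^ 3 / ρ ^ 2 * h := by
            rw [← sub_sub_sub_cancel_right _ _
              (‖flowNormal S ν t (M.vert K 0)‖⁻¹ • flowNormal S ν t (M.vert K 0))]
            exact (norm_sub_le _ _).trans (add_le_add (hN K i).2 (hN K j).2)
        _ = 72 * L ^ 3 / ρ ^ 2 * h := by ring
        _ ≤ (4 * E + 72 * L ^ 3) / ρ ^ 2 * h := by gcongr; linarith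
        _ ≤ _ := by gcongr
    · intro K ξ hξ
      obtain ⟨β, hβ0, hβ1, -, hβ2⟩ := exists_norm_triNormal_sub_le hS hT hkg M hf K
      set c := crossE (jacCol (M.elem kg t K) ξ 0) (jacCol (M.elem kg t K) ξ 1) with hc
      set N0 := flowNormal S ν t (M.vert K 0) with hN0
      have e1 : (WithLp.toLp 2 (normal (M.elem kg t K) ξ) : E3) = ‖c‖⁻¹ • c := by
        rw [normal_eq]
      have hcβ : ‖c - β • N0‖ ≤ E * h ^ 3 := by
        calc _ = ‖(c - triNormal fun j => S.flow t (M.vert K j)) +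
              ((triNormal fun j => S.flow t (M.vert K j)) - β • N0)‖ := by
              rw [sub_add_sub_cancel]
          _ ≤ 6 * D * h ^ 3 + 8 * L ^ 3 * h ^ 3 :=
              (norm_add_le _ _).trans (add_le_add (hcross t ht K ξ hξ) (hβ2 t ht))
          _ = _ := by rw [hE]; ring
      have hβN : ρ ^ 2 / 2 * h ^ 2 ≤ ‖β • N0‖ := by
        have h1 := hβ2 t ht
        have h2 := htri t ht K
        have h3 := norm_sub_norm_le (triNormal fun j => S.flow t (M.vert K j)) (β • N0)
        have h4 : 8 * L ^ 3 * h ^ 3 ≤ ρ ^ 2 * h ^ 2 / 2 := by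
          have : 8 * L ^ 3 * h ≤ ρ ^ 2 / 2 := by
            have : 8 * L ^ 3 ≤ E := by rw [hE]; linarith
            nlinarith
          nlinarith [mul_le_mul_of_nonneg_right this (sq_nonneg h)]
        linarith
      have hβN0 : 0 < ‖β • N0‖ := lt_of_lt_of_le (by positivity) hβN
      have e2 : ‖β • N0‖⁻¹ • (β • N0) = ‖N0‖⁻¹ • N0 := by
        rw [norm_smul, Real.norm_eq_abs, abs_of_pos hβ0, smul_smul, mul_inv, mul_right_comm,
          inv_mul_cancel₀ hβ0.ne', one_mul]
      have h7 : ‖‖c‖⁻¹ • c - ‖N0‖⁻¹ • N0‖ ≤ 4 * E / ρ ^ 2 * h := by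
        rw [← e2]
        refine (norm_inv_smul_sub_le (norm_pos_iff.1 hβN0)).trans ?_
        calc _ ≤ 2 * (E * h ^ 3) / (ρ ^ 2 / 2 * h ^ 2) := by gcongr
          _ = _ := by field_simp; ring
      have h8 := norm_flatMap_sub_le (v := fun j => ‖flowNormal S ν t (M.vert K j)‖⁻¹ •
        flowNormal S ν t (M.vert K j)) (p := ‖N0‖⁻¹ • N0) (fun j => (hN K j).2) hξ
      rw [e1]
      calc _ ≤ 4 * E / ρ ^ 2 * h + 36 * L ^ 3 / ρ ^ 2 * h := by
            rw [← sub_sub_sub_cancel_right _ _ (‖N0‖⁻¹ • N0)]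
            exact (norm_sub_le _ _).trans (add_le_add h7 h8)
        _ = (4 * E + 36 * L ^ 3) / ρ ^ 2 * h := by ring
        _ ≤ (4 * E + 72 * L ^ 3) / ρ ^ 2 * h := by
            gcongr; norm_num
        _ ≤ _ := by gcongr

end ESFEM

namespace ESFEM

/-! ### Orthogonal projection on a tangent plane -/

/-- `e₁, e₂, ν` is a positively oriented orthonormal basis. -/
structure Frame (ν e₁ e₂ : E3) : Prop where
  cross : crossE e₁ e₂ = ν
  norm_sq : ∀ x, ‖x‖ ^ 2 = inner ℝ e₁ x ^ 2 + inner ℝ e₂ x ^ 2 + inner ℝ ν x ^ 2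
  norm_one : ‖e₁‖ = 1
  norm_two : ‖e₂‖ = 1
  inner_one_two : inner ℝ e₁ e₂ = (0 : ℝ)
  inner_one : inner ℝ e₁ ν = (0 : ℝ)
  inner_two : inner ℝ e₂ ν = (0 : ℝ)

theorem crossE_swap (a b : E3) : crossE a b = -crossE b a := by
  obtain ⟨h0, h1, h2⟩ := crossE_apply a b
  obtain ⟨g0, g1, g2⟩ := crossE_apply b a
  ext i
  fin_cases i
  · simp only [Fin.zero_eta, PiLp.neg_apply, h0, g0]; ring
  · simp only [Fin.mk_one, PiLp.neg_apply, h1, g1]; ring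
  · simp only [Fin.reduceFinMk, PiLp.neg_apply, h2, g2]; ring

theorem inner_crossE_left (a b : E3) : inner ℝ a (crossE a b) = (0 : ℝ) := by
  obtain ⟨h0, h1, h2⟩ := crossE_apply a b
  rw [inner_E3, h0, h1, h2]; ring

theorem inner_crossE_right (a b : E3) : inner ℝ b (crossE a b) = (0 : ℝ) := by
  obtain ⟨h0, h1, h2⟩ := crossE_apply a b
  rw [inner_E3, h0, h1, h2]; ring

/-- The unit vector ν is extended to an orthonormal basis. The cross product of the two other
vectors is ν or -ν, and in the second case they are exchanged. -/
theorem exists_frame {ν : E3} (hν : ‖ν‖ = 1) : ∃ e₁ e₂, Frame ν e₁ e₂ := by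
  have ho : Orthonormal ℝ (({2} : Set (Fin 3)).domRestrict fun _ : Fin 3 => ν) := by
    refine ⟨fun _ => hν, fun i j hij => ?_⟩
    exact absurd (Subtype.ext (i.2.trans j.2.symm)) hij
  obtain ⟨b, hb⟩ := ho.exists_orthonormalBasis_extension_of_card_eq (by simp)
  have hb2 : b 2 = ν := hb 2 rfl
  have hin := b.orthonormal.2
  have h01 : inner ℝ (b 0) (b 1) = (0 : ℝ) := hin (by decide)
  have h02 : inner ℝ (b 0) ν = (0 : ℝ) := hb2 ▸ hin (by decide)
  have h12 : inner ℝ (b 1) ν = (0 : ℝ) := hb2 ▸ hin (by decide)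
  have hn := b.orthonormal.1
  have hsq : ∀ x, ‖x‖ ^ 2 = inner ℝ (b 0) x ^ 2 + inner ℝ (b 1) x ^ 2 + inner ℝ ν x ^ 2 := by
    intro x
    have := b.sum_sq_norm_inner_right x
    rw [Fin.sum_univ_three, hb2] at this
    simpa only [Real.norm_eq_abs, sq_abs] using this.symm
  set w := crossE (b 0) (b 1) with hw
  have hw0 : inner ℝ (b 0) w = (0 : ℝ) := inner_crossE_left _ _
  have hw1 : inner ℝ (b 1) w = (0 : ℝ) := inner_crossE_right _ _
  have hwn : ‖w‖ ^ 2 = 1 := by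
    rw [hw, norm_sq_crossE, hn, hn, h01]; norm_num
  have hin2 : inner ℝ ν w ^ 2 = (1 : ℝ) := by
    have := hsq w
    rw [hw0, hw1, hwn] at this
    linarith
  have hνν : inner ℝ ν ν = (1 : ℝ) := by rw [real_inner_self_eq_norm_sq, hν]; norm_num
  have hwν : w = (inner ℝ ν w : ℝ) • ν := by
    have h := hsq (w - (inner ℝ ν w : ℝ) • ν)
    simp only [inner_sub_right, inner_smul_right, hw0, hw1, h02, h12, hνν] at h
    rw [← sub_eq_zero, ← norm_eq_zero]
    exact pow_eq_zero_iff two_ne_zero |>.1 (by rw [h]; ring)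
  rcases sq_eq_sq_iff_eq_or_eq_neg.1 (hin2.trans (one_pow 2).symm) with h | h
  · exact ⟨b 0, b 1, by rw [← hw, hwν, h, one_smul], hsq, hn 0, hn 1, h01, h02, h12⟩
  · refine ⟨b 1, b 0, by rw [crossE_swap, ← hw, hwν, h]; simp, fun x => ?_, hn 1, hn 0, ?_, h12,
      h02⟩
    · rw [hsq x]; ring
    · rw [real_inner_comm]; exact h01

/-- Orthogonal projection on the plane spanned by `e₁, e₂`, in coordinates. -/
noncomputable def frameProj (e₁ e₂ : E3) : E3 →L[ℝ] R2 :=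
  ContinuousLinearMap.pi ![innerSL ℝ e₁, innerSL ℝ e₂]

theorem frameProj_zero (e₁ e₂ x : E3) : frameProj e₁ e₂ x 0 = inner ℝ e₁ x := rfl

theorem frameProj_one (e₁ e₂ x : E3) : frameProj e₁ e₂ x 1 = inner ℝ e₂ x := rfl

namespace Frame

variable {ν e₁ e₂ : E3}

theorem norm_proj_le (hf : Frame ν e₁ e₂) (x : E3) : ‖frameProj e₁ e₂ x‖ ≤ ‖x‖ := by
  rw [pi_norm_le_iff_of_nonneg (norm_nonneg _), Fin.forall_fin_two, frameProj_zero, frameProj_one]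
  constructor
  · simpa [hf.norm_one] using norm_inner_le_norm (𝕜 := ℝ) e₁ x
  · simpa [hf.norm_two] using norm_inner_le_norm (𝕜 := ℝ) e₂ x

theorem norm_le (hf : Frame ν e₁ e₂) {x : E3} (hx : |inner ℝ ν x| ≤ 1 / 4 * ‖x‖) :
    ‖x‖ ≤ 2 * ‖frameProj e₁ e₂ x‖ := by
  have h0 : |inner ℝ e₁ x| ≤ ‖frameProj e₁ e₂ x‖ := norm_le_pi_norm (frameProj e₁ e₂ x) 0
  have h1 : |inner ℝ e₂ x| ≤ ‖frameProj e₁ e₂ x‖ := norm_le_pi_norm (frameProj e₁ e₂ x) 1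
  have h2 := hf.norm_sq x
  have g0 := pow_le_pow_left₀ (abs_nonneg _) h0 2
  have g1 := pow_le_pow_left₀ (abs_nonneg _) h1 2
  have g2 := pow_le_pow_left₀ (abs_nonneg _) hx 2
  rw [sq_abs] at g0 g1 g2
  refine le_of_sq_le_sq ?_ (by positivity)
  nlinarith [norm_nonneg x]

theorem exists_lift (hf : Frame ν e₁ e₂) (y : R2) :
    ∃ x : E3, frameProj e₁ e₂ x = y ∧ inner ℝ x ν = (0 : ℝ) ∧ ‖x‖ ≤ 3 / 2 * ‖y‖ := by
  have h12 := hf.inner_one_two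
  have h21 : inner ℝ e₂ e₁ = (0 : ℝ) := by rw [real_inner_comm]; exact h12
  have hp : frameProj e₁ e₂ (y 0 • e₁ + y 1 • e₂) = y := by
    ext i
    fin_cases i
    · simp [frameProj_zero, inner_add_right, inner_smul_right, h12, hf.norm_one]
    · simp [frameProj_one, inner_add_right, inner_smul_right, h21, hf.norm_two]
  have hν : inner ℝ (y 0 • e₁ + y 1 • e₂) ν = (0 : ℝ) := by
    simp [inner_add_left, inner_smul_left, hf.inner_one, hf.inner_two]
  refine ⟨y 0 • e₁ + y 1 • e₂, hp, hν, ?_⟩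
  have h := hf.norm_sq (y 0 • e₁ + y 1 • e₂)
  rw [real_inner_comm] at hν
  rw [hν, ← frameProj_zero e₁ e₂, ← frameProj_one e₁ e₂, hp] at h
  have h0 := pow_le_pow_left₀ (norm_nonneg _) (norm_le_pi_norm y 0) 2
  have h1 := pow_le_pow_left₀ (norm_nonneg _) (norm_le_pi_norm y 1) 2
  rw [Real.norm_eq_abs, sq_abs] at h0 h1
  refine le_of_sq_le_sq ?_ (by positivity)
  nlinarith [sq_nonneg ‖y‖]

theorem proj_eq_of_add_smul (hf : Frame ν e₁ e₂) (x : E3) (s : ℝ) :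
    frameProj e₁ e₂ (x + s • ν) = frameProj e₁ e₂ x := by
  ext i
  fin_cases i
  · simp [frameProj_zero, inner_add_right, inner_smul_right, hf.inner_one]
  · simp [frameProj_one, inner_add_right, inner_smul_right, hf.inner_two]

/-- The identity (e₁ × e₂)·(a × b) = (e₁·a)(e₂·b) - (e₁·b)(e₂·a): the projected Jacobian determinant
is the ν-component of the vector area. -/
theorem det_eq (hf : Frame ν e₁ e₂) (a b : E3) :
    frameProj e₁ e₂ a 0 * frameProj e₁ e₂ b 1 - frameProj e₁ e₂ b 0 * frameProj e₁ e₂ a 1 =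
      inner ℝ ν (crossE a b) := by
  rw [← hf.cross]
  obtain ⟨h0, h1, h2⟩ := crossE_apply a b
  obtain ⟨g0, g1, g2⟩ := crossE_apply e₁ e₂
  simp only [frameProj_zero, frameProj_one, inner_E3, h0, h1, h2, g0, g1, g2]
  ring

end Frame

variable {T : ℝ} {m : ℕ} {S : EvolvingSurface T m} {L r : ℝ} {ν : E3 → E3} {c e₁ e₂ : E3} {R : ℝ}

/-- Near c chords of the surface are almost orthogonal to ν c: the chord deviates quadratically from
the tangent plane at its end point, and the normal there is close to ν c. Hence the projection is
injective with a Lipschitz inverse. -/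
theorem norm_sub_le_of_frame (hS : SurfaceBounds S L r ν) (hc : c ∈ S.init)
    (hf : Frame (ν c) e₁ e₂) (hR : 100 * (1 + L) ^ 2 * R ≤ min 1 r) (hR0 : 0 < R) {p q : E3}
    (hp : p ∈ S.init) (hq : q ∈ S.init) (hpc : ‖p - c‖ ≤ R) (hqc : ‖q - c‖ ≤ R) :
    ‖q - p‖ ≤ 2 * ‖frameProj e₁ e₂ (q - p)‖ := by
  have hL := hS.one_le
  have h1 : 100 * (1 + L) ^ 2 * R ≤ 1 := hR.trans (min_le_left _ _)
  have h2 : 100 * (1 + L) ^ 2 * R ≤ r := hR.trans (min_le_right _ _)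
  have hLR : L * R ≤ (1 + L) ^ 2 * R := by gcongr; nlinarith
  have hRR : R ≤ (1 + L) ^ 2 * R := le_mul_of_one_le_left hR0.le (by nlinarith)
  have hpq : ‖q - p‖ ≤ 2 * R := by
    calc _ = ‖(q - c) - (p - c)‖ := by rw [sub_sub_sub_cancel_right]
      _ ≤ _ := norm_sub_le _ _
      _ ≤ _ := by linarith
  refine hf.norm_le ?_
  have e1 := (hS.normal p hp).inner_le S.dom_open hq (by linarith)
  have e2 := hS.normal_lip p hp c hc
  have e3 : |inner ℝ (ν c - ν p) (q - p)| ≤ L * R * ‖q - p‖ := by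
    refine (abs_real_inner_le_norm _ _).trans ?_
    gcongr
    rw [norm_sub_rev]
    exact e2.trans (by gcongr)
  have e4 : inner ℝ (ν c) (q - p) = inner ℝ (q - p) (ν p) + inner ℝ (ν c - ν p) (q - p) := by
    rw [real_inner_comm (ν p) (q - p), inner_sub_left]; ring
  rw [e4]
  refine (abs_add_le _ _).trans ?_
  have e5 : L * ‖q - p‖ ^ 2 ≤ L * (2 * R) * ‖q - p‖ := by
    rw [sq, ← mul_assoc]; gcongr
  nlinarith [norm_nonneg (q - p)]

/-- The point of the tangent plane over y is moved to the surface along ν c, a direction that the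
projection annihilates. -/
theorem exists_mem_init_of_frame (hS : SurfaceBounds S L r ν) (hc : c ∈ S.init)
    (hf : Frame (ν c) e₁ e₂) (hR : 100 * (1 + L) ^ 2 * R ≤ min 1 r) {y : R2}
    (hy : ‖y‖ ≤ R / 4) : ∃ p ∈ S.init, ‖p - c‖ ≤ 2 * ‖y‖ ∧ frameProj e₁ e₂ (p - c) = y := by
  have hL := hS.one_le
  have hR0 : 0 ≤ R := by linarith [norm_nonneg y]
  obtain ⟨x, hx, hxν, hxy⟩ := hf.exists_lift y
  have h1 : 100 * (1 + L) ^ 2 * R ≤ 1 := hR.trans (min_le_left _ _)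
  have hLR : L * R ≤ (1 + L) ^ 2 * R := by gcongr; nlinarith
  obtain ⟨s, hs, hmem⟩ := (hS.normal c hc).exists_mem_frontier S.dom_open hc (by linarith)
    (y := c + x) (by
      rw [add_sub_cancel_left]
      calc _ ≤ 8 * (1 + L) * (3 * (1 + L)) * (3 / 2 * (R / 4)) := by
            gcongr
            · linarith
            · exact hxy.trans (by gcongr)
        _ = 9 * ((1 + L) ^ 2 * R) := by ring
        _ ≤ 100 * ((1 + L) ^ 2 * R) := by gcongr; norm_num
        _ ≤ _ := by rw [← mul_assoc]; exact hR)
  rw [add_sub_cancel_left, hxν, abs_zero, zero_add] at hs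
  refine ⟨_, hmem, ?_, ?_⟩
  · rw [add_assoc, add_sub_cancel_left]
    refine (norm_add_le _ _).trans ?_
    rw [norm_smul, (hS.normal c hc).norm_eq, mul_one, Real.norm_eq_abs]
    have : 2 * (3 * L * ‖x‖ ^ 2) ≤ 2 * (3 * L * (3 / 2 * ‖y‖) ^ 2) := by gcongr
    have h3 : L * ‖y‖ ^ 2 ≤ L * (R / 4) * ‖y‖ := by rw [sq, ← mul_assoc]; gcongr
    nlinarith [norm_nonneg y]
  · rw [add_assoc, add_sub_cancel_left, hf.proj_eq_of_add_smul, hx]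

end ESFEM

/-! ### Flat triangles and the closest point projection -/

namespace ESFEM

variable {T : ℝ} {m : ℕ} {S : EvolvingSurface T m} {L r : ℝ} {ν : E3 → E3}

theorem flatMap_sub_flatMap (v : Fin 3 → E3) (ξ η : R2) :
    flatMap v ξ - flatMap v η = (ξ 0 - η 0) • (v 1 - v 0) + (ξ 1 - η 1) • (v 2 - v 0) := by
  rw [flatMap_eq, flatMap_eq]; module

theorem inner_triNormal_flatMap_sub (v : Fin 3 → E3) (ξ η : R2) :
    inner ℝ (triNormal v) (flatMap v ξ - flatMap v η) = (0 : ℝ) := by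
  rw [flatMap_sub_flatMap, triNormal_eq_crossE, inner_add_right, inner_smul_right,
    inner_smul_right, real_inner_comm, inner_crossE_left, real_inner_comm, inner_crossE_right]
  ring

/-- The flat triangles are almost tangential. -/
theorem Mesh.tangential (M : Mesh S) (hS : SurfaceBounds S L r ν) (hT : 0 < T) {kg : ℕ}
    (hkg : 1 ≤ kg) (hf : M.Fine L r (M.size kg)) {ρ : ℝ} (hρ : 0 < ρ) (hM : M.QuasiUniform kg ρ)
    (hρh : 4 * L * M.size kg ≤ ρ ^ 2) (K : Fin M.numTri) :
    (∀ ξ η, |inner ℝ (ν (M.vert K 0)) (flatMap (M.vert K) ξ - flatMap (M.vert K) η)| ≤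
      4 * L / ρ ^ 2 * M.size kg * ‖flatMap (M.vert K) ξ - flatMap (M.vert K) η‖) ∧
    ∀ μ : E3, ‖μ‖ ≤ 1 → ‖ν (M.vert K 0) - μ‖ ≤ 1 / 4 →
      16 * L * M.size kg ≤ ρ ^ 2 →
      ρ ^ 2 / 4 * M.size kg ^ 2 ≤ inner ℝ μ (triNormal (M.vert K)) := by
  have hL := hS.one_le
  have hh := M.size_pos hT hkg K
  obtain ⟨β, hβ0, hβ1, hβ2, -⟩ := exists_norm_triNormal_sub_le hS hT hkg M hf K
  have htri := M.sq_le_norm_triNormal_vert hT hkg hρ hM K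
  set h := M.size kg
  set n := triNormal (M.vert K)
  set ν0 := ν (M.vert K 0) with hν0
  have hνn : ‖ν0‖ = 1 := (hS.normal _ (M.vert_mem K 0)).norm_eq
  have h3 := norm_sub_norm_le n (β • ν0)
  rw [norm_smul, Real.norm_eq_abs, abs_of_pos hβ0, hνn, mul_one] at h3
  have h4 : ρ ^ 2 * h ^ 2 - 2 * L * h ^ 3 ≤ β := by linarith
  have hh2 : 0 < h ^ 2 := by positivity
  have h5 : ρ ^ 2 / 2 * h ^ 2 ≤ β := by nlinarith
  refine ⟨fun ξ η => ?_, fun μ hμ hμν hh16 => ?_⟩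
  · set x := flatMap (M.vert K) ξ - flatMap (M.vert K) η with hx
    have h6 : inner ℝ n x = (0 : ℝ) := inner_triNormal_flatMap_sub _ _ _
    have h7 : β * |inner ℝ ν0 x| ≤ 2 * L * h ^ 3 * ‖x‖ := by
      calc _ = |inner ℝ (n - β • ν0) x| := by
            rw [inner_sub_left, h6, inner_smul_left, zero_sub, abs_neg, abs_mul]
            simp [abs_of_pos hβ0]
        _ ≤ ‖n - β • ν0‖ * ‖x‖ := abs_real_inner_le_norm _ _
        _ ≤ _ := by gcongr
    have h8 : ρ ^ 2 / 2 * h ^ 2 * |inner ℝ ν0 x| ≤ 2 * L * h ^ 3 * ‖x‖ :=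
      (by gcongr : _ ≤ β * |inner ℝ ν0 x|).trans h7
    have hpos : 0 < ρ ^ 2 / 2 * h ^ 2 := by positivity
    refine le_of_mul_le_mul_left (h8.trans_eq ?_) hpos
    field_simp; ring
  · have e : inner ℝ μ n = β - β * inner ℝ (ν0 - μ) ν0 + inner ℝ μ (n - β • ν0) := by
      rw [inner_sub_left, inner_sub_right, inner_smul_right, real_inner_self_eq_norm_sq, hνn]
      ring
    have e1 : inner ℝ (ν0 - μ) ν0 ≤ 1 / 4 := by
      refine (real_inner_le_norm _ _).trans ?_
      rw [hνn, mul_one]; exact hμν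
    have e2 : |inner ℝ μ (n - β • ν0)| ≤ 2 * L * h ^ 3 := by
      refine (abs_real_inner_le_norm _ _).trans ?_
      calc _ ≤ 1 * (2 * L * h ^ 3) := by gcongr
        _ = _ := one_mul _
    have e3 := (abs_le.1 e2).1
    rw [e]
    have e4 : 2 * L * h ^ 3 ≤ ρ ^ 2 / 8 * h ^ 2 := by nlinarith
    nlinarith

theorem abs_add_sub_sub_le (a b c d : ℝ) : |a + b - c - d| ≤ |a| + |b| + |c| + |d| :=
  (abs_sub _ _).trans (add_le_add_left ((abs_sub _ _).trans (add_le_add_left (abs_add_le _ _) _)) _)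

/-- Write x = p + sν(p) and x' = p' + s'ν(p'). The difference in question is (s - s')ν(p') + s(ν(p)
- ν(p')). Here s = O(h²), and s - s' is read off from the component along ν(p'), where the flat
triangle is nearly tangential for x - x' and the surface for p - p'; both contribute a factor h. -/
theorem closestPt_sub_closestPt (M : Mesh S) (hS : SurfaceBounds S L r ν) (hT : 0 < T) {kg : ℕ}
    (hkg : 1 ≤ kg) (hf : M.Fine L r (M.size kg)) {ρ : ℝ} (hρ : 0 < ρ) (hM : M.QuasiUniform kg ρ)
    (hρh : 4 * L * M.size kg ≤ ρ ^ 2) (hh1 : M.size kg ≤ 1)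
    (hA : 32 * (4 * L / ρ ^ 2 + 6 * L + 16 * L ^ 2) * M.size kg ≤ 1) (K : Fin M.numTri) {ξ η : R2}
    (hξ : ξ ∈ refTri) (hη : η ∈ refTri) :
    ‖(flatMap (M.vert K) ξ - flatMap (M.vert K) η) - (closestPt S.init (flatMap (M.vert K) ξ) -
      closestPt S.init (flatMap (M.vert K) η))‖ ≤ 1 / 8 *
      ‖closestPt S.init (flatMap (M.vert K) ξ) - closestPt S.init (flatMap (M.vert K) η)‖ := by
  have hL := hS.one_le
  have hh := M.size_pos hT hkg K
  have htan := (M.tangential hS hT hkg hf hρ hM hρh K).1 ξ η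
  have key : ∀ ζ ∈ refTri, ∃ s : ℝ, |s| ≤ 8 * L * M.size kg ^ 2 ∧
      flatMap (M.vert K) ζ - closestPt S.init (flatMap (M.vert K) ζ) =
        s • ν (closestPt S.init (flatMap (M.vert K) ζ)) := by
    intro ζ hζ
    have hmem := M.flatMap_mem_poly K hζ
    have hn := hS.normal _ (M.closestPt_mem hmem)
    have e := hn.sub_eq_smul_of_closest S.dom_open (M.closestPt_mem hmem) (by linarith) hS.r_pos
      fun q hq => M.norm_sub_closestPt_le hmem hq
    refine ⟨_, ?_, e⟩
    refine (abs_real_inner_le_norm _ _).trans ?_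
    rw [hn.norm_eq, mul_one]
    exact M.norm_flatMap_sub_closestPt_le hS hT hkg hf K hζ
  obtain ⟨s, hs, hes⟩ := key ξ hξ
  obtain ⟨s', hs', hes'⟩ := key η hη
  have hp := M.closestPt_mem (M.flatMap_mem_poly K hξ)
  have hp' := M.closestPt_mem (M.flatMap_mem_poly K hη)
  have hpv := M.norm_closestPt_sub_vert_le hS hT hkg hf K hξ 0
  have hpv' := M.norm_closestPt_sub_vert_le hS hT hkg hf K hη 0
  set x := flatMap (M.vert K) ξ
  set x' := flatMap (M.vert K) η
  set p := closestPt S.init x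
  set p' := closestPt S.init x'
  set h := M.size kg
  set v := M.vert K 0
  have hpp : ‖p - p'‖ ≤ 4 * h := by
    calc _ = ‖(p - v) - (p' - v)‖ := by rw [sub_sub_sub_cancel_right]
      _ ≤ _ := norm_sub_le _ _
      _ ≤ _ := by linarith
  have hν := hS.normal_lip p hp p' hp'
  have hν' := hS.normal_lip v (M.vert_mem K 0) p' hp'
  have hnn := (hS.normal p' hp').norm_eq
  set e := (x - x') - (p - p') with he
  have e1 : e = (s - s') • ν p' + s • (ν p - ν p') := by
    have : e = (x - p) - (x' - p') := by rw [he]; abel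
    rw [this, hes, hes']; module
  have hsν : ‖s • (ν p - ν p')‖ ≤ 8 * L * h ^ 2 * (L * ‖p - p'‖) := by
    rw [norm_smul, Real.norm_eq_abs]; gcongr
  have e2 : inner ℝ (ν p') e = (s - s') + inner ℝ (ν p') (s • (ν p - ν p')) := by
    rw [e1, inner_add_right, inner_smul_right, real_inner_self_eq_norm_sq, hnn]; ring
  have e3 : |inner ℝ (ν p') (s • (ν p - ν p'))| ≤ 8 * L * h ^ 2 * (L * ‖p - p'‖) := by
    refine (abs_real_inner_le_norm _ _).trans ?_
    rw [hnn, one_mul]; exact hsν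
  have e5 : |inner ℝ (ν p') (p - p')| ≤ L * (4 * h) * ‖p - p'‖ := by
    rw [real_inner_comm]
    refine ((hS.normal p' hp').inner_le S.dom_open hp ?_).trans ?_
    · have : 8 * (1 + L) * (1 + 3 * L) * h < r := lt_of_lt_of_le hf (min_le_right _ _)
      nlinarith [mul_nonneg (sub_nonneg.2 hL) hh.le, mul_nonneg (mul_nonneg (sub_nonneg.2 hL) hh.le)
        (zero_le_one.trans hL)]
    · rw [sq, ← mul_assoc]; gcongr
  have e6 : |inner ℝ (ν p' - ν v) (x - x')| ≤ L * (2 * h) * ‖x - x'‖ := by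
    refine (abs_real_inner_le_norm _ _).trans ?_
    gcongr
    rw [norm_sub_rev]
    refine hν'.trans ?_
    gcongr
    rw [norm_sub_rev]; exact hpv'
  have e7 : |s - s'| ≤ (4 * L / ρ ^ 2 * h + L * (2 * h)) * ‖x - x'‖ + L * (4 * h) * ‖p - p'‖ +
      8 * L * h ^ 2 * (L * ‖p - p'‖) := by
    have : s - s' = inner ℝ (ν v) (x - x') + inner ℝ (ν p' - ν v) (x - x') -
        inner ℝ (ν p') (p - p') - inner ℝ (ν p') (s • (ν p - ν p')) := by
      have h1 : inner ℝ (ν p') e = inner ℝ (ν p') (x - x') - inner ℝ (ν p') (p - p') :=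
        inner_sub_right _ _ _
      have h2 : inner ℝ (ν p' - ν v) (x - x') = inner ℝ (ν p') (x - x') - inner ℝ (ν v) (x - x') :=
        inner_sub_left _ _ _
      linarith
    rw [this]
    refine (abs_add_sub_sub_le _ _ _ _).trans ?_
    linarith
  have e8 : ‖e‖ ≤ |s - s'| + 8 * L * h ^ 2 * (L * ‖p - p'‖) := by
    rw [e1]
    refine (norm_add_le _ _).trans ?_
    rw [norm_smul (s - s'), hnn, mul_one, Real.norm_eq_abs]
    gcongr
  have e9 : ‖x - x'‖ ≤ ‖e‖ + ‖p - p'‖ := by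
    calc _ = ‖e + (p - p')‖ := by rw [he, sub_add_cancel]
      _ ≤ _ := norm_add_le _ _
  set A := 4 * L / ρ ^ 2 + 6 * L + 16 * L ^ 2 with hAdef
  have e10 : ‖e‖ ≤ A * h * ‖x - x'‖ + A * h * ‖p - p'‖ := by
    have h1 : (4 * L / ρ ^ 2 * h + L * (2 * h)) * ‖x - x'‖ ≤ A * h * ‖x - x'‖ := by
      gcongr ?_ * _
      rw [hAdef]
      have : 0 ≤ L * h := by positivity
      have : 0 ≤ L ^ 2 * h := by positivity
      linarith
    have h2 : L * (4 * h) * ‖p - p'‖ + 8 * L * h ^ 2 * (L * ‖p - p'‖) +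
        8 * L * h ^ 2 * (L * ‖p - p'‖) ≤ A * h * ‖p - p'‖ := by
      have h3 : h ^ 2 ≤ h := by nlinarith
      have h4 : 0 ≤ 4 * L / ρ ^ 2 := by positivity
      calc _ = (4 * L * h + 16 * L ^ 2 * h ^ 2) * ‖p - p'‖ := by ring
        _ ≤ (4 * L * h + 16 * L ^ 2 * h) * ‖p - p'‖ := by gcongr
        _ ≤ _ := by
          gcongr ?_ * _
          rw [hAdef]
          have := mul_nonneg h4 hh.le
          have : 0 ≤ L * h := by positivity
          linarith
    linarith
  -- With ‖x - x'‖ ≤ ‖e‖ + ‖p - p'‖ the term with ‖e‖ is absorbed, leaving ‖e‖ ≤ (2/31)‖p - p'‖.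
  have hAh : A * h ≤ 1 / 32 := by linarith
  have e11 : A * h * ‖x - x'‖ ≤ 1 / 32 * ‖x - x'‖ := by gcongr
  have e12 : A * h * ‖p - p'‖ ≤ 1 / 32 * ‖p - p'‖ := by gcongr
  linarith [norm_nonneg e, norm_nonneg (p - p')]

end ESFEM

/-! ### Planar charts of the polyhedral surface -/

namespace ESFEM

variable {T : ℝ} {m : ℕ} {S : EvolvingSurface T m} {L r : ℝ} {ν : E3 → E3}

/-- The projection `P` restricts to a chart of the polyhedral surface near the point `c`. -/
structure Mesh.Chart (M : Mesh S) (c : E3) (R d : ℝ) (P : E3 →L[ℝ] R2) : Prop where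
  norm_le : ∀ x, ‖P x‖ ≤ ‖x‖
  inj : ∀ x ∈ M.poly, ∀ y ∈ M.poly, ‖x - c‖ ≤ 4 * R → ‖y - c‖ ≤ 4 * R → P x = P y → x = y
  cover : ∀ y : R2, ‖y‖ ≤ R → ∃ x ∈ M.poly, ‖x - c‖ ≤ 4 * R ∧ P (x - c) = y
  le_det : ∀ K, ∀ ξ ∈ refTri, ‖flatMap (M.vert K) ξ - c‖ ≤ 4 * R →
    d ≤ P (M.vert K 1 - M.vert K 0) 0 * P (M.vert K 2 - M.vert K 0) 1 -
      P (M.vert K 2 - M.vert K 0) 0 * P (M.vert K 1 - M.vert K 0) 1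

/-- A perturbation of the identity with Lipschitz constant 1/4 covers the ball whose radius is
shrunk by the factor 1 - 1/4. -/
theorem surjOn_of_norm_sub_le {f : R2 → R2} {ε : ℝ} (hε : 0 ≤ ε)
    (hf : ∀ x ∈ Metric.closedBall (0 : R2) ε, ∀ y ∈ Metric.closedBall (0 : R2) ε,
      ‖f x - f y - (x - y)‖ ≤ 1 / 4 * ‖x - y‖) :
    SurjOn f (Metric.closedBall 0 ε) (Metric.closedBall (f 0) (3 / 4 * ε)) := by
  have ha : ApproximatesLinearOn f ((ContinuousLinearEquiv.refl ℝ R2 : R2 ≃L[ℝ] R2) : R2 →L[ℝ] R2)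
      (Metric.closedBall 0 ε) (1 / 4) := by
    intro x hx y hy
    simpa using hf x hx y hy
  have h := ha.surjOn_closedBall_of_nonlinearRightInverse
    (ContinuousLinearEquiv.refl ℝ R2).toNonlinearRightInverse hε subset_rfl
  have hn : ((ContinuousLinearEquiv.refl ℝ R2).toNonlinearRightInverse.nnnorm : ℝ) = 1 := by
    change ‖((ContinuousLinearEquiv.refl ℝ R2).symm : R2 →L[ℝ] R2)‖ = 1
    exact ContinuousLinearMap.norm_id
  rw [hn] at h
  norm_num at h
  exact h

theorem Mesh.lipschitz_closestPt {M : Mesh S} {K : Fin M.numTri}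
    (hcl : ∀ ξ ∈ refTri, ∀ η ∈ refTri, ‖(flatMap (M.vert K) ξ - flatMap (M.vert K) η) -
      (closestPt S.init (flatMap (M.vert K) ξ) - closestPt S.init (flatMap (M.vert K) η))‖ ≤ 1 / 8 *
      ‖closestPt S.init (flatMap (M.vert K) ξ) - closestPt S.init (flatMap (M.vert K) η)‖) :
    ContinuousOn (fun ξ => closestPt S.init (flatMap (M.vert K) ξ)) refTri := by
  intro ξ hξ
  rw [ContinuousWithinAt, tendsto_iff_norm_sub_tendsto_zero]
  have h1 : Tendsto (fun η => 2 * ‖flatMap (M.vert K) η - flatMap (M.vert K) ξ‖) (𝓝[refTri] ξ)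
      (𝓝 0) := by
    have : Continuous fun η => 2 * ‖flatMap (M.vert K) η - flatMap (M.vert K) ξ‖ :=
      continuous_const.mul ((continuous_flatMap _).sub continuous_const).norm
    have := (this.tendsto ξ).mono_left (nhdsWithin_le_nhds (s := refTri))
    simpa using this
  refine squeeze_zero' (Eventually.of_forall fun _ => norm_nonneg _) ?_ h1
  filter_upwards [self_mem_nhdsWithin] with η hη
  have h2 := hcl η hη ξ hξ
  have h3 := norm_sub_norm_le
    (closestPt S.init (flatMap (M.vert K) η) - closestPt S.init (flatMap (M.vert K) ξ))
    (flatMap (M.vert K) η - flatMap (M.vert K) ξ)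
  rw [norm_sub_rev] at h2
  linarith [norm_nonneg
    (closestPt S.init (flatMap (M.vert K) η) - closestPt S.init (flatMap (M.vert K) ξ))]

section graph

variable {c e₁ e₂ : E3} {R h : ℝ}

/-- Lifting the plane to the polyhedral surface through the smooth surface. -/
theorem Mesh.exists_graph_lift (M : Mesh S) (hS : SurfaceBounds S L r ν) (hc : c ∈ S.init)
    (hf : Frame (ν c) e₁ e₂) (hR : 100 * (1 + L) ^ 2 * R ≤ min 1 r) (hR0 : 0 < R)
    (hclose : ∀ K, ∀ ξ ∈ refTri,
      ‖flatMap (M.vert K) ξ - closestPt S.init (flatMap (M.vert K) ξ)‖ ≤ h)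
    (hcl : ∀ K, ∀ ξ ∈ refTri, ∀ η ∈ refTri, ‖(flatMap (M.vert K) ξ - flatMap (M.vert K) η) -
      (closestPt S.init (flatMap (M.vert K) ξ) - closestPt S.init (flatMap (M.vert K) η))‖ ≤ 1 / 8 *
      ‖closestPt S.init (flatMap (M.vert K) ξ) - closestPt S.init (flatMap (M.vert K) η)‖) :
    ∃ X : R2 → E3, (∀ y ∈ Metric.closedBall (0 : R2) (R / 4), X y ∈ M.poly ∧
        ‖X y - c‖ ≤ 2 * ‖y‖ + h ∧ ‖frameProj e₁ e₂ (X y - c) - y‖ ≤ h ∧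
        frameProj e₁ e₂ (closestPt S.init (X y) - c) = y ∧ ‖closestPt S.init (X y) - c‖ ≤ R) ∧
      ∀ y ∈ Metric.closedBall (0 : R2) (R / 4), ∀ z ∈ Metric.closedBall (0 : R2) (R / 4),
        ‖frameProj e₁ e₂ (X y - c) - frameProj e₁ e₂ (X z - c) - (y - z)‖ ≤ 1 / 4 * ‖y - z‖ := by
  have hex : ∀ y : R2, ∃ x : E3, y ∈ Metric.closedBall (0 : R2) (R / 4) →
      x ∈ M.poly ∧ ‖closestPt S.init x - c‖ ≤ 2 * ‖y‖ ∧
        frameProj e₁ e₂ (closestPt S.init x - c) = y := by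
    intro y
    by_cases hy : y ∈ Metric.closedBall (0 : R2) (R / 4)
    · obtain ⟨p, hp, hpc, hpy⟩ := exists_mem_init_of_frame hS hc hf hR
        (mem_closedBall_zero_iff.1 hy)
      obtain ⟨x, hx, hxp⟩ := M.bijective.surjOn hp
      exact ⟨x, fun _ => ⟨hx, by rw [hxp]; exact hpc, by rw [hxp]; exact hpy⟩⟩
    · exact ⟨0, fun h => absurd h hy⟩
  choose X hX using hex
  have hn : ∀ x ∈ M.poly, ‖x - closestPt S.init x‖ ≤ h := by
    intro x hx
    obtain ⟨K, ξ, hξ, rfl⟩ := M.mem_poly_iff.1 hx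
    exact hclose K ξ hξ
  set D := Metric.closedBall (0 : R2) (R / 4) with hD
  have hpR : ∀ y ∈ D, ‖closestPt S.init (X y) - c‖ ≤ R := fun y hy => by
    have := (hX y hy).2.1
    have := mem_closedBall_zero_iff.1 hy
    linarith
  have hlip : ∀ y ∈ D, ∀ z ∈ D, ‖closestPt S.init (X y) - closestPt S.init (X z)‖ ≤
      2 * ‖y - z‖ := by
    intro y hy z hz
    have h1 := norm_sub_le_of_frame hS hc hf hR hR0 (M.closestPt_mem (hX z hz).1)
      (M.closestPt_mem (hX y hy).1) (hpR z hz) (hpR y hy)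
    rwa [← sub_sub_sub_cancel_right _ _ c, map_sub, (hX y hy).2.2, (hX z hz).2.2,
      sub_sub_sub_cancel_right] at h1
  have hcont : ContinuousOn (fun y => closestPt S.init (X y)) D := by
    refine (LipschitzOnWith.of_dist_le_mul (K := 2) fun y hy z hz => ?_).continuousOn
    rw [dist_eq_norm, dist_eq_norm]
    exact hlip y hy z hz
  refine ⟨X, fun y hy => ⟨(hX y hy).1, ?_, ?_, (hX y hy).2.2, hpR y hy⟩, fun y hy z hz => ?_⟩
  · calc _ = ‖(X y - closestPt S.init (X y)) + (closestPt S.init (X y) - c)‖ := by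
          rw [sub_add_sub_cancel]
      _ ≤ _ := norm_add_le _ _
      _ ≤ _ := by linarith [hn _ (hX y hy).1, (hX y hy).2.1]
  · calc _ = ‖frameProj e₁ e₂ (X y - closestPt S.init (X y))‖ := by
          conv_lhs => rw [← (hX y hy).2.2, ← map_sub, (hX y hy).2.2, sub_sub_sub_cancel_right]
      _ ≤ _ := hf.norm_proj_le _
      _ ≤ _ := hn _ (hX y hy).1
  · have hcomp : ∀ K, IsCompact ((fun ξ => closestPt S.init (flatMap (M.vert K) ξ)) '' refTri) :=
      fun K => isCompact_refTri.image_of_continuousOn (Mesh.lipschitz_closestPt (hcl K))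
    have hpiece : ∀ K, ∀ y ∈ D, closestPt S.init (X y) ∈
        (fun ξ => closestPt S.init (flatMap (M.vert K) ξ)) '' refTri →
        ∃ ξ ∈ refTri, X y = flatMap (M.vert K) ξ := by
      rintro K y hy ⟨ξ, hξ, he⟩
      exact ⟨ξ, hξ, (M.bijective.injOn (M.flatMap_mem_poly K hξ) (hX y hy).1 he).symm⟩
    -- On the part of the disc belonging to one triangle the deviation from the identity is
    -- 1/4-Lipschitz by the estimate for a single triangle. These parts are closed, finite in number
    -- and cover the convex disc, so the bound holds on all of it.
    have := dist_le_of_finite_closed_cover (ι := Fin M.numTri)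
      (C := fun K => D ∩ (fun y => closestPt S.init (X y)) ⁻¹'
        ((fun ξ => closestPt S.init (flatMap (M.vert K) ξ)) '' refTri))
      (fun K => hcont.preimage_isClosed_of_isClosed Metric.isClosed_closedBall (hcomp K).isClosed)
      (s := D) (convex_closedBall _ _) (fun y hy => by
        obtain ⟨K, ξ, hξ, he⟩ := M.mem_poly_iff.1 (hX y hy).1
        exact mem_iUnion.2 ⟨K, hy, ξ, hξ, by simp only [he]⟩)
      (f := fun y => frameProj e₁ e₂ (X y - c) - y) (M := 1 / 4) (fun K y hy z hz => by
        obtain ⟨ξ, hξ, hey⟩ := hpiece K y hy.2 hy.1.2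
        obtain ⟨η, hη, hez⟩ := hpiece K z hz.2 hz.1.2
        rw [dist_eq_norm, dist_eq_norm]
        have h1 := hcl K ξ hξ η hη
        rw [← hey, ← hez] at h1
        calc _ = ‖frameProj e₁ e₂ ((X y - X z) -
              (closestPt S.init (X y) - closestPt S.init (X z)))‖ := by
              have e1 : frameProj e₁ e₂ ((X y - X z) -
                  (closestPt S.init (X y) - closestPt S.init (X z))) =
                  (frameProj e₁ e₂ (X y - c) - frameProj e₁ e₂ (X z - c)) -
                    (frameProj e₁ e₂ (closestPt S.init (X y) - c) -
                      frameProj e₁ e₂ (closestPt S.init (X z) - c)) := by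
                simp only [map_sub]; abel
              rw [e1, (hX y hy.2).2.2, (hX z hz.2).2.2, sub_sub_sub_comm]
          _ ≤ _ := hf.norm_proj_le _
          _ ≤ _ := h1
          _ ≤ 1 / 8 * (2 * ‖y - z‖) := by gcongr; exact hlip y hy.2 z hz.2
          _ = _ := by ring) hy hz
    rw [dist_eq_norm, dist_eq_norm] at this
    rwa [sub_sub_sub_comm] at this

end graph

/-- The map y ↦ P(X y - c) is a 1/4-Lipschitz perturbation of the identity on a disc of radius
independent of the mesh. Therefore it is injective and covers a smaller disc: near c the whole
polyhedron, not merely each triangle, is a graph over the tangent plane. -/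
theorem Mesh.exists_chart (hS : SurfaceBounds S L r ν) (hT : 0 < T) {kg : ℕ} (hkg : 1 ≤ kg)
    {ρ : ℝ} (hρ : 0 < ρ) : ∃ R > 0, ∃ h₀ > 0, ∀ M : Mesh S, M.QuasiUniform kg ρ →
      M.size kg < h₀ → ∀ c ∈ S.init, ∃ P, M.Chart c R (ρ ^ 2 / 4 * M.size kg ^ 2) P := by
  have hL := hS.one_le
  have hmin : 0 < min 1 r := lt_min one_pos hS.r_pos
  set R₁ := min 1 r / (100 * (1 + L) ^ 2) with hR₁
  have hR₁0 : 0 < R₁ := by positivity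
  have hR : 100 * (1 + L) ^ 2 * R₁ ≤ min 1 r := by
    rw [hR₁]; exact (mul_div_cancel₀ _ (by positivity)).le
  set A := 4 * L / ρ ^ 2 + 6 * L + 16 * L ^ 2 with hA
  have hA0 : 0 < A := by positivity
  set h₀ := min (min 1 r / (8 * (1 + L) * (1 + 3 * L))) (min (R₁ / 200)
    (min (ρ ^ 2 / (32 * L)) (1 / (32 * A)))) with hh₀
  have hRL : L * R₁ ≤ 1 / 100 := by
    have h1 : 100 * (1 + L) ^ 2 * R₁ ≤ 1 := hR.trans (min_le_left _ _)
    have h2 : L * R₁ ≤ (1 + L) ^ 2 * R₁ := by gcongr; nlinarith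
    linarith
  -- Polyhedral points within 4 · R₁/32 = R₁/8 of c have closest points within R₁/4, the radius of
  -- the disc on which X is defined.
  refine ⟨R₁ / 32, by positivity, h₀, by positivity, fun M hM hsize c hc => ?_⟩
  obtain ⟨e₁, e₂, hf⟩ := exists_frame (hS.normal c hc).norm_eq
  have hne : Nonempty (Fin M.numTri) := by
    obtain ⟨x, hx, -⟩ := M.bijective.surjOn hc
    obtain ⟨K, -⟩ := mem_iUnion.1 hx
    exact ⟨K⟩
  have hh := M.size_pos hT hkg hne.some
  have hfine : M.Fine L r (M.size kg) := by
    have : M.size kg < min 1 r / (8 * (1 + L) * (1 + 3 * L)) :=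
      lt_of_lt_of_le hsize (min_le_left _ _)
    rw [lt_div_iff₀ (by positivity)] at this
    rw [Mesh.Fine]; linarith
  have hhR : M.size kg ≤ R₁ / 200 := hsize.le.trans ((min_le_right _ _).trans (min_le_left _ _))
  have hh3 := hsize.le.trans ((min_le_right _ _).trans ((min_le_right _ _).trans (min_le_left _ _)))
  have hh4 := hsize.le.trans ((min_le_right _ _).trans ((min_le_right _ _).trans (min_le_right _ _)))
  rw [le_div_iff₀ (by positivity)] at hh3 hh4
  have hAh : 32 * A * M.size kg ≤ 1 := by linarith
  have h16 : 16 * L * M.size kg ≤ ρ ^ 2 := by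
    have : 0 ≤ L * M.size kg := by positivity
    linarith
  have h4 : 4 * L * M.size kg ≤ ρ ^ 2 := by
    have : 0 ≤ L * M.size kg := by positivity
    linarith
  have hh1 : M.size kg ≤ 1 := by
    have : R₁ ≤ L * R₁ := le_mul_of_one_le_left hR₁0.le hL
    linarith
  have hcl := fun K ξ (hξ : ξ ∈ refTri) η (hη : η ∈ refTri) =>
    closestPt_sub_closestPt M hS hT hkg hfine hρ hM h4 hh1 hAh K hξ hη
  have hclose : ∀ K, ∀ ξ ∈ refTri, ‖flatMap (M.vert K) ξ -
      closestPt S.init (flatMap (M.vert K) ξ)‖ ≤ M.size kg := by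
    intro K ξ hξ
    refine (M.norm_flatMap_sub_closestPt_le hS hT hkg hfine K hξ).trans ?_
    have := hfine.mul_le_one hL hh
    nlinarith
  obtain ⟨X, hX, hXl⟩ := M.exists_graph_lift hS hc hf hR hR₁0 hclose hcl
  have hν : ∀ K, ∀ ξ ∈ refTri, ‖flatMap (M.vert K) ξ - c‖ ≤ 4 * (R₁ / 32) →
      ‖ν (M.vert K 0) - ν c‖ ≤ 1 / 8 := by
    intro K ξ hξ hξc
    refine (hS.normal_lip _ (M.vert_mem K 0) _ hc).trans ?_
    have h1 : ‖flatMap (M.vert K) ξ - M.vert K 0‖ ≤ M.size kg :=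
      norm_flatMap_sub_le (fun i => M.norm_vert_sub_le hT hkg K i 0) hξ
    rw [norm_sub_rev] at h1
    have h2 : ‖M.vert K 0 - c‖ ≤ R₁ := by
      calc _ = ‖(M.vert K 0 - flatMap (M.vert K) ξ) + (flatMap (M.vert K) ξ - c)‖ := by
            rw [sub_add_sub_cancel]
        _ ≤ _ := norm_add_le _ _
        _ ≤ _ := by linarith
    calc L * ‖M.vert K 0 - c‖ ≤ L * R₁ := by gcongr
      _ ≤ _ := by linarith
  -- A polyhedral point near c is recovered as X y, where y is the projection of its closest point:
  -- the projection is injective on the surface near c, and closest points determine polyhedral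
  -- points.
  have huniq : ∀ x ∈ M.poly, ‖x - c‖ ≤ 4 * (R₁ / 32) →
      ∃ y ∈ Metric.closedBall (0 : R2) (R₁ / 4), X y = x := by
    intro x hx hxc
    obtain ⟨K, ξ, hξ, rfl⟩ := M.mem_poly_iff.1 hx
    set p := closestPt S.init (flatMap (M.vert K) ξ) with hp
    have h1 := hclose K ξ hξ
    rw [← hp, norm_sub_rev] at h1
    have hpc : ‖p - c‖ ≤ R₁ / 4 := by
      calc _ = ‖(p - flatMap (M.vert K) ξ) + (flatMap (M.vert K) ξ - c)‖ := by
            rw [sub_add_sub_cancel]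
        _ ≤ _ := norm_add_le _ _
        _ ≤ _ := by linarith
    obtain ⟨y, hyp⟩ : ∃ y, frameProj e₁ e₂ (p - c) = y := ⟨_, rfl⟩
    have hy : y ∈ Metric.closedBall (0 : R2) (R₁ / 4) :=
      mem_closedBall_zero_iff.2 (hyp ▸ (hf.norm_proj_le _).trans hpc)
    refine ⟨_, hy, M.bijective.injOn (hX _ hy).1 hx ?_⟩
    have h2 := norm_sub_le_of_frame hS hc hf hR hR₁0 (M.closestPt_mem hx)
      (M.closestPt_mem (hX _ hy).1) (hpc.trans (by linarith)) (hX _ hy).2.2.2.2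
    rw [← sub_sub_sub_cancel_right _ _ c, map_sub, (hX _ hy).2.2.2.1, ← hp, hyp, sub_self,
      norm_zero, mul_zero, sub_sub_sub_cancel_right] at h2
    exact sub_eq_zero.1 (norm_le_zero_iff.1 h2)
  refine ⟨frameProj e₁ e₂, hf.norm_proj_le, ?_, ?_, ?_⟩
  · intro x hx x' hx' hxc hxc' he
    obtain ⟨y, hy, rfl⟩ := huniq x hx hxc
    obtain ⟨z, hz, rfl⟩ := huniq x' hx' hxc'
    have h1 := hXl y hy z hz
    rw [← map_sub, sub_sub_sub_cancel_right, map_sub, he, sub_self, zero_sub, norm_neg] at h1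
    have : ‖y - z‖ ≤ 0 := by linarith [norm_nonneg (y - z)]
    rw [sub_eq_zero.1 (norm_le_zero_iff.1 this)]
  · intro y hy
    have hs := surjOn_of_norm_sub_le (ε := R₁ / 4) (by positivity) hXl
    have h0 : ‖frameProj e₁ e₂ (X 0 - c) - 0‖ ≤ M.size kg :=
      (hX 0 (Metric.mem_closedBall_self (by positivity))).2.2.1
    have hmem : y ∈ Metric.closedBall (frameProj e₁ e₂ (X 0 - c)) (3 / 4 * (R₁ / 4)) := by
      rw [mem_closedBall_iff_norm]
      rw [sub_zero] at h0
      refine (norm_sub_le _ _).trans ?_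
      linarith
    obtain ⟨z, hz, he⟩ := hs hmem
    obtain ⟨h1, h2, h3, -⟩ := hX z hz
    refine ⟨X z, h1, ?_, he⟩
    have he' : frameProj e₁ e₂ (X z - c) = y := he
    rw [he'] at h3
    have h5 : ‖z‖ ≤ ‖y‖ + M.size kg := by
      have := norm_sub_norm_le z y
      rw [norm_sub_rev] at this
      linarith
    linarith
  · intro K ξ hξ hξc
    have h1 := (M.tangential hS hT hkg hfine hρ hM h4 K).2 (ν c) (hS.normal c hc).norm_eq.le
      ((hν K ξ hξ hξc).trans (by norm_num)) h16
    rwa [hf.det_eq]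

end ESFEM

/-! ### Finite element functions as Lipschitz functions on the plane -/

namespace ESFEM

variable {T : ℝ} {m : ℕ} {S : EvolvingSurface T m}

namespace Mesh

/-- The triangles that lie within distance `R` of `c`. -/
noncomputable def near (M : Mesh S) (c : E3) (R : ℝ) : Finset (Fin M.numTri) := by
  classical exact Finset.univ.filter fun K => ∀ ξ ∈ refTri, ‖flatMap (M.vert K) ξ - c‖ < R

theorem mem_near {M : Mesh S} {c : E3} {R : ℝ} {K : Fin M.numTri} :
    K ∈ M.near c R ↔ ∀ ξ ∈ refTri, ‖flatMap (M.vert K) ξ - c‖ < R := by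
  simp [near]

/-- A triangle in the coordinates of a chart. -/
noncomputable def chartMap (M : Mesh S) (c : E3) (P : E3 →L[ℝ] R2) (K : Fin M.numTri) (ξ : R2) :
    R2 := P (flatMap (M.vert K) ξ - c)

/-- The matrix of the linear part of `chartMap`. -/
noncomputable def chartMatrix (M : Mesh S) (P : E3 →L[ℝ] R2) (K : Fin M.numTri) :
    Matrix (Fin 2) (Fin 2) ℝ :=
  Matrix.of fun i j => P (M.vert K j.succ - M.vert K 0) i

/-- The linear part of `chartMap`. -/
noncomputable def chartLin (M : Mesh S) (P : E3 →L[ℝ] R2) (K : Fin M.numTri) : R2 →L[ℝ] R2 :=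
  LinearMap.toContinuousLinearMap (Matrix.toLin' (M.chartMatrix P K))

variable {M : Mesh S} {c : E3} {R d : ℝ} {P : E3 →L[ℝ] R2} {K : Fin M.numTri}

theorem det_chartLin : (M.chartLin P K).det = (M.chartMatrix P K).det := by
  rw [chartLin, LinearMap.det_toContinuousLinearMap, LinearMap.det_toLin']

theorem chartLin_apply (w : R2) (i : Fin 2) : M.chartLin P K w i =
    M.chartMatrix P K i 0 * w 0 + M.chartMatrix P K i 1 * w 1 := by
  simp [chartLin, Matrix.toLin'_apply, Matrix.mulVec, dotProduct, Fin.sum_univ_two]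

theorem chartMap_add (ξ w : R2) : M.chartMap c P K (ξ + w) =
    M.chartMap c P K ξ + M.chartLin P K w := by
  have e : flatMap (M.vert K) (ξ + w) - c = (flatMap (M.vert K) ξ - c) +
      (w 0 • (M.vert K 1 - M.vert K 0) + w 1 • (M.vert K 2 - M.vert K 0)) := by
    rw [flatMap_eq, flatMap_eq, Pi.add_apply, Pi.add_apply]; module
  ext i
  rw [chartMap, e, map_add, map_add, map_smul, map_smul, Pi.add_apply, Pi.add_apply, Pi.add_apply,
    chartLin_apply]
  simp [chartMap, chartMatrix, mul_comm]

theorem hasFDerivAt_chartMap (ξ : R2) :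
    HasFDerivAt (M.chartMap c P K) (M.chartLin P K) ξ := by
  have e : M.chartMap c P K = fun ξ => M.chartMap c P K 0 + M.chartLin P K ξ := by
    ext ξ : 1
    rw [← chartMap_add, zero_add]
  rw [e]
  exact (M.chartLin P K).hasFDerivAt.const_add _

theorem continuous_chartMap : Continuous (M.chartMap c P K) :=
  continuous_iff_continuousAt.2 fun ξ => (hasFDerivAt_chartMap ξ).continuousAt

theorem det_chartMatrix : (M.chartMatrix P K).det =
    P (M.vert K 1 - M.vert K 0) 0 * P (M.vert K 2 - M.vert K 0) 1 -
      P (M.vert K 2 - M.vert K 0) 0 * P (M.vert K 1 - M.vert K 0) 1 := by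
  rw [Matrix.det_fin_two]; rfl

theorem det_mul_eq (ξ η : R2) (i : Fin 2) : (M.chartMatrix P K).det * (ξ i - η i) =
    ((M.chartMatrix P K).adjugate *ᵥ (M.chartMap c P K ξ - M.chartMap c P K η)) i := by
  have e := M.chartMap_add (c := c) (P := P) (K := K) η (ξ - η)
  rw [add_sub_cancel] at e
  rw [e, add_sub_cancel_left]
  have : M.chartLin P K (ξ - η) = M.chartMatrix P K *ᵥ (ξ - η) := by
    simp [chartLin, Matrix.toLin'_apply]
  rw [this, Matrix.mulVec_mulVec, Matrix.adjugate_mul, Matrix.smul_mulVec, Matrix.one_mulVec]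
  simp

theorem chartMap_injective (h : 0 < (M.chartMatrix P K).det) :
    Function.Injective (M.chartMap c P K) := by
  intro ξ η he
  ext i
  have := det_mul_eq (M := M) (c := c) (P := P) (K := K) ξ η i
  rw [he, sub_self, Matrix.mulVec_zero, Pi.zero_apply, mul_eq_zero] at this
  exact sub_eq_zero.1 (this.resolve_left h.ne')

theorem exists_norm_sub_le (h : 0 < (M.chartMatrix P K).det) : ∃ B ≥ 0, ∀ ξ η : R2,
    ‖ξ - η‖ ≤ B * ‖M.chartMap c P K ξ - M.chartMap c P K η‖ := by
  let Φ : R2 →L[ℝ] R2 := LinearMap.toContinuousLinearMap (Matrix.toLin' (M.chartMatrix P K).adjugate)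
  refine ⟨((M.chartMatrix P K).det)⁻¹ * ‖Φ‖, by positivity, fun ξ η => ?_⟩
  have e : ξ - η = ((M.chartMatrix P K).det)⁻¹ • Φ (M.chartMap c P K ξ - M.chartMap c P K η) := by
    ext i
    have := det_mul_eq (M := M) (c := c) (P := P) (K := K) ξ η i
    rw [Pi.sub_apply, Pi.smul_apply, smul_eq_mul, eq_inv_mul_iff_mul_eq₀ h.ne', this]
    simp [Φ, Matrix.toLin'_apply]
  rw [e, norm_smul, norm_inv, Real.norm_eq_abs, abs_of_pos h, mul_assoc]
  gcongr
  exact Φ.le_opNorm _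

/-- The function on the plane that represents a finite element function in a chart. -/
noncomputable def chartFn (M : Mesh S) (c : E3) (R : ℝ) (P : E3 →L[ℝ] R2) (a : ScalarFn M)
    (y : R2) : ℝ := by
  classical exact
    if h : ∃ K ξ, ξ ∈ refTri ∧ ‖flatMap (M.vert K) ξ - c‖ ≤ 4 * R ∧ M.chartMap c P K ξ = y then
      MvPolynomial.eval h.choose_spec.choose (a h.choose) else 0

variable {a : ScalarFn M} {k : ℕ}

/-- The value does not depend on the chosen preimage: by injectivity of the chart two preimages are
the same point of the polyhedron, where a finite element function is single-valued. -/
theorem Chart.chartFn_chartMap (hC : M.Chart c R d P) (ha : a ∈ M.scalarSpace k) {ξ : R2}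
    (hξ : ξ ∈ refTri) (hξc : ‖flatMap (M.vert K) ξ - c‖ ≤ 4 * R) :
    M.chartFn c R P a (M.chartMap c P K ξ) = MvPolynomial.eval ξ (a K) := by
  have h : ∃ K' ξ', ξ' ∈ refTri ∧ ‖flatMap (M.vert K') ξ' - c‖ ≤ 4 * R ∧
      M.chartMap c P K' ξ' = M.chartMap c P K ξ := ⟨K, ξ, hξ, hξc, rfl⟩
  rw [chartFn, dif_pos h]
  obtain ⟨h1, h2, h3⟩ := h.choose_spec.choose_spec
  refine ha.2 _ _ _ h1 _ hξ (hC.inj _ (M.flatMap_mem_poly _ h1) _ (M.flatMap_mem_poly _ hξ) h2 hξc ?_)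
  have h4 : P (flatMap (M.vert _) _ - c) = P (flatMap (M.vert K) ξ - c) := h3
  rw [map_sub, map_sub] at h4
  exact sub_left_injective h4

theorem Chart.chartFn_eq_zero (hC : M.Chart c R d P) (ha : a ∈ M.scalarSpace k)
    (hs : ∀ K, K ∉ M.near c R → a K = 0) {y : R2}
    (hy : ∀ K ∈ M.near c R, ∀ ξ ∈ refTri, M.chartMap c P K ξ ≠ y) : M.chartFn c R P a y = 0 := by
  by_cases h : ∃ K ξ, ξ ∈ refTri ∧ ‖flatMap (M.vert K) ξ - c‖ ≤ 4 * R ∧ M.chartMap c P K ξ = y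
  · obtain ⟨K, ξ, hξ, hξc, rfl⟩ := h
    rw [hC.chartFn_chartMap ha hξ hξc]
    by_cases hK : K ∈ M.near c R
    · exact absurd rfl (hy K hK ξ hξ)
    · rw [hs K hK, map_zero]
  · rw [chartFn, dif_neg h]

theorem Chart.chartFn_eq_zero_of_norm (hC : M.Chart c R d P)
    (ha : a ∈ M.scalarSpace k) (hs : ∀ K, K ∉ M.near c R → a K = 0) {y : R2} (hy : R ≤ ‖y‖) :
    M.chartFn c R P a y = 0 := by
  refine hC.chartFn_eq_zero ha hs fun K hK ξ hξ he => ?_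
  have h1 := mem_near.1 hK ξ hξ
  have h2 := hC.norm_le (flatMap (M.vert K) ξ - c)
  rw [chartMap] at he
  rw [he] at h2
  linarith

theorem Chart.hasCompactSupport_chartFn (hC : M.Chart c R d P)
    (ha : a ∈ M.scalarSpace k) (hs : ∀ K, K ∉ M.near c R → a K = 0) :
    HasCompactSupport (M.chartFn c R P a) := by
  refine HasCompactSupport.intro (isCompact_closedBall (0 : R2) R) fun y hy => ?_
  rw [mem_closedBall_zero_iff, not_le] at hy
  exact hC.chartFn_eq_zero_of_norm ha hs hy.le

theorem Chart.det_pos (hC : M.Chart c R d P) (hd : 0 < d) {ξ : R2} (hξ : ξ ∈ refTri)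
    (hξc : ‖flatMap (M.vert K) ξ - c‖ ≤ 4 * R) : 0 < (M.chartMatrix P K).det := by
  rw [det_chartMatrix]
  exact hd.trans_le (hC.le_det K ξ hξ hξc)

/-- The plane is covered by the closed set where ‖y‖ ≥ R, on which the function vanishes, and by the
images of finitely many compact pieces of triangles, on which it is a polynomial after an affine
change of variables. Lipschitz bounds on closed pieces glue along segments. The ball of radius 4R
contains all the preimages supplied by `cover`. -/
theorem Chart.exists_lipschitzWith_chartFn (hC : M.Chart c R d P) (hd : 0 < d)
    (ha : a ∈ M.scalarSpace k) (hs : ∀ K, K ∉ M.near c R → a K = 0) :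
    ∃ D, LipschitzWith D (M.chartFn c R P a) := by
  have hex : ∀ K, ∃ B ≥ 0, ∀ ξ ∈ refTri, ∀ η ∈ refTri, ‖flatMap (M.vert K) ξ - c‖ ≤ 4 * R →
      |MvPolynomial.eval ξ (a K) - MvPolynomial.eval η (a K)| ≤
        B * ‖M.chartMap c P K ξ - M.chartMap c P K η‖ := by
    intro K
    by_cases h : 0 < (M.chartMatrix P K).det
    · obtain ⟨B, hB0, hB⟩ := exists_norm_sub_le (c := c) h
      obtain ⟨B', hB0', hB'⟩ := exists_lipschitz_eval (a K)
      refine ⟨B' * B, by positivity, fun ξ hξ η hη _ => (hB' ξ hξ η hη).trans ?_⟩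
      rw [mul_assoc]
      exact mul_le_mul_of_nonneg_left (hB ξ η) hB0'
    · exact ⟨0, le_rfl, fun ξ hξ η hη hc => absurd (hC.det_pos hd hξ hc) h⟩
  choose B hB0 hB using hex
  have hBs : ∀ K, B K ≤ ∑ K, B K := fun K =>
    Finset.single_le_sum (fun K _ => hB0 K) (Finset.mem_univ K)
  have hs0 : 0 ≤ ∑ K, B K := Finset.sum_nonneg fun K _ => hB0 K
  refine ⟨⟨∑ K, B K, hs0⟩, LipschitzWith.of_dist_le_mul fun y z => ?_⟩
  refine dist_le_of_finite_closed_cover (ι := Option (Fin M.numTri)) (s := univ)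
    (C := fun o => o.elim {y | R ≤ ‖y‖} fun K =>
      M.chartMap c P K '' (refTri ∩ {ξ | ‖flatMap (M.vert K) ξ - c‖ ≤ 4 * R})) ?_ convex_univ ?_ ?_
      (mem_univ y) (mem_univ z)
  · rintro (_ | K)
    · exact isClosed_le continuous_const continuous_norm
    · refine ((isCompact_refTri.inter_right ?_).image continuous_chartMap).isClosed
      exact isClosed_le ((continuous_flatMap _).sub continuous_const).norm continuous_const
  · intro y _
    rw [mem_iUnion]
    rcases le_total R ‖y‖ with h | h
    · exact ⟨none, h⟩
    · obtain ⟨x, hx, hxc, hxy⟩ := hC.cover y h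
      obtain ⟨K, ξ, hξ, rfl⟩ := M.mem_poly_iff.1 hx
      exact ⟨some K, ξ, ⟨hξ, hxc⟩, hxy⟩
  · rintro (_ | K) y ⟨hy, -⟩ z ⟨hz, -⟩
    · rw [hC.chartFn_eq_zero_of_norm ha hs hy, hC.chartFn_eq_zero_of_norm ha hs hz, dist_self]
      positivity
    · obtain ⟨ξ, ⟨hξ, hξc⟩, rfl⟩ := hy
      obtain ⟨η, ⟨hη, hηc⟩, rfl⟩ := hz
      rw [hC.chartFn_chartMap ha hξ hξc, hC.chartFn_chartMap ha hη hηc, dist_eq_norm, dist_eq_norm]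
      refine (hB K ξ hξ η hη hξc).trans ?_
      gcongr
      exact hBs K

theorem Chart.lineDeriv_chartFn (hC : M.Chart c R d P) (ha : a ∈ M.scalarSpace k)
    (hK : K ∈ M.near c R) (hR : 0 ≤ R) {ξ : R2} (hξ : ξ ∈ openTri) (w : R2) :
    lineDeriv ℝ (M.chartFn c R P a) (M.chartMap c P K ξ) (M.chartLin P K w) =
      ∑ j, w j * MvPolynomial.eval ξ (MvPolynomial.pderiv j (a K)) := by
  have hlin : HasDerivAt (fun t : ℝ => ξ + t • w) w 0 := by
    simpa using ((hasDerivAt_id (0 : ℝ)).smul_const w).const_add ξ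
  have h1 : HasDerivAt (fun t : ℝ => MvPolynomial.eval (ξ + t • w) (a K))
      (∑ j, w j * MvPolynomial.eval ξ (MvPolynomial.pderiv j (a K))) 0 := by
    have := (hasFDerivAt_eval (a K) (ξ + (0 : ℝ) • w)).comp_hasDerivAt (0 : ℝ) hlin
    refine this.congr_deriv ?_
    simp [mul_comm]
  refine HasDerivAt.deriv (h1.congr_of_eventuallyEq ?_)
  have hmem : ∀ᶠ t : ℝ in 𝓝 0, ξ + t • w ∈ openTri := by
    refine hlin.continuousAt.eventually_mem ?_
    rw [zero_smul, add_zero]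
    exact isOpen_openTri.mem_nhds hξ
  filter_upwards [hmem] with t ht
  rw [← map_smul, ← chartMap_add]
  refine hC.chartFn_chartMap ha (openTri_subset_refTri ht) ?_
  have := mem_near.1 hK _ (openTri_subset_refTri ht)
  linarith

theorem Chart.lineDeriv_chartFn_eq_zero (hC : M.Chart c R d P)
    (ha : a ∈ M.scalarSpace k) (hs : ∀ K, K ∉ M.near c R → a K = 0) {y : R2}
    (hy : y ∉ ⋃ K ∈ M.near c R, M.chartMap c P K '' refTri) (v : R2) :
    lineDeriv ℝ (M.chartFn c R P a) y v = 0 := by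
  refine lineDeriv_eq_zero_of_eventuallyEq ?_ v
  have hcl : IsClosed (⋃ K ∈ M.near c R, M.chartMap c P K '' refTri) :=
    isClosed_biUnion_finset fun K _ => (isCompact_refTri.image continuous_chartMap).isClosed
  filter_upwards [hcl.isOpen_compl.mem_nhds hy] with z hz
  refine hC.chartFn_eq_zero ha hs fun K hK ξ hξ he => hz ?_
  exact mem_biUnion hK ⟨ξ, hξ, he⟩

end Mesh

end ESFEM

/-! ### Change of variables in charts and Jacobian determinants -/

namespace ESFEM

variable {T : ℝ} {m : ℕ} {S : EvolvingSurface T m}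

namespace Mesh

variable {M : Mesh S} {c : E3} {R d : ℝ} {P : E3 →L[ℝ] R2} {K : Fin M.numTri}

theorem Chart.det_pos_of_near (hC : M.Chart c R d P) (hd : 0 < d) (hR : 0 ≤ R)
    (hK : K ∈ M.near c R) : 0 < (M.chartMatrix P K).det := by
  have h0 : (0 : R2) ∈ refTri := by simp [refTri]
  refine hC.det_pos hd h0 ((mem_near.1 hK _ h0).le.trans ?_)
  linarith

theorem Chart.pairwiseDisjoint (hC : M.Chart c R d P) (hR : 0 ≤ R) :
    (M.near c R : Set (Fin M.numTri)).PairwiseDisjoint fun K => M.chartMap c P K '' openTri := by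
  intro K hK K' hK' hne
  refine disjoint_left.2 ?_
  rintro _ ⟨ξ, hξ, rfl⟩ ⟨η, hη, he⟩
  have hξ' := openTri_subset_refTri hξ
  have hη' := openTri_subset_refTri hη
  refine hne (M.eq_of_flatMap_eq hξ hη' ?_)
  have h1 := mem_near.1 hK ξ hξ'
  have h2 := mem_near.1 hK' η hη'
  refine hC.inj _ (M.flatMap_mem_poly _ hξ') _ (M.flatMap_mem_poly _ hη') (by linarith)
    (by linarith) ?_
  have h4 : P (flatMap (M.vert K') η - c) = P (flatMap (M.vert K) ξ - c) := he
  rw [map_sub, map_sub] at h4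
  exact (sub_left_injective h4).symm

/-- The affine images of the triangle boundaries are null sets. -/
theorem ae_notMem_of_notMem (c : E3) (P : E3 →L[ℝ] R2) (s : Finset (Fin M.numTri)) :
    ∀ᵐ y : R2, y ∉ (⋃ K ∈ s, M.chartMap c P K '' openTri) →
      y ∉ ⋃ K ∈ s, M.chartMap c P K '' refTri := by
  have hnull : volume (⋃ K ∈ s, M.chartMap c P K '' (refTri \ openTri)) = 0 := by
    refine (measure_biUnion_null_iff s.countable_toSet).2 fun K _ => ?_
    refine addHaar_image_eq_zero_of_differentiableOn_of_addHaar_eq_zero _ (fun ξ _ =>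
      (hasFDerivAt_chartMap ξ).differentiableAt.differentiableWithinAt) ?_
    exact (ae_le_set.1 openTri_ae_eq_refTri.symm.le)
  filter_upwards [compl_mem_ae_iff.2 hnull] with y hy h1 h2
  simp only [mem_iUnion, mem_image, exists_prop, not_exists, not_and] at h1
  simp only [mem_iUnion, mem_image, exists_prop] at h2
  obtain ⟨K, hK, ξ, hξ, he⟩ := h2
  refine hy (mem_biUnion hK ⟨ξ, ⟨hξ, fun hξ' => h1 K hK ξ hξ' he⟩, he⟩)

theorem Chart.lintegral_eq (hC : M.Chart c R d P) (hd : 0 < d) (hR : 0 ≤ R)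
    {Ψ : R2 → ENNReal} (h0 : ∀ y ∉ ⋃ K ∈ M.near c R, M.chartMap c P K '' refTri, Ψ y = 0) :
    ∫⁻ y, Ψ y = ∑ K ∈ M.near c R, ∫⁻ ξ in openTri,
      ENNReal.ofReal (M.chartMatrix P K).det * Ψ (M.chartMap c P K ξ) := by
  have hm : ∀ K ∈ M.near c R, MeasurableSet (M.chartMap c P K '' openTri) := fun K hK =>
    isOpen_openTri.measurableSet.image_of_continuousOn_injOn continuous_chartMap.continuousOn
      (chartMap_injective (hC.det_pos_of_near hd hR hK)).injOn
  have e1 : ∫⁻ y, Ψ y = ∫⁻ y in ⋃ K ∈ M.near c R, M.chartMap c P K '' openTri, Ψ y := by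
    rw [← lintegral_indicator (Finset.measurableSet_biUnion _ hm)]
    refine lintegral_congr_ae ?_
    filter_upwards [ae_notMem_of_notMem c P (M.near c R)] with y hy
    by_cases h : y ∈ ⋃ K ∈ M.near c R, M.chartMap c P K '' openTri
    · rw [indicator_of_mem h]
    · rw [indicator_of_notMem h, h0 y (hy h)]
  rw [e1, lintegral_biUnion_finset (hC.pairwiseDisjoint hR) hm]
  refine Finset.sum_congr rfl fun K hK => ?_
  rw [lintegral_image_eq_lintegral_abs_det_fderiv_mul _ isOpen_openTri.measurableSet
    (fun ξ _ => (hasFDerivAt_chartMap ξ).hasFDerivWithinAt)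
    (chartMap_injective (hC.det_pos_of_near hd hR hK)).injOn, det_chartLin,
    abs_of_pos (hC.det_pos_of_near hd hR hK)]

/-- The transformed integrand is matched with a continuous ψ on the open triangles. This supplies
integrability, and lets the closed reference triangle appear on the right. -/
theorem Chart.integral_eq (hC : M.Chart c R d P) (hd : 0 < d) (hR : 0 ≤ R)
    {Ψ : R2 → ℝ} (h0 : ∀ y ∉ ⋃ K ∈ M.near c R, M.chartMap c P K '' refTri, Ψ y = 0)
    {ψ : Fin M.numTri → R2 → ℝ} (hψ : ∀ K, Continuous (ψ K))
    (h : ∀ K ∈ M.near c R, ∀ ξ ∈ openTri,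
      (M.chartMatrix P K).det * Ψ (M.chartMap c P K ξ) = ψ K ξ) :
    ∫ y, Ψ y = ∑ K ∈ M.near c R, ∫ ξ in refTri, ψ K ξ := by
  have hm : ∀ K ∈ M.near c R, MeasurableSet (M.chartMap c P K '' openTri) := fun K hK =>
    isOpen_openTri.measurableSet.image_of_continuousOn_injOn continuous_chartMap.continuousOn
      (chartMap_injective (hC.det_pos_of_near hd hR hK)).injOn
  have hd' := fun K hK => hC.det_pos_of_near (K := K) hd hR hK
  have hf' : ∀ K, ∀ ξ ∈ openTri, HasFDerivWithinAt (M.chartMap c P K) (M.chartLin P K) openTri ξ :=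
    fun K ξ _ => (hasFDerivAt_chartMap ξ).hasFDerivWithinAt
  have he : ∀ K ∈ M.near c R, EqOn (fun ξ => |(M.chartLin P K).det| • Ψ (M.chartMap c P K ξ))
      (ψ K) openTri := fun K hK ξ hξ => by
    simp only [det_chartLin, abs_of_pos (hd' K hK), smul_eq_mul]
    exact h K hK ξ hξ
  rw [← setIntegral_eq_integral_of_ae_compl_eq_zero (s := ⋃ K ∈ M.near c R,
    M.chartMap c P K '' openTri), integral_biUnion_finset _ hm (hC.pairwiseDisjoint hR)]
  · refine Finset.sum_congr rfl fun K hK => ?_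
    rw [integral_image_eq_integral_abs_det_fderiv_smul _ isOpen_openTri.measurableSet (hf' K)
      (chartMap_injective (hd' K hK)).injOn, ← setIntegral_congr_set openTri_ae_eq_refTri]
    exact setIntegral_congr_fun isOpen_openTri.measurableSet (he K hK)
  · intro K hK
    rw [integrableOn_image_iff_integrableOn_abs_det_fderiv_smul _ isOpen_openTri.measurableSet
      (hf' K) (chartMap_injective (hd' K hK)).injOn]
    refine IntegrableOn.congr_fun ?_ (he K hK).symm isOpen_openTri.measurableSet
    exact (integrableOn_refTri (hψ K).continuousOn).mono_set openTri_subset_refTri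
  · filter_upwards [ae_notMem_of_notMem c P (M.near c R)] with y hy hy'
    exact h0 y (hy hy')

variable {a b : ScalarFn M} {k l : ℕ}

theorem Chart.det_mul_lineDeriv (hC : M.Chart c R d P) (hR : 0 ≤ R) (ha : a ∈ M.scalarSpace k)
    (hK : K ∈ M.near c R) {ξ : R2} (hξ : ξ ∈ openTri) (i : Fin 2) (hdet : 0 < (M.chartMatrix P K).det) :
    (M.chartMatrix P K).det *
      lineDeriv ℝ (M.chartFn c R P a) (M.chartMap c P K ξ) (Pi.single i 1) =
      ∑ j, (M.chartMatrix P K).adjugate j i * MvPolynomial.eval ξ (MvPolynomial.pderiv j (a K)) := by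
  have e : M.chartLin P K (fun j => (M.chartMatrix P K).adjugate j i / (M.chartMatrix P K).det) =
      Pi.single i 1 := by
    ext l
    rw [chartLin_apply, mul_div_assoc', mul_div_assoc', ← add_div, div_eq_iff hdet.ne',
      ← Fin.sum_univ_two fun j => M.chartMatrix P K l j * (M.chartMatrix P K).adjugate j i,
      ← Matrix.mul_apply, Matrix.mul_adjugate, Matrix.smul_apply, Matrix.one_apply, Pi.single_apply]
    simp [mul_comm]
  rw [← e, hC.lineDeriv_chartFn ha hK hR hξ, Finset.mul_sum]
  refine Finset.sum_congr rfl fun j _ => ?_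
  rw [← mul_assoc, mul_div_cancel₀ _ hdet.ne']

/-- The Jacobian determinant of a pair of functions on one triangle. -/
noncomputable def bracket (p q : MvPolynomial (Fin 2) ℝ) : MvPolynomial (Fin 2) ℝ :=
  MvPolynomial.pderiv 0 p * MvPolynomial.pderiv 1 q - MvPolynomial.pderiv 1 p * MvPolynomial.pderiv 0 q

/-- The bracket on a triangle is the chart determinant times the planar Jacobian ∂₁f ∂₂g - ∂₂f ∂₁g.
The sum is thus a single integral over the plane, which vanishes by the symmetry of ∫ ∂ᵥf ∂_w g for
compactly supported Lipschitz functions. -/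
theorem Chart.sum_integral_bracket (hC : M.Chart c R d P) (hd : 0 < d) (hR : 0 ≤ R)
    (ha : a ∈ M.scalarSpace k) (has : ∀ K, K ∉ M.near c R → a K = 0)
    (hb : b ∈ M.scalarSpace l) (hbs : ∀ K, K ∉ M.near c R → b K = 0) :
    ∑ K, ∫ ξ in refTri, MvPolynomial.eval ξ (bracket (a K) (b K)) = 0 := by
  obtain ⟨D, hD⟩ := hC.exists_lipschitzWith_chartFn hd ha has
  obtain ⟨D', hD'⟩ := hC.exists_lipschitzWith_chartFn hd hb hbs
  have h := integral_lineDeriv_mul_lineDeriv_comm (μ := volume) hD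
    (hC.hasCompactSupport_chartFn ha has) hD' (hC.hasCompactSupport_chartFn hb hbs)
    (Pi.single 0 1) (Pi.single 1 1)
  have key : ∀ i j : Fin 2, ∫ y, lineDeriv ℝ (M.chartFn c R P a) y (Pi.single i 1) *
      lineDeriv ℝ (M.chartFn c R P b) y (Pi.single j 1) = ∑ K ∈ M.near c R, ∫ ξ in refTri,
        ((M.chartMatrix P K).det)⁻¹ *
          ((∑ l, (M.chartMatrix P K).adjugate l i *
            MvPolynomial.eval ξ (MvPolynomial.pderiv l (a K))) *
          ∑ l, (M.chartMatrix P K).adjugate l j *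
            MvPolynomial.eval ξ (MvPolynomial.pderiv l (b K))) := by
    intro i j
    refine hC.integral_eq hd hR (fun y hy => ?_) (fun K => ?_) fun K hK ξ hξ => ?_
    · rw [hC.lineDeriv_chartFn_eq_zero ha has hy, zero_mul]
    · have := fun (p : MvPolynomial (Fin 2) ℝ) => continuous_eval p
      fun_prop
    · have hdet := hC.det_pos_of_near hd hR hK
      rw [← hC.det_mul_lineDeriv hR ha hK hξ i hdet, ← hC.det_mul_lineDeriv hR hb hK hξ j hdet]
      field_simp
  rw [key, key] at h
  rw [← Finset.sum_subset (Finset.subset_univ (M.near c R))]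
  · rw [← sub_eq_zero, ← Finset.sum_sub_distrib] at h
    rw [← h]
    refine Finset.sum_congr rfl fun K hK => ?_
    have hint : ∀ i j : Fin 2, IntegrableOn (fun ξ => ((M.chartMatrix P K).det)⁻¹ *
          ((∑ l, (M.chartMatrix P K).adjugate l i *
            MvPolynomial.eval ξ (MvPolynomial.pderiv l (a K))) *
          ∑ l, (M.chartMatrix P K).adjugate l j *
            MvPolynomial.eval ξ (MvPolynomial.pderiv l (b K)))) refTri := by
      intro i j
      refine integrableOn_refTri (Continuous.continuousOn ?_)
      have := fun (p : MvPolynomial (Fin 2) ℝ) => continuous_eval p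
      fun_prop
    rw [← integral_sub (hint _ _) (hint _ _)]
    refine integral_congr_ae (Eventually.of_forall fun ξ => ?_)
    have hdet := (hC.det_pos_of_near hd hR hK).ne'
    have e : (M.chartMatrix P K).det = M.chartMatrix P K 0 0 * M.chartMatrix P K 1 1 -
      M.chartMatrix P K 0 1 * M.chartMatrix P K 1 0 := Matrix.det_fin_two _
    simp only [bracket, map_sub, map_mul, Fin.sum_univ_two, Matrix.adjugate_fin_two, Matrix.of_apply,
      Matrix.cons_val_zero, Matrix.cons_val_one, Matrix.cons_val', Matrix.cons_val_fin_one]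
    rw [← mul_sub, eq_inv_mul_iff_mul_eq₀ hdet, e]
    ring
  · intro K _ hK
    simp [has K hK, bracket]

end Mesh

end ESFEM

/-! ### Partition of unity, local L⁴ estimate and vanishing of curl integrals -/

namespace ESFEM

variable {T : ℝ} {m : ℕ} {S : EvolvingSurface T m}

theorem sum_baryPoly : ∑ j, baryPoly j = 1 := by
  simp only [Fin.sum_univ_three, baryPoly, Matrix.cons_val]
  ring

theorem pderiv_baryPoly (i : Fin 2) (j : Fin 3) : MvPolynomial.pderiv i (baryPoly j) =
    MvPolynomial.C (if j = 0 then -1 else if j = i.succ then 1 else 0) := by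
  fin_cases i <;> fin_cases j <;> simp [baryPoly, MvPolynomial.pderiv_X]

/-- A Lipschitz partition of unity on a compact set. -/
theorem exists_lipschitz_partition {Γ : Set E3} (hΓ : IsCompact Γ) {R : ℝ} (hR : 0 < R) :
    ∃ (n : ℕ) (c : Fin n → E3) (N : Fin n → E3 → ℝ) (B : ℝ), 0 ≤ B ∧ (∀ i, c i ∈ Γ) ∧
      (∀ i, ∀ p ∈ Γ, 0 ≤ N i p ∧ N i p ≤ 1 ∧ (N i p ≠ 0 → ‖p - c i‖ < R)) ∧
      (∀ p ∈ Γ, ∑ i, N i p = 1) ∧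
      ∀ i, ∀ p ∈ Γ, ∀ q ∈ Γ, |N i p - N i q| ≤ B * ‖p - q‖ := by
  -- The cover uses radius R/2 although the tent functions have radius R, so their sum is at least
  -- R/2 on the set and may be divided by.
  obtain ⟨t, htΓ, ht⟩ := hΓ.elim_nhds_subcover (fun p => Metric.ball p (R / 2))
    fun p _ => Metric.ball_mem_nhds p (by positivity)
  obtain ⟨n, ⟨e⟩⟩ : ∃ n, Nonempty (Fin n ≃ t) := ⟨_, ⟨t.equivFin.symm⟩⟩
  set φ : Fin n → E3 → ℝ := fun i p => max 0 (R - ‖p - e i‖) with hφ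
  have hφ0 : ∀ i p, 0 ≤ φ i p := fun i p => le_max_left _ _
  have hφl : ∀ i p q, |φ i p - φ i q| ≤ ‖p - q‖ := by
    intro i p q
    refine (abs_max_sub_max_le_max _ _ _ _).trans (max_le (by simp) ?_)
    rw [sub_sub_sub_cancel_left]
    refine (abs_norm_sub_norm_le _ _).trans ?_
    rw [sub_sub_sub_cancel_right, norm_sub_rev]
  set s : E3 → ℝ := fun p => ∑ i, φ i p with hs
  have hφs : ∀ i p, φ i p ≤ s p := fun i p =>
    Finset.single_le_sum (fun i _ => hφ0 i p) (Finset.mem_univ i)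
  have hsR : ∀ p ∈ Γ, R / 2 ≤ s p := by
    intro p hp
    obtain ⟨x, hx, hpx⟩ := mem_iUnion₂.1 (ht hp)
    refine le_trans ?_ (hφs (e.symm ⟨x, hx⟩) p)
    rw [mem_ball_iff_norm] at hpx
    refine le_trans ?_ (le_max_right _ _)
    rw [e.apply_symm_apply]
    change R / 2 ≤ R - ‖p - x‖
    linarith
  have hsl : ∀ p q, |s p - s q| ≤ n * ‖p - q‖ := by
    intro p q
    rw [hs, ← Finset.sum_sub_distrib]
    refine (Finset.abs_sum_le_sum_abs _ _).trans ((Finset.sum_le_sum fun i _ => hφl i p q).trans ?_)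
    simp
  refine ⟨n, fun i => e i, fun i p => φ i p / s p, 2 / R * (1 + n), by positivity,
    fun i => htΓ _ (e i).2, fun i p hp => ?_, fun p hp => ?_, fun i p hp q hq => ?_⟩
  · have h1 := hsR p hp
    refine ⟨div_nonneg (hφ0 i p) (by linarith), div_le_one_of_le₀ (hφs i p) (by linarith),
      fun h => ?_⟩
    by_contra! h2
    exact h (by rw [hφ]; simp only; rw [max_eq_left (by linarith), zero_div])
  · rw [← Finset.sum_div, div_self]
    have := hsR p hp
    exact (by linarith : 0 < ∑ i, φ i p).ne'
  · have h1 := hsR p hp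
    have h2 := hsR q hq
    have hp0 : 0 < s p := by linarith
    have hq0 : 0 < s q := by linarith
    have e1 : φ i p / s p - φ i q / s q =
        (s p)⁻¹ * ((φ i p - φ i q) + φ i q / s q * (s q - s p)) := by
      field_simp; ring
    rw [e1, abs_mul, abs_of_pos (inv_pos.2 hp0)]
    have e2 : (s p)⁻¹ ≤ 2 / R := by
      rw [← one_div, div_le_div_iff₀ hp0 hR]; linarith
    have e3 : |φ i q / s q| ≤ 1 := by
      rw [abs_of_nonneg (div_nonneg (hφ0 i q) hq0.le)]
      exact div_le_one_of_le₀ (hφs i q) hq0.le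
    have e4 : |(φ i p - φ i q) + φ i q / s q * (s q - s p)| ≤ ‖p - q‖ + 1 * (n * ‖p - q‖) := by
      refine (abs_add_le _ _).trans (add_le_add (hφl i p q) ?_)
      rw [abs_mul]
      gcongr
      rw [abs_sub_comm]; exact hsl p q
    calc _ ≤ 2 / R * (‖p - q‖ + 1 * (n * ‖p - q‖)) := by gcongr
      _ = _ := by ring

namespace Mesh

variable {M : Mesh S} {c : E3} {R d : ℝ} {P : E3 →L[ℝ] R2} {K : Fin M.numTri} {k l : ℕ}
  {a b : ScalarFn M}

/-- The planar inequality ‖f‖_{L²} ≤ ‖∇f‖_{L¹} is applied to f = a². On the left the chart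
determinant is bounded below by d. On the right determinant times derivative is a combination with
adjugate entries, so no division occurs; 4H collects two directions and the factor 2 of ∇(a²). -/
theorem Chart.mul_sum_integral_pow_four_le (hC : M.Chart c R d P) (hd : 0 < d) (hR : 0 ≤ R)
    (ha : a ∈ M.scalarSpace k) (has : ∀ K, K ∉ M.near c R → a K = 0) {H : ℝ} (hH : 0 ≤ H)
    (hPH : ∀ K i j, |M.chartMatrix P K i j| ≤ H) :
    d * ∑ K, ∫ ξ in refTri, MvPolynomial.eval ξ (a K) ^ 4 ≤
      (∑ K, ∫ ξ in refTri, 4 * H * (|MvPolynomial.eval ξ (a K)| *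
        ∑ j, |MvPolynomial.eval ξ (MvPolynomial.pderiv j (a K))|)) ^ 2 := by
  have he := M.mul_mem_scalarSpace ha ha
  have hes : ∀ K, K ∉ M.near c R → (fun K => a K * a K) K = 0 := fun K hK => by
    simp only [has K hK, mul_zero]
  obtain ⟨D, hD⟩ := hC.exists_lipschitzWith_chartFn hd he hes
  have hc := fun (p : MvPolynomial (Fin 2) ℝ) => continuous_eval p
  have h := lintegral_sq_le_sq_lintegral_lineDeriv hD (hC.hasCompactSupport_chartFn he hes)
  rw [hC.lintegral_eq hd hR (fun y hy => by
      rw [hC.chartFn_eq_zero he hes fun K hK ξ hξ heq => hy (mem_biUnion hK ⟨ξ, hξ, heq⟩)]; simp),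
    hC.lintegral_eq hd hR (fun y hy => by
      rw [hC.lineDeriv_chartFn_eq_zero he hes hy, hC.lineDeriv_chartFn_eq_zero he hes hy]; simp)] at h
  have hconv : ∀ {g : R2 → ℝ}, Continuous g → (∀ ξ, 0 ≤ g ξ) →
      ∫⁻ ξ in openTri, ENNReal.ofReal (g ξ) = ENNReal.ofReal (∫ ξ in refTri, g ξ) := by
    intro g hg hg0
    rw [← setIntegral_congr_set openTri_ae_eq_refTri]
    exact (ofReal_integral_eq_lintegral_ofReal
      ((integrableOn_refTri hg.continuousOn).mono_set openTri_subset_refTri)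
      (Eventually.of_forall hg0)).symm
  have hleft : ENNReal.ofReal (d * ∑ K, ∫ ξ in refTri, MvPolynomial.eval ξ (a K) ^ 4) ≤
      ∑ K ∈ M.near c R, ∫⁻ ξ in openTri, ENNReal.ofReal (M.chartMatrix P K).det *
        ‖M.chartFn c R P (fun K => a K * a K) (M.chartMap c P K ξ)‖ₑ ^ 2 := by
    rw [← Finset.sum_subset (Finset.subset_univ (M.near c R)), Finset.mul_sum,
      ENNReal.ofReal_sum_of_nonneg]
    · refine Finset.sum_le_sum fun K hK => ?_
      rw [← integral_const_mul, ← hconv (by fun_prop) (fun ξ => by positivity)]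
      refine setLIntegral_mono' isOpen_openTri.measurableSet fun ξ hξ => ?_
      have hξ' := openTri_subset_refTri hξ
      have hn := mem_near.1 hK ξ hξ'
      rw [hC.chartFn_chartMap he hξ' (by linarith), map_mul, ENNReal.ofReal_mul hd.le,
        Real.enorm_eq_ofReal_abs, ← ENNReal.ofReal_pow (abs_nonneg _), sq_abs, ← sq, ← pow_mul]
      gcongr
      rw [det_chartMatrix]
      exact hC.le_det K ξ hξ' (by linarith)
    · intro K _
      exact mul_nonneg hd.le (integral_nonneg fun ξ => by positivity)
    · intro K _ hK
      simp [has K hK]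
  have hright : ∑ K ∈ M.near c R, ∫⁻ ξ in openTri, ENNReal.ofReal (M.chartMatrix P K).det *
      (‖lineDeriv ℝ (M.chartFn c R P fun K => a K * a K) (M.chartMap c P K ξ) (Pi.single 0 1)‖ₑ +
        ‖lineDeriv ℝ (M.chartFn c R P fun K => a K * a K) (M.chartMap c P K ξ)
          (Pi.single 1 1)‖ₑ) ≤
      ENNReal.ofReal (∑ K, ∫ ξ in refTri, 4 * H * (|MvPolynomial.eval ξ (a K)| *
        ∑ j, |MvPolynomial.eval ξ (MvPolynomial.pderiv j (a K))|)) := by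
    rw [← Finset.sum_subset (Finset.subset_univ (M.near c R)), ENNReal.ofReal_sum_of_nonneg]
    · refine Finset.sum_le_sum fun K hK => ?_
      rw [← hconv (by fun_prop) (fun ξ => by positivity)]
      refine setLIntegral_mono' isOpen_openTri.measurableSet fun ξ hξ => ?_
      have hdet := hC.det_pos_of_near hd hR hK
      have hb : ∀ i : Fin 2, (M.chartMatrix P K).det *
          |lineDeriv ℝ (M.chartFn c R P fun K => a K * a K) (M.chartMap c P K ξ) (Pi.single i 1)| ≤
          2 * H * (|MvPolynomial.eval ξ (a K)| *
            ∑ j, |MvPolynomial.eval ξ (MvPolynomial.pderiv j (a K))|) := by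
        intro i
        rw [← abs_of_pos hdet, ← abs_mul, hC.det_mul_lineDeriv hR he hK hξ i hdet]
        refine (Finset.abs_sum_le_sum_abs _ _).trans ?_
        rw [Finset.mul_sum, Finset.mul_sum]
        refine Finset.sum_le_sum fun j _ => ?_
        have hadj : |(M.chartMatrix P K).adjugate j i| ≤ H := by
          rw [Matrix.adjugate_fin_two]
          fin_cases i <;> fin_cases j <;> simp [hPH]
        rw [abs_mul, Derivation.leibniz, smul_eq_mul, map_add, map_mul, ← two_mul, abs_mul, abs_two,
          abs_mul]
        calc _ ≤ H * (2 * (|MvPolynomial.eval ξ (a K)| *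
              |MvPolynomial.eval ξ (MvPolynomial.pderiv j (a K))|)) := by gcongr
          _ = _ := by ring
      rw [Real.enorm_eq_ofReal_abs, Real.enorm_eq_ofReal_abs,
        ← ENNReal.ofReal_add (abs_nonneg _) (abs_nonneg _), ← ENNReal.ofReal_mul hdet.le]
      refine ENNReal.ofReal_le_ofReal ?_
      rw [mul_add]
      linarith [hb 0, hb 1]
    · intro K _
      exact integral_nonneg fun ξ => by positivity
    · intro K _ hK
      simp [has K hK]
  have hfin := hleft.trans (h.trans (pow_le_pow_left₀ (zero_le) hright 2))
  rw [← ENNReal.ofReal_pow (Finset.sum_nonneg fun K _ => integral_nonneg fun ξ => by positivity)]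
    at hfin
  exact (ENNReal.ofReal_le_ofReal_iff (by positivity)).1 hfin

theorem vertexInterp_eq_zero {N : E3 → ℝ} (h : ∀ j, N (M.vert K j) = 0) :
    M.vertexInterp N K = 0 := by
  simp [vertexInterp, h]

theorem vertexInterp_eq_one {N : E3 → ℝ} (h : ∀ j, N (M.vert K j) = 1) :
    M.vertexInterp N K = 1 := by
  simp [vertexInterp, h, sum_baryPoly]

theorem sum_vertexInterp_eq_one {n : ℕ} {N : Fin n → E3 → ℝ} (hN : ∀ p ∈ S.init, ∑ i, N i p = 1) :
    ∑ i, M.vertexInterp (N i) K = 1 := by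
  simp only [vertexInterp]
  rw [Finset.sum_comm]
  simp only [← Finset.sum_mul, ← map_sum, hN _ (M.vert_mem K _), map_one, one_mul, sum_baryPoly]

theorem mem_near_of_vert {h : ℝ} (hh : ∀ i j, ‖M.vert K i - M.vert K j‖ ≤ h) {j : Fin 3}
    (hj : ‖M.vert K j - c‖ + h < R) : K ∈ M.near c R := by
  refine mem_near.2 fun ξ hξ => ?_
  have h1 := norm_flatMap_sub_le (fun i => hh i j) hξ
  calc _ = ‖(flatMap (M.vert K) ξ - M.vert K j) + (M.vert K j - c)‖ := by rw [sub_add_sub_cancel]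
    _ ≤ _ := norm_add_le _ _
    _ < R := by linarith

theorem bracket_sum_left {ι : Type*} (s : Finset ι) (p : ι → MvPolynomial (Fin 2) ℝ)
    (q : MvPolynomial (Fin 2) ℝ) : bracket (∑ i ∈ s, p i) q = ∑ i ∈ s, bracket (p i) q := by
  simp only [bracket, map_sum, Finset.sum_mul, Finset.sum_sub_distrib]

end Mesh

/-- The integral of a Jacobian determinant over the closed polyhedral surface vanishes. -/
theorem exists_sum_integral_bracket_eq_zero {L r : ℝ} {ν : E3 → E3} (hS : SurfaceBounds S L r ν)
    (hT : 0 < T) {kg : ℕ} (hkg : 1 ≤ kg) {ρ : ℝ} (hρ : 0 < ρ) :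
    ∃ h₀ > 0, ∀ M : Mesh S, M.QuasiUniform kg ρ → M.size kg < h₀ → ∀ k l,
      ∀ a ∈ M.scalarSpace k, ∀ b ∈ M.scalarSpace l,
        ∑ K, ∫ ξ in refTri, MvPolynomial.eval ξ (Mesh.bracket (a K) (b K)) = 0 := by
  obtain ⟨R, hR, h₁, hh₁, hchart⟩ := Mesh.exists_chart hS hT hkg hρ
  obtain ⟨n, c, N, B, hB, hc, hN, hsum, -⟩ :=
    exists_lipschitz_partition S.isCompact_init (R := R / 2) (by positivity)
  refine ⟨min h₁ (R / 8), by positivity, fun M hM hsize k l a ha b hb => ?_⟩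
  have hhR : M.size kg < R / 8 := hsize.trans_le (min_le_right _ _)
  have hlocal : ∀ i, ∑ K, ∫ ξ in refTri, MvPolynomial.eval ξ
      (Mesh.bracket (M.vertexInterp (N i) K * a K) (b K)) = 0 := by
    intro i
    set U : Set E3 := {p | ‖p - c i‖ < R / 2 + M.size kg} with hU
    -- The second factor must be localized too. Only the vertex values of η matter: its piecewise
    -- linear interpolant is 1 on each triangle where the localized a may be nonzero, so multiplying
    -- b by it leaves the bracket unchanged.
    set η : E3 → ℝ := indicator U 1 with hη
    rcases isEmpty_or_nonempty (Fin M.numTri) with hemp | ⟨⟨K₀⟩⟩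
    · simp
    have hh := M.size_pos hT hkg K₀
    obtain ⟨P, hP⟩ := hchart M hM (hsize.trans_le (min_le_left _ _)) (c i) (hc i)
    have hnear : ∀ K j, ‖M.vert K j - c i‖ < R / 2 + M.size kg → K ∈ M.near (c i) R :=
      fun K j hj => Mesh.mem_near_of_vert (M.norm_vert_sub_le hT hkg K) (j := j) (by linarith)
    have hχ : ∀ K j, N i (M.vert K j) ≠ 0 → ∀ j', ‖M.vert K j' - c i‖ < R / 2 + M.size kg := by
      intro K j hj j'
      have h1 := (hN i _ (M.vert_mem K j)).2.2 hj
      have h2 := M.norm_vert_sub_le hT hkg K j' j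
      calc _ = ‖(M.vert K j' - M.vert K j) + (M.vert K j - c i)‖ := by rw [sub_add_sub_cancel]
        _ ≤ _ := norm_add_le _ _
        _ < _ := by linarith
    have h := hP.sum_integral_bracket (by positivity) hR.le
      (M.mul_mem_scalarSpace (M.vertexInterp_mem (N i)) ha) (fun K hK => by
        rw [Mesh.vertexInterp_eq_zero, zero_mul]
        intro j
        by_contra hj
        exact hK (hnear K j (hχ K j hj j)))
      (M.mul_mem_scalarSpace (M.vertexInterp_mem η) hb) (fun K hK => by
        rw [Mesh.vertexInterp_eq_zero, zero_mul]
        intro j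
        by_contra hj
        refine hK (hnear K j ?_)
        by_contra hlt
        exact hj (indicator_of_notMem (s := U) hlt _))
    rw [← h]
    refine Finset.sum_congr rfl fun K _ => ?_
    by_cases hK : ∀ j, N i (M.vert K j) = 0
    · simp [Mesh.vertexInterp_eq_zero hK, Mesh.bracket]
    · push Not at hK
      obtain ⟨j, hj⟩ := hK
      have : M.vertexInterp η K = 1 := Mesh.vertexInterp_eq_one fun j' =>
        indicator_of_mem (s := U) (hχ K j hj j') _
      rw [this, one_mul]
  have e : ∀ K, Mesh.bracket (a K) (b K) =
      ∑ i, Mesh.bracket (M.vertexInterp (N i) K * a K) (b K) := by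
    intro K
    rw [← Mesh.bracket_sum_left, ← Finset.sum_mul, Mesh.sum_vertexInterp_eq_one hsum, one_mul]
  simp only [e, map_sum]
  have hi : ∀ K i, Integrable (fun ξ => MvPolynomial.eval ξ
      (Mesh.bracket (M.vertexInterp (N i) K * a K) (b K))) (volume.restrict refTri) := fun K i =>
    integrableOn_refTri (continuous_eval _).continuousOn
  simp only [integral_finsetSum _ fun i _ => hi _ i]
  rw [Finset.sum_comm]
  exact Finset.sum_eq_zero fun i _ => hlocal i

end ESFEM

/-! ### The discrete Ladyzhenskaya inequality -/

namespace ESFEM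

variable {T : ℝ} {m : ℕ} {S : EvolvingSurface T m}

theorem eval_pderiv_vertexInterp (M : Mesh S) (N : E3 → ℝ) (K : Fin M.numTri) (i : Fin 2) (ξ : R2) :
    MvPolynomial.eval ξ (MvPolynomial.pderiv i (M.vertexInterp N K)) =
      N (M.vert K i.succ) - N (M.vert K 0) := by
  simp only [Mesh.vertexInterp, Fin.sum_univ_three, map_add, Derivation.leibniz,
    MvPolynomial.pderiv_C, smul_eq_mul, pderiv_baryPoly, map_mul, MvPolynomial.eval_C]
  fin_cases i <;> simp <;> ring

theorem sum_pow_four_le {n : ℕ} (x : Fin n → ℝ) : (∑ i, x i) ^ 4 ≤ (n : ℝ) ^ 3 * ∑ i, x i ^ 4 := by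
  have h1 := sq_sum_le_card_mul_sum_sq (s := Finset.univ) (f := x)
  have h2 := sq_sum_le_card_mul_sum_sq (s := Finset.univ) (f := fun i => x i ^ 2)
  simp only [Finset.card_univ, Fintype.card_fin, ← pow_mul] at h1 h2
  have h3 := pow_le_pow_left₀ (sq_nonneg _) h1 2
  rw [← pow_mul, mul_pow] at h3
  calc _ ≤ (n : ℝ) ^ 2 * (∑ i, x i ^ 2) ^ 2 := h3
    _ ≤ (n : ℝ) ^ 2 * (n * ∑ i, x i ^ 4) := by gcongr
    _ = _ := by ring

/-- The sum over all triangles of the integrals over the reference triangle. -/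
noncomputable def refSum {n : ℕ} (f : Fin n → R2 → ℝ) : ℝ := ∑ K, ∫ ξ in refTri, f K ξ

theorem refSum_nonneg {n : ℕ} {f : Fin n → R2 → ℝ} (hf : ∀ K ξ, 0 ≤ f K ξ) : 0 ≤ refSum f :=
  Finset.sum_nonneg fun K _ => integral_nonneg fun ξ => hf K ξ

theorem refSum_mono {n : ℕ} {f g : Fin n → R2 → ℝ} (hf : ∀ K, ContinuousOn (f K) refTri)
    (hg : ∀ K, ContinuousOn (g K) refTri) (h : ∀ K, ∀ ξ ∈ refTri, f K ξ ≤ g K ξ) :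
    refSum f ≤ refSum g :=
  Finset.sum_le_sum fun K _ => setIntegral_mono_on (integrableOn_refTri (hf K))
    (integrableOn_refTri (hg K)) measurableSet_refTri (h K)

theorem refSum_const_mul {n : ℕ} (c : ℝ) (f : Fin n → R2 → ℝ) :
    refSum (fun K ξ => c * f K ξ) = c * refSum f := by
  simp only [refSum, integral_const_mul, Finset.mul_sum]

theorem refSum_add {n : ℕ} {f g : Fin n → R2 → ℝ} (hf : ∀ K, ContinuousOn (f K) refTri)
    (hg : ∀ K, ContinuousOn (g K) refTri) :
    refSum (fun K ξ => f K ξ + g K ξ) = refSum f + refSum g := by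
  simp only [refSum, ← Finset.sum_add_distrib]
  exact Finset.sum_congr rfl fun K _ =>
    integral_add (integrableOn_refTri (hf K)) (integrableOn_refTri (hg K))

theorem refSum_finset_sum {n : ℕ} {ι : Type*} (s : Finset ι) {f : ι → Fin n → R2 → ℝ}
    (hf : ∀ i ∈ s, ∀ K, ContinuousOn (f i K) refTri) :
    refSum (fun K ξ => ∑ i ∈ s, f i K ξ) = ∑ i ∈ s, refSum (f i) := by
  simp only [refSum]
  rw [Finset.sum_comm]
  exact Finset.sum_congr rfl fun K _ =>
    integral_finsetSum _ fun i hi => integrableOn_refTri (hf i hi K)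

theorem refSum_mul_sq_le {n : ℕ} {f g : Fin n → R2 → ℝ} (hf : ∀ K, ContinuousOn (f K) refTri)
    (hg : ∀ K, ContinuousOn (g K) refTri) : refSum (fun K ξ => f K ξ * g K ξ) ^ 2 ≤
      refSum (fun K ξ => f K ξ ^ 2) * refSum fun K ξ => g K ξ ^ 2 :=
  sq_sum_integral_mul_le (fun K => integrableOn_refTri ((hf K).pow 2))
    (fun K => integrableOn_refTri ((hg K).pow 2)) fun K => integrableOn_refTri ((hf K).mul (hg K))

theorem refSum_abs_mul_sq_le {n : ℕ} (a : Fin n → MvPolynomial (Fin 2) ℝ) :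
    refSum (fun K ξ => |MvPolynomial.eval ξ (a K)| *
      ∑ j, |MvPolynomial.eval ξ (MvPolynomial.pderiv j (a K))|) ^ 2 ≤
    refSum (fun K ξ => MvPolynomial.eval ξ (a K) ^ 2) *
      (2 * refSum (fun K ξ => ∑ j, MvPolynomial.eval ξ (MvPolynomial.pderiv j (a K)) ^ 2)) := by
  have hcont := fun (p : MvPolynomial (Fin 2) ℝ) => continuous_eval p
  refine (refSum_mul_sq_le (fun K => by fun_prop) (fun K => by fun_prop)).trans ?_
  simp only [sq_abs]
  refine mul_le_mul_of_nonneg_left ?_ (refSum_nonneg fun _ _ => sq_nonneg _)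
  rw [← refSum_const_mul]
  refine refSum_mono (fun K => by fun_prop) (fun K => by fun_prop) fun K ξ _ => ?_
  simp only [Fin.sum_univ_two]
  nlinarith [sq_abs (MvPolynomial.eval ξ (MvPolynomial.pderiv 0 (a K))),
    sq_abs (MvPolynomial.eval ξ (MvPolynomial.pderiv 1 (a K))),
    sq_nonneg (|MvPolynomial.eval ξ (MvPolynomial.pderiv 0 (a K))| -
      |MvPolynomial.eval ξ (MvPolynomial.pderiv 1 (a K))|)]

theorem abs_eval_vertexInterp_le (M : Mesh S) {N : E3 → ℝ} {K : Fin M.numTri} {B : ℝ}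
    (hN : ∀ j, |N (M.vert K j)| ≤ B) {ξ : R2} (hξ : ξ ∈ refTri) :
    |MvPolynomial.eval ξ (M.vertexInterp N K)| ≤ B := by
  rw [M.eval_vertexInterp]
  refine (Finset.abs_sum_le_sum_abs _ _).trans ?_
  rw [← mul_one B, ← sum_eval_baryPoly ξ, Finset.mul_sum]
  refine Finset.sum_le_sum fun j _ => ?_
  rw [abs_mul, abs_of_nonneg (eval_baryPoly_nonneg hξ j)]
  exact mul_le_mul_of_nonneg_right (hN j) (eval_baryPoly_nonneg hξ j)

/-- Product rule: a cut-off bounded by 1 whose derivatives are at most B costs only the additional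
term 2B times the squared L² norm. -/
theorem refSum_localized_le (M : Mesh S) {N : E3 → ℝ} {B : ℝ}
    (hN : ∀ K j, |N (M.vert K j)| ≤ 1)
    (hB : ∀ K j, |N (M.vert K j) - N (M.vert K 0)| ≤ B) (a : ScalarFn M) :
    refSum (fun K ξ => |MvPolynomial.eval ξ (M.vertexInterp N K * a K)| *
        ∑ j, |MvPolynomial.eval ξ (MvPolynomial.pderiv j (M.vertexInterp N K * a K))|) ≤
      refSum (fun K ξ => |MvPolynomial.eval ξ (a K)| *
        ∑ j, |MvPolynomial.eval ξ (MvPolynomial.pderiv j (a K))|) +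
      2 * B * refSum (fun K ξ => MvPolynomial.eval ξ (a K) ^ 2) := by
  have hcont := fun (p : MvPolynomial (Fin 2) ℝ) => continuous_eval p
  rw [← refSum_const_mul, ← refSum_add (fun K => by fun_prop) (fun K => by fun_prop)]
  refine refSum_mono (fun K => by fun_prop) (fun K => by fun_prop) fun K ξ hξ => ?_
  have g0 := abs_eval_vertexInterp_le M (hN K) hξ
  set x := MvPolynomial.eval ξ (a K) with hx
  have g1 : |MvPolynomial.eval ξ (M.vertexInterp N K * a K)| ≤ |x| := by
    rw [map_mul, abs_mul]
    exact mul_le_of_le_one_left (abs_nonneg _) g0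
  have g2 : ∀ j, |MvPolynomial.eval ξ (MvPolynomial.pderiv j (M.vertexInterp N K * a K))| ≤
      |MvPolynomial.eval ξ (MvPolynomial.pderiv j (a K))| + B * |x| := by
    intro j
    rw [Derivation.leibniz, smul_eq_mul, smul_eq_mul, map_add, map_mul, map_mul]
    refine (abs_add_le _ _).trans ?_
    rw [abs_mul, abs_mul, mul_comm |MvPolynomial.eval ξ (a K)|, eval_pderiv_vertexInterp]
    gcongr
    · exact mul_le_of_le_one_left (abs_nonneg _) g0
    · exact hB K _
  have g3 : ∑ j, |MvPolynomial.eval ξ (MvPolynomial.pderiv j (M.vertexInterp N K * a K))| ≤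
      (∑ j, |MvPolynomial.eval ξ (MvPolynomial.pderiv j (a K))|) + 2 * B * |x| := by
    refine (Finset.sum_le_sum fun j _ => g2 j).trans_eq ?_
    simp only [Fin.sum_univ_two]; ring
  refine (mul_le_mul g1 g3 (Finset.sum_nonneg fun j _ => abs_nonneg _) (abs_nonneg _)).trans_eq ?_
  rw [← sq_abs x]
  ring

/-- The factor h² from the determinant on the left cancels the one from the chart matrix on the
right, so the constant depends only on ρ and on the Lipschitz constant B of the partition. -/
theorem le_of_local_estimate {ρ h B X Y Z W : ℝ} (hρ : 0 < ρ) (hh : 0 < h) (hB : 0 ≤ B)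
    (hX : 0 ≤ X) (hY : 0 ≤ Y) (hZ : Z ^ 2 ≤ X * (2 * Y))
    (hW : ρ ^ 2 / 4 * h ^ 2 * W ≤ (4 * h * (Z + 2 * (B * h) * X)) ^ 2) :
    W ≤ 512 * (1 + B) ^ 2 / ρ ^ 2 * (X * (Y + h ^ 2 * X)) := by
  have h6 : (4 * h * (Z + 2 * (B * h) * X)) ^ 2 ≤
      ρ ^ 2 / 4 * h ^ 2 * (512 * (1 + B) ^ 2 / ρ ^ 2 * (X * (Y + h ^ 2 * X))) := by
    have e : ρ ^ 2 / 4 * h ^ 2 * (512 * (1 + B) ^ 2 / ρ ^ 2 * (X * (Y + h ^ 2 * X))) =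
      128 * (1 + B) ^ 2 * h ^ 2 * (X * (Y + h ^ 2 * X)) := by field_simp; ring
    rw [e]
    have h7 : (Z + 2 * (B * h) * X) ^ 2 ≤ 2 * Z ^ 2 + 8 * B ^ 2 * (h ^ 2 * X ^ 2) := by
      nlinarith [sq_nonneg (Z - 2 * (B * h) * X)]
    have h8 : 2 * Z ^ 2 + 8 * B ^ 2 * (h ^ 2 * X ^ 2) ≤
        8 * (1 + B) ^ 2 * (X * (Y + h ^ 2 * X)) := by
      have g1 : X * Y ≤ (1 + B) ^ 2 * (X * Y) :=
        le_mul_of_one_le_left (by positivity) (by nlinarith)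
      have g2 : B ^ 2 * (h ^ 2 * X ^ 2) ≤ (1 + B) ^ 2 * (h ^ 2 * X ^ 2) := by
        gcongr; linarith
      have g3 : 0 ≤ X * Y := by positivity
      calc _ ≤ 2 * (X * (2 * Y)) + 8 * (B ^ 2 * (h ^ 2 * X ^ 2)) := by linarith
        _ ≤ 8 * ((1 + B) ^ 2 * (X * Y)) + 8 * ((1 + B) ^ 2 * (h ^ 2 * X ^ 2)) := by linarith
        _ = _ := by ring
    calc _ = 16 * h ^ 2 * (Z + 2 * (B * h) * X) ^ 2 := by ring
      _ ≤ 16 * h ^ 2 * (8 * (1 + B) ^ 2 * (X * (Y + h ^ 2 * X))) := by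
          gcongr; exact h7.trans h8
      _ = _ := by ring
  exact le_of_mul_le_mul_left (hW.trans h6) (by positivity)

/-- The discrete Ladyzhenskaya inequality. -/
theorem exists_sum_integral_pow_four_le {L r : ℝ} {ν : E3 → E3} (hS : SurfaceBounds S L r ν)
    (hT : 0 < T) {kg : ℕ} (hkg : 1 ≤ kg) {ρ : ℝ} (hρ : 0 < ρ) :
    ∃ h₀ > 0, ∃ C > 0, ∀ M : Mesh S, M.QuasiUniform kg ρ → M.size kg < h₀ → ∀ k,
      ∀ a ∈ M.scalarSpace k,
        refSum (fun K ξ => MvPolynomial.eval ξ (a K) ^ 4) ≤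
        C * refSum (fun K ξ => MvPolynomial.eval ξ (a K) ^ 2) *
          (refSum (fun K ξ => ∑ j, MvPolynomial.eval ξ (MvPolynomial.pderiv j (a K)) ^ 2) +
            M.size kg ^ 2 * refSum (fun K ξ => MvPolynomial.eval ξ (a K) ^ 2)) := by
  obtain ⟨R, hR, h₁, hh₁, hchart⟩ := Mesh.exists_chart hS hT hkg hρ
  obtain ⟨n, c, N, B, hB, hc, hN, hsum, hlip⟩ :=
    exists_lipschitz_partition S.isCompact_init (R := R / 2) (by positivity)
  refine ⟨min h₁ (R / 8), by positivity, (n : ℝ) ^ 4 * (512 * (1 + B) ^ 2 / ρ ^ 2) + 1,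
    by positivity, fun M hM hsize k a ha => ?_⟩
  have hcont := fun (p : MvPolynomial (Fin 2) ℝ) => continuous_eval p
  rcases isEmpty_or_nonempty (Fin M.numTri) with hemp | ⟨⟨K₀⟩⟩
  · simp [refSum]
  have hhR : M.size kg < R / 8 := hsize.trans_le (min_le_right _ _)
  have hh := M.size_pos hT hkg K₀
  set h := M.size kg with hhd
  set X := refSum (fun K ξ => MvPolynomial.eval ξ (a K) ^ 2) with hX
  set Y := refSum (fun K ξ => ∑ j, MvPolynomial.eval ξ (MvPolynomial.pderiv j (a K)) ^ 2) with hY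
  have hX0 : 0 ≤ X := refSum_nonneg fun K ξ => by positivity
  have hY0 : 0 ≤ Y := refSum_nonneg fun K ξ => by positivity
  have hlocal : ∀ i, refSum (fun K ξ => MvPolynomial.eval ξ (M.vertexInterp (N i) K * a K) ^ 4) ≤
      512 * (1 + B) ^ 2 / ρ ^ 2 * (X * (Y + h ^ 2 * X)) := by
    intro i
    obtain ⟨P, hP⟩ := hchart M hM (hsize.trans_le (min_le_left _ _)) (c i) (hc i)
    have hloc := hP.mul_sum_integral_pow_four_le (by positivity) hR.le
      (M.mul_mem_scalarSpace (M.vertexInterp_mem (N i)) ha) (fun K hK => by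
        rw [Mesh.vertexInterp_eq_zero, zero_mul]
        intro j
        by_contra hj
        refine hK (Mesh.mem_near_of_vert (M.norm_vert_sub_le hT hkg K) (j := j) ?_)
        have := (hN i _ (M.vert_mem K j)).2.2 hj
        linarith) hh.le (fun K i' j => by
        refine (norm_le_pi_norm (P (M.vert K j.succ - M.vert K 0)) i').trans
          ((hP.norm_le _).trans (M.norm_vert_sub_le hT hkg K _ _)))
    have hbd := refSum_localized_le M (N := N i) (B := B * h) (fun K j => by
        obtain ⟨g0, g1, -⟩ := hN i _ (M.vert_mem K j)
        rwa [abs_of_nonneg g0]) (fun K j =>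
        (hlip i _ (M.vert_mem K _) _ (M.vert_mem K 0)).trans (by
          gcongr; exact M.norm_vert_sub_le hT hkg K _ _)) a
    rw [← refSum, ← refSum, refSum_const_mul] at hloc
    refine le_of_local_estimate hρ hh hB hX0 hY0 (refSum_abs_mul_sq_le a) (hloc.trans ?_)
    exact pow_le_pow_left₀ (mul_nonneg (by positivity) (refSum_nonneg fun K ξ => by positivity))
      (mul_le_mul_of_nonneg_left hbd (by positivity)) 2
  -- The function is the sum of its n localized pieces, and the power mean inequality for fourth
  -- powers costs n³.
  have hfinal : refSum (fun K ξ => MvPolynomial.eval ξ (a K) ^ 4) ≤ (n : ℝ) ^ 3 *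
      ∑ i, refSum (fun K ξ => MvPolynomial.eval ξ (M.vertexInterp (N i) K * a K) ^ 4) := by
    rw [← refSum_finset_sum _ fun i _ K => by fun_prop, ← refSum_const_mul]
    refine refSum_mono (fun K => by fun_prop) (fun K => by fun_prop) fun K ξ _ => ?_
    have e : MvPolynomial.eval ξ (a K) =
        ∑ i, MvPolynomial.eval ξ (M.vertexInterp (N i) K * a K) := by
      rw [← map_sum, ← Finset.sum_mul, Mesh.sum_vertexInterp_eq_one hsum, one_mul]
    conv_lhs => rw [e]
    exact sum_pow_four_le _
  calc _ ≤ (n : ℝ) ^ 3 * ∑ i : Fin n, 512 * (1 + B) ^ 2 / ρ ^ 2 * (X * (Y + h ^ 2 * X)) :=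
        hfinal.trans (by gcongr with i; exact hlocal i)
    _ = (n : ℝ) ^ 4 * (512 * (1 + B) ^ 2 / ρ ^ 2) * (X * (Y + h ^ 2 * X)) := by
        rw [Finset.sum_const, Finset.card_univ, Fintype.card_fin, nsmul_eq_mul]; ring
    _ ≤ ((n : ℝ) ^ 4 * (512 * (1 + B) ^ 2 / ρ ^ 2) + 1) * (X * (Y + h ^ 2 * X)) := by
        gcongr; linarith
    _ = _ := by ring

end ESFEM

namespace ESFEM

/-! ### Linear algebra on one element -/

variable (F w : Fin 3 → MvPolynomial (Fin 2) ℝ) (ξ : R2)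

/-- The left inverse `G⁻¹ Jᵀ` of the Jacobian. -/
noncomputable def pinv : Matrix (Fin 2) (Fin 3) ℝ := (metric F ξ)⁻¹ * (jac F ξ)ᵀ

theorem transpose_metric : (metric F ξ)ᵀ = metric F ξ := by
  rw [metric, Matrix.transpose_mul, Matrix.transpose_transpose]

theorem gradV_eq : gradV F w ξ = jac w ξ * pinv F ξ := by
  have e : pinv F ξ = (jac F ξ * (metric F ξ)⁻¹)ᵀ := by
    rw [Matrix.transpose_mul, Matrix.transpose_nonsing_inv, transpose_metric, pinv]
  ext i l
  rw [e, Matrix.mul_apply, gradV, Matrix.of_apply, gradS, Matrix.mulVec, dotProduct]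
  refine Finset.sum_congr rfl fun j _ => ?_
  rw [Matrix.transpose_apply, mul_comm]; rfl

theorem det_metric_eq_cross : (metric F ξ).det =
    ((fun i => jac F ξ i 0) ⨯₃ (fun i => jac F ξ i 1)) ⬝ᵥ
      ((fun i => jac F ξ i 0) ⨯₃ (fun i => jac F ξ i 1)) := by
  rw [Matrix.det_fin_two, cross_apply]
  simp only [metric, Matrix.mul_apply, Matrix.transpose_apply, dotProduct, Fin.sum_univ_three,
    Matrix.cons_val_zero, Matrix.cons_val_one, Matrix.cons_val]
  ring

variable {F ξ}

theorem det_metric_eq_sq (hα : 0 < areaDensity F ξ) :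
    (metric F ξ).det = areaDensity F ξ ^ 2 :=
  (Real.sq_sqrt (Real.sqrt_pos.1 hα).le).symm

theorem normal_dotProduct_self (hα : 0 < areaDensity F ξ) : normal F ξ ⬝ᵥ normal F ξ = 1 := by
  rw [normal, smul_dotProduct, dotProduct_smul, ← det_metric_eq_cross, det_metric_eq_sq hα,
    smul_eq_mul, smul_eq_mul]
  field_simp

theorem normal_dotProduct_jac (j : Fin 2) : (normal F ξ ⬝ᵥ fun i => jac F ξ i j) = 0 := by
  rw [normal, smul_dotProduct]
  fin_cases j
  · simp [cross_apply, dotProduct, Fin.sum_univ_three]; ring_nf; simp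
  · simp [cross_apply, dotProduct, Fin.sum_univ_three]; ring_nf; simp

theorem pinv_mul_jac (hα : 0 < areaDensity F ξ) : pinv F ξ * jac F ξ = 1 := by
  rw [pinv, Matrix.mul_assoc]
  change (metric F ξ)⁻¹ * metric F ξ = 1
  refine Matrix.nonsing_inv_mul _ ?_
  rw [det_metric_eq_sq hα]
  exact (pow_pos hα 2).ne'.isUnit

theorem pinv_mul_tangProj (F : Fin 3 → MvPolynomial (Fin 2) ℝ) (ξ : R2) :
    pinv F ξ * tangProj F ξ = pinv F ξ := by
  have : (jac F ξ)ᵀ * Matrix.vecMulVec (normal F ξ) (normal F ξ) = 0 := by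
    ext j l
    rw [Matrix.mul_apply]
    simp only [Matrix.transpose_apply, Matrix.vecMulVec_apply, ← mul_assoc, ← Finset.sum_mul,
      Matrix.zero_apply]
    have := normal_dotProduct_jac (F := F) (ξ := ξ) j
    rw [dotProduct_comm] at this
    rw [dotProduct] at this
    rw [this, zero_mul]
  rw [tangProj, Matrix.mul_sub, Matrix.mul_one, pinv, Matrix.mul_assoc _ _ (Matrix.vecMulVec _ _),
    this, Matrix.mul_zero, sub_zero]

theorem trace_mul_self_two (B : Matrix (Fin 2) (Fin 2) ℝ) :
    (B * B).trace = B.trace ^ 2 - 2 * B.det := by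
  rw [Matrix.trace_fin_two, Matrix.trace_fin_two, Matrix.det_fin_two, Matrix.mul_apply,
    Matrix.mul_apply, Fin.sum_univ_two, Fin.sum_univ_two]
  ring

theorem trace_transpose_mul_self {m n : Type*} [Fintype m] [Fintype n] (A : Matrix m n ℝ) :
    (Aᵀ * A).trace = ∑ j, ∑ i, A i j ^ 2 := by
  simp [Matrix.trace, Matrix.mul_apply, sq]

theorem trace_transpose_mul_self_nonneg {m n : Type*} [Fintype m] [Fintype n] (A : Matrix m n ℝ) :
    0 ≤ (Aᵀ * A).trace := by
  rw [trace_transpose_mul_self]; positivity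

theorem trace_mul_le (C : Matrix (Fin 3) (Fin 3) ℝ) (J : Matrix (Fin 3) (Fin 2) ℝ) :
    ((C * J)ᵀ * (C * J)).trace ≤ (Cᵀ * C).trace * (Jᵀ * J).trace := by
  simp only [trace_transpose_mul_self, Matrix.mul_apply]
  rw [Finset.sum_comm (f := fun j i => C i j ^ 2), Finset.mul_sum]
  refine Finset.sum_le_sum fun j _ => ?_
  rw [Finset.sum_mul]
  exact Finset.sum_le_sum fun i _ => Finset.sum_mul_sq_le_sq_mul_sq _ _ _

/-- With C the covariant derivative, |E|² = (|C|² + tr C²)/2. The trace of C² equals that of B² for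
the 2×2 matrix B = `pinv F ξ * jac w ξ`, which is (tr B)² - 2 det B by Cayley-Hamilton, and the area
density times det B is n·(∂₁w × ∂₂w). This is the Korn identity: the last term is a divergence up to
the variation of n. -/
theorem trace_strain_sq (hα : 0 < areaDensity F ξ) :
    2 * areaDensity F ξ * ((strain F w ξ)ᵀ * strain F w ξ).trace =
      areaDensity F ξ * ((covV F w ξ)ᵀ * covV F w ξ).trace +
        areaDensity F ξ * (pinv F ξ * jac w ξ).trace ^ 2 -
          2 * (normal F ξ ⬝ᵥ ((fun i => jac w ξ i 0) ⨯₃ (fun i => jac w ξ i 1))) := by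
  set C := covV F w ξ with hC
  have h1 : ((strain F w ξ)ᵀ * strain F w ξ).trace = 1 / 2 * ((Cᵀ * C).trace + (C * C).trace) := by
    have e1 : (C * Cᵀ).trace = (Cᵀ * C).trace := Matrix.trace_mul_comm _ _
    have e2 : (Cᵀ * Cᵀ).trace = (C * C).trace := by
      rw [← Matrix.transpose_mul, Matrix.trace_transpose]
    rw [strain, ← hC, Matrix.transpose_smul, Matrix.transpose_add, Matrix.transpose_transpose,
      Matrix.smul_mul, Matrix.mul_smul, Matrix.trace_smul, Matrix.trace_smul, Matrix.add_mul,
      Matrix.mul_add, Matrix.mul_add, Matrix.trace_add, Matrix.trace_add, Matrix.trace_add, e1, e2,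
      smul_eq_mul, smul_eq_mul]
    ring
  have h2 : (C * C).trace = ((pinv F ξ * jac w ξ) * (pinv F ξ * jac w ξ)).trace := by
    have hQ : pinv F ξ * (tangProj F ξ * jac w ξ) = pinv F ξ * jac w ξ := by
      rw [← Matrix.mul_assoc, pinv_mul_tangProj]
    have hCC : covV F w ξ = tangProj F ξ * jac w ξ * pinv F ξ := by
      rw [covV, gradV_eq, Matrix.mul_assoc]
    rw [hC, hCC, Matrix.mul_assoc (tangProj F ξ * jac w ξ), Matrix.trace_mul_comm,
      Matrix.mul_assoc, Matrix.mul_assoc, hQ, ← Matrix.mul_assoc, hQ]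
  have h3 : (pinv F ξ * jac w ξ).det = (areaDensity F ξ)⁻¹ *
      (normal F ξ ⬝ᵥ ((fun i => jac w ξ i 0) ⨯₃ (fun i => jac w ξ i 1))) := by
    have e : ((jac F ξ)ᵀ * jac w ξ).det = ((fun i => jac F ξ i 0) ⨯₃ (fun i => jac F ξ i 1)) ⬝ᵥ
        ((fun i => jac w ξ i 0) ⨯₃ (fun i => jac w ξ i 1)) := by
      rw [Matrix.det_fin_two, cross_apply, cross_apply]
      simp only [Matrix.mul_apply, Matrix.transpose_apply, dotProduct, Fin.sum_univ_three,
        Matrix.cons_val_zero, Matrix.cons_val_one, Matrix.cons_val]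
      ring
    rw [pinv, Matrix.mul_assoc, Matrix.det_mul, Matrix.det_nonsing_inv, det_metric_eq_sq hα, e,
      normal, smul_dotProduct, Ring.inverse_eq_inv, smul_eq_mul]
    ring
  rw [h1, h2, trace_mul_self_two, h3]
  field_simp
  ring

theorem trace_tangProj_mul_sq (hα : 0 < areaDensity F ξ) (W : Matrix (Fin 3) (Fin 2) ℝ) :
    ((tangProj F ξ * W)ᵀ * (tangProj F ξ * W)).trace =
      ∑ j, ((∑ i, W i j ^ 2) - (normal F ξ ⬝ᵥ fun i => W i j) ^ 2) := by
  rw [trace_transpose_mul_self]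
  refine Finset.sum_congr rfl fun j _ => ?_
  have h := normal_dotProduct_self hα
  simp only [dotProduct, Fin.sum_univ_three] at h ⊢
  set n := normal F ξ
  have e : ∀ i, (tangProj F ξ * W) i j = W i j - n i * (n 0 * W 0 j + n 1 * W 1 j + n 2 * W 2 j) := by
    intro i
    rw [tangProj, Matrix.sub_mul, Matrix.one_mul, Matrix.sub_apply, Matrix.mul_apply,
      Fin.sum_univ_three]
    simp only [Matrix.vecMulVec_apply]
    ring
  rw [e, e, e]
  linear_combination (n 0 * W 0 j + n 1 * W 1 j + n 2 * W 2 j) ^ 2 * h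

theorem trace_covV_sq_le (hα : 0 < areaDensity F ξ) :
    areaDensity F ξ * ((covV F w ξ)ᵀ * covV F w ξ).trace ≤
      2 * (areaDensity F ξ * ((strain F w ξ)ᵀ * strain F w ξ).trace +
        (normal F ξ ⬝ᵥ ((fun i => jac w ξ i 0) ⨯₃ (fun i => jac w ξ i 1)))) := by
  have h1 := trace_strain_sq w hα
  have : 0 ≤ areaDensity F ξ * (pinv F ξ * jac w ξ).trace ^ 2 := by positivity
  linarith

theorem korn_pointwise_nonneg (hα : 0 < areaDensity F ξ) :
    0 ≤ areaDensity F ξ * ((strain F w ξ)ᵀ * strain F w ξ).trace +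
        (normal F ξ ⬝ᵥ ((fun i => jac w ξ i 0) ⨯₃ (fun i => jac w ξ i 1))) := by
  have h1 := trace_covV_sq_le w hα
  have := mul_nonneg hα.le (trace_transpose_mul_self_nonneg (covV F w ξ))
  linarith

/-- Pointwise form of Korn's inequality. -/
theorem korn_pointwise (hα : 0 < areaDensity F ξ) :
    areaDensity F ξ * ∑ j, ((∑ i, jac w ξ i j ^ 2) - (normal F ξ ⬝ᵥ fun i => jac w ξ i j) ^ 2) ≤
      2 * (areaDensity F ξ * ((strain F w ξ)ᵀ * strain F w ξ).trace +
        (normal F ξ ⬝ᵥ ((fun i => jac w ξ i 0) ⨯₃ (fun i => jac w ξ i 1)))) *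
        ((jac F ξ)ᵀ * jac F ξ).trace := by
  have h2 := trace_mul_le (covV F w ξ) (jac F ξ)
  have e : covV F w ξ * jac F ξ = tangProj F ξ * jac w ξ := by
    rw [covV, gradV_eq, Matrix.mul_assoc, Matrix.mul_assoc, pinv_mul_jac hα, Matrix.mul_one]
  rw [e, trace_tangProj_mul_sq hα] at h2
  have h3 := trace_transpose_mul_self_nonneg (jac F ξ)
  calc _ ≤ areaDensity F ξ * (((covV F w ξ)ᵀ * covV F w ξ).trace *
        ((jac F ξ)ᵀ * jac F ξ).trace) := by gcongr
    _ = areaDensity F ξ * ((covV F w ξ)ᵀ * covV F w ξ).trace *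
        ((jac F ξ)ᵀ * jac F ξ).trace := by ring
    _ ≤ _ := mul_le_mul_of_nonneg_right (trace_covV_sq_le w hα) h3

/-- Scaling: metric entries are at most of order h², the determinant is at least of order h⁴ and the
Jacobian is at most of order h. -/
theorem abs_pinv_le {C h : ℝ} (hC : 1 ≤ C) (hh : 0 < h) (hJ : ∀ i j, |jac F ξ i j| ≤ C * h)
    (hα : h ^ 2 ≤ C * areaDensity F ξ) (j : Fin 2) (l : Fin 3) :
    |pinv F ξ j l| ≤ 6 * C ^ 5 / h := by
  have hα0 : 0 < areaDensity F ξ := by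
    have : 0 < C * areaDensity F ξ := lt_of_lt_of_le (by positivity) hα
    exact pos_of_mul_pos_right this (by linarith)
  have hG : ∀ i j, |metric F ξ i j| ≤ 3 * (C * h) ^ 2 := by
    intro i j
    rw [metric, Matrix.mul_apply]
    refine (Finset.abs_sum_le_sum_abs _ _).trans ?_
    calc _ ≤ ∑ l : Fin 3, C * h * (C * h) := by
          gcongr with l
          rw [abs_mul, Matrix.transpose_apply]
          gcongr
          exacts [hJ l i, hJ l j]
      _ = _ := by simp; ring
  have hadj : ∀ i j, |(metric F ξ).adjugate i j| ≤ 3 * (C * h) ^ 2 := by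
    intro i j
    rw [Matrix.adjugate_fin_two]
    fin_cases i <;> fin_cases j <;> simp [hG]
  have hinv : ∀ i j, |(metric F ξ)⁻¹ i j| ≤ 3 * C ^ 4 / h ^ 2 := by
    intro i j
    rw [Matrix.inv_def, Matrix.smul_apply, Ring.inverse_eq_inv, smul_eq_mul, abs_mul,
      det_metric_eq_sq hα0, abs_inv, abs_of_pos (pow_pos hα0 2), inv_mul_le_iff₀ (pow_pos hα0 2)]
    have h4 : h ^ 4 ≤ C ^ 2 * areaDensity F ξ ^ 2 := by
      have := pow_le_pow_left₀ (by positivity) hα 2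
      calc _ = (h ^ 2) ^ 2 := by ring
        _ ≤ _ := this
        _ = _ := by ring
    refine (hadj i j).trans ?_
    rw [mul_div_assoc', le_div_iff₀ (by positivity)]
    calc _ = 3 * C ^ 2 * h ^ 4 := by ring
      _ ≤ 3 * C ^ 2 * (C ^ 2 * areaDensity F ξ ^ 2) := by gcongr
      _ = _ := by ring
  rw [pinv, Matrix.mul_apply]
  refine (Finset.abs_sum_le_sum_abs _ _).trans ?_
  calc _ ≤ ∑ _i : Fin 2, 3 * C ^ 4 / h ^ 2 * (C * h) := by
        gcongr with i
        rw [abs_mul, Matrix.transpose_apply]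
        gcongr
        exacts [hinv j i, hJ l i]
    _ = _ := by
        simp only [Finset.sum_const, Finset.card_univ, Fintype.card_fin, nsmul_eq_mul]
        field_simp; norm_num

end ESFEM

namespace ESFEM

/-! ### Continuity of the pulled-back integrands -/

theorem continuous_jac (F : Fin 3 → MvPolynomial (Fin 2) ℝ) (i : Fin 3) (j : Fin 2) :
    Continuous fun ξ => jac F ξ i j := continuous_eval _

theorem continuous_metric (F : Fin 3 → MvPolynomial (Fin 2) ℝ) (i j : Fin 2) :
    Continuous fun ξ => metric F ξ i j := by
  simp only [metric, Matrix.mul_apply, Matrix.transpose_apply]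
  have := continuous_jac F
  fun_prop

theorem continuous_areaDensity (F : Fin 3 → MvPolynomial (Fin 2) ℝ) :
    Continuous (areaDensity F) := by
  have := continuous_metric F
  have e : areaDensity F = fun ξ =>
      √(metric F ξ 0 0 * metric F ξ 1 1 - metric F ξ 0 1 * metric F ξ 1 0) := by
    ext ξ; rw [areaDensity, Matrix.det_fin_two]
  rw [e]
  fun_prop

theorem areaDensity_nonneg (F : Fin 3 → MvPolynomial (Fin 2) ℝ) (ξ : R2) : 0 ≤ areaDensity F ξ :=
  Real.sqrt_nonneg _

section

variable {F : Fin 3 → MvPolynomial (Fin 2) ℝ}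

theorem continuousOn_inv_areaDensity (hF : ∀ ξ ∈ refTri, 0 < areaDensity F ξ) :
    ContinuousOn (fun ξ => (areaDensity F ξ)⁻¹) refTri :=
  (continuous_areaDensity F).continuousOn.inv₀ fun ξ hξ => (hF ξ hξ).ne'

theorem continuousOn_normal (hF : ∀ ξ ∈ refTri, 0 < areaDensity F ξ)
    (i : Fin 3) : ContinuousOn (fun ξ => normal F ξ i) refTri := by
  have h2 := continuousOn_inv_areaDensity hF
  have h3 := continuous_jac F
  have h4 : Continuous fun ξ => ((fun i => jac F ξ i 0) ⨯₃ (fun i => jac F ξ i 1)) i := by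
    fin_cases i <;> simp [cross_apply] <;> fun_prop
  exact h2.mul h4.continuousOn

theorem continuousOn_pinv (hF : ∀ ξ ∈ refTri, 0 < areaDensity F ξ)
    (j : Fin 2) (l : Fin 3) :
    ContinuousOn (fun ξ => pinv F ξ j l) refTri := by
  have h2 := continuousOn_inv_areaDensity hF
  have h3 := continuous_jac F
  have h4 := continuous_metric F
  have h5 : ∀ i j, Continuous fun ξ => (metric F ξ).adjugate i j := by
    intro i j
    simp only [Matrix.adjugate_fin_two]
    fin_cases i <;> fin_cases j <;> simp <;> fun_prop
  have h6 : ContinuousOn (fun ξ => (areaDensity F ξ)⁻¹ ^ 2 *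
      ∑ i, (metric F ξ).adjugate j i * jac F ξ l i) refTri :=
    (h2.pow 2).mul (by fun_prop)
  refine h6.congr fun ξ hξ => ?_
  simp only
  rw [pinv, Matrix.inv_def, Ring.inverse_eq_inv, det_metric_eq_sq (hF ξ hξ), Matrix.smul_mul,
    Matrix.smul_apply, Matrix.mul_apply, smul_eq_mul, inv_pow]
  rfl

theorem continuousOn_gradV (hF : ∀ ξ ∈ refTri, 0 < areaDensity F ξ)
    (w : Fin 3 → MvPolynomial (Fin 2) ℝ) (i l : Fin 3) :
    ContinuousOn (fun ξ => gradV F w ξ i l) refTri := by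
  have h1 := continuousOn_pinv hF
  have h2 := continuous_jac w
  simp only [gradV_eq, Matrix.mul_apply]
  fun_prop

theorem continuousOn_strain (hF : ∀ ξ ∈ refTri, 0 < areaDensity F ξ)
    (w : Fin 3 → MvPolynomial (Fin 2) ℝ) (i l : Fin 3) :
    ContinuousOn (fun ξ => strain F w ξ i l) refTri := by
  have h1 := continuousOn_gradV hF w
  have h2 := continuousOn_normal hF
  have h3 : ∀ i l, ContinuousOn (fun ξ => covV F w ξ i l) refTri := by
    intro i l
    simp only [covV, tangProj, Matrix.mul_apply, Matrix.sub_apply, Matrix.vecMulVec_apply]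
    fun_prop
  simp only [strain, Matrix.smul_apply, Matrix.add_apply, Matrix.transpose_apply, smul_eq_mul]
  fun_prop

theorem continuousOn_trace_strain (hF : ∀ ξ ∈ refTri, 0 < areaDensity F ξ)
    (w v : Fin 3 → MvPolynomial (Fin 2) ℝ) :
    ContinuousOn (fun ξ => ((strain F w ξ)ᵀ * strain F v ξ).trace) refTri := by
  have h1 := continuousOn_strain hF w
  have h2 := continuousOn_strain hF v
  simp only [Matrix.trace, Matrix.diag_apply, Matrix.mul_apply, Matrix.transpose_apply]
  exact continuousOn_finsetSum _ fun i _ => continuousOn_finsetSum _ fun j _ =>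
    (h1 j i).mul (h2 j i)

end

variable {T : ℝ} {m : ℕ} {S : EvolvingSurface T m} {M : Mesh S} {kg : ℕ} {C t : ℝ}

namespace Mesh

theorem continuous_field (w : VectorFn M) (K : Fin M.numTri) (i : Fin 3) :
    Continuous fun ξ => M.field w K ξ i := continuous_eval _

theorem integral_eq_refSum (φ : Fin M.numTri → R2 → ℝ) :
    M.integral kg t φ = refSum fun K ξ => φ K ξ * areaDensity (M.elem kg t K) ξ := rfl

/-- The sum of the squared `L²` norms on the reference triangle. -/
noncomputable def refSq (w : VectorFn M) : ℝ :=
  refSum fun K ξ => ∑ i, MvPolynomial.eval ξ (w i K) ^ 2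

/-- The sum of the squared `L²` norms of the gradients on the reference triangle. -/
noncomputable def refGradSq (w : VectorFn M) : ℝ :=
  refSum fun K ξ => ∑ i, ∑ j, MvPolynomial.eval ξ (MvPolynomial.pderiv j (w i K)) ^ 2

theorem refSq_nonneg (w : VectorFn M) : 0 ≤ refSq w := refSum_nonneg fun K ξ => by positivity

theorem refGradSq_nonneg (w : VectorFn M) : 0 ≤ refGradSq w :=
  refSum_nonneg fun K ξ => by positivity

namespace Regular

theorem area_pos (hM : M.Regular kg C) (hC : 1 ≤ C) (ht : t ∈ Icc 0 T)
    (K : Fin M.numTri) {ξ : R2} (hξ : ξ ∈ refTri) :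
    0 < areaDensity (M.elem kg t K) ξ := by
  have h1 := hM.le_areaDensity t ht K ξ hξ
  have h2 : 0 < C * areaDensity (M.elem kg t K) ξ := lt_of_lt_of_le (pow_pos hM.size_pos 2) h1
  exact pos_of_mul_pos_right h2 (by linarith)

theorem norm_jacCol_le (hM : M.Regular kg C) (ht : t ∈ Icc 0 T)
    (K : Fin M.numTri) {ξ : R2} (hξ : ξ ∈ refTri) (j : Fin 2) :
    ‖jacCol (M.elem kg t K) ξ j‖ ≤ 2 * (C * M.size kg) :=
  norm_le_of_abs_apply_le fun i => hM.abs_jac_le t ht K ξ hξ i j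

theorem area_le (hM : M.Regular kg C) (hC : 1 ≤ C) (ht : t ∈ Icc 0 T)
    (K : Fin M.numTri) {ξ : R2} (hξ : ξ ∈ refTri) :
    areaDensity (M.elem kg t K) ξ ≤ 4 * C ^ 2 * M.size kg ^ 2 := by
  have hh := hM.size_pos
  rw [areaDensity_eq_norm]
  calc _ ≤ _ := norm_crossE_le _ _
    _ ≤ 2 * (C * M.size kg) * (2 * (C * M.size kg)) := by
      gcongr <;> exact hM.norm_jacCol_le ht K hξ _
    _ = _ := by ring

/-- The cross products of the columns differ by O(h²|t - s|), and h² is bounded by C times the area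
density. The relative form compares mass forms at consecutive times. -/
theorem area_le_area (hM : M.Regular kg C) (hC : 1 ≤ C) (ht : t ∈ Icc 0 T)
    {s : ℝ} (hs : s ∈ Icc 0 T) (K : Fin M.numTri) {ξ : R2} (hξ : ξ ∈ refTri) :
    areaDensity (M.elem kg s K) ξ ≤ (1 + 8 * C ^ 3 * |t - s|) * areaDensity (M.elem kg t K) ξ := by
  have hh := hM.size_pos
  have hd : ∀ j, ‖jacCol (M.elem kg s K) ξ j - jacCol (M.elem kg t K) ξ j‖ ≤
      2 * (C * M.size kg * |t - s|) := fun j => norm_le_of_abs_apply_le fun i => by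
    rw [abs_sub_comm]
    exact hM.abs_jac_sub_le s hs t ht K ξ hξ i j
  have h1 : areaDensity (M.elem kg s K) ξ - areaDensity (M.elem kg t K) ξ ≤
      8 * C ^ 2 * M.size kg ^ 2 * |t - s| := by
    rw [areaDensity_eq_norm, areaDensity_eq_norm]
    refine (norm_sub_norm_le _ _).trans ((norm_crossE_sub_le _ _ _ _).trans ?_)
    calc _ ≤ 2 * (C * M.size kg * |t - s|) * (2 * (C * M.size kg)) +
          2 * (C * M.size kg) * (2 * (C * M.size kg * |t - s|)) := by
          gcongr
          exacts [hd 0, hM.norm_jacCol_le hs K hξ 1, hM.norm_jacCol_le ht K hξ 0, hd 1]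
      _ = _ := by ring
  have h2 : 8 * C ^ 2 * |t - s| * M.size kg ^ 2 ≤
      8 * C ^ 2 * |t - s| * (C * areaDensity (M.elem kg t K) ξ) := by
    gcongr; exact hM.le_areaDensity t ht K ξ hξ
  linarith

theorem sq_mul_refSum_le (hM : M.Regular kg C) (ht : t ∈ Icc 0 T)
    {φ : Fin M.numTri → R2 → ℝ} (hφ : ∀ K, ContinuousOn (φ K) refTri)
    (h0 : ∀ K, ∀ ξ ∈ refTri, 0 ≤ φ K ξ) :
    M.size kg ^ 2 * refSum φ ≤ C * M.integral kg t φ := by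
  rw [integral_eq_refSum, ← refSum_const_mul, ← refSum_const_mul]
  have h1 := fun K => continuous_areaDensity (M.elem kg t K)
  refine refSum_mono (fun K => by fun_prop) (fun K => by fun_prop) fun K ξ hξ => ?_
  have := mul_le_mul_of_nonneg_right (hM.le_areaDensity t ht K ξ hξ) (h0 K ξ hξ)
  linarith

theorem integral_le_sq_mul_refSum (hM : M.Regular kg C) (hC : 1 ≤ C) (ht : t ∈ Icc 0 T)
    {φ : Fin M.numTri → R2 → ℝ}
    (hφ : ∀ K, ContinuousOn (φ K) refTri) (h0 : ∀ K, ∀ ξ ∈ refTri, 0 ≤ φ K ξ) :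
    M.integral kg t φ ≤ 4 * C ^ 2 * (M.size kg ^ 2 * refSum φ) := by
  rw [integral_eq_refSum, ← refSum_const_mul, ← refSum_const_mul]
  have h1 := fun K => continuous_areaDensity (M.elem kg t K)
  refine refSum_mono (fun K => by fun_prop) (fun K => by fun_prop) fun K ξ hξ => ?_
  have := mul_le_mul_of_nonneg_right (hM.area_le hC ht K hξ) (h0 K ξ hξ)
  linarith

theorem refSq_le_mForm (hM : M.Regular kg C) (ht : t ∈ Icc 0 T)
    (w : VectorFn M) :
    M.size kg ^ 2 * refSq w ≤ C * M.mForm kg t (M.field w) (M.field w) := by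
  have hc := fun (p : MvPolynomial (Fin 2) ℝ) => continuous_eval p
  refine (hM.sq_mul_refSum_le ht (fun K => by fun_prop) fun K ξ _ => by positivity).trans_eq ?_
  simp only [mForm, dotProduct, field, sq]

theorem mForm_le_mForm (hM : M.Regular kg C) (hC : 1 ≤ C) (ht : t ∈ Icc 0 T)
    {s : ℝ} (hs : s ∈ Icc 0 T) (w : VectorFn M) :
    M.mForm kg s (M.field w) (M.field w) ≤
      (1 + 8 * C ^ 3 * |t - s|) * M.mForm kg t (M.field w) (M.field w) := by
  rw [mForm, mForm, integral_eq_refSum, integral_eq_refSum, ← refSum_const_mul]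
  have h1 := fun s K => continuous_areaDensity (M.elem kg s K)
  have h2 := M.continuous_field w
  simp only [dotProduct]
  refine refSum_mono (fun K => by fun_prop) (fun K => by fun_prop) fun K ξ hξ => ?_
  have h3 : 0 ≤ ∑ i, M.field w K ξ i * M.field w K ξ i :=
    Finset.sum_nonneg fun i _ => mul_self_nonneg _
  have := mul_le_mul_of_nonneg_left (hM.area_le_area hC ht hs K hξ) h3
  linarith

end Regular

end Mesh

/-- Square integrability of a vector field. -/
def Mesh.IsL2 (w : VectorField M) : Prop :=
  ∀ K i, MemLp (fun ξ => w K ξ i) 2 (volume.restrict refTri)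

namespace Mesh

theorem isL2_field (w : VectorFn M) : IsL2 (M.field w) := fun K i => by
  have hc : ContinuousOn (fun ξ => M.field w K ξ i) refTri :=
    (M.continuous_field w K i).continuousOn
  refine (memLp_two_iff_integrable_sq (hc.aestronglyMeasurable measurableSet_refTri)).2 ?_
  exact integrableOn_refTri (hc.pow 2)

theorem IsL2.integrableOn {w v : VectorField M} (hw : IsL2 w) (hv : IsL2 v) (t : ℝ)
    (K : Fin M.numTri) :
    IntegrableOn (fun ξ => w K ξ ⬝ᵥ v K ξ * areaDensity (M.elem kg t K) ξ) refTri := by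
  refine IntegrableOn.mul_continuousOn ?_ (continuous_areaDensity _).continuousOn isCompact_refTri
  simp only [dotProduct]
  exact integrable_finsetSum _ fun i _ => (hw K i).integrable_mul (hv K i)

theorem mForm_self_nonneg (w : VectorField M) : 0 ≤ M.mForm kg t w w :=
  refSum_nonneg fun _ _ => mul_nonneg (by simp [dotProduct, ← sq]; positivity) (Real.sqrt_nonneg _)

theorem aSForm_self_nonneg (w : VectorFn M) : 0 ≤ M.aSForm kg t w w :=
  refSum_nonneg fun _ _ => mul_nonneg (trace_transpose_mul_self_nonneg _) (Real.sqrt_nonneg _)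

theorem two_mul_abs_dotProduct_le {ι : Type*} [Fintype ι] (x y : ι → ℝ) {δ : ℝ} (hδ : 0 < δ) :
    2 * |x ⬝ᵥ y| ≤ δ * (x ⬝ᵥ x) + δ⁻¹ * (y ⬝ᵥ y) := by
  simp only [dotProduct, Finset.mul_sum, ← Finset.sum_add_distrib]
  calc 2 * |∑ i, x i * y i| ≤ 2 * ∑ i, |x i * y i| := by
        gcongr; exact Finset.abs_sum_le_sum_abs _ _
    _ = ∑ i, 2 * |x i * y i| := Finset.mul_sum _ _ _
    _ ≤ _ := by
      refine Finset.sum_le_sum fun i _ => ?_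
      have h := mul_nonneg (inv_pos.2 hδ).le (sq_nonneg (δ * |x i| - |y i|))
      have e : δ⁻¹ * (δ * |x i| - |y i|) ^ 2 =
          δ * |x i| ^ 2 - 2 * (|x i| * |y i|) + δ⁻¹ * |y i| ^ 2 := by field_simp; ring
      rw [e, sq_abs, sq_abs] at h
      rw [abs_mul]
      linarith

theorem two_mul_abs_mForm_le {w v : VectorField M} (hw : IsL2 w) (hv : IsL2 v) {δ : ℝ}
    (hδ : 0 < δ) :
    2 * |M.mForm kg t w v| ≤ δ * M.mForm kg t w w + δ⁻¹ * M.mForm kg t v v := by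
  simp only [mForm, Mesh.integral, Finset.mul_sum, ← Finset.sum_add_distrib]
  refine (mul_le_mul_of_nonneg_left (Finset.abs_sum_le_sum_abs _ _) zero_le_two).trans ?_
  rw [Finset.mul_sum]
  refine Finset.sum_le_sum fun K _ => ?_
  rw [← integral_const_mul, ← integral_const_mul,
    ← integral_add ((hw.integrableOn hw t K).const_mul _) ((hv.integrableOn hv t K).const_mul _)]
  refine (mul_le_mul_of_nonneg_left (abs_integral_le_integral_abs) zero_le_two).trans ?_
  rw [← integral_const_mul]
  refine integral_mono ((hw.integrableOn hv t K).abs.const_mul _)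
    (((hw.integrableOn hw t K).const_mul _).add ((hv.integrableOn hv t K).const_mul _)) fun ξ => ?_
  simp only
  rw [abs_mul, abs_of_nonneg (areaDensity_nonneg _ _)]
  have := mul_le_mul_of_nonneg_right (two_mul_abs_dotProduct_le (w K ξ) (v K ξ) hδ)
    (areaDensity_nonneg (M.elem kg t K) ξ)
  linarith

theorem mForm_sub_left {w w' v : VectorField M} (hw : IsL2 w) (hw' : IsL2 w') (hv : IsL2 v) :
    M.mForm kg t (fun K ξ => w K ξ - w' K ξ) v = M.mForm kg t w v - M.mForm kg t w' v := by
  simp only [mForm, Mesh.integral, ← Finset.sum_sub_distrib]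
  refine Finset.sum_congr rfl fun K _ => ?_
  rw [← integral_sub (hw.integrableOn hv t K) (hw'.integrableOn hv t K)]
  simp only [sub_dotProduct, sub_mul]

/-- `|φ|`-bound of the integral over the discrete surface. -/
theorem abs_integral_le {φ ψ : Fin M.numTri → R2 → ℝ}
    (hφ : ∀ K, ContinuousOn (φ K) refTri) (hψ : ∀ K, ContinuousOn (ψ K) refTri)
    (h : ∀ K, ∀ ξ ∈ refTri, |φ K ξ| * areaDensity (M.elem kg t K) ξ ≤ ψ K ξ) :
    |M.integral kg t φ| ≤ refSum ψ := by
  have h1 := fun K => continuous_areaDensity (M.elem kg t K)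
  refine (Finset.abs_sum_le_sum_abs _ _).trans (Finset.sum_le_sum fun K _ => ?_)
  refine abs_integral_le_integral_abs.trans ?_
  refine setIntegral_mono_on (integrableOn_refTri (by fun_prop)) (integrableOn_refTri (hψ K))
    measurableSet_refTri fun ξ hξ => ?_
  rw [abs_mul, abs_of_nonneg (areaDensity_nonneg _ _)]
  exact h K ξ hξ

end Mesh

end ESFEM

namespace ESFEM

/-! ### Superapproximation -/

/-- Lagrange interpolation of degree `k` of a scalar function. -/
noncomputable def nodalInterp (k : ℕ) (f : R2 → ℝ) : MvPolynomial (Fin 2) ℝ :=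
  ∑ α ∈ Finset.Nat.antidiagonalTuple 3 k, MvPolynomial.C (f (lagrangeNode k α)) * lagrangePoly k α

theorem eval_nodalInterp (k : ℕ) (f : R2 → ℝ) (ξ : R2) :
    MvPolynomial.eval ξ (nodalInterp k f) = ∑ α ∈ Finset.Nat.antidiagonalTuple 3 k,
      f (lagrangeNode k α) * MvPolynomial.eval ξ (lagrangePoly k α) := by
  simp [nodalInterp, map_sum]

/-- Freeze ν at the constants c: the combination ∑ cᵢwᵢ has degree at most k and is reproduced by
interpolation. What remains is ∑ wᵢ(νᵢ - cᵢ), of size δ times w by the inverse inequality, and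
interpolation is stable in the maximum norm. -/
theorem exists_sq_sub_nodalInterp_le {k : ℕ} (hk : 1 ≤ k) : ∃ B > 0,
    ∀ (w ν : Fin 3 → MvPolynomial (Fin 2) ℝ) (c : Fin 3 → ℝ) (δ : ℝ),
      (∀ i, (w i).totalDegree ≤ k) →
      (∀ ξ ∈ refTri, ∀ i, |MvPolynomial.eval ξ (ν i) - c i| ≤ δ) → ∀ ξ ∈ refTri,
      (MvPolynomial.eval ξ (∑ i, w i * ν i) - MvPolynomial.eval ξ
        (nodalInterp k fun η => MvPolynomial.eval η (∑ i, w i * ν i))) ^ 2 ≤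
        B * δ ^ 2 * ∑ i, ∫ ξ in refTri, MvPolynomial.eval ξ (w i) ^ 2 := by
  obtain ⟨B, hB0, hB⟩ := exists_bound_lagrangePoly k
  obtain ⟨D, hD0, hD⟩ := exists_inverse_bound k
  set I := Finset.Nat.antidiagonalTuple 3 k with hI
  refine ⟨(2 + 2 * I.card ^ 2 * B ^ 2) * (3 * D), by positivity, fun w ν c δ hw hν ξ hξ => ?_⟩
  set J := ∑ i, ∫ ξ in refTri, MvPolynomial.eval ξ (w i) ^ 2 with hJ
  set d : R2 → ℝ := fun η => ∑ i, MvPolynomial.eval η (w i) * (MvPolynomial.eval η (ν i) - c i)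
    with hd
  set p : MvPolynomial (Fin 2) ℝ := ∑ i, MvPolynomial.C (c i) * w i with hp
  have hpd : p.totalDegree ≤ k := by
    refine MvPolynomial.totalDegree_finsetSum_le fun i _ => ?_
    refine (MvPolynomial.totalDegree_mul _ _).trans ?_
    rw [MvPolynomial.totalDegree_C, zero_add]
    exact hw i
  have hg : ∀ η, MvPolynomial.eval η (∑ i, w i * ν i) = MvPolynomial.eval η p + d η := by
    intro η
    simp only [hp, hd, map_sum, map_mul, MvPolynomial.eval_C, ← Finset.sum_add_distrib]
    exact Finset.sum_congr rfl fun i _ => by ring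
  have hpr : MvPolynomial.eval ξ p = ∑ α ∈ I,
      MvPolynomial.eval (lagrangeNode k α) p * MvPolynomial.eval ξ (lagrangePoly k α) := by
    conv_lhs => rw [sum_lagrangePoly_eq hk hpd]
    simp [map_sum, hI]
  have hdiff : MvPolynomial.eval ξ (∑ i, w i * ν i) - MvPolynomial.eval ξ
        (nodalInterp k fun η => MvPolynomial.eval η (∑ i, w i * ν i)) =
      d ξ - ∑ α ∈ I, d (lagrangeNode k α) * MvPolynomial.eval ξ (lagrangePoly k α) := by
    rw [eval_nodalInterp]
    simp only [hg, add_mul, Finset.sum_add_distrib]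
    rw [← hI, ← hpr]; ring
  have hdle : ∀ η ∈ refTri, d η ^ 2 ≤ 3 * D * δ ^ 2 * J := by
    intro η hη
    have h1 := sq_sum_le_card_mul_sum_sq (s := Finset.univ)
      (f := fun i => MvPolynomial.eval η (w i) * (MvPolynomial.eval η (ν i) - c i))
    simp only [Finset.card_univ, Fintype.card_fin, Nat.cast_ofNat] at h1
    refine h1.trans ?_
    have e : 3 * D * δ ^ 2 * J =
        3 * ∑ i, D * δ ^ 2 * ∫ ξ in refTri, MvPolynomial.eval ξ (w i) ^ 2 := by
      rw [← Finset.mul_sum]; ring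
    rw [e]
    refine mul_le_mul_of_nonneg_left (Finset.sum_le_sum fun i _ => ?_) (by norm_num)
    rw [mul_pow]
    have h2 := (hD (w i) (hw i) η hη).1
    have h3 : (MvPolynomial.eval η (ν i) - c i) ^ 2 ≤ δ ^ 2 := by
      rw [← sq_abs]
      exact pow_le_pow_left₀ (abs_nonneg _) (hν η hη i) 2
    calc _ ≤ D * (∫ ξ in refTri, MvPolynomial.eval ξ (w i) ^ 2) * δ ^ 2 :=
          mul_le_mul h2 h3 (sq_nonneg _) ((sq_nonneg _).trans h2)
      _ = _ := by ring
  have hsum : (∑ α ∈ I, d (lagrangeNode k α) * MvPolynomial.eval ξ (lagrangePoly k α)) ^ 2 ≤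
      I.card ^ 2 * (3 * D * δ ^ 2 * J * B ^ 2) := by
    refine sq_sum_le_card_mul_sum_sq.trans ?_
    rw [sq (I.card : ℝ), mul_assoc]
    gcongr
    rw [← nsmul_eq_mul]
    refine Finset.sum_le_card_nsmul _ _ _ fun α hα => ?_
    rw [mul_pow]
    have h2 := hdle _ (lagrangeNode_mem_refTri hk hα)
    refine mul_le_mul h2 ?_ (sq_nonneg _) ((sq_nonneg _).trans h2)
    rw [← sq_abs]
    exact pow_le_pow_left₀ (abs_nonneg _) (hB α hα ξ hξ).1 2
  rw [hdiff]
  have h4 : ∀ x y : ℝ, (x - y) ^ 2 ≤ 2 * x ^ 2 + 2 * y ^ 2 := fun x y => by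
    nlinarith [sq_nonneg (x + y)]
  refine (h4 _ _).trans ?_
  have := hdle ξ hξ
  linarith

variable {T : ℝ} {m : ℕ} {S : EvolvingSurface T m} {M : Mesh S} {kg : ℕ} {C t : ℝ}

theorem Mesh.Regular.exists_normal_interp (hM : M.Regular kg C) (ht : t ∈ Icc 0 T) :
    ∃ N : Fin 3 → E3 → ℝ, ∀ K, ∀ ξ ∈ refTri, ∀ i,
      |MvPolynomial.eval ξ (M.vertexInterp (N i) K)| ≤ 1 ∧
      (∀ j, |MvPolynomial.eval ξ (MvPolynomial.pderiv j (M.vertexInterp (N i) K))| ≤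
        C * M.size kg) ∧
      |MvPolynomial.eval ξ (M.vertexInterp (N i) K) - N i (M.vert K 0)| ≤ C * M.size kg ∧
      |normal (M.elem kg t K) ξ i - MvPolynomial.eval ξ (M.vertexInterp (N i) K)| ≤
        C * M.size kg := by
  obtain ⟨N, h1, h2, h3⟩ := hM.exists_normal t ht
  refine ⟨fun i x => N x i, fun K ξ hξ i => ⟨?_, fun j => ?_, ?_, ?_⟩⟩
  · exact abs_eval_vertexInterp_le M (fun j => (abs_apply_le _ i).trans (h1 K j)) hξ
  · rw [eval_pderiv_vertexInterp]
    exact (abs_apply_le (N (M.vert K j.succ) - N (M.vert K 0)) i).trans (h2 K _ _)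
  · have e : MvPolynomial.eval ξ (M.vertexInterp (fun x => N x i) K) - N (M.vert K 0) i =
        MvPolynomial.eval ξ (M.vertexInterp (fun x => N x i - N (M.vert K 0) i) K) := by
      rw [M.eval_vertexInterp, M.eval_vertexInterp]
      simp only [sub_mul, Finset.sum_sub_distrib]
      rw [← Finset.mul_sum, sum_eval_baryPoly, mul_one]
    rw [e]
    exact abs_eval_vertexInterp_le M (fun j =>
      (abs_apply_le (N (M.vert K j) - N (M.vert K 0)) i).trans (h2 K _ _)) hξ
  · have := (abs_apply_le _ i).trans (h3 K ξ hξ)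
    rw [flatMap_eq] at this
    rw [M.eval_vertexInterp, Fin.sum_univ_three, eval_baryPoly_zero, eval_baryPoly_one,
      eval_baryPoly_two]
    refine le_trans (le_of_eq ?_) this
    simp
    ring_nf

theorem gradS_zero (F : Fin 3 → MvPolynomial (Fin 2) ℝ) (ξ : R2) : gradS F 0 ξ = 0 := by
  have : (fun j => MvPolynomial.eval ξ (MvPolynomial.pderiv j (0 : MvPolynomial (Fin 2) ℝ))) = 0 := by
    ext j; simp
  rw [gradS, this, Matrix.mulVec_zero]

/-- The pressure test function q = 0 isolates the normal constraint. -/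
theorem Mesh.integral_mul_normal_eq_zero {ku : ℕ} {w : VectorFn M} (hw : w ∈ M.divFree ku kg t)
    {η : ScalarFn M} (hη : η ∈ M.scalarSpace ku) :
    M.integral kg t (fun K ξ =>
      MvPolynomial.eval ξ (η K) * (M.field w K ξ ⬝ᵥ normal (M.elem kg t K) ξ)) = 0 := by
  have h0 : (0 : ScalarFn M) ∈ M.presSpace kg (ku - 1) t :=
    ⟨⟨fun K => by simp, fun K K' ξ _ ξ' _ _ => by simp⟩, by simp [Mesh.integral]⟩
  have h := hw.2 0 h0 η hη
  rw [Mesh.bForm] at h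
  simp only [Pi.zero_apply, gradS_zero, dotProduct_zero] at h
  rw [← h]
  simp [Mesh.integral]

end ESFEM

namespace ESFEM

/-! ### The normal component of discretely tangential fields -/

variable {T : ℝ} {m : ℕ} {S : EvolvingSurface T m} {kg : ℕ} {C : ℝ}

theorem sq_sum_three_le (x y : Fin 3 → ℝ) {B : ℝ} (hy : ∀ i, |y i| ≤ B) :
    (∑ i, x i * y i) ^ 2 ≤ 3 * B ^ 2 * ∑ i, x i ^ 2 := by
  have h1 := sq_sum_le_card_mul_sum_sq (s := Finset.univ) (f := fun i => x i * y i)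
  simp only [Finset.card_univ, Fintype.card_fin, Nat.cast_ofNat] at h1
  refine h1.trans ?_
  rw [mul_assoc, Finset.mul_sum (a := B ^ 2)]
  refine mul_le_mul_of_nonneg_left (Finset.sum_le_sum fun i _ => ?_) (by norm_num)
  rw [mul_pow, mul_comm]
  have : y i ^ 2 ≤ B ^ 2 := by
    rw [← sq_abs]; exact pow_le_pow_left₀ (abs_nonneg _) (hy i) 2
  gcongr

theorem add_sq_le (x y : ℝ) : (x + y) ^ 2 ≤ 2 * x ^ 2 + 2 * y ^ 2 := by
  nlinarith [sq_nonneg (x - y)]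

theorem refSum_le_sum_mul {n : ℕ} {f : Fin n → R2 → ℝ} {B : Fin n → ℝ}
    (hf : ∀ K, ContinuousOn (f K) refTri) (h : ∀ K, ∀ ξ ∈ refTri, f K ξ ≤ B K) :
    refSum f ≤ (volume.real refTri) * ∑ K, B K := by
  refine (refSum_mono (g := fun K _ => B K) hf (fun K => continuousOn_const) h).trans_eq ?_
  simp [refSum, Finset.mul_sum]

theorem sum_refSum_sq {n : ℕ} (w : Fin 3 → Fin n → MvPolynomial (Fin 2) ℝ) :
    ∑ K, ∑ i, ∫ ξ in refTri, MvPolynomial.eval ξ (w i K) ^ 2 =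
      refSum fun K ξ => ∑ i, MvPolynomial.eval ξ (w i K) ^ 2 := by
  have hc := fun (p : MvPolynomial (Fin 2) ℝ) => continuous_eval p
  rw [refSum_finset_sum _ fun i _ K => by fun_prop, Finset.sum_comm]
  rfl

/-- The product of a velocity field with the interpolated normal. -/
noncomputable def normalComp (M : Mesh S) (N : Fin 3 → E3 → ℝ) (w : VectorFn M) : ScalarFn M :=
  fun K => ∑ i, w i K * M.vertexInterp (N i) K

theorem normalComp_mem {M : Mesh S} (N : Fin 3 → E3 → ℝ) {k : ℕ} {w : VectorFn M}
    (hw : w ∈ M.velSpace k) : normalComp M N w ∈ M.scalarSpace (k + 1) :=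
  M.sum_mem_scalarSpace Finset.univ fun i _ => M.mul_mem_scalarSpace (hw i) (M.vertexInterp_mem _)

/-- `N` interpolates the discrete normal at time `t`. -/
def IsNormalInterp (M : Mesh S) (kg : ℕ) (C t : ℝ) (N : Fin 3 → E3 → ℝ) : Prop :=
  ∀ K, ∀ ξ ∈ refTri, ∀ i,
    |MvPolynomial.eval ξ (M.vertexInterp (N i) K)| ≤ 1 ∧
    (∀ j, |MvPolynomial.eval ξ (MvPolynomial.pderiv j (M.vertexInterp (N i) K))| ≤
      C * M.size kg) ∧
    |MvPolynomial.eval ξ (M.vertexInterp (N i) K) - N i (M.vert K 0)| ≤ C * M.size kg ∧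
    |normal (M.elem kg t K) ξ i - MvPolynomial.eval ξ (M.vertexInterp (N i) K)| ≤ C * M.size kg

/-- Since b is an admissible multiplier, the integral of 2b(w·n) vanishes and may be added on the
right. With g = w·N and d = w·(n - N), the pointwise inequality is b² ≤ 2b(g + d) + 2(g - b)² + 2d².
-/
theorem integral_sq_le_of_divFree {M : Mesh S} (hM : M.Regular kg C) (hC : 1 ≤ C) {t : ℝ}
    (ht : t ∈ Icc 0 T) {N : Fin 3 → E3 → ℝ} (hN : IsNormalInterp M kg C t N) {ku : ℕ}
    {w : VectorFn M} (hw : w ∈ M.divFree ku kg t) {b : ScalarFn M} (hbm : b ∈ M.scalarSpace ku) :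
    M.integral kg t (fun K ξ => MvPolynomial.eval ξ (b K) ^ 2) ≤
      M.integral kg t (fun K ξ => 2 * (MvPolynomial.eval ξ (normalComp M N w K) -
        MvPolynomial.eval ξ (b K)) ^ 2 +
        6 * (C * M.size kg) ^ 2 * ∑ i, MvPolynomial.eval ξ (w i K) ^ 2) := by
  have hc := fun (p : MvPolynomial (Fin 2) ℝ) => continuous_eval p
  set h := M.size kg with hhd
  set g := normalComp M N w with hg
  have hα : ∀ K, ∀ ξ ∈ refTri, 0 < areaDensity (M.elem kg t K) ξ := fun K ξ hξ =>
    hM.area_pos hC ht K hξ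
  have ha := fun K => continuous_areaDensity (M.elem kg t K)
  have hf := M.continuous_field w
  have hn := fun K => continuousOn_normal (hα K)
  have h0 := M.integral_mul_normal_eq_zero hw hbm
  have e : M.integral kg t (fun K ξ => 2 * (MvPolynomial.eval ξ (b K) *
      (M.field w K ξ ⬝ᵥ normal (M.elem kg t K) ξ))) = 0 := by
    rw [Mesh.integral_eq_refSum] at h0 ⊢
    simp only [mul_assoc] at h0 ⊢
    rw [refSum_const_mul, h0, mul_zero]
  rw [← zero_add (M.integral kg t fun K ξ => 2 * (MvPolynomial.eval ξ (g K) -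
    MvPolynomial.eval ξ (b K)) ^ 2 + 6 * (C * h) ^ 2 * ∑ i, MvPolynomial.eval ξ (w i K) ^ 2), ← e]
  simp only [Mesh.integral_eq_refSum, dotProduct]
  rw [← refSum_add (fun K => by fun_prop) (fun K => by fun_prop)]
  refine refSum_mono (fun K => by fun_prop) (fun K => by fun_prop) fun K ξ hξ => ?_
  rw [← add_mul]
  refine mul_le_mul_of_nonneg_right ?_ (areaDensity_nonneg _ _)
  have h3 := sq_sum_three_le (fun i => M.field w K ξ i) (fun i => normal (M.elem kg t K) ξ i -
    MvPolynomial.eval ξ (M.vertexInterp (N i) K)) fun i => (hN K ξ hξ i).2.2.2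
  have e2 : ∑ i, M.field w K ξ i * normal (M.elem kg t K) ξ i =
      MvPolynomial.eval ξ (g K) + ∑ i, M.field w K ξ i * (normal (M.elem kg t K) ξ i -
        MvPolynomial.eval ξ (M.vertexInterp (N i) K)) := by
    simp only [hg, normalComp, map_sum, map_mul, Mesh.field, mul_sub, Finset.sum_sub_distrib]
    ring
  rw [e2]
  simp only [Mesh.field] at h3 ⊢
  set d := ∑ i, MvPolynomial.eval ξ (w i K) * (normal (M.elem kg t K) ξ i -
        MvPolynomial.eval ξ (M.vertexInterp (N i) K))
  set x := MvPolynomial.eval ξ (g K)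
  set y := MvPolynomial.eval ξ (b K)
  nlinarith [sq_nonneg (x + d), add_sq_le (x - y) d]

theorem refSum_sq_sub_nodalInterp_le {M : Mesh S} {k : ℕ} {B t : ℝ}
    (hB : ∀ (w ν : Fin 3 → MvPolynomial (Fin 2) ℝ) (c : Fin 3 → ℝ) (δ : ℝ),
      (∀ i, (w i).totalDegree ≤ k) →
      (∀ ξ ∈ refTri, ∀ i, |MvPolynomial.eval ξ (ν i) - c i| ≤ δ) → ∀ ξ ∈ refTri,
      (MvPolynomial.eval ξ (∑ i, w i * ν i) - MvPolynomial.eval ξ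
        (nodalInterp k fun η => MvPolynomial.eval η (∑ i, w i * ν i))) ^ 2 ≤
        B * δ ^ 2 * ∑ i, ∫ ξ in refTri, MvPolynomial.eval ξ (w i) ^ 2)
    {N : Fin 3 → E3 → ℝ} (hN : IsNormalInterp M kg C t N) {w : VectorFn M}
    (hw : ∀ i K, (w i K).totalDegree ≤ k) :
    refSum (fun K ξ => (MvPolynomial.eval ξ (normalComp M N w K) - MvPolynomial.eval ξ
      (nodalInterp k fun η => MvPolynomial.eval η (normalComp M N w K))) ^ 2) ≤
      volume.real refTri * (B * (C * M.size kg) ^ 2 * Mesh.refSq w) := by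
  have hc := fun (p : MvPolynomial (Fin 2) ℝ) => continuous_eval p
  have h := refSum_le_sum_mul (f := fun K ξ => (MvPolynomial.eval ξ (normalComp M N w K) -
      MvPolynomial.eval ξ (nodalInterp k fun η => MvPolynomial.eval η (normalComp M N w K))) ^ 2)
    (B := fun K => B * (C * M.size kg) ^ 2 * ∑ i, ∫ ξ in refTri, MvPolynomial.eval ξ (w i K) ^ 2)
    (fun K => by fun_prop) fun K ξ hξ =>
      hB (fun i => w i K) (fun i => M.vertexInterp (N i) K) (fun i => N i (M.vert K 0))
        (C * M.size kg) (fun i => hw i K) (fun η hη i => (hN K η hη i).2.2.1) ξ hξ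
  rwa [← Finset.mul_sum, sum_refSum_sq] at h

theorem nodalInterp_mem {M : Mesh S} {k l : ℕ} (hk : 1 ≤ k) {g : ScalarFn M}
    (hg : g ∈ M.scalarSpace l) :
    (fun K => nodalInterp k fun η => MvPolynomial.eval η (g K)) ∈ M.scalarSpace k :=
  M.sum_lagrangePoly_mem hk (fun K η => MvPolynomial.eval η (g K)) hg.2

theorem refSum_sq_le_of_divFree {M : Mesh S} (hM : M.Regular kg C) (hC : 1 ≤ C) {t : ℝ}
    (ht : t ∈ Icc 0 T) {N : Fin 3 → E3 → ℝ} (hN : IsNormalInterp M kg C t N) {ku : ℕ}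
    {w : VectorFn M} (hw : w ∈ M.divFree ku kg t) {b : ScalarFn M} (hbm : b ∈ M.scalarSpace ku) :
    refSum (fun K ξ => MvPolynomial.eval ξ (b K) ^ 2) ≤
      4 * C ^ 3 * (2 * refSum (fun K ξ => (MvPolynomial.eval ξ (normalComp M N w K) -
        MvPolynomial.eval ξ (b K)) ^ 2) + 6 * (C * M.size kg) ^ 2 * Mesh.refSq w) := by
  have hc := fun (p : MvPolynomial (Fin 2) ℝ) => continuous_eval p
  have hh := hM.size_pos
  have h2 := integral_sq_le_of_divFree hM hC ht hN hw hbm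
  have h3 := hM.sq_mul_refSum_le ht (φ := fun K ξ => MvPolynomial.eval ξ (b K) ^ 2)
    (fun K => by fun_prop) fun K ξ _ => sq_nonneg _
  have h4 := hM.integral_le_sq_mul_refSum hC ht (φ := fun K ξ =>
    2 * (MvPolynomial.eval ξ (normalComp M N w K) - MvPolynomial.eval ξ (b K)) ^ 2 +
      6 * (C * M.size kg) ^ 2 * ∑ i, MvPolynomial.eval ξ (w i K) ^ 2)
    (fun K => by fun_prop) fun K ξ _ => by positivity
  rw [refSum_add (fun K => by fun_prop) (fun K => by fun_prop), refSum_const_mul,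
    refSum_const_mul] at h4
  refine le_of_mul_le_mul_left ((h3.trans (mul_le_mul_of_nonneg_left (h2.trans h4)
    (zero_le_one.trans hC))).trans_eq ?_) (pow_pos hh 2)
  rw [Mesh.refSq]
  ring

theorem refSum_sq_le_add {n : ℕ} (g b : Fin n → MvPolynomial (Fin 2) ℝ) :
    refSum (fun K ξ => MvPolynomial.eval ξ (g K) ^ 2) ≤
      2 * refSum (fun K ξ => MvPolynomial.eval ξ (b K) ^ 2) + 2 * refSum (fun K ξ =>
        (MvPolynomial.eval ξ (g K) - MvPolynomial.eval ξ (b K)) ^ 2) := by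
  have hc := fun (p : MvPolynomial (Fin 2) ℝ) => continuous_eval p
  rw [← refSum_const_mul, ← refSum_const_mul,
    ← refSum_add (fun K => by fun_prop) (fun K => by fun_prop)]
  refine refSum_mono (fun K => by fun_prop) (fun K => by fun_prop) fun K ξ _ => ?_
  have := add_sq_le (MvPolynomial.eval ξ (b K))
    (MvPolynomial.eval ξ (g K) - MvPolynomial.eval ξ (b K))
  rwa [add_sub_cancel] at this

/-- The nodal interpolant b of g = w·N is an admissible multiplier, and superapproximation makes g -
b of order h in w. The constraint then makes b, and with it g, of order h in w. -/
theorem exists_refSum_normalComp_sq_le {ku : ℕ} (hku : 1 ≤ ku) (hC : 1 ≤ C) : ∃ D > 0,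
    ∀ M : Mesh S, M.Regular kg C → ∀ t ∈ Icc 0 T, ∀ N, IsNormalInterp M kg C t N →
      ∀ w ∈ M.divFree ku kg t,
      refSum (fun K ξ => MvPolynomial.eval ξ (normalComp M N w K) ^ 2) ≤
        D * M.size kg ^ 2 * Mesh.refSq w := by
  obtain ⟨B, hB0, hB⟩ := exists_sq_sub_nodalInterp_le hku
  have hV0 : 0 ≤ volume.real refTri := measureReal_nonneg
  refine ⟨2 * (4 * C ^ 3 * (2 * (volume.real refTri * (B * C ^ 2)) + 6 * C ^ 2)) +
    2 * (volume.real refTri * (B * C ^ 2)), by positivity, fun M hM t ht N hN w hw => ?_⟩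
  have h1 := refSum_sq_sub_nodalInterp_le hB hN fun i K => (hw.1 i).1 K
  have h2 := refSum_sq_le_of_divFree hM hC ht hN hw (nodalInterp_mem hku (normalComp_mem N hw.1))
  have h3 := refSum_sq_le_add (normalComp M N w)
    fun K => nodalInterp ku fun η => MvPolynomial.eval η (normalComp M N w K)
  generalize refSum (fun K ξ => (MvPolynomial.eval ξ (normalComp M N w K) - MvPolynomial.eval ξ
      (nodalInterp ku fun η => MvPolynomial.eval η (normalComp M N w K))) ^ 2) = Z at h1 h2 h3
  have h4 := mul_le_mul_of_nonneg_left h1 (by positivity : 0 ≤ 16 * C ^ 3 + 2)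
  linarith

/-- n·∂ⱼw = ∂ⱼ(w·N) - w·∂ⱼN + (n - N)·∂ⱼw. The last two terms carry a factor Ch. The first is
controlled by the inverse inequality for the degree ku + 1 of w·N; on the reference triangle it
loses no power of h. -/
theorem exists_refSum_normal_grad_le {ku : ℕ} (hku : 1 ≤ ku) (hC : 1 ≤ C) : ∃ D > 0,
    ∀ M : Mesh S, M.Regular kg C → ∀ t ∈ Icc 0 T, ∀ w ∈ M.divFree ku kg t,
      refSum (fun K ξ => ∑ j, (normal (M.elem kg t K) ξ ⬝ᵥ fun i => jac (M.loc w K) ξ i j) ^ 2) ≤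
        D * M.size kg ^ 2 * (Mesh.refSq w + Mesh.refGradSq w) := by
  obtain ⟨D, hD0, hD⟩ := exists_refSum_normalComp_sq_le (S := S) (kg := kg) hku hC
  obtain ⟨B, hB0, hB⟩ := exists_inverse_bound (ku + 1)
  have hc := fun (p : MvPolynomial (Fin 2) ℝ) => continuous_eval p
  set V := volume.real refTri with hV
  have hV0 : 0 ≤ V := measureReal_nonneg
  refine ⟨3 * (V * (2 * B * D)) + 18 * C ^ 2 + 9 * C ^ 2, by positivity, fun M hM t ht w hw => ?_⟩
  obtain ⟨N, hN⟩ := hM.exists_normal_interp ht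
  have hh := hM.size_pos
  have hn := fun K => continuousOn_normal fun ξ hξ => hM.area_pos hC ht K (ξ := ξ) hξ
  have hgm := normalComp_mem N hw.1
  have h0 := hD M hM t ht N hN w hw
  set h := M.size kg with hhd
  set g := normalComp M N w with hg
  have h1 : refSum (fun K ξ => ∑ j, MvPolynomial.eval ξ (MvPolynomial.pderiv j (g K)) ^ 2) ≤
      V * (2 * B * (D * h ^ 2 * Mesh.refSq w)) := by
    refine (refSum_le_sum_mul (B := fun K => 2 * B * ∫ ξ in refTri, MvPolynomial.eval ξ (g K) ^ 2)
      (fun K => by fun_prop) fun K ξ hξ => ?_).trans ?_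
    · rw [Fin.sum_univ_two]
      have := (hB (g K) (hgm.1 K) ξ hξ).2
      linarith [this 0, this 1]
    · rw [← Finset.mul_sum]
      gcongr
      exact h0
  have hpt : ∀ K, ∀ ξ ∈ refTri, ∑ j, (normal (M.elem kg t K) ξ ⬝ᵥ
      fun i => jac (M.loc w K) ξ i j) ^ 2 ≤
      3 * (∑ j, MvPolynomial.eval ξ (MvPolynomial.pderiv j (g K)) ^ 2) +
      (18 * (C * h) ^ 2 * (∑ i, MvPolynomial.eval ξ (w i K) ^ 2) +
      9 * (C * h) ^ 2 * ∑ i, ∑ j, MvPolynomial.eval ξ (MvPolynomial.pderiv j (w i K)) ^ 2) := by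
    intro K ξ hξ
    have key : ∀ j, (normal (M.elem kg t K) ξ ⬝ᵥ fun i => jac (M.loc w K) ξ i j) ^ 2 ≤
        3 * MvPolynomial.eval ξ (MvPolynomial.pderiv j (g K)) ^ 2 +
        9 * (C * h) ^ 2 * (∑ i, MvPolynomial.eval ξ (w i K) ^ 2) +
        9 * (C * h) ^ 2 * ∑ i, MvPolynomial.eval ξ (MvPolynomial.pderiv j (w i K)) ^ 2 := by
      intro j
      have g1 := sq_sum_three_le (fun i => MvPolynomial.eval ξ (w i K)) (fun i =>
        MvPolynomial.eval ξ (MvPolynomial.pderiv j (M.vertexInterp (N i) K)))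
        fun i => (hN K ξ hξ i).2.1 j
      have g2 := sq_sum_three_le (fun i => MvPolynomial.eval ξ (MvPolynomial.pderiv j (w i K)))
        (fun i => normal (M.elem kg t K) ξ i - MvPolynomial.eval ξ (M.vertexInterp (N i) K))
        fun i => (hN K ξ hξ i).2.2.2
      have e : (normal (M.elem kg t K) ξ ⬝ᵥ fun i => jac (M.loc w K) ξ i j) =
          MvPolynomial.eval ξ (MvPolynomial.pderiv j (g K)) -
          (∑ i, MvPolynomial.eval ξ (w i K) *
            MvPolynomial.eval ξ (MvPolynomial.pderiv j (M.vertexInterp (N i) K))) +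
          ∑ i, MvPolynomial.eval ξ (MvPolynomial.pderiv j (w i K)) *
            (normal (M.elem kg t K) ξ i - MvPolynomial.eval ξ (M.vertexInterp (N i) K)) := by
        simp only [hg, normalComp, dotProduct, jac, Mesh.loc, Matrix.of_apply, map_sum,
          Derivation.leibniz, smul_eq_mul, map_add, map_mul, ← Finset.sum_sub_distrib,
          ← Finset.sum_add_distrib]
        exact Finset.sum_congr rfl fun i _ => by ring
      rw [e]
      have g3 : ∀ x y z : ℝ, (x - y + z) ^ 2 ≤ 3 * x ^ 2 + 3 * y ^ 2 + 3 * z ^ 2 := fun x y z => by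
        nlinarith [sq_nonneg (x + y), sq_nonneg (x - z), sq_nonneg (y + z)]
      refine (g3 _ _ _).trans ?_
      linarith
    have := add_le_add (key 0) (key 1)
    rw [Fin.sum_univ_two, Finset.sum_comm, Fin.sum_univ_two, Fin.sum_univ_two]
    linarith
  have hfin := refSum_mono (fun K => by
    refine continuousOn_finsetSum _ fun j _ => ContinuousOn.pow ?_ 2
    simp only [dotProduct]
    exact continuousOn_finsetSum _ fun i _ =>
      (hn K i).mul (continuous_jac (M.loc w K) i j).continuousOn) (fun K => by fun_prop) hpt
  rw [refSum_add (fun K => by fun_prop) (fun K => by fun_prop),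
    refSum_add (fun K => by fun_prop) (fun K => by fun_prop), refSum_const_mul, refSum_const_mul,
    refSum_const_mul] at hfin
  have hX := Mesh.refSq_nonneg w
  have hY := Mesh.refGradSq_nonneg w
  change _ ≤ _ + (_ * Mesh.refSq w + _ * Mesh.refGradSq w) at hfin
  refine hfin.trans ?_
  have q1 : 0 ≤ (3 * (V * (2 * B * D)) + 18 * C ^ 2) * h ^ 2 * Mesh.refGradSq w := by positivity
  have q2 : 0 ≤ 9 * C ^ 2 * h ^ 2 * Mesh.refSq w := by positivity
  linarith

end ESFEM

namespace ESFEM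

/-! ### Korn's inequality for discretely tangential fields -/

theorem korn_pointwise_le {F : Fin 3 → MvPolynomial (Fin 2) ℝ} (w : Fin 3 → MvPolynomial (Fin 2) ℝ)
    {ξ : R2} {C h : ℝ} (hC : 1 ≤ C) (hh : 0 < h) (hJ : ∀ i j, |jac F ξ i j| ≤ C * h)
    (hα : h ^ 2 ≤ C * areaDensity F ξ) :
    ∑ i, ∑ j, jac w ξ i j ^ 2 ≤ ∑ j, (normal F ξ ⬝ᵥ fun i => jac w ξ i j) ^ 2 +
      12 * C ^ 3 * (((strain F w ξ)ᵀ * strain F w ξ).trace * areaDensity F ξ +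
        normal F ξ ⬝ᵥ ((fun i => jac w ξ i 0) ⨯₃ (fun i => jac w ξ i 1))) := by
  have hα0 : 0 < areaDensity F ξ :=
    pos_of_mul_pos_right ((pow_pos hh 2).trans_le hα) (by linarith)
  have h1 := korn_pointwise w hα0
  have h0 := korn_pointwise_nonneg w hα0
  set R := areaDensity F ξ * ((strain F w ξ)ᵀ * strain F w ξ).trace +
        (normal F ξ ⬝ᵥ ((fun i => jac w ξ i 0) ⨯₃ (fun i => jac w ξ i 1))) with hR
  set Q := ∑ j, ((∑ i, jac w ξ i j ^ 2) - (normal F ξ ⬝ᵥ fun i => jac w ξ i j) ^ 2) with hQ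
  have h2 : ((jac F ξ)ᵀ * jac F ξ).trace ≤ 6 * (C * h) ^ 2 := by
    rw [trace_transpose_mul_self]
    calc _ ≤ ∑ _j : Fin 2, ∑ _i : Fin 3, (C * h) ^ 2 := by
          refine Finset.sum_le_sum fun j _ => Finset.sum_le_sum fun i _ => ?_
          rw [← sq_abs]
          exact pow_le_pow_left₀ (abs_nonneg _) (hJ i j) 2
      _ = _ := by simp; ring
  have hQ0 : 0 ≤ Q := by
    rw [hQ, ← trace_tangProj_mul_sq hα0]
    exact trace_transpose_mul_self_nonneg _
  -- The constant 12C³ is made of 2 from `korn_pointwise`, 6C²h² from the trace of the metric, and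
  -- C/h² from the lower bound of the area density.
  have h3 : Q ≤ 12 * C ^ 3 * R := by
    refine le_of_mul_le_mul_left ?_ (pow_pos hh 2)
    calc h ^ 2 * Q ≤ C * areaDensity F ξ * Q := by gcongr
      _ = C * (areaDensity F ξ * Q) := by ring
      _ ≤ C * (2 * R * (6 * (C * h) ^ 2)) := mul_le_mul_of_nonneg_left
          (h1.trans (mul_le_mul_of_nonneg_left h2 (by linarith))) (by linarith)
      _ = _ := by ring
  have e : ∑ i, ∑ j, jac w ξ i j ^ 2 =
      ∑ j, (normal F ξ ⬝ᵥ fun i => jac w ξ i j) ^ 2 + Q := by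
    rw [hQ, Finset.sum_comm, ← Finset.sum_add_distrib]
    exact Finset.sum_congr rfl fun j _ => by ring
  rw [e, mul_comm _ (areaDensity F ξ), ← hR]
  linarith

/-- Here a, b are the two derivatives of w, and p, q those of ν. Replacing n by ν costs δ times the
squared gradient. Completing the terms of ν·(a × b) by the product rule, so that p₀w₁ + ν₀a₁ =
∂₁(ν₀w₁), yields Jacobian brackets; the surplus terms have a factor p or q without derivative of w
and are split by Young's inequality. -/
theorem triple_product_le (n ν w a b p q : Fin 3 → ℝ) {δ ε : ℝ} (hε : 0 < ε)
    (h1 : ∀ i, |n i - ν i| ≤ δ) (h2 : ∀ i, |p i| ≤ δ) (h3 : ∀ i, |q i| ≤ δ) :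
    n ⬝ᵥ (a ⨯₃ b) ≤
      (((p 0 * w 1 + ν 0 * a 1) * b 2 - (q 0 * w 1 + ν 0 * b 1) * a 2) +
      ((p 1 * w 2 + ν 1 * a 2) * b 0 - (q 1 * w 2 + ν 1 * b 2) * a 0) +
      ((p 2 * w 0 + ν 2 * a 0) * b 1 - (q 2 * w 0 + ν 2 * b 0) * a 1)) +
      (ε + δ) * ∑ i, (a i ^ 2 + b i ^ 2) + δ ^ 2 / (2 * ε) * ∑ i, w i ^ 2 := by
  have hδ : 0 ≤ δ := (abs_nonneg _).trans (h1 0)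
  have k1 : ∀ i x y z t, (n i - ν i) * (x * y - z * t) ≤ δ / 2 * (x ^ 2 + y ^ 2 + z ^ 2 + t ^ 2) := by
    intro i x y z t
    refine (le_abs_self _).trans ?_
    rw [abs_mul]
    have : |x * y - z * t| ≤ (x ^ 2 + y ^ 2 + z ^ 2 + t ^ 2) / 2 := by
      rw [abs_le]; constructor <;>
        nlinarith [sq_nonneg (x + y), sq_nonneg (x - y), sq_nonneg (z + t), sq_nonneg (z - t)]
    calc _ ≤ δ * ((x ^ 2 + y ^ 2 + z ^ 2 + t ^ 2) / 2) := by gcongr; exact h1 i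
      _ = _ := by ring
  have k2 : ∀ r x y : ℝ, |r| ≤ δ → r * x * y ≤ ε * y ^ 2 + δ ^ 2 / (4 * ε) * x ^ 2 := by
    intro r x y hr
    have g1 : r ^ 2 ≤ δ ^ 2 := by rw [← sq_abs]; gcongr
    have g2 : r * x * y ≤ ε * y ^ 2 + r ^ 2 / (4 * ε) * x ^ 2 := by
      have := mul_nonneg hε.le (sq_nonneg (y - r * x / (2 * ε)))
      have e : ε * (y - r * x / (2 * ε)) ^ 2 =
          ε * y ^ 2 - r * x * y + r ^ 2 / (4 * ε) * x ^ 2 := by field_simp; ring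
      linarith
    refine g2.trans ?_
    gcongr
  have k2' : ∀ r x y : ℝ, |r| ≤ δ → -(r * x * y) ≤ ε * y ^ 2 + δ ^ 2 / (4 * ε) * x ^ 2 := by
    intro r x y hr
    have := k2 (-r) x y (by rwa [abs_neg])
    linarith
  have e : δ ^ 2 / (2 * ε) = 2 * (δ ^ 2 / (4 * ε)) := by field_simp; ring
  rw [e]
  simp only [cross_apply, dotProduct, Fin.sum_univ_three, Matrix.cons_val_zero, Matrix.cons_val_one,
    Matrix.cons_val]
  linarith [k1 0 (a 1) (b 2) (a 2) (b 1), k1 1 (a 2) (b 0) (a 0) (b 2), k1 2 (a 0) (b 1) (a 1) (b 0),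
    k2' (p 0) (w 1) (b 2) (h2 0), k2 (q 0) (w 1) (a 2) (h3 0), k2' (p 1) (w 2) (b 0) (h2 1),
    k2 (q 1) (w 2) (a 0) (h3 1), k2' (p 2) (w 0) (b 1) (h2 2), k2 (q 2) (w 0) (a 1) (h3 2)]

variable {T : ℝ} {m : ℕ} {S : EvolvingSurface T m} {kg : ℕ} {C : ℝ}

/-- A mesh on which the geometric estimates hold, curl integrals vanish and the discrete
Ladyzhenskaya inequality is valid. -/
structure Mesh.Admissible (M : Mesh S) (kg : ℕ) (C : ℝ) : Prop extends M.Regular kg C where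
  refSum_bracket : ∀ k l, ∀ a ∈ M.scalarSpace k, ∀ b ∈ M.scalarSpace l,
    refSum (fun K ξ => MvPolynomial.eval ξ (Mesh.bracket (a K) (b K))) = 0
  refSum_pow_four_le : ∀ k, ∀ a ∈ M.scalarSpace k,
    refSum (fun K ξ => MvPolynomial.eval ξ (a K) ^ 4) ≤
      C * refSum (fun K ξ => MvPolynomial.eval ξ (a K) ^ 2) *
        (refSum (fun K ξ => ∑ j, MvPolynomial.eval ξ (MvPolynomial.pderiv j (a K)) ^ 2) +
          M.size kg ^ 2 * refSum (fun K ξ => MvPolynomial.eval ξ (a K) ^ 2))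

theorem Mesh.Regular.mono {M : Mesh S} {C' : ℝ} (hM : M.Regular kg C) (h : C ≤ C') :
    M.Regular kg C' := by
  have hh := hM.size_pos
  refine ⟨hh, hM.size_le, fun t ht K ξ hξ i j => (hM.abs_jac_le t ht K ξ hξ i j).trans (by gcongr),
    fun t ht K ξ hξ => (hM.le_areaDensity t ht K ξ hξ).trans ?_,
    fun t ht K ξ hξ i j => (hM.abs_jac_vel_le t ht K ξ hξ i j).trans (by gcongr),
    fun t ht s hs K ξ hξ i j => (hM.abs_jac_sub_le t ht s hs K ξ hξ i j).trans (by gcongr),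
    fun t ht => ?_⟩
  · exact mul_le_mul_of_nonneg_right h (areaDensity_nonneg _ _)
  · obtain ⟨N, h1, h2, h3⟩ := hM.exists_normal t ht
    exact ⟨N, h1, fun K i j => (h2 K i j).trans (by gcongr),
      fun K ξ hξ => (h3 K ξ hξ).trans (by gcongr)⟩

theorem exists_admissible (hm : 2 ≤ m) (S : EvolvingSurface T m) (hT : 0 < T) (hkg : 1 ≤ kg) {ρ : ℝ}
    (hρ : 0 < ρ) : ∃ h₀ > 0, ∃ C ≥ 1, ∀ M : Mesh S, M.QuasiUniform kg ρ → M.size kg < h₀ →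
      (∃ _ : Fin M.numTri, True) → M.Admissible kg C := by
  obtain ⟨L, r, ν, hS⟩ := exists_surfaceBounds hm S
  obtain ⟨h₁, hh₁, C₁, hC₁, H₁⟩ := exists_regular hS hT hkg hρ
  obtain ⟨h₂, hh₂, H₂⟩ := exists_sum_integral_bracket_eq_zero hS hT hkg hρ
  obtain ⟨h₃, hh₃, C₃, hC₃, H₃⟩ := exists_sum_integral_pow_four_le hS hT hkg hρ
  refine ⟨min h₁ (min h₂ h₃), by positivity, max C₁ C₃, hC₁.trans (le_max_left _ _),
    fun M hM hsize hK => ?_⟩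
  simp only [lt_min_iff] at hsize
  refine ⟨(H₁ M hM hsize.1 hK).mono (le_max_left _ _), fun k l a ha b hb =>
    H₂ M hM hsize.2.1 k l a ha b hb, fun k a ha => (H₃ M hM hsize.2.2 k a ha).trans ?_⟩
  have hX : 0 ≤ refSum fun K ξ => MvPolynomial.eval ξ (a K) ^ 2 := refSum_nonneg fun K ξ => sq_nonneg _
  have hY : 0 ≤ refSum fun K ξ => ∑ j, MvPolynomial.eval ξ (MvPolynomial.pderiv j (a K)) ^ 2 :=
    refSum_nonneg fun K ξ => by positivity
  gcongr
  exact le_max_right _ _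

theorem refSum_le_of_le_add {n : ℕ} {f b₁ b₂ b₃ g : Fin n → R2 → ℝ}
    (hf : ∀ K, ContinuousOn (f K) refTri) (h₁ : ∀ K, ContinuousOn (b₁ K) refTri)
    (h₂ : ∀ K, ContinuousOn (b₂ K) refTri) (h₃ : ∀ K, ContinuousOn (b₃ K) refTri)
    (hg : ∀ K, ContinuousOn (g K) refTri)
    (h : ∀ K, ∀ ξ ∈ refTri, f K ξ ≤ b₁ K ξ + b₂ K ξ + b₃ K ξ + g K ξ) (z₁ : refSum b₁ = 0)
    (z₂ : refSum b₂ = 0) (z₃ : refSum b₃ = 0) : refSum f ≤ refSum g := by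
  refine (refSum_mono hf (fun K => (((h₁ K).add (h₂ K)).add (h₃ K)).add (hg K)) h).trans_eq ?_
  have e := refSum_add (fun K => ((h₁ K).add (h₂ K)).add (h₃ K)) hg
  have e12 := refSum_add (fun K => (h₁ K).add (h₂ K)) h₃
  have e1 := refSum_add h₁ h₂
  refine e.trans ?_
  rw [← zero_add (refSum g)]
  congr 1
  · refine e12.trans ?_
    rw [z₃, add_zero]
    exact e1.trans (by rw [z₁, z₂, add_zero])
  · rw [zero_add]

theorem refSum_le_of_le_add_mul {n : ℕ} {f a b d : Fin n → R2 → ℝ} {c : ℝ}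
    (hf : ∀ K, ContinuousOn (f K) refTri) (ha : ∀ K, ContinuousOn (a K) refTri)
    (hb : ∀ K, ContinuousOn (b K) refTri) (hd : ∀ K, ContinuousOn (d K) refTri)
    (h : ∀ K, ∀ ξ ∈ refTri, f K ξ ≤ a K ξ + c * (b K ξ + d K ξ)) :
    refSum f ≤ refSum a + c * (refSum b + refSum d) := by
  have hbd : ∀ K, ContinuousOn (fun ξ => c * (b K ξ + d K ξ)) refTri := fun K =>
    continuousOn_const.mul ((hb K).add (hd K))
  rw [← refSum_add hb hd, ← refSum_const_mul, ← refSum_add ha hbd]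
  exact refSum_mono hf (fun K => (ha K).add (hbd K)) h

theorem continuousOn_triple_product {F : Fin 3 → MvPolynomial (Fin 2) ℝ}
    (hF : ∀ ξ ∈ refTri, 0 < areaDensity F ξ) (w : Fin 3 → MvPolynomial (Fin 2) ℝ) :
    ContinuousOn (fun ξ => normal F ξ ⬝ᵥ
      ((fun i => jac w ξ i 0) ⨯₃ (fun i => jac w ξ i 1))) refTri := by
  have hn := continuousOn_normal hF
  have hj := continuous_jac w
  have hx : ∀ l, Continuous fun ξ => ((fun i => jac w ξ i 0) ⨯₃ (fun i => jac w ξ i 1)) l := by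
    intro l
    fin_cases l <;> simp [cross_apply] <;> fun_prop
  simp only [dotProduct]
  exact continuousOn_finsetSum _ fun l _ => (hn l).mul (hx l).continuousOn

/-- The three brackets of Nᵢwⱼ and wₗ integrate to zero over the closed polyhedron, since both
arguments are continuous finite element functions. Only the error terms of `triple_product_le` are
left. -/
theorem Mesh.Admissible.refSum_triple_product_le {M : Mesh S} (hM : M.Admissible kg C) (hC : 1 ≤ C)
    {t : ℝ} (ht : t ∈ Icc 0 T) {k : ℕ} {w : VectorFn M} (hw : w ∈ M.velSpace k) {ε : ℝ}
    (hε : 0 < ε) :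
    refSum (fun K ξ => normal (M.elem kg t K) ξ ⬝ᵥ
      ((fun i => jac (M.loc w K) ξ i 0) ⨯₃ (fun i => jac (M.loc w K) ξ i 1))) ≤
      (ε + C * M.size kg) * refGradSq w + (C * M.size kg) ^ 2 / (2 * ε) * refSq w := by
  have hc := fun (p : MvPolynomial (Fin 2) ℝ) => continuous_eval p
  obtain ⟨N, hN⟩ := hM.exists_normal_interp ht
  have hb : ∀ i j l : Fin 3, refSum (fun K ξ => MvPolynomial.eval ξ (bracket
      (M.vertexInterp (N i) K * w j K) (w l K))) = 0 := fun i j l =>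
    hM.refSum_bracket _ _ _ (M.mul_mem_scalarSpace (M.vertexInterp_mem (N i)) (hw j)) _ (hw l)
  have hpt : ∀ K, ∀ ξ ∈ refTri, normal (M.elem kg t K) ξ ⬝ᵥ
      ((fun i => jac (M.loc w K) ξ i 0) ⨯₃ (fun i => jac (M.loc w K) ξ i 1)) ≤
      ((MvPolynomial.eval ξ (bracket (M.vertexInterp (N 0) K * w 1 K) (w 2 K)) +
        MvPolynomial.eval ξ (bracket (M.vertexInterp (N 1) K * w 2 K) (w 0 K))) +
        MvPolynomial.eval ξ (bracket (M.vertexInterp (N 2) K * w 0 K) (w 1 K))) +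
      ((ε + C * M.size kg) * (∑ i, ∑ j, MvPolynomial.eval ξ (MvPolynomial.pderiv j (w i K)) ^ 2) +
        (C * M.size kg) ^ 2 / (2 * ε) * ∑ i, MvPolynomial.eval ξ (w i K) ^ 2) := by
    intro K ξ hξ
    refine (triple_product_le (normal (M.elem kg t K) ξ)
      (fun i => MvPolynomial.eval ξ (M.vertexInterp (N i) K)) (fun i => MvPolynomial.eval ξ (w i K))
      _ _ (fun i => MvPolynomial.eval ξ (MvPolynomial.pderiv 0 (M.vertexInterp (N i) K)))
      (fun i => MvPolynomial.eval ξ (MvPolynomial.pderiv 1 (M.vertexInterp (N i) K))) hε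
      (fun i => (hN K ξ hξ i).2.2.2) (fun i => (hN K ξ hξ i).2.1 0)
      fun i => (hN K ξ hξ i).2.1 1).trans_eq ?_
    simp only [bracket, jac, Mesh.loc, Matrix.of_apply, Derivation.leibniz, smul_eq_mul, map_add,
      map_sub, map_mul, Fin.sum_univ_two]
    ring
  refine (refSum_le_of_le_add (fun K => continuousOn_triple_product
    (fun ξ hξ => hM.area_pos hC ht K hξ) _) (fun K => (hc _).continuousOn)
    (fun K => (hc _).continuousOn) (fun K => (hc _).continuousOn) (fun K => by fun_prop) hpt
    (hb 0 1 2) (hb 1 2 0) (hb 2 0 1)).trans_eq ?_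
  rw [refSum_add (fun K => by fun_prop) (fun K => by fun_prop), refSum_const_mul, refSum_const_mul]
  rfl

theorem Mesh.Regular.refGradSq_le {M : Mesh S} (hM : M.Regular kg C) (hC : 1 ≤ C)
    {t : ℝ} (ht : t ∈ Icc 0 T) (w : VectorFn M) :
    refGradSq w ≤
      refSum (fun K ξ => ∑ j, (normal (M.elem kg t K) ξ ⬝ᵥ fun i => jac (M.loc w K) ξ i j) ^ 2) +
      12 * C ^ 3 * (M.aSForm kg t w w + refSum (fun K ξ => normal (M.elem kg t K) ξ ⬝ᵥ
        ((fun i => jac (M.loc w K) ξ i 0) ⨯₃ (fun i => jac (M.loc w K) ξ i 1)))) := by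
  have hα := fun K ξ hξ => hM.area_pos hC ht K (ξ := ξ) hξ
  have hn := fun K => continuousOn_normal (hα K)
  have hj := fun K => continuous_jac (M.loc w K)
  have c1 : ∀ K, ContinuousOn (fun ξ => ∑ j, (normal (M.elem kg t K) ξ ⬝ᵥ
      fun i => jac (M.loc w K) ξ i j) ^ 2) refTri := fun K => by
    simp only [dotProduct]
    exact continuousOn_finsetSum _ fun j _ => (continuousOn_finsetSum _ fun i _ =>
      (hn K i).mul (hj K i j).continuousOn).pow 2
  have c2 := fun K => continuousOn_triple_product (hα K) (M.loc w K)
  have c3 : ∀ K, ContinuousOn (fun ξ => ((strain (M.elem kg t K) (M.loc w K) ξ)ᵀ *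
      strain (M.elem kg t K) (M.loc w K) ξ).trace * areaDensity (M.elem kg t K) ξ) refTri :=
    fun K => (continuousOn_trace_strain (hα K) _ _).mul (continuous_areaDensity _).continuousOn
  have c4 : ∀ K, ContinuousOn (fun ξ => ∑ i, ∑ j, jac (M.loc w K) ξ i j ^ 2) refTri :=
    fun K => continuousOn_finsetSum _ fun i _ => continuousOn_finsetSum _ fun j _ =>
      ((hj K i j).pow 2).continuousOn
  exact refSum_le_of_le_add_mul c4 c1 c3 c2 fun K ξ hξ => korn_pointwise_le (M.loc w K) hC
    hM.size_pos (hM.abs_jac_le t ht K ξ hξ) (hM.le_areaDensity t ht K ξ hξ)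

/-- The gradient splits into a normal part, small by the multiplier constraint, and a tangential
part, bounded by the strain and the triple product. For small h all gradient terms on the right are
absorbed, leaving the strain and the L² norm. -/
theorem exists_korn {ku : ℕ} (hku : 1 ≤ ku) (hC : 1 ≤ C) : ∃ h₀ > 0, ∃ E > 0,
    ∀ M : Mesh S, M.Admissible kg C → M.size kg < h₀ → ∀ t ∈ Icc 0 T, ∀ w ∈ M.divFree ku kg t,
      Mesh.refGradSq w + M.size kg ^ 2 * Mesh.refSq w ≤
        E * (M.aSForm kg t w w + M.mForm kg t (M.field w) (M.field w)) := by
  obtain ⟨D, hD0, hD⟩ := exists_refSum_normal_grad_le (S := S) (kg := kg) hku hC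
  refine ⟨min (1 / (48 * C ^ 4)) (1 / (4 * D)), by positivity,
    48 * C ^ 3 + (4 * (288 * C ^ 8 + D) + 1) * C, by positivity, fun M hM hsize t ht w hw => ?_⟩
  obtain ⟨hs1, hs2⟩ := lt_min_iff.1 hsize
  have hh := hM.size_pos
  have hh1 := hM.size_le
  set h := M.size kg with hhd
  have hN := hD M hM.toRegular t ht w hw
  have hX := Mesh.refSq_nonneg w
  have hY := Mesh.refGradSq_nonneg w
  have hm := hM.refSq_le_mForm ht w
  have ha := M.aSForm_self_nonneg (kg := kg) (t := t) w
  set ε := 1 / (48 * C ^ 3) with hε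
  have hε0 : 0 < ε := by positivity
  have hτ := hM.refSum_triple_product_le hC ht hw.1 hε0
  have hkorn := hM.refGradSq_le hC ht w
  have e1 : D * h ^ 2 ≤ 1 / 4 := by
    have : h * (4 * D) < 1 := (lt_div_iff₀ (by positivity)).1 hs2
    nlinarith
  have e2 : 12 * C ^ 3 * (ε + C * h) ≤ 1 / 2 := by
    have g1 : h * (48 * C ^ 4) < 1 := (lt_div_iff₀ (by positivity)).1 hs1
    have g2 : 12 * C ^ 3 * ε = 1 / 4 := by rw [hε]; field_simp; norm_num
    linarith
  have e3 : 12 * C ^ 3 * ((C * h) ^ 2 / (2 * ε)) = 288 * C ^ 8 * h ^ 2 := by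
    rw [hε]; field_simp; norm_num
  have e4 : 12 * C ^ 3 * refSum (fun K ξ => normal (M.elem kg t K) ξ ⬝ᵥ
      ((fun i => jac (M.loc w K) ξ i 0) ⨯₃ (fun i => jac (M.loc w K) ξ i 1))) ≤
      1 / 2 * Mesh.refGradSq w + 288 * C ^ 8 * h ^ 2 * Mesh.refSq w := by
    refine (mul_le_mul_of_nonneg_left hτ (by positivity)).trans ?_
    rw [mul_add, ← mul_assoc, ← mul_assoc, e3]
    gcongr
  have e5 : D * h ^ 2 * Mesh.refGradSq w ≤ 1 / 4 * Mesh.refGradSq w := by gcongr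
  have e6 : (4 * (288 * C ^ 8 + D) + 1) * (h ^ 2 * Mesh.refSq w) ≤
      (4 * (288 * C ^ 8 + D) + 1) * (C * M.mForm kg t (M.field w) (M.field w)) := by gcongr
  have hm0 := M.mForm_self_nonneg (kg := kg) (t := t) (M.field w)
  have e7 : 0 ≤ (4 * (288 * C ^ 8 + D) + 1) * C * M.aSForm kg t w w := by positivity
  have e8 : 0 ≤ 48 * C ^ 3 * M.mForm kg t (M.field w) (M.field w) := by positivity
  linarith

end ESFEM

namespace ESFEM

variable {T : ℝ} {m : ℕ} {S : EvolvingSurface T m} {M : Mesh S} {kg : ℕ} {C t : ℝ}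

/-! ### Bounds of the forms -/

theorem trace_transpose_mul {m n : Type*} [Fintype m] [Fintype n] (A B : Matrix m n ℝ) :
    (Aᵀ * B).trace = (fun p : n × m => A p.2 p.1) ⬝ᵥ fun p => B p.2 p.1 := by
  simp [Matrix.trace, Matrix.mul_apply, dotProduct, Fintype.sum_prod_type]

namespace Mesh

theorem integral_mono {φ ψ : Fin M.numTri → R2 → ℝ} (hφ : ∀ K, ContinuousOn (φ K) refTri)
    (hψ : ∀ K, ContinuousOn (ψ K) refTri) (h : ∀ K, ∀ ξ ∈ refTri, φ K ξ ≤ ψ K ξ) :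
    M.integral kg t φ ≤ M.integral kg t ψ :=
  refSum_mono (fun K => (hφ K).mul (continuous_areaDensity _).continuousOn)
    (fun K => (hψ K).mul (continuous_areaDensity _).continuousOn) fun K ξ hξ =>
      mul_le_mul_of_nonneg_right (h K ξ hξ) (areaDensity_nonneg _ _)

theorem integral_const_mul (c : ℝ) (φ : Fin M.numTri → R2 → ℝ) :
    M.integral kg t (fun K ξ => c * φ K ξ) = c * M.integral kg t φ := by
  simp only [integral_eq_refSum, mul_assoc, refSum_const_mul]

theorem integral_add {φ ψ : Fin M.numTri → R2 → ℝ} (hφ : ∀ K, ContinuousOn (φ K) refTri)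
    (hψ : ∀ K, ContinuousOn (ψ K) refTri) :
    M.integral kg t (fun K ξ => φ K ξ + ψ K ξ) = M.integral kg t φ + M.integral kg t ψ := by
  simp only [integral_eq_refSum, add_mul]
  exact refSum_add (fun K => (hφ K).mul (continuous_areaDensity _).continuousOn)
    fun K => (hψ K).mul (continuous_areaDensity _).continuousOn

theorem abs_integral_le_integral {φ ψ : Fin M.numTri → R2 → ℝ}
    (hφ : ∀ K, ContinuousOn (φ K) refTri) (hψ : ∀ K, ContinuousOn (ψ K) refTri)
    (h : ∀ K, ∀ ξ ∈ refTri, |φ K ξ| ≤ ψ K ξ) :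
    |M.integral kg t φ| ≤ M.integral kg t ψ := by
  have e : M.integral kg t (fun K ξ => -φ K ξ) = -M.integral kg t φ := by
    simpa using integral_const_mul (kg := kg) (t := t) (-1) φ
  rw [abs_le]
  constructor
  · rw [neg_le, ← e]
    exact integral_mono (fun K => (hφ K).neg) hψ fun K ξ hξ => (neg_le_abs _).trans (h K ξ hξ)
  · exact integral_mono hφ hψ fun K ξ hξ => (le_abs_self _).trans (h K ξ hξ)

/-- Young's inequality for weighted `L²` products of continuous functions. -/
theorem two_mul_abs_integral_le {ι : Type*} [Fintype ι] {g : Fin M.numTri → R2 → ℝ}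
    {x y : Fin M.numTri → R2 → ι → ℝ} (hg : ∀ K, ContinuousOn (g K) refTri)
    (hx : ∀ K i, ContinuousOn (fun ξ => x K ξ i) refTri)
    (hy : ∀ K i, ContinuousOn (fun ξ => y K ξ i) refTri) {G : ℝ}
    (hG : ∀ K, ∀ ξ ∈ refTri, |g K ξ| ≤ G) {δ : ℝ} (hδ : 0 < δ) :
    2 * |M.integral kg t fun K ξ => g K ξ * (x K ξ ⬝ᵥ y K ξ)| ≤
      G * (δ * M.integral kg t (fun K ξ => x K ξ ⬝ᵥ x K ξ) +
        δ⁻¹ * M.integral kg t fun K ξ => y K ξ ⬝ᵥ y K ξ) := by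
  have hd : ∀ {x y : Fin M.numTri → R2 → ι → ℝ} (_ : ∀ K i, ContinuousOn (fun ξ => x K ξ i) refTri)
    (_ : ∀ K i, ContinuousOn (fun ξ => y K ξ i) refTri) (K),
    ContinuousOn (fun ξ => x K ξ ⬝ᵥ y K ξ) refTri := fun hx hy K =>
      continuousOn_finsetSum _ fun i _ => (hx K i).mul (hy K i)
  have h := abs_integral_le_integral (kg := kg) (t := t)
    (φ := fun K ξ => 2 * (g K ξ * (x K ξ ⬝ᵥ y K ξ)))
    (ψ := fun K ξ => G * (δ * (x K ξ ⬝ᵥ x K ξ) + δ⁻¹ * (y K ξ ⬝ᵥ y K ξ)))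
    (fun K => continuousOn_const.mul ((hg K).mul (hd hx hy K)))
    (fun K => continuousOn_const.mul ((continuousOn_const.mul (hd hx hx K)).add
      (continuousOn_const.mul (hd hy hy K)))) fun K ξ hξ => by
      have h1 := two_mul_abs_dotProduct_le (x K ξ) (y K ξ) hδ
      have h2 := hG K ξ hξ
      rw [abs_mul, abs_mul, abs_two]
      calc _ = |g K ξ| * (2 * |x K ξ ⬝ᵥ y K ξ|) := by ring
        _ ≤ _ := mul_le_mul h2 h1 (by positivity) ((abs_nonneg _).trans h2)
  have hx' : ∀ K, ContinuousOn (fun ξ => δ * (x K ξ ⬝ᵥ x K ξ)) refTri := fun K =>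
    continuousOn_const.mul (hd hx hx K)
  have hy' : ∀ K, ContinuousOn (fun ξ => δ⁻¹ * (y K ξ ⬝ᵥ y K ξ)) refTri := fun K =>
    continuousOn_const.mul (hd hy hy K)
  rw [integral_const_mul, integral_const_mul, integral_add hx' hy', integral_const_mul,
    integral_const_mul, abs_mul, abs_two] at h
  exact h

theorem aSForm_eq (w v : VectorFn M) : M.aSForm kg t w v = M.integral kg t fun K ξ =>
    (fun p : Fin 3 × Fin 3 => strain (M.elem kg t K) (M.loc w K) ξ p.2 p.1) ⬝ᵥ
      fun p => strain (M.elem kg t K) (M.loc v K) ξ p.2 p.1 := by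
  simp only [aSForm, trace_transpose_mul]

namespace Regular

theorem two_mul_abs_aSForm_le (hM : M.Regular kg C) (hC : 1 ≤ C) (ht : t ∈ Icc 0 T)
    (w v : VectorFn M) {δ : ℝ} (hδ : 0 < δ) :
    2 * |M.aSForm kg t w v| ≤ δ * M.aSForm kg t w w + δ⁻¹ * M.aSForm kg t v v := by
  have hα := fun K ξ hξ => hM.area_pos hC ht K (ξ := ξ) hξ
  have h := two_mul_abs_integral_le (M := M) (kg := kg) (t := t) (g := fun _ _ => 1)
    (x := fun K ξ (p : Fin 3 × Fin 3) => strain (M.elem kg t K) (M.loc w K) ξ p.2 p.1)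
    (y := fun K ξ p => strain (M.elem kg t K) (M.loc v K) ξ p.2 p.1) (G := 1)
    (fun K => continuousOn_const) (fun K p => continuousOn_strain (hα K) _ _ _)
    (fun K p => continuousOn_strain (hα K) _ _ _) (fun K ξ _ => by simp) hδ
  simp only [one_mul, ← aSForm_eq] at h
  exact h

theorem two_mul_abs_gForm_le (hM : M.Regular kg C) (hC : 1 ≤ C) (ht : t ∈ Icc 0 T)
    (w v : VectorFn M) {δ : ℝ} (hδ : 0 < δ) :
    2 * |M.gForm kg t w v| ≤ 36 * C ^ 6 *
      (δ * M.mForm kg t (M.field w) (M.field w) + δ⁻¹ * M.mForm kg t (M.field v) (M.field v)) := by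
  have hα := fun K ξ hξ => hM.area_pos hC ht K (ξ := ξ) hξ
  have hh := hM.size_pos
  refine two_mul_abs_integral_le (g := fun K => divV (M.elem kg t K) (M.elemVel kg t K))
    (fun K => ?_) (fun K i => (M.continuous_field w K i).continuousOn)
    (fun K i => (M.continuous_field v K i).continuousOn) (fun K ξ hξ => ?_) hδ
  · change ContinuousOn (fun ξ => divV (M.elem kg t K) (M.elemVel kg t K) ξ) refTri
    simp only [divV, Matrix.trace, Matrix.diag_apply]
    exact continuousOn_finsetSum _ fun i _ => continuousOn_gradV (hα K) _ _ _
  · rw [divV, gradV_eq, Matrix.trace]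
    simp only [Matrix.diag_apply, Matrix.mul_apply]
    -- The velocity Jacobian is O(h) and the left inverse of the element Jacobian is O(1/h), so the
    -- divergence is bounded; 36C⁶ counts 3 · 2 terms of size 6C⁶.
    calc _ ≤ ∑ _i : Fin 3, ∑ _j : Fin 2, C * M.size kg * (6 * C ^ 5 / M.size kg) := by
          refine (Finset.abs_sum_le_sum_abs _ _).trans (Finset.sum_le_sum fun i _ =>
            (Finset.abs_sum_le_sum_abs _ _).trans (Finset.sum_le_sum fun j _ => ?_))
          rw [abs_mul]
          exact mul_le_mul (hM.abs_jac_vel_le t ht K ξ hξ i j)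
            (abs_pinv_le hC hh (hM.abs_jac_le t ht K ξ hξ) (hM.le_areaDensity t ht K ξ hξ) j i)
            (abs_nonneg _) (by positivity)
      _ = _ := by
          simp only [Finset.sum_const, Finset.card_univ, Fintype.card_fin, nsmul_eq_mul]
          field_simp; norm_num

end Regular

/-- The squared norm of the pull-backs that scales like the norm of `H¹`. -/
noncomputable def refH1Sq (kg : ℕ) (w : VectorFn M) : ℝ :=
  refGradSq w + M.size kg ^ 2 * refSq w

theorem refH1Sq_nonneg (w : VectorFn M) : 0 ≤ refH1Sq kg w :=
  add_nonneg (refGradSq_nonneg w) (mul_nonneg (sq_nonneg _) (refSq_nonneg w))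

/-- The sum of the absolute values of the components. -/
noncomputable def absSum (w : VectorFn M) (K : Fin M.numTri) (ξ : R2) : ℝ :=
  ∑ i, |MvPolynomial.eval ξ (w i K)|

theorem continuous_absSum (w : VectorFn M) (K : Fin M.numTri) : Continuous (absSum w K) :=
  continuous_finsetSum _ fun _ _ => (continuous_eval _).abs

/-- The Ladyzhenskaya inequality for each component, with the L² factor also bounded by the H¹
quantity at the price of h². The constant 81 is 27 from the power mean times three components. -/
theorem Admissible.sq_mul_refSum_absSum_pow_four_le (hM : M.Admissible kg C) (hC : 1 ≤ C) {k : ℕ}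
    {w : VectorFn M} (hw : w ∈ M.velSpace k) :
    M.size kg ^ 2 * refSum (fun K ξ => absSum w K ξ ^ 4) ≤ 81 * C * refH1Sq kg w ^ 2 := by
  have hc := fun (p : MvPolynomial (Fin 2) ℝ) => continuous_eval p
  have h1 : refSum (fun K ξ => absSum w K ξ ^ 4) ≤
      27 * ∑ i, refSum (fun K ξ => MvPolynomial.eval ξ (w i K) ^ 4) := by
    rw [← refSum_finset_sum _ fun i _ K => by fun_prop, ← refSum_const_mul]
    refine refSum_mono (fun K => ((continuous_absSum w K).pow 4).continuousOn)
      (fun K => by fun_prop) fun K ξ _ => ?_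
    have := sum_pow_four_le fun i => |MvPolynomial.eval ξ (w i K)|
    simp only [Even.pow_abs (show Even 4 by decide)] at this
    refine this.trans_eq ?_
    norm_num
  have h2 : ∀ i, refSum (fun K ξ => MvPolynomial.eval ξ (w i K) ^ 4) ≤
      C * refSq w * refH1Sq kg w := by
    intro i
    have hX : refSum (fun K ξ => MvPolynomial.eval ξ (w i K) ^ 2) ≤ refSq w :=
      refSum_mono (fun K => by fun_prop) (fun K => by fun_prop) fun K ξ _ =>
        Finset.single_le_sum (f := fun i => MvPolynomial.eval ξ (w i K) ^ 2)
          (fun i _ => sq_nonneg _) (Finset.mem_univ i)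
    have hY : refSum (fun K ξ => ∑ j, MvPolynomial.eval ξ (MvPolynomial.pderiv j (w i K)) ^ 2) ≤
        refGradSq w :=
      refSum_mono (fun K => by fun_prop) (fun K => by fun_prop) fun K ξ _ =>
        Finset.single_le_sum
          (f := fun i => ∑ j, MvPolynomial.eval ξ (MvPolynomial.pderiv j (w i K)) ^ 2)
          (fun i _ => by positivity) (Finset.mem_univ i)
    refine (hM.refSum_pow_four_le k (w i) (hw i)).trans ?_
    have hX0 : 0 ≤ refSum fun K ξ => MvPolynomial.eval ξ (w i K) ^ 2 :=
      refSum_nonneg fun K ξ => sq_nonneg _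
    have hY0 : 0 ≤ refSum fun K ξ => ∑ j, MvPolynomial.eval ξ (MvPolynomial.pderiv j (w i K)) ^ 2 :=
      refSum_nonneg fun K ξ => by positivity
    have hX1 := refSq_nonneg w
    unfold refH1Sq
    gcongr
  have h3 : M.size kg ^ 2 * refSq w ≤ refH1Sq kg w :=
    le_add_of_nonneg_left (refGradSq_nonneg w)
  have h4 := refH1Sq_nonneg (kg := kg) w
  calc _ ≤ M.size kg ^ 2 * (27 * ∑ _i : Fin 3, C * refSq w * refH1Sq kg w) := by
        refine mul_le_mul_of_nonneg_left (h1.trans ?_) (sq_nonneg _)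
        gcongr with i
        exact h2 i
    _ = 81 * C * (M.size kg ^ 2 * refSq w) * refH1Sq kg w := by simp; ring
    _ ≤ 81 * C * refH1Sq kg w * refH1Sq kg w := by gcongr
    _ = _ := by ring

/-- The sum of the absolute values of the derivatives. -/
noncomputable def gradAbsSum (w : VectorFn M) (K : Fin M.numTri) (ξ : R2) : ℝ :=
  ∑ i, ∑ j, |MvPolynomial.eval ξ (MvPolynomial.pderiv j (w i K))|

theorem continuous_gradAbsSum (w : VectorFn M) (K : Fin M.numTri) : Continuous (gradAbsSum w K) :=
  continuous_finsetSum _ fun _ _ => continuous_finsetSum _ fun _ _ => (continuous_eval _).abs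

theorem refSum_gradAbsSum_sq_le (w : VectorFn M) :
    refSum (fun K ξ => gradAbsSum w K ξ ^ 2) ≤ 6 * refGradSq w := by
  have hc := fun (p : MvPolynomial (Fin 2) ℝ) => continuous_eval p
  rw [refGradSq, ← refSum_const_mul]
  refine refSum_mono (fun K => ((continuous_gradAbsSum w K).pow 2).continuousOn)
    (fun K => by fun_prop) fun K ξ _ => ?_
  have := sq_sum_le_card_mul_sum_sq (s := (Finset.univ : Finset (Fin 3 × Fin 2)))
    (f := fun p => |MvPolynomial.eval ξ (MvPolynomial.pderiv p.2 (w p.1 K))|)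
  simp only [Fintype.sum_prod_type, sq_abs, Finset.card_univ, Fintype.card_prod,
    Fintype.card_fin] at this
  refine this.trans_eq ?_
  norm_num

theorem Regular.abs_convective_le (hM : M.Regular kg C) (hC : 1 ≤ C) (ht : t ∈ Icc 0 T)
    (z w v : VectorFn M) (K : Fin M.numTri) {ξ : R2} (hξ : ξ ∈ refTri) :
    |(gradV (M.elem kg t K) (M.loc w K) ξ *ᵥ M.field z K ξ) ⬝ᵥ M.field v K ξ| *
      areaDensity (M.elem kg t K) ξ ≤
      24 * C ^ 7 * M.size kg * (gradAbsSum w K ξ * (absSum v K ξ * absSum z K ξ)) := by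
  have hh := hM.size_pos
  have hg : ∀ i l, |gradV (M.elem kg t K) (M.loc w K) ξ i l| ≤
      6 * C ^ 5 / M.size kg * ∑ j, |MvPolynomial.eval ξ (MvPolynomial.pderiv j (w i K))| := by
    intro i l
    rw [gradV_eq, Matrix.mul_apply, Finset.mul_sum]
    refine (Finset.abs_sum_le_sum_abs _ _).trans (Finset.sum_le_sum fun j _ => ?_)
    rw [abs_mul, mul_comm]
    exact mul_le_mul_of_nonneg_right (abs_pinv_le hC hh (hM.abs_jac_le t ht K ξ hξ)
      (hM.le_areaDensity t ht K ξ hξ) j l) (abs_nonneg _)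
  have h1 : |(gradV (M.elem kg t K) (M.loc w K) ξ *ᵥ M.field z K ξ) ⬝ᵥ M.field v K ξ| ≤
      6 * C ^ 5 / M.size kg * (gradAbsSum w K ξ * (absSum v K ξ * absSum z K ξ)) := by
    have h2 : ∀ i, |(gradV (M.elem kg t K) (M.loc w K) ξ *ᵥ M.field z K ξ) i| ≤
        6 * C ^ 5 / M.size kg * gradAbsSum w K ξ * absSum z K ξ := by
      intro i
      rw [Matrix.mulVec, dotProduct, absSum, Finset.mul_sum]
      refine (Finset.abs_sum_le_sum_abs _ _).trans (Finset.sum_le_sum fun l _ => ?_)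
      rw [abs_mul]
      refine mul_le_mul_of_nonneg_right ((hg i l).trans ?_) (abs_nonneg _)
      refine mul_le_mul_of_nonneg_left ?_ (by positivity)
      exact Finset.single_le_sum
        (f := fun i => ∑ j, |MvPolynomial.eval ξ (MvPolynomial.pderiv j (w i K))|)
        (fun i _ => by positivity) (Finset.mem_univ i)
    calc _ ≤ ∑ i, 6 * C ^ 5 / M.size kg * gradAbsSum w K ξ * absSum z K ξ *
          |MvPolynomial.eval ξ (v i K)| := by
          refine (Finset.abs_sum_le_sum_abs _ _).trans (Finset.sum_le_sum fun i _ => ?_)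
          rw [abs_mul]
          exact mul_le_mul_of_nonneg_right (h2 i) (abs_nonneg _)
      _ = _ := by rw [← Finset.mul_sum, ← absSum]; ring
  -- One power of h survives: the surface gradient costs 1/h and the area density supplies h².
  calc _ ≤ 6 * C ^ 5 / M.size kg * (gradAbsSum w K ξ * (absSum v K ξ * absSum z K ξ)) *
        (4 * C ^ 2 * M.size kg ^ 2) :=
        mul_le_mul h1 (hM.area_le hC ht K hξ) (areaDensity_nonneg _ _) ((abs_nonneg _).trans h1)
    _ = _ := by field_simp; ring

theorem mul_le_mul_of_sq_le {h P V Z a x y : ℝ} (h3 : P ^ 2 ≤ V * Z) (h4 : h ^ 2 * V ≤ a * x ^ 2)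
    (h5 : h ^ 2 * Z ≤ a * y ^ 2) (hZ : 0 ≤ Z) (ha : 0 ≤ a) (hx : 0 ≤ x) (hy : 0 ≤ y) :
    h ^ 2 * P ≤ a * (x * y) := by
  refine le_of_sq_le_sq ?_ (by positivity)
  calc _ = h ^ 2 * h ^ 2 * P ^ 2 := by ring
    _ ≤ h ^ 2 * h ^ 2 * (V * Z) := mul_le_mul_of_nonneg_left h3 (by positivity)
    _ = (h ^ 2 * V) * (h ^ 2 * Z) := by ring
    _ ≤ (a * x ^ 2) * (a * y ^ 2) := mul_le_mul h4 h5 (by positivity) (by positivity)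
    _ = _ := by ring

theorem Admissible.sq_mul_refSum_absSum_mul_sq_le (hM : M.Admissible kg C) (hC : 1 ≤ C)
    {k : ℕ} {z v : VectorFn M} (hz : z ∈ M.velSpace k) (hv : v ∈ M.velSpace k) :
    M.size kg ^ 2 * refSum (fun K ξ => (absSum v K ξ * absSum z K ξ) ^ 2) ≤
      81 * C * (refH1Sq kg v * refH1Sq kg z) := by
  have ca := continuous_absSum (M := M)
  have h3 := refSum_mul_sq_le (f := fun K ξ => absSum v K ξ ^ 2) (g := fun K ξ => absSum z K ξ ^ 2)
    (fun K => ((ca v K).pow 2).continuousOn) fun K => ((ca z K).pow 2).continuousOn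
  have h4 := hM.sq_mul_refSum_absSum_pow_four_le hC hv
  have h5 := hM.sq_mul_refSum_absSum_pow_four_le hC hz
  have e : ∀ x : ℝ, x ^ 4 = (x ^ 2) ^ 2 := fun x => by ring
  simp only [e] at h4 h5
  simp only [mul_pow]
  have hv0 := refH1Sq_nonneg (kg := kg) v
  have hz0 := refH1Sq_nonneg (kg := kg) z
  have pz : 0 ≤ refSum (fun K ξ => (absSum z K ξ ^ 2) ^ 2) := refSum_nonneg fun K ξ => sq_nonneg _
  exact mul_le_mul_of_sq_le h3 h4 h5 pz (by linarith) hv0 hz0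

theorem Regular.abs_integral_convective_le (hM : M.Regular kg C) (hC : 1 ≤ C) (ht : t ∈ Icc 0 T)
    (z w v : VectorFn M) :
    |M.integral kg t (fun K ξ =>
        (gradV (M.elem kg t K) (M.loc w K) ξ *ᵥ M.field z K ξ) ⬝ᵥ M.field v K ξ)| ≤
      24 * C ^ 7 * M.size kg *
        refSum fun K ξ => gradAbsSum w K ξ * (absSum v K ξ * absSum z K ξ) := by
  have hα := fun K ξ hξ => hM.area_pos hC ht K (ξ := ξ) hξ
  have ca := continuous_absSum (M := M)
  have cg := continuous_gradAbsSum (M := M)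
  have cm : ∀ K i, ContinuousOn
      (fun ξ => (gradV (M.elem kg t K) (M.loc w K) ξ *ᵥ M.field z K ξ) i) refTri := fun K i => by
    simp only [Matrix.mulVec, dotProduct]
    exact continuousOn_finsetSum _ fun l _ => (continuousOn_gradV (hα K) (M.loc w K) i l).mul
      (M.continuous_field z K l).continuousOn
  have cd : ∀ K, ContinuousOn (fun ξ =>
      (gradV (M.elem kg t K) (M.loc w K) ξ *ᵥ M.field z K ξ) ⬝ᵥ M.field v K ξ) refTri := fun K => by
    simp only [dotProduct]
    exact continuousOn_finsetSum _ fun i _ => (cm K i).mul (M.continuous_field v K i).continuousOn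
  rw [← refSum_const_mul]
  exact abs_integral_le cd
    (fun K => (continuous_const.mul ((cg w K).mul ((ca v K).mul (ca z K)))).continuousOn)
    fun K ξ hξ => hM.abs_convective_le hC ht z w v K hξ

/-- Hölder's inequality with exponents 2, 4, 4, as two applications of Cauchy-Schwarz. The explicit
factor h² is exactly what the two L⁴ bounds require, so the estimate is uniform in h. Everything is
squared to avoid roots. -/
theorem Admissible.sq_convective_le (hM : M.Admissible kg C) (hC : 1 ≤ C) (ht : t ∈ Icc 0 T)
    {k : ℕ} {z v : VectorFn M} (w : VectorFn M) (hz : z ∈ M.velSpace k) (hv : v ∈ M.velSpace k) :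
    M.integral kg t (fun K ξ =>
        (gradV (M.elem kg t K) (M.loc w K) ξ *ᵥ M.field z K ξ) ⬝ᵥ M.field v K ξ) ^ 2 ≤
      (24 * C ^ 7) ^ 2 * (486 * C) * (refH1Sq kg z * refH1Sq kg w * refH1Sq kg v) := by
  have h1 := hM.abs_integral_convective_le hC ht z w v
  have h2 := refSum_mul_sq_le (f := gradAbsSum w) (g := fun K ξ => absSum v K ξ * absSum z K ξ)
    (fun K => (continuous_gradAbsSum w K).continuousOn) fun K =>
      ((continuous_absSum v K).mul (continuous_absSum z K)).continuousOn
  have h6 := refSum_gradAbsSum_sq_le w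
  have h7 := hM.sq_mul_refSum_absSum_mul_sq_le hC hz hv
  have hGw := refGradSq_nonneg w
  have hw0 := refH1Sq_nonneg (kg := kg) w
  have h8 : refGradSq w ≤ refH1Sq kg w :=
    le_add_of_nonneg_right (mul_nonneg (sq_nonneg _) (refSq_nonneg w))
  have p0 : 0 ≤ refSum (fun K ξ => (absSum v K ξ * absSum z K ξ) ^ 2) :=
    refSum_nonneg fun K ξ => sq_nonneg _
  generalize refSum (fun K ξ => (absSum v K ξ * absSum z K ξ) ^ 2) = P at h2 h7 p0
  generalize refSum (fun K ξ => gradAbsSum w K ξ * (absSum v K ξ * absSum z K ξ)) = Q at h1 h2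
  calc _ ≤ (24 * C ^ 7 * M.size kg * Q) ^ 2 := by
        rw [← sq_abs]
        exact pow_le_pow_left₀ (abs_nonneg _) h1 2
    _ = (24 * C ^ 7) ^ 2 * (M.size kg ^ 2 * Q ^ 2) := by ring
    _ ≤ (24 * C ^ 7) ^ 2 * (M.size kg ^ 2 * (6 * refGradSq w * P)) := by
        gcongr
        exact h2.trans (mul_le_mul_of_nonneg_right h6 p0)
    _ = (24 * C ^ 7) ^ 2 * (6 * refGradSq w * (M.size kg ^ 2 * P)) := by ring
    _ ≤ (24 * C ^ 7) ^ 2 * (6 * refH1Sq kg w * (81 * C * (refH1Sq kg v * refH1Sq kg z))) := by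
        gcongr
    _ = _ := by ring

theorem Admissible.sq_cForm_le (hM : M.Admissible kg C) (hC : 1 ≤ C) (ht : t ∈ Icc 0 T)
    {k : ℕ} {z w v : VectorFn M} (hz : z ∈ M.velSpace k) (hw : w ∈ M.velSpace k)
    (hv : v ∈ M.velSpace k) :
    M.cForm kg t z w v ^ 2 ≤
      (24 * C ^ 7) ^ 2 * (486 * C) * (refH1Sq kg z * refH1Sq kg w * refH1Sq kg v) := by
  have h1 := hM.sq_convective_le hC ht w hz hv
  have h2 := hM.sq_convective_le hC ht v hz hw
  rw [cForm]
  set x := M.integral kg t (fun K ξ =>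
        (gradV (M.elem kg t K) (M.loc w K) ξ *ᵥ M.field z K ξ) ⬝ᵥ M.field v K ξ)
  set y := M.integral kg t (fun K ξ =>
        (gradV (M.elem kg t K) (M.loc v K) ξ *ᵥ M.field z K ξ) ⬝ᵥ M.field w K ξ)
  nlinarith [sq_nonneg (x + y)]

theorem cForm_self (z w : VectorFn M) : M.cForm kg t z w w = 0 := by simp [cForm]

theorem mForm_smul_smul (c : ℝ) (w : VectorFn M) :
    M.mForm kg t (M.field (c • w)) (M.field (c • w)) =
      c ^ 2 * M.mForm kg t (M.field w) (M.field w) := by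
  have e : ∀ K ξ, M.field (c • w) K ξ = c • M.field w K ξ := fun K ξ => by
    ext i; simp [field, MvPolynomial.smul_eval]
  simp only [mForm, e, smul_dotProduct, dotProduct_smul, smul_eq_mul, ← mul_assoc, ← sq]
  exact integral_const_mul _ _

theorem aSForm_smul_smul (c : ℝ) (w : VectorFn M) :
    M.aSForm kg t (c • w) (c • w) = c ^ 2 * M.aSForm kg t w w := by
  have e : ∀ K ξ, strain (M.elem kg t K) (M.loc (c • w) K) ξ =
      c • strain (M.elem kg t K) (M.loc w K) ξ := fun K ξ => by
    have e1 : jac (M.loc (c • w) K) ξ = c • jac (M.loc w K) ξ := by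
      ext i j
      simp [jac, loc, MvPolynomial.smul_eval]
    rw [strain, strain, covV, covV, gradV_eq, gradV_eq, e1, Matrix.smul_mul, Matrix.mul_smul,
      Matrix.transpose_smul, ← smul_add, smul_comm]
  simp only [aSForm, e, Matrix.transpose_smul, Matrix.smul_mul, Matrix.mul_smul, Matrix.trace_smul,
    smul_eq_mul, ← mul_assoc, ← sq]
  exact integral_const_mul _ _

end Mesh

end ESFEM

namespace ESFEM

/-! ### Stability of the scheme -/

/-- Implicit form: x (n + 1) also occurs on the right and is absorbed, which requires Gτ ≤ 1/2. -/
theorem discrete_gronwall {G τ : ℝ} (hG : 0 ≤ G) (hτ : 0 ≤ τ) (hGτ : G * τ ≤ 1 / 2) {x F : ℕ → ℝ}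
    (hx : ∀ n, 0 ≤ x n) (hF : ∀ n, 0 ≤ F n) {N : ℕ}
    (h : ∀ n, n + 1 ≤ N → x (n + 1) ≤ x n + τ * (G * x (n + 1) + F (n + 1))) (n : ℕ) (hn : n ≤ N) :
    x n ≤ Real.exp (2 * G * (n * τ)) * (x 0 + τ * ∑ k ∈ Finset.range (n + 1), F k) := by
  induction n with
  | zero => simpa using mul_nonneg hτ (hF 0)
  | succ n ih =>
    have h1 := ih (by omega)
    have h2 := h n hn
    set B := x 0 + τ * ∑ k ∈ Finset.range (n + 1), F k with hB
    have e1 : x 0 + τ * ∑ k ∈ Finset.range (n + 1 + 1), F k = B + τ * F (n + 1) := by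
      rw [Finset.sum_range_succ, hB]; ring
    have e2 : Real.exp (2 * G * ((n + 1 : ℕ) * τ)) =
        Real.exp (2 * (G * τ)) * Real.exp (2 * G * (n * τ)) := by
      rw [← Real.exp_add]; push_cast; ring_nf
    rw [e1, e2]
    set y := G * τ with hy
    have hy0 : 0 ≤ y := mul_nonneg hG hτ
    have h3 := Real.add_one_le_exp (2 * y)
    have h4 : 1 ≤ Real.exp (2 * G * (n * τ)) := Real.one_le_exp (by positivity)
    have h5 : (1 - y) * x (n + 1) ≤ Real.exp (2 * G * (n * τ)) * (B + τ * F (n + 1)) := by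
      have := mul_nonneg hτ (hF (n + 1))
      nlinarith
    -- Since exp(2y) ≥ 1 + 2y and (1 + 2y)(1 - y) = 1 + y(1 - 2y), this holds for 0 ≤ y ≤ 1/2.
    have h6 : 1 ≤ Real.exp (2 * y) * (1 - y) := by nlinarith
    calc x (n + 1) = 1 * x (n + 1) := (one_mul _).symm
      _ ≤ Real.exp (2 * y) * (1 - y) * x (n + 1) := mul_le_mul_of_nonneg_right h6 (hx _)
      _ = Real.exp (2 * y) * ((1 - y) * x (n + 1)) := by ring
      _ ≤ Real.exp (2 * y) * (Real.exp (2 * G * (n * τ)) * (B + τ * F (n + 1))) := by gcongr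
      _ = _ := by ring

variable {T : ℝ} {m : ℕ} {S : EvolvingSurface T m} {M : Mesh S} {ku kg N : ℕ} {C t : ℝ}

namespace Mesh

/-- A nonempty bounded open set has a nonempty frontier, which the polyhedron has to cover.
Positivity of the mesh size rests on this. -/
theorem exists_triangle (M : Mesh S) : ∃ _ : Fin M.numTri, True := by
  have h : (frontier S.dom).Nonempty := by
    rw [nonempty_frontier_iff]
    refine ⟨S.dom_nonempty, fun h => ?_⟩
    have := S.dom_bounded
    rw [h] at this
    exact NormedSpace.unbounded_univ ℝ E3 this
  obtain ⟨p, hp⟩ := h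
  obtain ⟨x, hx, -⟩ := M.bijective.surjOn hp
  obtain ⟨K, -⟩ := mem_iUnion.1 hx
  exact ⟨K, trivial⟩

theorem time_mem_Icc (M : Mesh S) (hT : 0 < T) {n : ℕ} (hN : 1 ≤ N) (hn : n ≤ N) :
    M.time N n ∈ Icc 0 T := by
  have hN0 : (0 : ℝ) < N := by exact_mod_cast hN
  have hnN : (n : ℝ) ≤ N := by exact_mod_cast hn
  refine ⟨by unfold time; positivity, ?_⟩
  calc (n : ℝ) * (T / N) ≤ N * (T / N) := by gcongr
    _ = T := by field_simp

theorem time_succ_sub (M : Mesh S) (n : ℕ) : M.time N (n + 1) - M.time N n = T / N := by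
  simp only [time]; push_cast; ring

theorem sq_normL2 (w : VectorField M) : M.normL2 kg t w ^ 2 = M.mForm kg t w w :=
  Real.sq_sqrt (mForm_self_nonneg w)

theorem sq_normA_le (w : VectorFn M) : M.normA kg t w ^ 2 ≤ 2 * M.aForm kg t w w := by
  have h := add_sq_le (√(M.aSForm kg t w w)) (M.normL2 kg t (M.field w))
  rw [sq_normL2, Real.sq_sqrt (aSForm_self_nonneg w)] at h
  rw [normA, aForm]
  linarith

theorem aForm_le_sq_normA (w : VectorFn M) : M.aForm kg t w w ≤ M.normA kg t w ^ 2 := by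
  have h1 := sq_normL2 (kg := kg) (t := t) (M.field w)
  have h2 := Real.sq_sqrt (aSForm_self_nonneg (kg := kg) (t := t) w)
  have h3 : 0 ≤ √(M.aSForm kg t w w) * M.normL2 kg t (M.field w) :=
    mul_nonneg (Real.sqrt_nonneg _) (Real.sqrt_nonneg _)
  rw [normA, aForm]
  nlinarith

theorem aForm_self_nonneg (w : VectorFn M) : 0 ≤ M.aForm kg t w w :=
  add_nonneg (aSForm_self_nonneg w) (mForm_self_nonneg _)

theorem sq_normA_smul_le (c : ℝ) (w : VectorFn M) :
    M.normA kg t (c • w) ^ 2 ≤ 2 * (c ^ 2 * M.aForm kg t w w) := by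
  refine (sq_normA_le _).trans_eq ?_
  rw [aForm, aForm, aSForm_smul_smul, mForm_smul_smul]
  ring

theorem sum_normL2_sq_le_energyBound (hT : 0 < T) (c : ℝ) (hc : 0 ≤ c) (u0 : VectorFn M)
    (f : ℕ → VectorField M) (n : ℕ) :
    T / N * ∑ k ∈ Finset.Icc 1 n, M.normL2 kg (M.time N k) (f k) ^ 2 ≤
      M.energyBound kg N c u0 f n := by
  have h1 : 1 ≤ Real.exp (c * M.time N n) := Real.one_le_exp (by unfold time; positivity)
  have h2 : ∑ k ∈ Finset.Icc 1 n, M.normL2 kg (M.time N k) (f k) ^ 2 ≤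
      ∑ k ∈ Finset.range (n + 1), M.normL2 kg (M.time N k) (f k) ^ 2 :=
    Finset.sum_le_sum_of_subset_of_nonneg (fun k hk => by
      simp only [Finset.mem_Icc] at hk; simp only [Finset.mem_range]; omega)
      fun k _ _ => sq_nonneg _
  have h3 : 0 ≤ T / N * ∑ k ∈ Finset.range (n + 1), M.normL2 kg (M.time N k) (f k) ^ 2 :=
    mul_nonneg (by positivity) (Finset.sum_nonneg fun k _ => sq_nonneg _)
  have h4 : 0 ≤ M.normL2 kg 0 (M.field u0) ^ 2 := sq_nonneg _
  calc _ ≤ T / N * ∑ k ∈ Finset.range (n + 1), M.normL2 kg (M.time N k) (f k) ^ 2 := by gcongr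
    _ ≤ 1 * (M.normL2 kg 0 (M.field u0) ^ 2 +
        T / N * ∑ k ∈ Finset.range (n + 1), M.normL2 kg (M.time N k) (f k) ^ 2) := by linarith
    _ ≤ _ := mul_le_mul_of_nonneg_right h1 (by linarith)

namespace IsSolution

variable {f : ℕ → VectorField M} {u : ℕ → VectorFn M} {p l : ℕ → ScalarFn M}

theorem mem_divFree (hu : M.IsSolution ku kg N f u p l) {n : ℕ} (hn : n ≤ N) :
    u n ∈ M.divFree ku kg (M.time N n) := by
  rcases Nat.eq_zero_or_pos n with rfl | h
  · simpa [time] using hu.init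
  · exact ⟨hu.vel_mem n h hn, hu.constraint n h hn⟩

theorem momentum_divFree (hu : M.IsSolution ku kg N f u p l) {n : ℕ} (hn : n + 1 ≤ N)
    {v : VectorFn M} (hv : v ∈ M.divFree ku kg (M.time N (n + 1))) :
    1 / (T / N) * (M.mForm kg (M.time N (n + 1)) (M.field (u (n + 1))) (M.field v)
        - M.mForm kg (M.time N n) (M.field (u n)) (M.field v))
      - M.gForm kg (M.time N (n + 1)) (u (n + 1)) v
      + M.aSForm kg (M.time N (n + 1)) (u (n + 1)) v
      + M.cForm kg (M.time N (n + 1)) (u n) (u (n + 1)) v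
      = M.mForm kg (M.time N (n + 1)) (f (n + 1)) (M.field v) := by
  have h := hu.momentum (n + 1) (by omega) hn v hv.1
  rw [hv.2 _ (hu.pres_mem (n + 1) (by omega) hn) _ (hu.mult_mem (n + 1) (by omega) hn),
    add_zero] at h
  exact h

/-- Testing with u (n + 1) removes convection, pressure and multiplier. Young's inequality on the
old mass form produces u (n + 1) measured at the old time, and moving it to the new time costs 1 +
8C³Δt. Of the remaining constants 72C⁶ comes from the velocity divergence, 1 from the force, and 2
from completing the strain to the energy norm. -/
theorem energy_step (hM : M.Regular kg C) (hC : 1 ≤ C) (hT : 0 < T) (hN : 1 ≤ N)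
    (hf : M.SquareIntegrable N f) (hu : M.IsSolution ku kg N f u p l) {n : ℕ} (hn : n + 1 ≤ N) :
    M.mForm kg (M.time N (n + 1)) (M.field (u (n + 1))) (M.field (u (n + 1))) +
        T / N * M.normA kg (M.time N (n + 1)) (u (n + 1)) ^ 2 ≤
      M.mForm kg (M.time N n) (M.field (u n)) (M.field (u n)) +
        T / N * ((8 * C ^ 3 + 72 * C ^ 6 + 3) *
          M.mForm kg (M.time N (n + 1)) (M.field (u (n + 1))) (M.field (u (n + 1))) +
          M.mForm kg (M.time N (n + 1)) (f (n + 1)) (f (n + 1))) := by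
  have hτ : 0 < T / N := div_pos hT (by exact_mod_cast hN)
  have ht := M.time_mem_Icc hT hN hn
  have hs := M.time_mem_Icc hT hN (show n ≤ N by omega)
  have h1 := hu.momentum_divFree hn (hu.mem_divFree hn)
  have h2 := two_mul_abs_mForm_le (kg := kg) (t := M.time N n) (isL2_field (u n))
    (isL2_field (u (n + 1))) one_pos
  have h3 := hM.mForm_le_mForm hC ht hs (u (n + 1))
  have h4 := hM.two_mul_abs_gForm_le hC ht (u (n + 1)) (u (n + 1)) one_pos
  have h5 := two_mul_abs_mForm_le (kg := kg) (t := M.time N (n + 1)) (hf (n + 1) hn)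
    (isL2_field (u (n + 1))) one_pos
  have h6 := sq_normA_le (kg := kg) (t := M.time N (n + 1)) (u (n + 1))
  rw [cForm_self, add_zero] at h1
  rw [time_succ_sub, abs_of_pos hτ] at h3
  rw [aForm] at h6
  generalize M.aSForm kg (M.time N (n + 1)) (u (n + 1)) (u (n + 1)) = a at *
  generalize M.gForm kg (M.time N (n + 1)) (u (n + 1)) (u (n + 1)) = g at *
  generalize M.mForm kg (M.time N (n + 1)) (f (n + 1)) (M.field (u (n + 1))) = d at *
  generalize M.mForm kg (M.time N (n + 1)) (f (n + 1)) (f (n + 1)) = F at *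
  generalize M.mForm kg (M.time N n) (M.field (u n)) (M.field (u (n + 1))) = e at *
  generalize M.mForm kg (M.time N n) (M.field (u (n + 1))) (M.field (u (n + 1))) = y at *
  generalize M.mForm kg (M.time N (n + 1)) (M.field (u (n + 1))) (M.field (u (n + 1))) = x at *
  generalize M.mForm kg (M.time N n) (M.field (u n)) (M.field (u n)) = x₀ at *
  generalize M.normA kg (M.time N (n + 1)) (u (n + 1)) ^ 2 = b at *
  generalize T / N = τ at *
  have h7 : x - e = τ * (g - a + d) := by
    have : 1 / τ * (x - e) = g - a + d := by linarith
    rw [← this]; field_simp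
  have h8 := le_abs_self e
  have h9 : τ * (2 * g) ≤ τ * (36 * C ^ 6 * (x + x)) := by
    have := le_abs_self g
    exact mul_le_mul_of_nonneg_left (by linarith) hτ.le
  have h10 : τ * (2 * d) ≤ τ * (F + x) := by
    have := le_abs_self d
    exact mul_le_mul_of_nonneg_left (by linarith) hτ.le
  have h11 : τ * b ≤ τ * (2 * (a + x)) := by gcongr
  linarith

theorem energy_bound (hM : M.Regular kg C) (hC : 1 ≤ C) (hT : 0 < T) (hN : 1 ≤ N)
    (hτ : (8 * C ^ 3 + 72 * C ^ 6 + 3) * (T / N) ≤ 1 / 2)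
    (hf : M.SquareIntegrable N f) (hu : M.IsSolution ku kg N f u p l) {n : ℕ} (hn : n ≤ N) :
    M.normL2 kg (M.time N n) (M.field (u n)) ^ 2
        + T / N * ∑ k ∈ Finset.Icc 1 n, M.normA kg (M.time N k) (u k) ^ 2
      ≤ M.energyBound kg N (2 * (8 * C ^ 3 + 72 * C ^ 6 + 3)) (u 0) f n := by
  have hτ0 : 0 ≤ T / N := by positivity
  -- The Gronwall quantity is the kinetic energy plus the accumulated dissipation. Its right-hand
  -- side then contains the dissipation with the factor G as well, which is nonnegative and only
  -- weakens the hypothesis to be checked.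
  have h := discrete_gronwall (G := 8 * C ^ 3 + 72 * C ^ 6 + 3) (N := N) (by positivity) hτ0 hτ
    (x := fun n => M.normL2 kg (M.time N n) (M.field (u n)) ^ 2
        + T / N * ∑ k ∈ Finset.Icc 1 n, M.normA kg (M.time N k) (u k) ^ 2)
    (F := fun n => M.normL2 kg (M.time N n) (f n) ^ 2)
    (fun n => add_nonneg (sq_nonneg _)
      (mul_nonneg hτ0 (Finset.sum_nonneg fun k _ => sq_nonneg _))) (fun n => sq_nonneg _)
    (fun n hn => ?_) n hn
  · simpa [energyBound, time] using h
  · have h1 := energy_step hM hC hT hN hf hu hn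
    have h2 : 0 ≤ ∑ k ∈ Finset.Icc 1 (n + 1), M.normA kg (M.time N k) (u k) ^ 2 :=
      Finset.sum_nonneg fun k _ => sq_nonneg _
    have h3 : 0 ≤ T / N * ((8 * C ^ 3 + 72 * C ^ 6 + 3) *
        (T / N * ∑ k ∈ Finset.Icc 1 (n + 1), M.normA kg (M.time N k) (u k) ^ 2)) := by positivity
    have e : ∑ k ∈ Finset.Icc 1 (n + 1), M.normA kg (M.time N k) (u k) ^ 2 =
        ∑ k ∈ Finset.Icc 1 n, M.normA kg (M.time N k) (u k) ^ 2 +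
          M.normA kg (M.time N (n + 1)) (u (n + 1)) ^ 2 :=
      Finset.sum_Icc_succ_top (by omega) _
    simp only [sq_normL2] at *
    rw [e] at h3 ⊢
    linarith

end IsSolution

/-! ### The dual estimate -/

/-- Every term is split by Young's inequality with the same δ = s(G + 3). The multiples of A then
add up to at most A/s, half of the doubled left-hand side, and are absorbed; the other terms carry a
factor s, which cancels one power of s⁻¹. -/
theorem le_of_dual_estimate {s A am az x a F g d r c G L : ℝ} (hs : 0 < s) (hA : A = az + am)
    (hA0 : 0 ≤ A) (hG : 0 ≤ G) (hx : 0 ≤ x) (ha : 0 ≤ a) (hL : 0 ≤ L)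
    (haz : 0 ≤ az) (ham : 0 ≤ am) (h1 : 1 / s * A = g - r - c + d)
    (hg : ∀ δ > 0, 2 * |g| ≤ G * (δ * x + δ⁻¹ * am))
    (hr : ∀ δ > 0, 2 * |r| ≤ δ * a + δ⁻¹ * az)
    (hd : ∀ δ > 0, 2 * |d| ≤ δ * F + δ⁻¹ * am)
    (hc : c ^ 2 ≤ L * ((a + x) * A)) :
    s⁻¹ ^ 2 * A ≤ (G + 3) * (G + 1 + L) * (a + x) + (G + 3) * F := by
  set δ := s * (G + 3) with hδ
  have hδ0 : 0 < δ := by positivity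
  have h2 : 2 * |c| ≤ δ * (L * (a + x)) + δ⁻¹ * A := by
    refine le_of_sq_le_sq ?_ (by positivity)
    have e : (δ * (L * (a + x)) + δ⁻¹ * A) ^ 2 =
        (δ * (L * (a + x)) - δ⁻¹ * A) ^ 2 + 4 * (L * ((a + x) * A)) := by field_simp; ring
    rw [e, mul_pow, sq_abs]
    nlinarith [sq_nonneg (δ * (L * (a + x)) - δ⁻¹ * A)]
  have h3 : 2 * (1 / s * A) ≤ δ * ((G + 1 + L) * (a + x) + F) + δ⁻¹ * ((G + 3) * A) := by
    have k1 := hg δ hδ0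
    have k2 := hr δ hδ0
    have k3 := hd δ hδ0
    have q1 := le_abs_self g
    have q2 := neg_le_abs r
    have q3 := neg_le_abs c
    have q4 := le_abs_self d
    have hδi : 0 < δ⁻¹ := inv_pos.2 hδ0
    have r1 : 0 ≤ δ * (G * a + x) := by positivity
    have r2 : 0 ≤ δ⁻¹ * (G * az + az) := by positivity
    have r3 : 0 ≤ δ⁻¹ * am := by positivity
    rw [hA] at h2 ⊢
    rw [hA] at h1
    nlinarith
  have h4 : δ⁻¹ * ((G + 3) * A) = 1 / s * A := by rw [hδ]; field_simp
  have h5 : 1 / s * A ≤ s * ((G + 3) * ((G + 1 + L) * (a + x) + F)) := by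
    rw [h4] at h3
    calc _ ≤ δ * ((G + 1 + L) * (a + x) + F) := by linarith
      _ = _ := by rw [hδ]; ring
  calc s⁻¹ ^ 2 * A = s⁻¹ * (1 / s * A) := by field_simp
    _ ≤ s⁻¹ * (s * ((G + 3) * ((G + 1 + L) * (a + x) + F))) := by gcongr
    _ = _ := by field_simp

/-- Only the first factor, which stands for the transporting velocity, is replaced by its a priori
bound; the other two keep their energies. -/
theorem le_of_korn_bounds {K E B x y z a b c : ℝ} (hE : 0 < E) (hK : 0 ≤ K) (hx : 0 ≤ x)
    (hy : 0 ≤ y) (hz : 0 ≤ z) (h1 : x ≤ E * a) (h2 : y ≤ E * b) (h3 : z ≤ E * c) (h4 : a ≤ B) :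
    K * (x * y * z) ≤ K * (E ^ 3 * B) * (b * c) := by
  have h5 : x ≤ E * B := h1.trans (by gcongr)
  have h6 : 0 ≤ E * B := hx.trans h5
  have h7 : 0 ≤ E * b := hy.trans h2
  calc _ ≤ K * (E * B * (E * b) * (E * c)) := by gcongr
    _ = _ := by ring

/-- Testing both the inverse Stokes problem and the Leray projection with z, which is discretely
divergence-free at the new time, gives precisely the difference of mass forms in the scheme's time
derivative. -/
theorem aForm_invStokes_eq {s : ℝ} {w w₀ what z : VectorFn M}
    (hL : M.IsLerayProj ku kg s t w₀ what) (hz : M.IsInvStokes ku kg t (w - what) z) :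
    M.aForm kg t z z = M.mForm kg t (M.field w) (M.field z) -
      M.mForm kg s (M.field w₀) (M.field z) := by
  obtain ⟨-, ⟨p, hp, l, hl, h⟩, -⟩ := hL
  have h1 := h z hz.1.1
  rw [hz.1.2 p hp l hl, add_zero] at h1
  rw [hz.2 z hz.1, ← h1, ← mForm_sub_left (isL2_field w) (isL2_field what) (isL2_field z)]
  congr 1
  ext K ξ i
  simp [field]

end Mesh

open Mesh in
-- The scheme tested with z becomes an identity for the energy of z divided by Δt. Korn's inequality
-- turns the trilinear bound into energies; the norm of the old velocity is bounded by Ca, measured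
-- at the old time, which is legitimate because the pull-back quantity `refH1Sq` does not depend on
-- time.
theorem exists_invStokes_bound {E Ca : ℝ} (hC : 1 ≤ C) (hE : 0 < E) :
    ∃ D > 0, ∀ M : Mesh S, M.Admissible kg C →
      (∀ t ∈ Icc 0 T, ∀ w ∈ M.divFree ku kg t, refH1Sq kg w ≤ E * M.aForm kg t w w) → 0 < T →
      ∀ N : ℕ, 1 ≤ N → ∀ (f : ℕ → VectorField M) (u : ℕ → VectorFn M) (p l : ℕ → ScalarFn M),
        M.SquareIntegrable N f → M.IsSolution ku kg N f u p l →
        (∀ k, k ≤ N → M.normA kg (M.time N k) (u k) ≤ Ca) → ∀ n, n + 1 ≤ N →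
        ∀ what z : VectorFn M, M.IsLerayProj ku kg (M.time N n) (M.time N (n + 1)) (u n) what →
          M.IsInvStokes ku kg (M.time N (n + 1)) (u (n + 1) - what) z →
          M.normA kg (M.time N (n + 1)) ((T / N : ℝ)⁻¹ • z) ^ 2 ≤
            D * (M.normA kg (M.time N (n + 1)) (u (n + 1)) ^ 2 +
              M.normL2 kg (M.time N (n + 1)) (f (n + 1)) ^ 2) := by
  obtain ⟨G, hG⟩ : ∃ G, G = 36 * C ^ 6 := ⟨_, rfl⟩
  obtain ⟨L, hL⟩ : ∃ L, L = (24 * C ^ 7) ^ 2 * (486 * C) * (E ^ 3 * Ca ^ 2) := ⟨_, rfl⟩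
  have hG0 : 0 ≤ G := by rw [hG]; positivity
  have hL0 : 0 ≤ L := by rw [hL]; positivity
  refine ⟨2 * ((G + 3) * (G + 1 + L)), by positivity,
    fun M hM hK hT N hN f u p l hf hu hCa n hn what z hwhat hz => ?_⟩
  have hτ : 0 < T / N := div_pos hT (by exact_mod_cast hN)
  have ht := M.time_mem_Icc hT hN hn
  have hs := M.time_mem_Icc hT hN (show n ≤ N by omega)
  have h1 := hu.momentum_divFree hn hz.1
  rw [← aForm_invStokes_eq hwhat hz] at h1
  have hu0 := hu.mem_divFree (show n ≤ N by omega)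
  have hu1 := hu.mem_divFree hn
  have hAz := aForm_self_nonneg (kg := kg) (t := M.time N (n + 1)) z
  have hu2 : M.aForm kg (M.time N n) (u n) (u n) ≤ Ca ^ 2 := (aForm_le_sq_normA _).trans
    (pow_le_pow_left₀ (add_nonneg (Real.sqrt_nonneg _) (Real.sqrt_nonneg _)) (hCa n (by omega)) 2)
  have hc : M.cForm kg (M.time N (n + 1)) (u n) (u (n + 1)) z ^ 2 ≤
      L * (M.aForm kg (M.time N (n + 1)) (u (n + 1)) (u (n + 1)) *
        M.aForm kg (M.time N (n + 1)) z z) := by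
    refine (hM.sq_cForm_le hC ht hu0.1 hu1.1 hz.1.1).trans ?_
    rw [hL]
    exact le_of_korn_bounds hE (by positivity) (refH1Sq_nonneg _) (refH1Sq_nonneg _)
      (refH1Sq_nonneg _) (hK _ hs _ hu0) (hK _ ht _ hu1) (hK _ ht _ hz.1) hu2
  have hg : ∀ δ > 0, 2 * |M.gForm kg (M.time N (n + 1)) (u (n + 1)) z| ≤
      G * (δ * M.mForm kg (M.time N (n + 1)) (M.field (u (n + 1))) (M.field (u (n + 1))) +
        δ⁻¹ * M.mForm kg (M.time N (n + 1)) (M.field z) (M.field z)) := fun δ hδ => by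
    rw [hG]
    exact hM.two_mul_abs_gForm_le hC ht (u (n + 1)) z hδ
  have hr := fun δ (hδ : 0 < δ) => hM.two_mul_abs_aSForm_le hC ht (u (n + 1)) z hδ
  have hd := fun δ (hδ : 0 < δ) => two_mul_abs_mForm_le (kg := kg) (t := M.time N (n + 1))
    (hf (n + 1) hn) (isL2_field z) hδ
  have hx := M.mForm_self_nonneg (kg := kg) (t := M.time N (n + 1)) (M.field (u (n + 1)))
  have ha := M.aSForm_self_nonneg (kg := kg) (t := M.time N (n + 1)) (u (n + 1))
  have haz := M.aSForm_self_nonneg (kg := kg) (t := M.time N (n + 1)) z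
  have ham := M.mForm_self_nonneg (kg := kg) (t := M.time N (n + 1)) (M.field z)
  have h2 : 1 / (T / N) * M.aForm kg (M.time N (n + 1)) z z =
      M.gForm kg (M.time N (n + 1)) (u (n + 1)) z - M.aSForm kg (M.time N (n + 1)) (u (n + 1)) z -
      M.cForm kg (M.time N (n + 1)) (u n) (u (n + 1)) z +
      M.mForm kg (M.time N (n + 1)) (f (n + 1)) (M.field z) := by linarith
  have key := le_of_dual_estimate hτ (aForm.eq_1 M kg _ z z) hAz hG0 hx ha hL0 haz ham h2 hg hr hd hc
  refine (sq_normA_smul_le _ _).trans ?_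
  have hle := aForm_le_sq_normA (kg := kg) (t := M.time N (n + 1)) (u (n + 1))
  rw [sq_normL2]
  have hF := M.mForm_self_nonneg (kg := kg) (t := M.time N (n + 1)) (f (n + 1))
  calc _ ≤ 2 * ((G + 3) * (G + 1 + L) * M.aForm kg (M.time N (n + 1)) (u (n + 1)) (u (n + 1)) +
        (G + 3) * M.mForm kg (M.time N (n + 1)) (f (n + 1)) (f (n + 1))) := by
        gcongr
        exact key
    _ ≤ 2 * ((G + 3) * (G + 1 + L) * M.normA kg (M.time N (n + 1)) (u (n + 1)) ^ 2 +
        (G + 3) * (G + 1 + L) * M.mForm kg (M.time N (n + 1)) (f (n + 1)) (f (n + 1))) := by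
        gcongr
        exact le_mul_of_one_le_right (by positivity) (by linarith)
    _ = _ := by ring

end ESFEM

theorem mainTheorem9 (T : ℝ) (hT : 0 < T) (m : ℕ) (hm : 3 ≤ m) (S : ESFEM.EvolvingSurface T m)
    (ku kg : ℕ) (hku : 2 ≤ ku) (hkg : 1 ≤ kg) (ρ : ℝ) (hρ : 0 < ρ) :
    ∃ h₀ > 0, ∃ τ₀ > 0, ∃ c > 0,
      -- the velocity estimate that determines the bound `A(u⁰, f)`
      (∀ (M : ESFEM.Mesh S), M.QuasiUniform kg ρ → M.size kg < h₀ →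
        ∀ N : ℕ, 1 ≤ N → T / N ≤ τ₀ →
        ∀ (f : ℕ → ESFEM.VectorField M) (u : ℕ → ESFEM.VectorFn M) (p l : ℕ → ESFEM.ScalarFn M),
          M.SquareIntegrable N f → M.IsSolution ku kg N f u p l →
          ∀ n, 1 ≤ n → n ≤ N →
            M.normL2 kg (M.time N n) (M.field (u n)) ^ 2
                + T / N * ∑ k ∈ Finset.Icc 1 n, M.normA kg (M.time N k) (u k) ^ 2
              ≤ M.energyBound kg N c (u 0) f n) ∧
      -- the auxiliary bound
      (∀ Ca > 0, ∃ C > 0, ∀ (M : ESFEM.Mesh S), M.QuasiUniform kg ρ → M.size kg < h₀ →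
        ∀ N : ℕ, 1 ≤ N → T / N ≤ τ₀ →
        ∀ (f : ℕ → ESFEM.VectorField M) (u : ℕ → ESFEM.VectorFn M) (p l : ℕ → ESFEM.ScalarFn M),
          M.SquareIntegrable N f → M.IsSolution ku kg N f u p l →
          (∀ k, k ≤ N → M.normA kg (M.time N k) (u k) ≤ Ca) →
          ∀ uhat z : ℕ → ESFEM.VectorFn M,
            (∀ k, 1 ≤ k → k ≤ N →
              M.IsLerayProj ku kg (M.time N (k - 1)) (M.time N k) (u (k - 1)) (uhat (k - 1))) →
            (∀ k, 1 ≤ k → k ≤ N →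
              M.IsInvStokes ku kg (M.time N k) (u k - uhat (k - 1)) (z k)) →
            ∀ n, 1 ≤ n → n ≤ N →
              ∑ k ∈ Finset.Icc 1 n,
                  T / N * M.normA kg (M.time N k) ((T / N : ℝ)⁻¹ • z k) ^ 2
                ≤ C * M.energyBound kg N c (u 0) f n) := by
  obtain ⟨h₁, hh₁, C, hC, hadm⟩ := ESFEM.exists_admissible (show 2 ≤ m by omega) S hT hkg hρ
  obtain ⟨h₂, hh₂, E, hE, hkorn⟩ :=
    ESFEM.exists_korn (S := S) (kg := kg) (ku := ku) (by omega) hC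
  have hG : 0 < 8 * C ^ 3 + 72 * C ^ 6 + 3 := by positivity
  have hτ : ∀ τ, τ ≤ 1 / (2 * (8 * C ^ 3 + 72 * C ^ 6 + 3)) →
      (8 * C ^ 3 + 72 * C ^ 6 + 3) * τ ≤ 1 / 2 := fun τ h => by
    rw [le_div_iff₀ (by positivity)] at h
    linarith
  -- h₁ secures the geometry and the Ladyzhenskaya inequality, h₂ Korn's inequality. The bound on
  -- the time step and the rate c are those of the Gronwall argument, and neither depends on Ca.
  refine ⟨min h₁ h₂, by positivity, 1 / (2 * (8 * C ^ 3 + 72 * C ^ 6 + 3)), by positivity,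
    2 * (8 * C ^ 3 + 72 * C ^ 6 + 3), by positivity, ?_, ?_⟩
  · intro M hM hsize N hN hNτ f u p l hf hu n _ hn
    have hA := hadm M hM (hsize.trans_le (min_le_left _ _)) M.exists_triangle
    exact hu.energy_bound hA.toRegular hC hT hN (hτ _ hNτ) hf hn
  · intro Ca _
    obtain ⟨D, hD, H⟩ := ESFEM.exists_invStokes_bound (S := S) (kg := kg) (ku := ku) (Ca := Ca) hC hE
    -- One energy bound is spent on the accumulated dissipation from the first part, the other on
    -- the forcing.
    refine ⟨2 * D, by positivity, ?_⟩
    intro M hM hsize N hN hNτ f u p l hf hu hCa uhat z huhat hz n _ hn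
    have hA := hadm M hM (hsize.trans_le (min_le_left _ _)) M.exists_triangle
    have h1 := hu.energy_bound hA.toRegular hC hT hN (hτ _ hNτ) hf hn
    have h2 := M.sum_normL2_sq_le_energyBound (kg := kg) (N := N) hT
      (2 * (8 * C ^ 3 + 72 * C ^ 6 + 3)) (by positivity) (u 0) f n
    have h3 : 0 ≤ M.normL2 kg (M.time N n) (M.field (u n)) ^ 2 := sq_nonneg _
    calc _ ≤ ∑ k ∈ Finset.Icc 1 n, T / N * (D * (M.normA kg (M.time N k) (u k) ^ 2 +
          M.normL2 kg (M.time N k) (f k) ^ 2)) := by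
          refine Finset.sum_le_sum fun k hk => mul_le_mul_of_nonneg_left ?_ (by positivity)
          obtain ⟨hk1, hkn⟩ := Finset.mem_Icc.1 hk
          obtain ⟨j, rfl⟩ : ∃ j, k = j + 1 := ⟨k - 1, by omega⟩
          exact H M hA (hkorn M hA (hsize.trans_le (min_le_right _ _))) hT N hN f u p l hf hu hCa
            j (by omega) (uhat j) (z (j + 1)) (huhat (j + 1) hk1 (by omega))
            (hz (j + 1) hk1 (by omega))
      _ = D * (T / N * ∑ k ∈ Finset.Icc 1 n, M.normA kg (M.time N k) (u k) ^ 2 +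
          T / N * ∑ k ∈ Finset.Icc 1 n, M.normL2 kg (M.time N k) (f k) ^ 2) := by
          rw [← mul_add, ← Finset.sum_add_distrib, ← Finset.mul_sum, ← Finset.mul_sum]
          ring
      _ ≤ D * (M.energyBound kg N (2 * (8 * C ^ 3 + 72 * C ^ 6 + 3)) (u 0) f n +
          M.energyBound kg N (2 * (8 * C ^ 3 + 72 * C ^ 6 + 3)) (u 0) f n) := by
          gcongr
          linarith
      _ = _ := by ring
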